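/- **Conventions.** All gradings are by $\mathbb Z/2$, tensor products are over $\mathbb C$. A (small) cdg category has $\mathbb Z/2$-graded complex morphism spaces, an odd differential $d$ satisfying the graded Leibniz rule, and for each object $x$ an even closed curvature $h_x\in\mathrm{End}(x)$ with $d^2a=h_ya-ah_x$ for $a:x\to y$. For a small cdg category $C$ let $C_k(C)$ be spanned by the cyclic words $a_0[a_1|\cdots|a_k]$ with homogeneous $a_i: x_{i+1}\to x_i$, $x_{k+1}=x_0$, of degree $|a_0|+\sum_{i\ge1}(|a_i|+1)$. The Hochschild complex of the second kind is $C^{II}(C)=\prod_{k\ge0}C_k(C)$ with differential $\bar d_0+\bar d_1+\bar d_2$, where $$\bar d_0:\ a_0[\cdots|a_k]\mapsto\sum_{i=0}^k(-1)^{|a_0|+\dots+|a_i|+i}\,a_0[\cdots|a_i|h|a_{i+1}|\cdots|a_k],$$ $$\bar d_1:\ a_0[\cdots|a_k]\mapsto\sum_{i=0}^k(-1)^{|a_0|+\dots+|a_{i-1}|+i}\,a_0[\cdots|d a_i|\cdots|a_k],$$ $$\bar d_2:\ a_0[\cdots|a_k]\mapsto\sum_{i=0}^{k-1}(-1)^{|a_0|+\dots+|a_i|+i}\,a_0[\cdots|a_ia_{i+1}|\cdots]+(-1)^{1+(|a_k|+1)(|a_0|+\dots+|a_{k-1}|+k-1)}\,(a_ka_0)[a_1|\cdots|a_{k-1}],$$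 with $\bar d_2=0$ on $C_0$. It is covariant for strict cdg functors. For a presheaf $\mathscr E$ of small cdg categories on a space with a finite family $\mathscr U=(U_1,\dots,U_N)$ of open sets, $\check C(\mathscr U,\underline C^{II}(\mathscr E))=\prod_{i_0<\dots<i_p}C^{II}(\mathscr E(U_{i_0\cdots i_p}))$, where $U_{i_0\cdots i_p}=U_{i_0}\cap\dots\cap U_{i_p}$; the differential is $d_{\check Cech}+(-1)^p(\bar d_0+\bar d_1+\bar d_2)$ and the grading is $p$ plus the degree above, modulo $2$. **Setting.** Let $X$ be a smooth separated scheme over $\mathbb C$ with a finite cover $\mathscr U=(U_1,\dots,U_N)$ by affine open sets, and let $f\in\mathcal O(X)$. Let $P_1,\dots,P_r$ be $\mathbb Z/2$-graded $\mathcal O_X$-modules, each with an odd endomorphism $\delta=\delta_{P_i}$ (no condition on $\delta^2$), with chosen trivialisations $P_i|_{U_j}\cong\mathcal O_{U_j}^{n_i}\oplus\mathcal O_{U_j}^{m_i}$ of the underlying graded modules. Let $\mathscr C$ be the presheaf of cdg categories such that $\mathscr C(V)$ has objects $P_1|_V,\dots,P_r|_V$, morphisms all $\mathcal O_V$-linear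 maps of both parities, differential $\alpha\mapsto\delta\alpha-(-1)^{|\alpha|}\alpha\delta$ and curvature $\delta^2-f$. Let $\mathcal O_{-f}$ be the presheaf of cdg categories with one object, endomorphisms $\mathcal O(V)$ in even degree, zero differential and curvature $-f$. **The map $\varphi$.** For a word $\bar\alpha=\alpha_0[\alpha_1|\cdots|\alpha_k]$ put $$Sh(\underbrace{[\delta|\cdots|\delta]}_{n},\bar\alpha)=\sum_{i_0+\dots+i_k=n}\alpha_0[\delta^{i_0}|\alpha_1|\delta^{i_1}|\cdots|\alpha_k|\delta^{i_k}],$$ where $\delta^{i}$ denotes $i$ consecutive letters $\delta$. Write $(\alpha)_l$ for the matrix of a morphism $\alpha$ in the trivialisations over $U_l$, and $g_{kl}$ for the change of basis matrices, so that $g_{kl}(\alpha)_lg_{kl}^{-1}=(\alpha)_k$. For $\bar\alpha$ over $U_{i_0\cdots i_p}$ and $q\ge0$ put $$h^q(\bar\alpha)=\sum(-1)^{\epsilon+pq+\binom q2}\,g_{i_0i_{-q}}(\alpha_0)_{i_{-q}}\Big[(\alpha_1)_{i_{-q}}\Big|\cdots\Big|(\alpha_{l_1})_{i_{-q}}\Big|g^{-1}_{i_{1-q}i_{-q}}\Big|(\alpha_{l_1+1})_{i_{1-q}}\Big|\cdots\Big|(\alpha_{l_q})_{i_{-1}}\Big|g^{-1}_{i_0i_{-1}}\Big|(\alpha_{l_q+1})_{i_0}\Big|\cdots\Big|(\alpha_k)_{i_0}\Big],$$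 where the sum is over all $i_{-q}<\dots<i_{-1}<i_0$ and $0\le l_1\le\dots\le l_q\le k$, the summand belongs to the component of the Čech complex with index $i_{-q}<\dots<i_p$, and $\epsilon=\sum_{s=1}^q\big(\sum_{j=0}^{l_s}|\alpha_j|+l_s\big)$. For matrices $F^0,\dots,F^m$ that are cyclically composable with respect to homogeneous bases $(e_i^j)_j$, put $$sTr(F^0[F^1|\cdots|F^m])=\sum_{j_0,\dots,j_m}(-1)^{(m+1)|e_0^{j_0}|+|e_1^{j_1}|+\dots+|e_m^{j_m}|}\,F^0_{j_0j_1}[F^1_{j_1j_2}|\cdots|F^m_{j_mj_0}].$$ Finally let $$\varphi=\sum_{n,q\ge0}(-1)^n\,sTr\Big(h^q\big(Sh(\underbrace{[\delta|\cdots|\delta]}_{n},-)\big)\Big):\ \check C(\mathscr U,\underline C^{II}(\mathscr C))\to\check C(\mathscr U,\underline C^{II}(\mathcal O_{-f})).$$ **Theorem.** (i) $\varphi$ is a chain map (it preserves the $\mathbb Z/2$-grading and commutes with the differentials). (ii) If $(P_i,\delta_{P_i})=(\mathcal O_X,0)$ for some $i$ (with $\mathcal O_X$ in even degree, up to isomorphism),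 then the map $\check C(\mathscr U,\underline C^{II}(\mathcal O_{-f}))\to\check C(\mathscr U,\underline C^{II}(\mathscr C))$ induced by the Yoneda functor $\mathcal O_{-f}\to\mathscr C$ (the object goes to $P_i$, a function to the multiplication by it) is a quasi-isomorphism, and $\varphi$ is a quasi-inverse of it: the two maps become mutually inverse in the derived category of $\mathbb Z/2$-graded complexes of complex vector spaces. -/

import Mathlib

open CategoryTheory TensorProduct DirectSum

noncomputable section

namespace CechHoch

section Words

variable {Ob : Type}

/-- Words of length `k` on a quiver `Q` (`Q x y` is the space of arrows from `x` to `y`):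
`Word Q k x z = ⨁ Q x₁ x ⊗ Q x₂ x₁ ⊗ ⋯ ⊗ Q z x_k`, the sum over all `x₁, …, x_k`. A pure tensor is written
`a₀[a₁|…|a_k]`; its letters are composable, the source of each letter being the target of the next.
Tensor products are over `ℂ`. -/
def Word (Q : Ob → Ob → ModuleCat.{0} ℂ) : ℕ → Ob → Ob → ModuleCat.{0} ℂ
  | 0, x, z => Q z x
  | k + 1, x, z => ModuleCat.of ℂ (⨁ y : Ob, (Q y x ⊗[ℂ] Word Q k y z))

variable {Q : Ob → Ob → ModuleCat.{0} ℂ}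

namespace Word

open Classical in
/-- A linear map out of words of length `k + 1`, given on words `a[w]` bilinearly in `a` and `w`. -/
def lift {k : ℕ} {x z : Ob} {M : Type} [AddCommGroup M] [Module ℂ M]
    (F : ∀ y, Q y x →ₗ[ℂ] Word Q k y z →ₗ[ℂ] M) : Word Q (k + 1) x z →ₗ[ℂ] M :=
  DirectSum.toModule ℂ Ob M fun y => TensorProduct.lift (F y)

open Classical in
/-- Put a letter in front of a word. -/
def cons {k : ℕ} {x y z : Ob} : Q y x →ₗ[ℂ] Word Q k y z →ₗ[ℂ] Word Q (k + 1) x z :=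
  (TensorProduct.mk ℂ (Q y x) (Word Q k y z)).compr₂
    (DirectSum.lof ℂ Ob (fun y => Q y x ⊗[ℂ] Word Q k y z) y)

@[simp] theorem lift_cons {k : ℕ} {x y z : Ob} {M : Type} [AddCommGroup M] [Module ℂ M]
    (F : ∀ y, Q y x →ₗ[ℂ] Word Q k y z →ₗ[ℂ] M) (a : Q y x) (w : Word Q k y z) :
    lift F (cons a w) = F y a w := by
  classical
  exact (DirectSum.toModule_lof ℂ y _).trans (TensorProduct.lift.tmul _ _)

theorem ext_cons {k : ℕ} {x z : Ob} {M : Type} [AddCommGroup M] [Module ℂ M]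
    {f g : Word Q (k + 1) x z →ₗ[ℂ] M}
    (H : ∀ y (a : Q y x) (w : Word Q k y z), f (cons a w) = g (cons a w)) : f = g := by
  classical
  refine DirectSum.linearMap_ext ℂ fun y => ?_
  exact TensorProduct.ext' fun a w => H y a w

/-- A single letter as a word of length `0`. -/
def single {x z : Ob} : Q z x →ₗ[ℂ] Word Q 0 x z := LinearMap.id

/-- Words are spanned by the pure ones. -/
theorem wordInd {z : Ob} {p : ∀ k x, Word Q k x z → Prop}
    (add : ∀ k x v w, p k x v → p k x w → p k x (v + w))
    (zero : ∀ k x, p k x 0)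
    (h0 : ∀ x (a : Q z x), p 0 x (single a))
    (hc : ∀ k x y (a : Q y x) (w : Word Q k y z), p k y w → p (k + 1) x (cons a w)) :
    ∀ k x (w : Word Q k x z), p k x w := by
  classical
  intro k
  induction k with
  | zero => exact fun x w => h0 x w
  | succ k ih =>
    intro x w
    refine DirectSum.induction_on (motive := p (k + 1) x) w (zero _ _) (fun y t => ?_)
      (fun v w => add (k + 1) x v w)
    refine TensorProduct.induction_on
      (motive := fun t => p (k + 1) x (DirectSum.of (fun y => Q y x ⊗[ℂ] Word Q k y z) y t))
      t ?_ (fun a w => hc k x y a w (ih y w)) ?_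
    · rw [map_zero]; exact zero _ _
    · intro s t hs ht
      rw [map_add]; exact add _ _ _ _ hs ht

end Word
end Words

/-- A small `ℤ/2`-graded curved differential graded category over `ℂ`.
The grading of each morphism space is recorded by the involution `gr`, `gr a = (-1)^|a| a`
(the even and odd parts are its eigenspaces for `1` and `-1`); `d` is the odd differential,
`h x` is the even curvature of `x`, and `d² a = h a - a h`. -/
structure CdgCat where
  Ob : Type
  Hom : Ob → Ob → ModuleCat.{0} ℂ
  comp : ∀ {x y z : Ob}, Hom y z →ₗ[ℂ] Hom x y →ₗ[ℂ] Hom x z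
  one : ∀ x : Ob, Hom x x
  one_comp : ∀ {x y : Ob} (a : Hom x y), comp (one y) a = a
  comp_one : ∀ {x y : Ob} (a : Hom x y), comp a (one x) = a
  assoc : ∀ {w x y z : Ob} (a : Hom y z) (b : Hom x y) (c : Hom w x),
    comp (comp a b) c = comp a (comp b c)
  gr : ∀ {x y : Ob}, Hom x y →ₗ[ℂ] Hom x y
  gr_gr : ∀ {x y : Ob} (a : Hom x y), gr (gr a) = a
  gr_one : ∀ x : Ob, gr (one x) = one x
  gr_comp : ∀ {x y z : Ob} (a : Hom y z) (b : Hom x y), gr (comp a b) = comp (gr a) (gr b)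
  d : ∀ {x y : Ob}, Hom x y →ₗ[ℂ] Hom x y
  d_gr : ∀ {x y : Ob} (a : Hom x y), d (gr a) = -gr (d a)
  d_comp : ∀ {x y z : Ob} (a : Hom y z) (b : Hom x y),
    d (comp a b) = comp (d a) b + comp (gr a) (d b)
  h : ∀ x : Ob, Hom x x
  gr_h : ∀ x : Ob, gr (h x) = h x
  d_h : ∀ x : Ob, d (h x) = 0
  d_d : ∀ {x y : Ob} (a : Hom x y), d (d a) = comp (h y) a - comp a (h x)

section Hoch
variable (C : CdgCat)
open Word

/-- Multiply the first letter of a word from the left: `a₀[a₁|…] ↦ (b a₀)[a₁|…]`. -/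
def lmul : ∀ (k : ℕ) {x y z : C.Ob}, C.Hom x y →ₗ[ℂ] Word C.Hom k x z →ₗ[ℂ] Word C.Hom k y z
  | 0, _, _, _ => C.comp
  | _ + 1, _, _, _ => LinearMap.flip (lift fun _ =>
      (LinearMap.llcomp ℂ _ _ _).flip.compl₁₂ C.comp.flip cons.flip)

/-- `a₀[a₁|…|a_k] ↦ (-1)^e a₀[a₁|…|a_k]` with `e = ∑_{i ≤ k} (|a_i| + 1)`. -/
def koszul : ∀ (k : ℕ) {x z : C.Ob}, Word C.Hom k x z →ₗ[ℂ] Word C.Hom k x z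
  | 0, _, _ => -C.gr
  | k + 1, _, _ => lift fun _ => -cons.compl₁₂ C.gr (koszul k)

/-- Insertion of curvature:
`a₀[…|a_k] ↦ ∑_{i ≤ k} (-1)^(|a₀| + … + |a_i| + i) a₀[…|a_i|h|a_{i+1}|…]`. -/
def hochD0 : ∀ (k : ℕ) {x z : C.Ob}, Word C.Hom k x z →ₗ[ℂ] Word C.Hom (k + 1) x z
  | 0, _, z => (cons.flip (single (C.h z))).comp C.gr
  | k + 1, _, _ => lift fun y => cons.compl₁₂ C.gr (cons (C.h y) - hochD0 k)

/-- Internal differential: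
`a₀[…|a_k] ↦ ∑_{i ≤ k} (-1)^(|a₀| + … + |a_{i-1}| + i) a₀[…|d a_i|…]`. -/
def hochD1 : ∀ (k : ℕ) {x z : C.Ob}, Word C.Hom k x z →ₗ[ℂ] Word C.Hom k x z
  | 0, _, _ => C.d
  | k + 1, _, _ => lift fun _ => cons.comp C.d - cons.compl₁₂ C.gr (hochD1 k)

/-- Multiplication of adjacent letters (the non-cyclic part of the bar differential):
`a₀[…|a_k] ↦ ∑_{i < k} (-1)^(|a₀| + … + |a_i| + i) a₀[…|a_i a_{i+1}|…]`. -/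
def hochMerge : ∀ (k : ℕ) {x z : C.Ob}, Word C.Hom (k + 1) x z →ₗ[ℂ] Word C.Hom k x z
  | 0, _, _ => lift fun _ => (lmul C 0).comp C.gr
  | k + 1, _, _ => lift fun _ => (lmul C (k + 1)).comp C.gr - cons.compl₁₂ C.gr (hochMerge k)

open Classical in
/-- Split off the last letter, `a₀[…|a_{k+1}] ↦ a_{k+1} ⊗ a₀[…|a_k]`. -/
def lastLetter : ∀ (k : ℕ) {x z : C.Ob}, Word C.Hom (k + 1) x z →ₗ[ℂ]
    ⨁ y : C.Ob, (C.Hom z y ⊗[ℂ] Word C.Hom k x y)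
  | 0, _, _ => lift fun y => ((TensorProduct.mk ℂ _ _).compr₂
      (DirectSum.lof ℂ C.Ob (fun y => C.Hom _ y ⊗[ℂ] Word C.Hom 0 _ y) y)).flip
  | k + 1, _, _ => lift fun _ => LinearMap.flip (((DirectSum.toModule ℂ C.Ob _ fun u =>
      LinearMap.flip ((LinearMap.llcomp ℂ _ _ _
        (DirectSum.lof ℂ C.Ob (fun u => C.Hom _ u ⊗[ℂ] Word C.Hom (k + 1) _ u) u)).comp
        ((LinearMap.lTensorHom (C.Hom _ u)).comp cons)))).comp (lastLetter k))

/-- The cyclic term of a word with last letter `b` and remaining word `v = a₀[…|a_k]`: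
it is `(-1)^(1 + (|b| + 1)(|a₀| + … + |a_k| + k)) (b a₀)[a₁|…|a_k]`. For `b` even the sign is that of
`koszul`, for `b` odd it is `-1`; the two parts `(b + gr b)/2` and `(b - gr b)/2` of a general `b`
are treated separately. -/
def cycSign (k : ℕ) {x y : C.Ob} : C.Hom x y →ₗ[ℂ] Word C.Hom k x y →ₗ[ℂ] Word C.Hom k y y :=
  (2⁻¹ : ℂ) • ((lmul C k).compl₁₂ (LinearMap.id + C.gr) (koszul C k)
    - (lmul C k).comp (LinearMap.id - C.gr))

/-- Hochschild chains of length `k`: cyclically composable words. -/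
abbrev HochChain (k : ℕ) : Type := ⨁ x : C.Ob, Word C.Hom k x x

open Classical in
/-- The cyclic part of the bar differential. -/
def hochCyc (k : ℕ) (x : C.Ob) : Word C.Hom (k + 1) x x →ₗ[ℂ] HochChain C k :=
  (DirectSum.toModule ℂ C.Ob _ fun y =>
    (DirectSum.lof ℂ C.Ob (fun y => Word C.Hom k y y) y).comp
      (TensorProduct.lift (cycSign C k))).comp (lastLetter C k)

open Classical in
/-- The bar differential `d₂` on chains: the products of adjacent letters and the cyclic term. -/
def hochD2 (k : ℕ) : HochChain C (k + 1) →ₗ[ℂ] HochChain C k :=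
  DirectSum.toModule ℂ C.Ob _ fun x =>
    (DirectSum.lof ℂ C.Ob (fun y => Word C.Hom k y y) x).comp (hochMerge C k) + hochCyc C k x

/-- The Hochschild complex of the second kind: the product over all lengths. -/
abbrev HochII : Type := ∀ k : ℕ, HochChain C k

/-- The Hochschild differential of the second kind, `d₀ + d₁ + d₂`. -/
def hochD : HochII C →ₗ[ℂ] HochII C :=
  LinearMap.pi fun k => match k with
    | 0 => (DirectSum.lmap fun _ => hochD1 C 0).comp (LinearMap.proj 0)
        + (hochD2 C 0).comp (LinearMap.proj 1)
    | k + 1 => (DirectSum.lmap fun _ => hochD0 C k).comp (LinearMap.proj k)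
        + (DirectSum.lmap fun _ => hochD1 C (k + 1)).comp (LinearMap.proj (k + 1))
        + (hochD2 C (k + 1)).comp (LinearMap.proj (k + 2))

/-- The `ℤ/2`-grading: `a₀[a₁|…|a_k]` has degree `|a₀| + ∑_{i ≥ 1} (|a_i| + 1)`. -/
def hochGr : HochII C →ₗ[ℂ] HochII C :=
  LinearMap.pi fun k => (DirectSum.lmap fun _ => -koszul C k).comp (LinearMap.proj k)

end Hoch

section Square
variable {C : CdgCat}
open Word

section
variable {x y z u : C.Ob}

theorem lmul_single (b : C.Hom x y) (a : C.Hom z x) :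
    lmul C 0 b (single a) = single (C.comp b a) := rfl

theorem lmul_cons {k : ℕ} (b : C.Hom x y) (a : C.Hom u x) (w : Word C.Hom k u z) :
    lmul C (k + 1) b (cons a w) = cons (C.comp b a) w := by
  simp [lmul]

theorem koszul_single (a : C.Hom z x) : koszul C 0 (single a) = -single (C.gr a) := rfl

theorem koszul_cons {k : ℕ} (a : C.Hom y x) (w : Word C.Hom k y z) :
    koszul C (k + 1) (cons a w) = -cons (C.gr a) (koszul C k w) := by
  simp [koszul]

theorem hochD1_single (a : C.Hom z x) : hochD1 C 0 (single a) = single (C.d a) := rfl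

theorem hochD1_cons {k : ℕ} (a : C.Hom y x) (w : Word C.Hom k y z) :
    hochD1 C (k + 1) (cons a w) = cons (C.d a) w - cons (C.gr a) (hochD1 C k w) := by
  simp [hochD1]

theorem hochD0_single (a : C.Hom z x) :
    hochD0 C 0 (single a) = cons (C.gr a) (single (C.h z)) := rfl

theorem hochD0_cons {k : ℕ} (a : C.Hom y x) (w : Word C.Hom k y z) :
    hochD0 C (k + 1) (cons a w) =
      cons (C.gr a) (cons (C.h y) w) - cons (C.gr a) (hochD0 C k w) := by
  simp [hochD0]

theorem hochMerge_zero (a : C.Hom y x) (w : Word C.Hom 0 y z) :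
    hochMerge C 0 (cons a w) = lmul C 0 (C.gr a) w := by
  simp [hochMerge]

theorem hochMerge_succ {k : ℕ} (a : C.Hom y x) (w : Word C.Hom (k + 1) y z) :
    hochMerge C (k + 1) (cons a w) =
      lmul C (k + 1) (C.gr a) w - cons (C.gr a) (hochMerge C k w) := by
  simp [hochMerge]

end

/-- Sums of words of all lengths. Together with the operators below this is only used to show
that the Hochschild differential squares to zero and is compatible with functors. -/
abbrev Words (C : CdgCat) (x z : C.Ob) : Type := ⨁ k : ℕ, Word C.Hom k x z

namespace Words

def ι (k : ℕ) {x z : C.Ob} : Word C.Hom k x z →ₗ[ℂ] Words C x z :=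
  DirectSum.lof ℂ ℕ (fun k => Word C.Hom k x z) k

def sg {x z : C.Ob} : C.Hom z x →ₗ[ℂ] Words C x z := (ι 0).comp single

def cn {x y z : C.Ob} : C.Hom y x →ₗ[ℂ] Words C y z →ₗ[ℂ] Words C x z :=
  LinearMap.flip (DirectSum.toModule ℂ ℕ _ fun k => (Word.cons.compr₂ (ι (k + 1))).flip)

theorem sg_eq {x z : C.Ob} (a : C.Hom z x) : (sg a : Words C x z) = ι 0 (single a) := rfl

theorem cn_ι {k : ℕ} {x y z : C.Ob} (a : C.Hom y x) (w : Word C.Hom k y z) :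
    cn a (ι k w) = ι (k + 1) (Word.cons a w) := by
  simp [cn, ι]

theorem ind {z : C.Ob} {p : ∀ x, Words C x z → Prop}
    (zero : ∀ x, p x 0) (add : ∀ x v w, p x v → p x w → p x (v + w))
    (h0 : ∀ x (a : C.Hom z x), p x (sg a))
    (hc : ∀ x y (a : C.Hom y x) (w : Words C y z), p y w → p x (cn a w)) :
    ∀ x w, p x w := by
  intro x w
  induction w using DirectSum.induction_on with
  | zero => exact zero x
  | add v w hv hw => exact add _ _ _ hv hw
  | of k w =>
    refine wordInd (p := fun k x w => p x (ι k w)) ?_ ?_ ?_ ?_ k x w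
    · intro k x v w hv hw; rw [map_add]; exact add _ _ _ hv hw
    · intro k x; rw [map_zero]; exact zero x
    · exact h0
    · intro k x y a w hw; rw [← cn_ι]; exact hc _ _ _ _ hw

theorem ind_ι {y z : C.Ob} {p : Words C y z → Prop} (zero : p 0)
    (add : ∀ v w, p v → p w → p (v + w))
    (h : ∀ k (w : Word C.Hom k y z), p (ι k w)) (w : Words C y z) : p w :=
  DirectSum.induction_on w zero (fun k w => h k w) add

def lm {x y z : C.Ob} : C.Hom x y →ₗ[ℂ] Words C x z →ₗ[ℂ] Words C y z :=
  LinearMap.flip (DirectSum.toModule ℂ ℕ _ fun k => ((lmul C k).compr₂ (ι k)).flip)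

def T {x z : C.Ob} : Words C x z →ₗ[ℂ] Words C x z := DirectSum.lmap fun k => koszul C k

/-- The part of the differential that involves no cyclic permutation. -/
def N {x z : C.Ob} : Words C x z →ₗ[ℂ] Words C x z :=
  DirectSum.toModule ℂ ℕ _ fun k => (ι (k + 1)).comp (hochD0 C k) + (ι k).comp (hochD1 C k)
    + match k with
      | 0 => 0
      | k + 1 => (ι k).comp (hochMerge C k)

section
variable {x y z u : C.Ob}

theorem lm_ι (b : C.Hom x y) (k : ℕ) (w : Word C.Hom k x z) : lm b (ι k w) = ι k (lmul C k b w) := by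
  simp [lm, ι]

theorem T_ι (k : ℕ) (w : Word C.Hom k x z) : T (ι k w) = ι k (koszul C k w) := by
  simp [T, ι]

theorem N_ι_zero (w : Word C.Hom 0 x z) :
    N (ι 0 w) = ι 1 (hochD0 C 0 w) + ι 0 (hochD1 C 0 w) := by
  simp [N, ι]

theorem N_ι_succ (k : ℕ) (w : Word C.Hom (k + 1) x z) :
    N (ι (k + 1) w) = ι (k + 2) (hochD0 C (k + 1) w) + ι (k + 1) (hochD1 C (k + 1) w)
      + ι k (hochMerge C k w) := by
  simp [N, ι]

theorem lm_sg (b : C.Hom x y) (a : C.Hom z x) : lm b (sg a) = sg (C.comp b a) := by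
  rw [sg_eq, lm_ι, lmul_single, sg_eq]

theorem lm_cn (b : C.Hom x y) (a : C.Hom u x) (w : Words C u z) :
    lm b (cn a w) = cn (C.comp b a) w := by
  induction w using ind_ι with
  | zero => simp
  | add v w hv hw => simp only [map_add, hv, hw]
  | h k w => rw [cn_ι, lm_ι, cn_ι, lmul_cons]

theorem T_sg (a : C.Hom z x) : T (sg a) = -sg (C.gr a) := by
  rw [sg_eq, T_ι, koszul_single, map_neg, sg_eq]

theorem T_cn (a : C.Hom y x) (w : Words C y z) : T (cn a w) = -cn (C.gr a) (T w) := by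
  induction w using ind_ι with
  | zero => simp
  | add v w hv hw => simp only [map_add, hv, hw]; abel
  | h k w => rw [cn_ι, T_ι, T_ι, cn_ι, koszul_cons, map_neg]

theorem N_sg (a : C.Hom z x) : N (sg a) = sg (C.d a) + cn (C.gr a) (sg (C.h z)) := by
  rw [sg_eq, N_ι_zero, hochD0_single, hochD1_single, sg_eq, sg_eq, cn_ι, add_comm]

theorem N_cn (a : C.Hom y x) (w : Words C y z) :
    N (cn a w) = cn (C.d a) w + cn (C.gr a) (cn (C.h y) w) - cn (C.gr a) (N w) + lm (C.gr a) w := by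
  induction w using ind_ι with
  | zero => simp
  | add v w hv hw => simp only [map_add, hv, hw]; abel
  | h k w =>
    cases k with
    | zero =>
      rw [cn_ι, N_ι_succ, N_ι_zero, hochD0_cons, hochD1_cons, hochMerge_zero, lm_ι]
      simp only [map_sub, map_add, cn_ι]
      abel
    | succ k =>
      rw [cn_ι, N_ι_succ, N_ι_succ, hochD0_cons, hochD1_cons, hochMerge_succ, lm_ι]
      simp only [map_sub, map_add, cn_ι]
      abel

theorem lm_lm (b : C.Hom x y) (c : C.Hom y u) (w : Words C x z) :
    lm c (lm b w) = lm (C.comp c b) w := by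
  revert y u b c
  refine ind (p := fun x w => ∀ {y u : C.Ob} (b : C.Hom x y) (c : C.Hom y u),
    lm c (lm b w) = lm (C.comp c b) w) ?_ ?_ ?_ ?_ x w
  · intros; simp
  · intro x v w hv hw y u b c; simp only [map_add, hv, hw]
  · intro x a y u b c; simp only [lm_sg, C.assoc]
  · intro x t a w hw y u b c; simp only [lm_cn, C.assoc]

theorem T_lm (b : C.Hom x y) (w : Words C x z) : T (lm b w) = lm (C.gr b) (T w) := by
  revert y b
  refine ind (p := fun x w => ∀ {y : C.Ob} (b : C.Hom x y),
    T (lm b w) = lm (C.gr b) (T w)) ?_ ?_ ?_ ?_ x w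
  · intros; simp
  · intro x v w hv hw y b; simp only [map_add, hv, hw]
  · intro x a y b; simp only [lm_sg, T_sg, map_neg, C.gr_comp]
  · intro x t a w hw y b; simp only [lm_cn, T_cn, map_neg, C.gr_comp]

theorem T_T (w : Words C x z) : T (T w) = w := by
  refine ind (p := fun x w => T (T w) = w) ?_ ?_ ?_ ?_ x w
  · intros; simp
  · intro x v w hv hw; simp only [map_add, hv, hw]
  · intro x a; simp only [T_sg, map_neg, C.gr_gr, neg_neg]
  · intro x t a w hw; simp only [T_cn, map_neg, C.gr_gr, neg_neg, hw]

theorem N_lm (b : C.Hom x y) (w : Words C x z) :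
    N (lm b w) = lm (C.d b) w + lm (C.gr b) (N w) := by
  revert y b
  refine ind (p := fun x w => ∀ {y : C.Ob} (b : C.Hom x y),
    N (lm b w) = lm (C.d b) w + lm (C.gr b) (N w)) ?_ ?_ ?_ ?_ x w
  · intros; simp
  · intro x v w hv hw y b; simp only [map_add, hv, hw]; abel
  · intro x a y b
    simp only [lm_sg, N_sg, map_add, lm_cn, C.d_comp, C.gr_comp]; abel
  · intro x u a w hw y b
    simp only [lm_cn, N_cn, map_add, map_sub, C.d_comp, C.gr_comp, LinearMap.add_apply, lm_lm]
    abel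

theorem N_T (w : Words C x z) : N (T w) = -T (N w) := by
  refine ind (p := fun x w => N (T w) = -T (N w)) ?_ ?_ ?_ ?_ x w
  · intros; simp
  · intro x v w hv hw; simp only [map_add, hv, hw]; abel
  · intro x a
    simp only [T_sg, N_sg, map_neg, map_add, C.d_gr, C.gr_gr, T_cn, C.gr_h]
    abel
  · intro x t a w hw
    simp only [T_cn, N_cn, map_neg, map_add, map_sub, C.d_gr, C.gr_gr, C.gr_h, hw, T_lm,
      LinearMap.neg_apply]
    abel

theorem N_N (w : Words C x z) : N (N w) = lm (C.h x) w := by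
  refine ind (p := fun x w => N (N w) = lm (C.h x) w) ?_ ?_ ?_ ?_ x w
  · intros; simp
  · intro x v w hv hw; simp only [map_add, hv, hw]
  · intro x a
    simp only [N_sg, N_cn, map_add, lm_sg, C.d_gr, C.gr_gr, C.d_d, C.gr_h, C.d_h, map_neg,
      LinearMap.neg_apply, map_zero, map_sub]
    abel
  · intro x y a w hw
    simp only [N_cn, map_add, C.d_gr, C.gr_gr, C.d_d, C.gr_h, C.d_h, map_neg,
      LinearMap.neg_apply, map_zero, map_sub, hw, N_lm, lm_cn, LinearMap.zero_apply,
      LinearMap.sub_apply]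
    abel

end

/-- Append a letter to a word. -/
def snoc : ∀ (k : ℕ) {x y z : C.Ob},
    Word C.Hom k x y →ₗ[ℂ] C.Hom z y →ₗ[ℂ] Word C.Hom (k + 1) x z
  | 0, _, _, _ => (cons (Q := C.Hom) (k := 0)).compl₂ (single (Q := C.Hom))
  | k + 1, _, _, _ => lift fun _ => (LinearMap.llcomp ℂ _ _ _).compl₁₂ cons (snoc k)

def sn {x y z : C.Ob} : Words C x y →ₗ[ℂ] C.Hom z y →ₗ[ℂ] Words C x z :=
  DirectSum.toModule ℂ ℕ _ fun k => (snoc k).compr₂ (ι (k + 1))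

/-- Multiply the last letter of a word from the right. -/
def rmul : ∀ (k : ℕ) {x y z : C.Ob},
    Word C.Hom k x y →ₗ[ℂ] C.Hom z y →ₗ[ℂ] Word C.Hom k x z
  | 0, _, _, _ => C.comp
  | k + 1, _, _, _ => lift fun _ => (LinearMap.llcomp ℂ _ _ _).compl₁₂ cons (rmul k)

def rm {x y z : C.Ob} : Words C x y →ₗ[ℂ] C.Hom z y →ₗ[ℂ] Words C x z :=
  DirectSum.toModule ℂ ℕ _ fun k => (rmul k).compr₂ (ι k)

section
variable {x y z u t : C.Ob}

theorem sn_ι (k : ℕ) (w : Word C.Hom k x y) (b : C.Hom z y) :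
    sn (ι k w) b = ι (k + 1) (snoc k w b) := by
  simp [sn, ι]

theorem rm_ι (k : ℕ) (w : Word C.Hom k x y) (b : C.Hom z y) :
    rm (ι k w) b = ι k (rmul k w b) := by
  simp [rm, ι]

theorem snoc_zero (a : C.Hom y x) (b : C.Hom z y) :
    snoc 0 (single a) b = cons a (single b) := rfl

theorem snoc_cons (k : ℕ) (a : C.Hom u x) (w : Word C.Hom k u y) (b : C.Hom z y) :
    snoc (k + 1) (cons a w) b = cons a (snoc k w b) := by
  simp [snoc]

theorem rmul_zero (a : C.Hom y x) (b : C.Hom z y) :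
    rmul 0 (single a) b = single (C.comp a b) := rfl

theorem rmul_cons (k : ℕ) (a : C.Hom u x) (w : Word C.Hom k u y) (b : C.Hom z y) :
    rmul (k + 1) (cons a w) b = cons a (rmul k w b) := by
  simp [rmul]

theorem sn_sg (a : C.Hom y x) (b : C.Hom z y) : sn (sg a) b = cn a (sg b) := by
  rw [sg_eq, sn_ι, snoc_zero, sg_eq, cn_ι]

theorem sn_cn (a : C.Hom u x) (w : Words C u y) (b : C.Hom z y) :
    sn (cn a w) b = cn a (sn w b) := by
  induction w using ind_ι with
  | zero => simp
  | add v w hv hw => simp only [map_add, LinearMap.add_apply, hv, hw]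
  | h k w => rw [cn_ι, sn_ι, sn_ι, cn_ι, snoc_cons]

theorem rm_sg (a : C.Hom y x) (b : C.Hom z y) : rm (sg a) b = sg (C.comp a b) := by
  rw [sg_eq, rm_ι, rmul_zero, sg_eq]

theorem rm_cn (a : C.Hom u x) (w : Words C u y) (b : C.Hom z y) :
    rm (cn a w) b = cn a (rm w b) := by
  induction w using ind_ι with
  | zero => simp
  | add v w hv hw => simp only [map_add, LinearMap.add_apply, hv, hw]
  | h k w => rw [cn_ι, rm_ι, rm_ι, cn_ι, rmul_cons]

theorem ind_sn {p : Words C x z → Prop} (zero : p 0) (add : ∀ v w, p v → p w → p (v + w))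
    (h0 : ∀ a : C.Hom z x, p (sg a))
    (h1 : ∀ (y : C.Ob) (v : Words C x y) (b : C.Hom z y), p (sn v b)) (w : Words C x z) : p w := by
  revert p
  refine ind (p := fun x w => ∀ {p : Words C x z → Prop}, p 0 → (∀ v w, p v → p w → p (v + w)) →
    (∀ a : C.Hom z x, p (sg a)) →
    (∀ (y : C.Ob) (v : Words C x y) (b : C.Hom z y), p (sn v b)) → p w) ?_ ?_ ?_ ?_ x w
  · intro x p h _ _ _; exact h
  · intro x v w hv hw p h ha h0 h1; exact ha _ _ (hv h ha h0 h1) (hw h ha h0 h1)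
  · intro x a p h ha h0 h1; exact h0 a
  · intro x y a w hw p h ha h0 h1
    refine hw (p := fun w => p (cn a w)) ?_ ?_ ?_ ?_
    · rw [map_zero]; exact h
    · intro v w hv hw; rw [map_add]; exact ha _ _ hv hw
    · intro b; rw [← sn_sg]; exact h1 _ _ _
    · intro y v b; rw [← sn_cn]; exact h1 _ _ _

theorem lm_sn (c : C.Hom x u) (v : Words C x y) (b : C.Hom z y) :
    lm c (sn v b) = sn (lm c v) b := by
  revert u c
  refine ind (p := fun x v => ∀ {u : C.Ob} (c : C.Hom x u), lm c (sn v b) = sn (lm c v) b)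
    ?_ ?_ ?_ ?_ x v
  · intros; simp
  · intro x v w hv hw u c; simp only [map_add, LinearMap.add_apply, hv, hw]
  · intro x a u c; simp only [sn_sg, lm_cn, lm_sg]
  · intro x y a w hw u c; simp only [sn_cn, lm_cn]

theorem rm_sn (v : Words C x y) (b : C.Hom z y) (c : C.Hom u z) :
    rm (sn v b) c = sn v (C.comp b c) := by
  refine ind (p := fun x v => rm (sn v b) c = sn v (C.comp b c)) ?_ ?_ ?_ ?_ x v
  · intros; simp
  · intro x v w hv hw; simp only [map_add, LinearMap.add_apply, hv, hw]
  · intro x a; simp only [sn_sg, rm_cn, rm_sg]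
  · intro x y a w hw; simp only [sn_cn, rm_cn, hw]

theorem T_sn (v : Words C x y) (b : C.Hom z y) : T (sn v b) = -sn (T v) (C.gr b) := by
  refine ind (p := fun x v => T (sn v b) = -sn (T v) (C.gr b)) ?_ ?_ ?_ ?_ x v
  · intros; simp
  · intro x v w hv hw; simp only [map_add, LinearMap.add_apply, hv, hw]; abel
  · intro x a; simp only [sn_sg, T_sg, T_cn, map_neg, LinearMap.neg_apply]
  · intro x y a w hw; simp only [sn_cn, T_cn, hw, map_neg, LinearMap.neg_apply]

theorem N_sn (v : Words C x y) (b : C.Hom z y) :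
    N (sn v b) = sn (N v) b + sn (T v) (C.d b) + sn (sn (T v) (C.gr b)) (C.h z) - rm (T v) b := by
  refine ind (p := fun x v => N (sn v b) =
    sn (N v) b + sn (T v) (C.d b) + sn (sn (T v) (C.gr b)) (C.h z) - rm (T v) b) ?_ ?_ ?_ ?_ x v
  · intros; simp
  · intro x v w hv hw; simp only [map_add, LinearMap.add_apply, hv, hw]; abel
  · intro x a
    simp only [sn_sg, N_sg, N_cn, T_sg, map_add, map_neg, LinearMap.neg_apply, LinearMap.add_apply,
      sn_cn, rm_sg, lm_sg]
    abel
  · intro x t a w hw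
    simp only [sn_cn, N_cn, T_cn, hw, map_add, map_sub, map_neg, LinearMap.neg_apply,
      LinearMap.add_apply, LinearMap.sub_apply, rm_cn, lm_sn]
    abel

open Classical in
theorem lastLetter_snoc (k : ℕ) (w : Word C.Hom k x y) (b : C.Hom z y) :
    lastLetter C k (snoc k w b) =
      DirectSum.lof ℂ C.Ob (fun y => C.Hom z y ⊗[ℂ] Word C.Hom k x y) y (b ⊗ₜ w) := by
  refine wordInd (p := fun k x w => lastLetter C k (snoc k w b) =
      DirectSum.lof ℂ C.Ob (fun y => C.Hom z y ⊗[ℂ] Word C.Hom k x y) y (b ⊗ₜ w)) ?_ ?_ ?_ ?_ k x w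
  · intro k x v w hv hw
    rw [map_add, LinearMap.add_apply, map_add, hv, hw, TensorProduct.tmul_add, map_add]
  · intro k x; simp
  · intro x a
    rw [snoc_zero]
    exact (lift_cons _ a (single b)).trans rfl
  · intro k x u a w hw
    rw [snoc_cons]
    simp only [lastLetter, lift_cons, LinearMap.flip_apply, LinearMap.comp_apply, hw,
      DirectSum.toModule_lof]
    rfl

/-- Finite sums of Hochschild chains of all lengths. -/
abbrev Cyc (C : CdgCat) : Type := ⨁ k : ℕ, HochChain C k

open Classical in
/-- A cyclic word as a chain. -/
def inc : Words C x x →ₗ[ℂ] Cyc C := DirectSum.toModule ℂ ℕ _ fun k =>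
  (DirectSum.lof ℂ ℕ (fun k => HochChain C k) k).comp
    (DirectSum.lof ℂ C.Ob (fun y => Word C.Hom k y y) x)

/-- The cyclic part of the differential. -/
def cyc : Words C x x →ₗ[ℂ] Cyc C := DirectSum.toModule ℂ ℕ _ fun k =>
  match k with
  | 0 => 0
  | k + 1 => (DirectSum.lof ℂ ℕ (fun k => HochChain C k) k).comp (hochCyc C k x)

def K (b : C.Hom x y) (v : Words C x y) : Words C y y :=
  (2⁻¹ : ℂ) • (lm (b + C.gr b) (T v) - lm (b - C.gr b) v)

theorem cyc_sg (a : C.Hom x x) : cyc (sg a) = 0 := by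
  simp [cyc, sg, ι]

theorem cyc_sn (v : Words C x y) (b : C.Hom x y) : cyc (sn v b) = inc (K b v) := by
  induction v using ind_ι with
  | zero => simp [K]
  | add v w hv hw =>
    rw [map_add, LinearMap.add_apply, map_add, hv, hw, ← map_add]
    congr 1
    simp only [K, map_add, ← smul_add]
    congr 1; abel
  | h k w =>
    rw [sn_ι, K, T_ι, lm_ι, lm_ι, ← map_sub, ← map_smul]
    simp only [cyc, ι, inc, DirectSum.toModule_lof, LinearMap.comp_apply, hochCyc, lastLetter_snoc,
      TensorProduct.lift.tmul, cycSign]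
    rfl

open Classical in
/-- The differential on finite sums of chains. -/
def Dt : Cyc C →ₗ[ℂ] Cyc C := DirectSum.toModule ℂ ℕ _ fun k =>
  DirectSum.toModule ℂ C.Ob _ fun _ => (inc.comp N + cyc).comp (ι k)

open Classical in
theorem Dt_inc (w : Words C x x) : Dt (inc w) = inc (N w) + cyc w := by
  induction w using ind_ι with
  | zero => simp
  | add v w hv hw => simp only [map_add, hv, hw]; abel
  | h k w =>
    have : inc (ι k w) = DirectSum.lof ℂ ℕ (fun k => HochChain C k) k
        (DirectSum.lof ℂ C.Ob (fun y => Word C.Hom k y y) x w) := by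
      simp [inc, ι]
    rw [this, Dt, DirectSum.toModule_lof, DirectSum.toModule_lof]
    rfl

theorem K_even {b : C.Hom x y} (hb : C.gr b = b) (v : Words C x y) : K b v = lm b (T v) := by
  rw [K, hb, sub_self, map_zero, LinearMap.zero_apply, sub_zero, ← two_smul ℂ b, map_smul,
    LinearMap.smul_apply, smul_smul, inv_mul_cancel₀ two_ne_zero, one_smul]

theorem K_odd {b : C.Hom x y} (hb : C.gr b = -b) (v : Words C x y) : K b v = -lm b v := by
  rw [K, hb, add_neg_cancel, map_zero, LinearMap.zero_apply, sub_neg_eq_add, zero_sub,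
    ← two_smul ℂ b, map_smul, LinearMap.smul_apply, smul_neg, smul_smul,
    inv_mul_cancel₀ two_ne_zero, one_smul]

theorem K_add (b c : C.Hom x y) (v : Words C x y) : K (b + c) v = K b v + K c v := by
  simp only [K, map_add, map_sub, LinearMap.add_apply, LinearMap.sub_apply, ← smul_add]
  congr 1; abel

theorem cyc_even {b : C.Hom x y} (hb : C.gr b = b) (u : Words C x y) :
    cyc (lm b u) = cyc (rm u b) := by
  refine ind_sn (p := fun u => cyc (lm b u) = cyc (rm u b)) ?_ ?_ ?_ ?_ u
  · simp
  · intro v w hv hw; simp only [map_add, LinearMap.add_apply, hv, hw]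
  · intro a; rw [lm_sg, rm_sg, cyc_sg, cyc_sg]
  · intro z v c
    rw [lm_sn, rm_sn, cyc_sn, cyc_sn]
    simp only [K, T_lm, lm_lm, C.gr_comp, hb, map_add, map_sub, LinearMap.add_apply,
      LinearMap.sub_apply]

theorem cyc_odd {b : C.Hom x y} (hb : C.gr b = -b) (u : Words C x y) :
    cyc (lm b u) = -cyc (rm (T u) b) := by
  refine ind_sn (p := fun u => cyc (lm b u) = -cyc (rm (T u) b)) ?_ ?_ ?_ ?_ u
  · simp
  · intro v w hv hw; simp only [map_add, LinearMap.add_apply, hv, hw]; abel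
  · intro a; rw [lm_sg, T_sg, map_neg, LinearMap.neg_apply, rm_sg, map_neg, cyc_sg, cyc_sg]; simp
  · intro z v c
    rw [lm_sn, T_sn, map_neg, LinearMap.neg_apply, rm_sn, map_neg, neg_neg, cyc_sn, cyc_sn]
    congr 1
    simp only [K, T_lm, T_T, lm_lm, C.gr_comp, C.gr_gr, hb, map_add, map_sub, map_neg,
      LinearMap.add_apply, LinearMap.sub_apply, LinearMap.neg_apply]
    congr 1; abel

theorem Dt_Dt_sn (v : Words C x y) (b : C.Hom x y) : Dt (Dt (inc (sn v b))) = 0 := by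
  have key : ∀ b : C.Hom x y, (C.gr b = b ∨ C.gr b = -b) → Dt (Dt (inc (sn v b))) = 0 := by
    intro b hb
    rw [Dt_inc, map_add, Dt_inc, N_N, cyc_sn, Dt_inc, N_sn, map_sub, map_add, map_add, cyc_sn,
      cyc_sn, cyc_sn, K_even (C.gr_h x), T_sn, T_T, C.gr_gr]
    rcases hb with hb | hb
    · have hd : C.gr (C.d b) = -C.d b := by rw [← neg_eq_iff_eq_neg, ← C.d_gr, hb]
      rw [K_even hb, K_even hb, K_odd hd, cyc_even hb, N_lm, N_T, hb]
      simp only [map_add, map_neg]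
      abel
    · have hd : C.gr (C.d b) = C.d b := by rw [← neg_inj, ← C.d_gr, hb, map_neg]
      rw [K_odd hb, K_odd hb, K_even hd, T_T, map_neg N, map_neg cyc, cyc_odd hb, N_lm, hb]
      simp only [map_add, map_neg, LinearMap.neg_apply]
      abel
  have h2 : b = (2⁻¹ : ℂ) • (b + C.gr b) + (2⁻¹ : ℂ) • (b - C.gr b) := by
    rw [← smul_add, add_add_sub_cancel, ← two_smul ℂ b, smul_smul,
      inv_mul_cancel₀ two_ne_zero, one_smul]
  rw [h2, map_add, map_add, map_add, map_add, key, key, add_zero]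
  · right; rw [map_smul, map_sub, C.gr_gr, ← smul_neg, neg_sub]
  · left; rw [map_smul, map_add, C.gr_gr, add_comm]

theorem Dt_Dt_inc (w : Words C x x) : Dt (Dt (inc w)) = 0 := by
  refine ind_sn (p := fun w => Dt (Dt (inc w)) = 0) ?_ ?_ ?_ ?_ w
  · simp
  · intro v w hv hw; simp only [map_add, hv, hw, add_zero]
  · intro a
    rw [Dt_inc, cyc_sg, add_zero, Dt_inc, N_N, N_sg, map_add, cyc_sg, ← sn_sg, cyc_sn,
      K_even (C.gr_h x), T_sg, C.gr_gr, zero_add, ← map_add]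
    simp
  · intro y v b; exact Dt_Dt_sn v b

end

open Classical in
theorem Dt_lof (k : ℕ) (x : C.Ob) (w : Word C.Hom k x x) :
    Dt (DirectSum.lof ℂ ℕ (fun k => HochChain C k) k
        (DirectSum.lof ℂ C.Ob (fun y => Word C.Hom k y y) x w)) = inc (N (ι k w)) + cyc (ι k w) := by
  rw [Dt, DirectSum.toModule_lof, DirectSum.toModule_lof]
  rfl

open Classical in
theorem inc_ι (k : ℕ) (x : C.Ob) (w : Word C.Hom k x x) :
    inc (ι k w) = DirectSum.lof ℂ ℕ (fun k => HochChain C k) k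
        (DirectSum.lof ℂ C.Ob (fun y => Word C.Hom k y y) x w) := by
  simp [inc, ι]

theorem Dt_lof_zero (c : HochChain C 0) :
    Dt (DirectSum.lof ℂ ℕ (fun k => HochChain C k) 0 c) =
      DirectSum.lof ℂ ℕ (fun k => HochChain C k) 1 (DirectSum.lmap (fun _ => hochD0 C 0) c)
      + DirectSum.lof ℂ ℕ (fun k => HochChain C k) 0 (DirectSum.lmap (fun _ => hochD1 C 0) c) := by
  classical
  induction c using DirectSum.induction_on with
  | zero => simp
  | add v w hv hw => simp only [map_add, hv, hw]; abel
  | of x w =>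
    have := Dt_lof 0 x w
    rw [DirectSum.lof_eq_of, DirectSum.lof_eq_of] at this
    rw [DirectSum.lof_eq_of, this, N_ι_zero, map_add, inc_ι, inc_ι, ← DirectSum.lof_eq_of ℂ,
      DirectSum.lmap_lof, DirectSum.lmap_lof]
    simp [cyc, ι]

theorem Dt_lof_succ (k : ℕ) (c : HochChain C (k + 1)) :
    Dt (DirectSum.lof ℂ ℕ (fun k => HochChain C k) (k + 1) c) =
      DirectSum.lof ℂ ℕ (fun k => HochChain C k) (k + 2)
        (DirectSum.lmap (fun _ => hochD0 C (k + 1)) c)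
      + DirectSum.lof ℂ ℕ (fun k => HochChain C k) (k + 1)
        (DirectSum.lmap (fun _ => hochD1 C (k + 1)) c)
      + DirectSum.lof ℂ ℕ (fun k => HochChain C k) k (hochD2 C k c) := by
  classical
  induction c using DirectSum.induction_on with
  | zero => simp
  | add v w hv hw => simp only [map_add, hv, hw]; abel
  | of x w =>
    have := Dt_lof (k + 1) x w
    rw [DirectSum.lof_eq_of, DirectSum.lof_eq_of] at this
    rw [DirectSum.lof_eq_of, this, N_ι_succ, map_add, map_add, inc_ι, inc_ι, inc_ι,
      ← DirectSum.lof_eq_of ℂ, DirectSum.lmap_lof, DirectSum.lmap_lof, hochD2,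
      DirectSum.toModule_lof]
    simp [cyc, ι]
    abel

theorem Dt_Dt (c : Cyc C) : Dt (Dt c) = 0 := by
  classical
  induction c using DirectSum.induction_on with
  | zero => simp
  | add v w hv hw => simp only [map_add, hv, hw, add_zero]
  | of k c =>
    induction c using DirectSum.induction_on with
    | zero => simp
    | add v w hv hw => simp only [map_add, hv, hw, add_zero]
    | of x w =>
      have := Dt_Dt_inc (ι k w)
      rwa [inc_ι] at this

end Words

section
open Words
variable (C)

abbrev δ0 (k : ℕ) : HochChain C k →ₗ[ℂ] HochChain C (k + 1) := DirectSum.lmap fun _ => hochD0 C k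
abbrev δ1 (k : ℕ) : HochChain C k →ₗ[ℂ] HochChain C k := DirectSum.lmap fun _ => hochD1 C k

theorem lof_ne {k j : ℕ} (h : k ≠ j) (c : HochChain C k) :
    (DirectSum.lof ℂ ℕ (fun k => HochChain C k) k c) j = 0 := by
  rw [DirectSum.lof_eq_of]; exact DirectSum.of_eq_of_ne _ _ _ h.symm

theorem δ_zero (c : HochChain C 0) : δ0 C 1 (δ0 C 0 c) = 0 ∧
    δ1 C 1 (δ0 C 0 c) + δ0 C 0 (δ1 C 0 c) = 0 ∧
    hochD2 C 0 (δ0 C 0 c) + δ1 C 0 (δ1 C 0 c) = 0 := by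
  have h := Dt_Dt (C := C) (DirectSum.lof ℂ ℕ (fun k => HochChain C k) 0 c)
  rw [Dt_lof_zero, map_add, Dt_lof_zero, Dt_lof_succ] at h
  refine ⟨?_, ?_, ?_⟩
  · simpa (disch := omega) [lof_ne, DirectSum.lof_apply] using congr($h 2)
  · simpa (disch := omega) [lof_ne, DirectSum.lof_apply] using congr($h 1)
  · simpa (disch := omega) [lof_ne, DirectSum.lof_apply] using congr($h 0)

theorem δ_succ (k : ℕ) (c : HochChain C (k + 1)) : δ0 C (k + 2) (δ0 C (k + 1) c) = 0 ∧
    δ1 C (k + 2) (δ0 C (k + 1) c) + δ0 C (k + 1) (δ1 C (k + 1) c) = 0 ∧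
    hochD2 C (k + 1) (δ0 C (k + 1) c) + δ1 C (k + 1) (δ1 C (k + 1) c)
      + δ0 C k (hochD2 C k c) = 0 ∧
    hochD2 C k (δ1 C (k + 1) c) + δ1 C k (hochD2 C k c) = 0 := by
  have h := Dt_Dt (C := C) (DirectSum.lof ℂ ℕ (fun k => HochChain C k) (k + 1) c)
  rw [Dt_lof_succ, map_add, map_add, Dt_lof_succ, Dt_lof_succ] at h
  cases k with
  | zero =>
    rw [Dt_lof_zero] at h
    refine ⟨?_, ?_, ?_, ?_⟩
    · simpa (disch := omega) [lof_ne, DirectSum.lof_apply] using congr($h 3)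
    · simpa (disch := omega) [lof_ne, DirectSum.lof_apply] using congr($h 2)
    · simpa (disch := omega) [lof_ne, DirectSum.lof_apply] using congr($h 1)
    · simpa (disch := omega) [lof_ne, DirectSum.lof_apply] using congr($h 0)
  | succ k =>
    rw [Dt_lof_succ] at h
    refine ⟨?_, ?_, ?_, ?_⟩
    · simpa (disch := omega) [lof_ne, DirectSum.lof_apply] using congr($h (k + 4))
    · simpa (disch := omega) [lof_ne, DirectSum.lof_apply] using congr($h (k + 3))
    · simpa (disch := omega) [lof_ne, DirectSum.lof_apply] using congr($h (k + 2))
    · simpa (disch := omega) [lof_ne, DirectSum.lof_apply] using congr($h (k + 1))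

theorem δ_two (k : ℕ) (c : HochChain C (k + 2)) : hochD2 C k (hochD2 C (k + 1) c) = 0 := by
  have h := Dt_Dt (C := C) (DirectSum.lof ℂ ℕ (fun k => HochChain C k) (k + 2) c)
  rw [Dt_lof_succ, map_add, map_add, Dt_lof_succ, Dt_lof_succ, Dt_lof_succ] at h
  simpa (disch := omega) [lof_ne, DirectSum.lof_apply] using congr($h k)

end

theorem hochD_hochD (c : HochII C) : hochD C (hochD C c) = 0 := by
  have e0 : ∀ c, hochD C c 0 = δ1 C 0 (c 0) + hochD2 C 0 (c 1) := fun c => rfl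
  have es : ∀ c k, hochD C c (k + 1) =
    δ0 C k (c k) + δ1 C (k + 1) (c (k + 1)) + hochD2 C (k + 1) (c (k + 2)) := fun c k => rfl
  funext k
  match k with
  | 0 =>
    obtain ⟨_, _, h3⟩ := δ_zero C (c 0)
    obtain ⟨_, _, _, h4⟩ := δ_succ C 0 (c 1)
    have h5 := δ_two C 0 (c 2)
    rw [e0, e0, es]
    simp only [map_add, Pi.zero_apply]
    linear_combination (norm := module) h3 + h4 + h5
  | 1 =>
    obtain ⟨_, h2, _⟩ := δ_zero C (c 0)
    obtain ⟨_, _, h3, _⟩ := δ_succ C 0 (c 1)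
    obtain ⟨_, _, _, h4⟩ := δ_succ C 1 (c 2)
    have h5 := δ_two C 1 (c 3)
    rw [es, e0, es, es]
    simp only [map_add, Pi.zero_apply]
    linear_combination (norm := module) h2 + h3 + h4 + h5
  | 2 =>
    obtain ⟨h1, _, _⟩ := δ_zero C (c 0)
    obtain ⟨_, h2, _, _⟩ := δ_succ C 0 (c 1)
    obtain ⟨_, _, h3, _⟩ := δ_succ C 1 (c 2)
    obtain ⟨_, _, _, h4⟩ := δ_succ C 2 (c 3)
    have h5 := δ_two C 2 (c 4)
    rw [es, es, es, es]
    simp only [map_add, Pi.zero_apply]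
    linear_combination (norm := module) h1 + h2 + h3 + h4 + h5
  | k + 3 =>
    obtain ⟨h1, _, _, _⟩ := δ_succ C k (c (k + 1))
    obtain ⟨_, h2, _, _⟩ := δ_succ C (k + 1) (c (k + 2))
    obtain ⟨_, _, h3, _⟩ := δ_succ C (k + 2) (c (k + 3))
    obtain ⟨_, _, _, h4⟩ := δ_succ C (k + 3) (c (k + 4))
    have h5 := δ_two C (k + 3) (c (k + 5))
    rw [es, es, es, es]
    simp only [map_add, Pi.zero_apply]
    linear_combination (norm := module) h1 + h2 + h3 + h4 + h5

end Square

section Transfer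
open Words
variable {C C' : CdgCat}

theorem transfer (φ : ∀ k, HochChain C k →ₗ[ℂ] HochChain C' k) (s : ℂ)
    (H : ∀ c : Cyc C, Dt (DirectSum.lmap φ c) = s • DirectSum.lmap φ (Dt c)) (c : HochII C) :
    hochD C' (fun k => φ k (c k)) = s • fun k => φ k (hochD C c k) := by
  have e0 : ∀ (C : CdgCat) c, hochD C c 0 = δ1 C 0 (c 0) + hochD2 C 0 (c 1) := fun C c => rfl
  have es : ∀ (C : CdgCat) c k, hochD C c (k + 1) =
    δ0 C k (c k) + δ1 C (k + 1) (c (k + 1)) + hochD2 C (k + 1) (c (k + 2)) := fun C c k => rfl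
  have hz : ∀ c, δ0 C' 0 (φ 0 c) = s • φ 1 (δ0 C 0 c) ∧ δ1 C' 0 (φ 0 c) = s • φ 0 (δ1 C 0 c) := by
    intro c
    have h := H (DirectSum.lof ℂ ℕ (fun k => HochChain C k) 0 c)
    rw [Dt_lof_zero, DirectSum.lmap_lof, Dt_lof_zero, map_add, DirectSum.lmap_lof,
      DirectSum.lmap_lof] at h
    constructor
    · simpa (disch := omega) [lof_ne, DirectSum.lof_apply, DirectSum.smul_apply] using congr($h 1)
    · simpa (disch := omega) [lof_ne, DirectSum.lof_apply, DirectSum.smul_apply] using congr($h 0)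
  have hs : ∀ k c, δ0 C' (k + 1) (φ (k + 1) c) = s • φ (k + 2) (δ0 C (k + 1) c) ∧
      δ1 C' (k + 1) (φ (k + 1) c) = s • φ (k + 1) (δ1 C (k + 1) c) ∧
      hochD2 C' k (φ (k + 1) c) = s • φ k (hochD2 C k c) := by
    intro k c
    have h := H (DirectSum.lof ℂ ℕ (fun k => HochChain C k) (k + 1) c)
    rw [Dt_lof_succ, DirectSum.lmap_lof, Dt_lof_succ, map_add, map_add, DirectSum.lmap_lof,
      DirectSum.lmap_lof, DirectSum.lmap_lof] at h
    refine ⟨?_, ?_, ?_⟩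
    · simpa (disch := omega) [lof_ne, DirectSum.lof_apply, DirectSum.smul_apply] using congr($h (k + 2))
    · simpa (disch := omega) [lof_ne, DirectSum.lof_apply, DirectSum.smul_apply] using congr($h (k + 1))
    · simpa (disch := omega) [lof_ne, DirectSum.lof_apply, DirectSum.smul_apply] using congr($h k)
  funext k
  rw [Pi.smul_apply]
  match k with
  | 0 => rw [e0, e0, (hz _).2, (hs 0 _).2.2, map_add, smul_add]
  | 1 => rw [es, es, (hz _).1, (hs 0 _).2.1, (hs 1 _).2.2, map_add, map_add, smul_add, smul_add]
  | k + 2 =>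
    rw [es, es, (hs k _).1, (hs (k + 1) _).2.1, (hs (k + 2) _).2.2, map_add, map_add, smul_add,
      smul_add]

/-- Linear maps on chains agree if they agree on words. -/
theorem cyc_ext {M : Type} [AddCommGroup M] [Module ℂ M] {f g : Cyc C →ₗ[ℂ] M}
    (h : ∀ (x : C.Ob) (w : Words C x x), f (inc w) = g (inc w)) : f = g := by
  classical
  refine DirectSum.linearMap_ext ℂ fun k => DirectSum.linearMap_ext ℂ fun x => ?_
  ext w
  have := h x (ι k w)
  rwa [inc_ι] at this

end Transfer

section Grading
open Words
variable {C : CdgCat}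

/-- The grading on chains of length `k`. -/
def chainGr (C : CdgCat) (k : ℕ) : HochChain C k →ₗ[ℂ] HochChain C k :=
  DirectSum.lmap fun _ => -koszul C k

theorem lmap_chainGr_inc {x : C.Ob} (w : Words C x x) :
    DirectSum.lmap (chainGr C) (inc w) = -inc (T w) := by
  classical
  induction w using ind_ι with
  | zero => simp
  | add v w hv hw => simp only [map_add, hv, hw]; abel
  | h k w =>
    rw [T_ι, inc_ι, inc_ι, DirectSum.lmap_lof, chainGr, DirectSum.lmap_lof]
    simp

theorem cyc_T {x : C.Ob} (w : Words C x x) :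
    cyc (T w) = DirectSum.lmap (chainGr C) (cyc w) := by
  refine ind_sn (p := fun w => cyc (T w) = DirectSum.lmap (chainGr C) (cyc w)) ?_ ?_ ?_ ?_ w
  · simp
  · intro v w hv hw; simp only [map_add, hv, hw]
  · intro a; simp only [T_sg, map_neg, cyc_sg, map_zero, neg_zero]
  · intro y v b
    rw [T_sn, map_neg, cyc_sn, cyc_sn, lmap_chainGr_inc]
    congr 2
    simp only [K, C.gr_gr, T_T, map_smul, map_sub, map_add, T_lm, LinearMap.add_apply,
      LinearMap.sub_apply]

theorem hochD_gr (c : HochII C) : hochD C (hochGr C c) = -hochGr C (hochD C c) := by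
  have := transfer (chainGr C) (-1) ?_ c
  · rw [neg_smul, one_smul] at this; exact this
  · intro c
    have : Dt.comp (DirectSum.lmap (chainGr C)) = (-1 : ℂ) • (DirectSum.lmap (chainGr C)).comp Dt := by
      refine cyc_ext fun x w => ?_
      simp only [LinearMap.comp_apply, LinearMap.smul_apply, lmap_chainGr_inc, Dt_inc, map_neg,
        map_add, N_T, cyc_T]
      module
    exact congr($this c)

theorem hochGr_hochGr (c : HochII C) : hochGr C (hochGr C c) = c := by
  funext k
  change chainGr C k (chainGr C k (c k)) = c k
  have : (chainGr C k).comp (chainGr C k) = LinearMap.id := by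
    classical
    refine DirectSum.linearMap_ext ℂ fun x => ?_
    ext w : 1
    simp only [LinearMap.comp_apply, chainGr, DirectSum.lmap_lof, LinearMap.neg_apply, map_neg,
      neg_neg, LinearMap.id_apply]
    congr 1
    have := T_T (ι k w)
    rw [T_ι, T_ι] at this
    exact DirectSum.of_injective (β := fun k => Word C.Hom k x x) k this
  exact congr($this (c k))

end Grading

/-- A strict cdg functor: it is compatible with composition, identities, gradings, differentials
and curvatures. -/
@[ext]
structure CdgFunctor (C C' : CdgCat) where
  obj : C.Ob → C'.Ob
  map : ∀ {x y : C.Ob}, C.Hom x y →ₗ[ℂ] C'.Hom (obj x) (obj y)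
  map_one : ∀ x : C.Ob, map (C.one x) = C'.one (obj x)
  map_comp : ∀ {x y z : C.Ob} (a : C.Hom y z) (b : C.Hom x y),
    map (C.comp a b) = C'.comp (map a) (map b)
  map_gr : ∀ {x y : C.Ob} (a : C.Hom x y), map (C.gr a) = C'.gr (map a)
  map_d : ∀ {x y : C.Ob} (a : C.Hom x y), map (C.d a) = C'.d (map a)
  map_h : ∀ x : C.Ob, map (C.h x) = C'.h (obj x)

instance : Category CdgCat where
  Hom := CdgFunctor
  id C := ⟨id, LinearMap.id, fun _ => rfl, fun _ _ => rfl, fun _ => rfl, fun _ => rfl, fun _ => rfl⟩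
  comp F G := ⟨G.obj ∘ F.obj, G.map.comp F.map,
    fun x => by simp [F.map_one, G.map_one],
    fun a b => by simp [F.map_comp, G.map_comp],
    fun a => by simp [F.map_gr, G.map_gr],
    fun a => by simp [F.map_d, G.map_d],
    fun x => by simp [F.map_h, G.map_h]⟩

section Functor
open Word Words
variable {C C' C'' : CdgCat}

/-- The effect of a cdg functor on words. -/
def mapWord (F : C ⟶ C') : ∀ (k : ℕ) {x z : C.Ob},
    Word C.Hom k x z →ₗ[ℂ] Word C'.Hom k (F.obj x) (F.obj z)
  | 0, _, _ => F.map
  | k + 1, _, _ => lift fun _ => cons.compl₁₂ F.map (mapWord F k)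

theorem mapWord_single (F : C ⟶ C') {x z : C.Ob} (a : C.Hom z x) :
    mapWord F 0 (single a) = single (F.map a) := rfl

theorem mapWord_cons (F : C ⟶ C') {k : ℕ} {x y z : C.Ob} (a : C.Hom y x) (w : Word C.Hom k y z) :
    mapWord F (k + 1) (cons a w) = cons (F.map a) (mapWord F k w) := by
  simp [mapWord]

open Classical in
/-- The effect of a cdg functor on chains. -/
def chainMap (F : C ⟶ C') (k : ℕ) : HochChain C k →ₗ[ℂ] HochChain C' k :=
  DirectSum.toModule ℂ C.Ob _ fun x =>
    (DirectSum.lof ℂ C'.Ob (fun y => Word C'.Hom k y y) (F.obj x)).comp (mapWord F k)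

/-- The map of Hochschild complexes of the second kind induced by a cdg functor. -/
def hochMap (F : C ⟶ C') : HochII C →ₗ[ℂ] HochII C' :=
  LinearMap.pi fun k => (chainMap F k).comp (LinearMap.proj k)

theorem hochMap_comp (F : C ⟶ C') (G : C' ⟶ C'') (c : HochII C) :
    hochMap (F ≫ G) c = hochMap G (hochMap F c) := by
  have hw : ∀ {z : C.Ob} k x (w : Word C.Hom k x z),
      mapWord (F ≫ G) k w = mapWord G k (mapWord F k w) := by
    intro z
    refine wordInd ?_ ?_ ?_ ?_
    · intro k x v w hv hw; simp only [map_add]; rw [hv, hw]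
    · intro k x; simp only [map_zero]
    · intro x a; rfl
    · intro k x y a w hw; rw [mapWord_cons, mapWord_cons, mapWord_cons, hw]; rfl
  funext k
  change chainMap (F ≫ G) k (c k) = chainMap G k (chainMap F k (c k))
  have : chainMap (F ≫ G) k = (chainMap G k).comp (chainMap F k) := by
    classical
    refine DirectSum.linearMap_ext ℂ fun x => ?_
    ext w : 1
    simp only [LinearMap.comp_apply, chainMap, DirectSum.toModule_lof]
    rw [hw]; rfl
  exact congr($this (c k))

def fW (F : C ⟶ C') {x z : C.Ob} : Words C x z →ₗ[ℂ] Words C' (F.obj x) (F.obj z) :=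
  DirectSum.lmap fun k => mapWord F k

section
variable (F : C ⟶ C') {x y z : C.Ob}

theorem fW_ι (k : ℕ) (w : Word C.Hom k x z) : fW F (ι k w) = ι k (mapWord F k w) := by
  simp [fW, ι]

theorem fW_sg (a : C.Hom z x) : fW F (sg a) = sg (F.map a) := by
  rw [sg_eq, fW_ι, mapWord_single, sg_eq]

theorem fW_cn (a : C.Hom y x) (w : Words C y z) : fW F (cn a w) = cn (F.map a) (fW F w) := by
  induction w using ind_ι with
  | zero => simp
  | add v w hv hw => simp only [map_add, hv, hw]
  | h k w => rw [cn_ι, fW_ι, fW_ι, cn_ι, mapWord_cons]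

theorem fW_lm (b : C.Hom x y) (w : Words C x z) : fW F (lm b w) = lm (F.map b) (fW F w) := by
  revert y b
  refine ind (p := fun x w => ∀ {y : C.Ob} (b : C.Hom x y),
    fW F (lm b w) = lm (F.map b) (fW F w)) ?_ ?_ ?_ ?_ x w
  · intros; simp
  · intro x v w hv hw y b; simp only [map_add, hv, hw]
  · intro x a y b; simp only [lm_sg, fW_sg, F.map_comp]
  · intro x u a w hw y b; simp only [lm_cn, fW_cn, F.map_comp]

theorem fW_T (w : Words C x z) : fW F (T w) = T (fW F w) := by
  refine ind (p := fun x w => fW F (T w) = T (fW F w)) ?_ ?_ ?_ ?_ x w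
  · intros; simp
  · intro x v w hv hw; simp only [map_add, hv, hw]
  · intro x a; simp only [T_sg, fW_sg, map_neg, F.map_gr]
  · intro x u a w hw; simp only [T_cn, fW_cn, map_neg, F.map_gr, hw]

theorem fW_N (w : Words C x z) : fW F (N w) = N (fW F w) := by
  refine ind (p := fun x w => fW F (N w) = N (fW F w)) ?_ ?_ ?_ ?_ x w
  · intros; simp
  · intro x v w hv hw; simp only [map_add, hv, hw]
  · intro x a; simp only [N_sg, fW_sg, fW_cn, map_add, F.map_gr, F.map_d, F.map_h]
  · intro x u a w hw
    simp only [N_cn, fW_cn, fW_lm, map_add, map_sub, F.map_gr, F.map_d, F.map_h, hw]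

theorem fW_sn (v : Words C x y) (b : C.Hom z y) : fW F (sn v b) = sn (fW F v) (F.map b) := by
  refine ind (p := fun x v => fW F (sn v b) = sn (fW F v) (F.map b)) ?_ ?_ ?_ ?_ x v
  · intros; simp
  · intro x v w hv hw; simp only [map_add, LinearMap.add_apply, hv, hw]
  · intro x a; simp only [sn_sg, fW_sg, fW_cn]
  · intro x u a w hw; simp only [sn_cn, fW_cn, hw]

theorem chainMap_inc (w : Words C x x) :
    DirectSum.lmap (chainMap F) (inc w) = inc (fW F w) := by
  classical
  induction w using ind_ι with
  | zero => simp
  | add v w hv hw => simp only [map_add, hv, hw]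
  | h k w => rw [fW_ι, inc_ι, inc_ι, DirectSum.lmap_lof, chainMap, DirectSum.toModule_lof]; rfl

theorem chainMap_cyc (w : Words C x x) :
    DirectSum.lmap (chainMap F) (cyc w) = cyc (fW F w) := by
  refine ind_sn (p := fun w => DirectSum.lmap (chainMap F) (cyc w) = cyc (fW F w)) ?_ ?_ ?_ ?_ w
  · simp
  · intro v w hv hw; simp only [map_add, hv, hw]
  · intro a; simp only [fW_sg, cyc_sg, map_zero]
  · intro y v b
    rw [fW_sn, cyc_sn, cyc_sn, chainMap_inc]
    simp only [K, map_smul, map_sub, map_add, fW_lm, fW_T, F.map_gr, LinearMap.add_apply,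
      LinearMap.sub_apply]

end

theorem hochD_map (F : C ⟶ C') (c : HochII C) :
    hochD C' (hochMap F c) = hochMap F (hochD C c) := by
  have := transfer (chainMap F) 1 ?_ c
  · rw [one_smul] at this; exact this
  · intro c
    have : Dt.comp (DirectSum.lmap (chainMap F)) = (1 : ℂ) • (DirectSum.lmap (chainMap F)).comp Dt := by
      refine cyc_ext fun x w => ?_
      simp only [LinearMap.comp_apply, chainMap_inc, Dt_inc,
        map_add, fW_N, chainMap_cyc, one_smul]
    exact congr($this c)

theorem hochGr_map (F : C ⟶ C') (c : HochII C) :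
    hochGr C' (hochMap F c) = hochMap F (hochGr C c) := by
  funext k
  change chainGr C' k (chainMap F k (c k)) = chainMap F k (chainGr C k (c k))
  have : (chainGr C' k).comp (chainMap F k) = (chainMap F k).comp (chainGr C k) := by
    classical
    refine DirectSum.linearMap_ext ℂ fun x => ?_
    ext w : 1
    have := fW_T F (ι k w)
    rw [T_ι, fW_ι, fW_ι, T_ι] at this
    have := DirectSum.of_injective (β := fun k => Word C'.Hom k (F.obj x) (F.obj x)) k this
    simp only [LinearMap.comp_apply, chainGr, chainMap, DirectSum.lmap_lof, LinearMap.neg_apply,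
      map_neg, DirectSum.toModule_lof, this]
  exact congr($this (c k))

end Functor

/-- A `ℤ/2`-graded complex of complex vector spaces: `gr v = (-1)^|v| v`, and `D` is odd with `D² = 0`. -/
structure SuperComplex where
  V : ModuleCat.{0} ℂ
  gr : V →ₗ[ℂ] V
  D : V →ₗ[ℂ] V
  gr_gr : ∀ v, gr (gr v) = v
  D_gr : ∀ v, D (gr v) = -gr (D v)
  D_D : ∀ v, D (D v) = 0

namespace SuperComplex

/-- The homogeneous part of degree `p`. -/
def part (A : SuperComplex) (p : ZMod 2) : Submodule ℂ A.V :=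
  LinearMap.ker (A.gr - ((-1 : ℂ) ^ p.val) • LinearMap.id)

theorem mem_part {A : SuperComplex} {p : ZMod 2} {v : A.V} :
    v ∈ A.part p ↔ A.gr v = ((-1 : ℂ) ^ p.val) • v := by
  simp [part, sub_eq_zero]

theorem sign_succ (p : ZMod 2) : (-1 : ℂ) ^ (p + 1).val = -(-1 : ℂ) ^ p.val := by
  fin_cases p
  · change (-1 : ℂ) ^ 1 = -(-1 : ℂ) ^ 0; norm_num
  · change (-1 : ℂ) ^ 0 = -(-1 : ℂ) ^ 1; norm_num

theorem D_mem (A : SuperComplex) (p : ZMod 2) : ∀ v ∈ A.part p, A.D v ∈ A.part (p + 1) := by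
  intro v hv
  rw [mem_part] at hv ⊢
  rw [sign_succ, neg_smul, ← map_smul, ← hv, A.D_gr, neg_neg]

/-- A `ℤ/2`-graded complex as a complex indexed by `ℤ/2`. -/
def toComplex (A : SuperComplex) :
    HomologicalComplex (ModuleCat.{0} ℂ) (ComplexShape.up (ZMod 2)) where
  X p := ModuleCat.of ℂ (A.part p)
  d p q := if h : p + 1 = q then ModuleCat.ofHom (A.D.restrict (h ▸ A.D_mem p)) else 0
  shape p q h := dif_neg h
  d_comp_d' p q r h h' := by
    obtain rfl : p + 1 = q := h
    obtain rfl : p + 1 + 1 = r := h'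
    rw [dif_pos rfl, dif_pos rfl]
    refine ModuleCat.hom_ext (LinearMap.ext fun v => ?_)
    exact Subtype.ext (A.D_D (Subtype.val (p := (· ∈ A.part p)) v))

/-- Chain maps: linear maps that preserve the grading and commute with the differentials. -/
structure IsChainMap {A B : SuperComplex} (f : A.V →ₗ[ℂ] B.V) : Prop where
  map_gr : ∀ v, f (A.gr v) = B.gr (f v)
  map_D : ∀ v, f (A.D v) = B.D (f v)

theorem IsChainMap.mem {A B : SuperComplex} {f : A.V →ₗ[ℂ] B.V} (hf : IsChainMap f) (p : ZMod 2) :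
    ∀ v ∈ A.part p, f v ∈ B.part p := by
  intro v hv
  rw [mem_part] at hv ⊢
  rw [← hf.map_gr, hv, map_smul]

/-- A chain map as a morphism of complexes. -/
def IsChainMap.hom {A B : SuperComplex} {f : A.V →ₗ[ℂ] B.V} (hf : IsChainMap f) :
    A.toComplex ⟶ B.toComplex where
  f p := ModuleCat.ofHom (f.restrict (hf.mem p))
  comm' p q h := by
    obtain rfl : p + 1 = q := h
    simp only [toComplex, dif_pos]
    refine ModuleCat.hom_ext (LinearMap.ext fun v => ?_)
    exact Subtype.ext (hf.map_D (Subtype.val (p := (· ∈ A.part p)) v)).symm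

end SuperComplex

section Cech
open Opposite TopologicalSpace
variable {X : TopCat.{0}} (E : TopCat.Presheaf CdgCat X) {n : ℕ} (U : Fin n → Opens X)

/-- The index `i₀ < … < i_p` of a Čech cochain is recorded as the set `{i₀, …, i_p}`. -/
abbrev CechIndex (n : ℕ) : Type := {I : Finset (Fin n) // I.Nonempty}

/-- The intersection `U_I` of the `U_i` with `i ∈ I`. -/
def cap (I : Finset (Fin n)) : Opens X := I.inf U

theorem cap_mono {I J : Finset (Fin n)} (h : I ⊆ J) : cap U J ≤ cap U I := Finset.inf_mono h

/-- Restriction from `U_I` to `U_J` for `I ⊆ J`, on Hochschild complexes of the second kind. -/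
def capRes {I J : Finset (Fin n)} (h : I ⊆ J) :
    HochII (E.obj (op (cap U I))) →ₗ[ℂ] HochII (E.obj (op (cap U J))) :=
  hochMap (E.map (homOfLE (cap_mono U h)).op)

theorem capRes_capRes {I J K : Finset (Fin n)} (h : I ⊆ J) (h' : J ⊆ K) (c) :
    capRes E U h' (capRes E U h c) = capRes E U (h.trans h') c := by
  rw [capRes, capRes, ← hochMap_comp, ← E.map_comp]
  rfl

/-- Čech cochains with values in the presheaf of Hochschild complexes of the second kind of a presheaf
of cdg categories `E`. -/
abbrev CechHochII : Type := ∀ I : CechIndex n, HochII (E.obj (op (cap U I.1)))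

/-- The position of `j` in the increasing enumeration of `J`, counted from `0`. -/
def place (J : Finset (Fin n)) (j : Fin n) : ℕ := (J.filter (· < j)).card

/-- The restriction to `U_J` of the component with index `J` minus `j`. -/
def cechFace (J : CechIndex n) (j : Fin n) :
    CechHochII E U →ₗ[ℂ] HochII (E.obj (op (cap U J.1))) :=
  if h : (J.1.erase j).Nonempty then
    (capRes E U (Finset.erase_subset j J.1)).comp (LinearMap.proj (⟨J.1.erase j, h⟩ : CechIndex n))
  else 0

/-- The differential `d_Čech + (-1)^p d` of the total complex, where `p + 1` is the number of indices,
`d` is the Hochschild differential and `d_Čech` is the alternating sum of the restrictions. -/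
def cechD : CechHochII E U →ₗ[ℂ] CechHochII E U :=
  LinearMap.pi fun J =>
    (∑ j ∈ J.1, ((-1 : ℂ) ^ place J.1 j) • cechFace E U J j)
      + ((-1 : ℂ) ^ (J.1.card - 1)) • (hochD _).comp (LinearMap.proj J)

/-- The total degree: the Čech degree `p` plus the Hochschild degree. -/
def cechGr : CechHochII E U →ₗ[ℂ] CechHochII E U :=
  LinearMap.pi fun J => ((-1 : ℂ) ^ (J.1.card - 1)) • (hochGr _).comp (LinearMap.proj J)

theorem cechGr_cechGr (c : CechHochII E U) : cechGr E U (cechGr E U c) = c := by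
  funext J
  simp only [cechGr, LinearMap.pi_apply, LinearMap.smul_apply, LinearMap.comp_apply,
    LinearMap.proj_apply, map_smul, smul_smul, hochGr_hochGr, ← mul_pow]
  simp

theorem hochD_capRes {I J : Finset (Fin n)} (h : I ⊆ J) (c) :
    hochD _ (capRes E U h c) = capRes E U h (hochD _ c) := hochD_map _ _

theorem hochGr_capRes {I J : Finset (Fin n)} (h : I ⊆ J) (c) :
    hochGr _ (capRes E U h c) = capRes E U h (hochGr _ c) := hochGr_map _ _

theorem sign_erase {J : Finset (Fin n)} {j : Fin n} (hj : j ∈ J) (h : (J.erase j).Nonempty) :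
    (-1 : ℂ) ^ ((J.erase j).card - 1) = -(-1 : ℂ) ^ (J.card - 1) := by
  rw [Finset.card_erase_of_mem hj]
  have h1 : 1 ≤ (J.erase j).card := h.card_pos
  rw [Finset.card_erase_of_mem hj] at h1
  obtain ⟨m, hm⟩ : ∃ m, J.card = m + 2 := ⟨J.card - 2, by omega⟩
  rw [hm]
  simp [pow_succ]

theorem cechFace_gr (J : CechIndex n) {j : Fin n} (hj : j ∈ J.1) (c : CechHochII E U) :
    cechFace E U J j (cechGr E U c) =
      -(((-1 : ℂ) ^ (J.1.card - 1)) • hochGr _ (cechFace E U J j c)) := by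
  by_cases h : (J.1.erase j).Nonempty
  · simp only [cechFace, dif_pos h, LinearMap.comp_apply, LinearMap.proj_apply, cechGr,
      LinearMap.pi_apply, LinearMap.smul_apply, map_smul, hochGr_capRes]
    rw [sign_erase hj h, neg_smul]
  · simp [cechFace, dif_neg h]

theorem cechD_gr (c : CechHochII E U) : cechD E U (cechGr E U c) = -cechGr E U (cechD E U c) := by
  funext J
  have : cechD E U (cechGr E U c) J = (∑ j ∈ J.1, ((-1 : ℂ) ^ place J.1 j) •
      cechFace E U J j (cechGr E U c)) +
      ((-1 : ℂ) ^ (J.1.card - 1)) • hochD _ (((-1 : ℂ) ^ (J.1.card - 1)) • hochGr _ (c J)) := by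
    simp [cechD, cechGr]
  have h2 : cechGr E U (cechD E U c) J = ((-1 : ℂ) ^ (J.1.card - 1)) • hochGr _
      ((∑ j ∈ J.1, ((-1 : ℂ) ^ place J.1 j) • cechFace E U J j c) +
      ((-1 : ℂ) ^ (J.1.card - 1)) • hochD _ (c J)) := by
    simp [cechD, cechGr]
  rw [Pi.neg_apply, this, h2, Finset.sum_congr rfl fun j hj => by rw [cechFace_gr E U J hj c]]
  simp only [map_add, map_sum, map_smul, smul_neg, Finset.sum_neg_distrib, smul_add,
    Finset.smul_sum, hochD_gr, neg_add]
  congr 1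
  congr 1
  refine Finset.sum_congr rfl fun j _ => smul_comm _ _ _

/-- The restriction to `U_J` of the component with index `J` minus `i`, `j`. -/
def cechFace2 (J : CechIndex n) (i j : Fin n) :
    CechHochII E U →ₗ[ℂ] HochII (E.obj (op (cap U J.1))) :=
  if h : ((J.1.erase j).erase i).Nonempty then
    (capRes E U ((Finset.erase_subset i _).trans (Finset.erase_subset j J.1))).comp
      (LinearMap.proj (⟨(J.1.erase j).erase i, h⟩ : CechIndex n))
  else 0

theorem cechFace2_swap (J : CechIndex n) (i j : Fin n) (c : CechHochII E U) :
    cechFace2 E U J i j c = cechFace2 E U J j i c := by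
  have key : ∀ (A B : Finset (Fin n)) (hA : A ⊆ J.1) (hB : B ⊆ J.1), A = B →
      (if h : A.Nonempty then (capRes E U hA).comp (LinearMap.proj (⟨A, h⟩ : CechIndex n))
        else 0 : CechHochII E U →ₗ[ℂ] HochII (E.obj (op (cap U J.1)))) =
      (if h : B.Nonempty then (capRes E U hB).comp (LinearMap.proj (⟨B, h⟩ : CechIndex n)) else 0) := by
    rintro A B hA hB rfl; rfl
  exact congr($(key _ _ _ _ (Finset.erase_right_comm)) c)

theorem place_erase {J : Finset (Fin n)} {i j : Fin n} (hj : j ∈ J) :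
    place (J.erase j) i + (if j < i then 1 else 0) = place J i := by
  unfold place
  rw [Finset.filter_erase]
  split_ifs with h
  · exact Finset.card_erase_add_one (by simp [hj, h])
  · rw [Finset.erase_eq_of_notMem (by simp [h])]; rfl

theorem cech_sign {J : Finset (Fin n)} {i j : Fin n} (hi : i ∈ J) (hj : j ∈ J) (hij : i ≠ j) :
    (-1 : ℂ) ^ place J j * (-1) ^ place (J.erase j) i =
      -((-1 : ℂ) ^ place J i * (-1) ^ place (J.erase i) j) := by
  have h1 := place_erase (i := i) hj
  have h2 := place_erase (i := j) hi
  rcases lt_or_gt_of_ne hij with h | h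
  · rw [if_neg h.asymm] at h1; rw [if_pos h] at h2
    rw [← h1, ← h2]; ring
  · rw [if_pos h] at h1; rw [if_neg h.asymm] at h2
    rw [← h1, ← h2]; ring

theorem cechD_cechD (c : CechHochII E U) : cechD E U (cechD E U c) = 0 := by
  have hD : ∀ c J, cechD E U c J = (∑ j ∈ J.1, ((-1 : ℂ) ^ place J.1 j) • cechFace E U J j c) +
      ((-1 : ℂ) ^ (J.1.card - 1)) • hochD _ (c J) := by
    intro c J; simp [cechD]
  have hF : ∀ (J : CechIndex n), ∀ j ∈ J.1, cechFace E U J j (cechD E U c) =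
      (∑ i ∈ J.1.erase j, ((-1 : ℂ) ^ place (J.1.erase j) i) • cechFace2 E U J i j c) -
      ((-1 : ℂ) ^ (J.1.card - 1)) • hochD _ (cechFace E U J j c) := by
    intro J j hj
    by_cases h : (J.1.erase j).Nonempty
    · simp only [cechFace, dif_pos h, LinearMap.comp_apply, LinearMap.proj_apply, hD, map_add,
        map_sum, map_smul, hochD_capRes]
      rw [sign_erase hj h, neg_smul, sub_eq_add_neg]
      congr 1
      refine Finset.sum_congr rfl fun i _ => ?_
      congr 1
      unfold cechFace2
      by_cases h' : ((J.1.erase j).erase i).Nonempty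
      · rw [dif_pos h', dif_pos h', LinearMap.comp_apply, LinearMap.comp_apply, capRes_capRes]
      · rw [dif_neg h', dif_neg h']; simp
    · simp only [cechFace, dif_neg h]
      rw [Finset.not_nonempty_iff_eq_empty] at h
      simp [h]
  funext J
  rw [hD, Finset.sum_congr rfl fun j hj => by rw [hF J j hj], hD, map_add, map_smul, hochD_hochD,
    smul_zero, add_zero]
  simp only [map_sum, map_smul, smul_sub, Finset.sum_sub_distrib, Finset.smul_sum, Pi.zero_apply]
  have h0 : ∑ j ∈ J.1, ∑ i ∈ J.1.erase j, ((-1 : ℂ) ^ place J.1 j) •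
      ((-1 : ℂ) ^ place (J.1.erase j) i) • cechFace2 E U J i j c = 0 := by
    set S := ∑ j ∈ J.1, ∑ i ∈ J.1.erase j, ((-1 : ℂ) ^ place J.1 j) •
      ((-1 : ℂ) ^ place (J.1.erase j) i) • cechFace2 E U J i j c with hS
    have : S = -S := by
      conv_lhs => rw [hS]
      rw [Finset.sum_comm' (t' := J.1) (s' := fun i => J.1.erase i)
        (by intro x y; simp only [Finset.mem_erase]; tauto), hS, ← Finset.sum_neg_distrib]
      refine Finset.sum_congr rfl fun i hi => ?_
      rw [← Finset.sum_neg_distrib]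
      refine Finset.sum_congr rfl fun j hj => ?_
      rw [Finset.mem_erase] at hj
      rw [smul_smul, smul_smul, cech_sign hi hj.2 hj.1.symm, neg_smul, cechFace2_swap]
    have h2 : (2 : ℂ) • S = 0 := by rw [two_smul]; nth_rw 1 [this]; exact neg_add_cancel S
    exact (smul_eq_zero.mp h2).resolve_left two_ne_zero
  rw [h0, zero_sub, neg_add_eq_zero]
  refine Finset.sum_congr rfl fun j _ => smul_comm _ _ _

/-- The total Čech complex of a presheaf of cdg categories, with coefficients in the Hochschild complexes
of the second kind. -/
def cechComplex : SuperComplex where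
  V := ModuleCat.of ℂ (CechHochII E U)
  gr := cechGr E U
  D := cechD E U
  gr_gr := cechGr_cechGr E U
  D_gr := cechD_gr E U
  D_D := cechD_cechD E U

variable {E} {E' : TopCat.Presheaf CdgCat X}

/-- The map of Čech complexes induced by a morphism of presheaves of cdg categories. -/
def cechMap (η : E ⟶ E') : CechHochII E U →ₗ[ℂ] CechHochII E' U :=
  LinearMap.pi fun I => (hochMap (η.app (op (cap U I.1)))).comp (LinearMap.proj I)

theorem cechMap_gr (η : E ⟶ E') (c : CechHochII E U) :
    cechMap U η (cechGr E U c) = cechGr E' U (cechMap U η c) := by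
  funext J
  simp [cechGr, cechMap, hochGr_map]

theorem cechMap_D (η : E ⟶ E') (c : CechHochII E U) :
    cechMap U η (cechD E U c) = cechD E' U (cechMap U η c) := by
  funext J
  have h1 : cechMap U η (cechD E U c) J = hochMap (η.app (op (cap U J.1))) (cechD E U c J) := rfl
  have h2 : cechMap U η c J = hochMap (η.app (op (cap U J.1))) (c J) := rfl
  rw [h1]
  simp only [cechD, LinearMap.pi_apply, LinearMap.add_apply, LinearMap.sum_apply,
    LinearMap.smul_apply, LinearMap.comp_apply, LinearMap.proj_apply, map_add, map_sum, map_smul, h2,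
    hochD_map]
  congr 1
  refine Finset.sum_congr rfl fun j _ => ?_
  congr 1
  unfold cechFace
  by_cases h : (J.1.erase j).Nonempty
  · simp only [dif_pos h, LinearMap.comp_apply, LinearMap.proj_apply, cechMap,
      LinearMap.pi_apply, capRes, ← hochMap_comp, η.naturality]
  · simp [dif_neg h]

theorem cechMap_isChainMap (η : E ⟶ E') :
    SuperComplex.IsChainMap (A := cechComplex E U) (B := cechComplex E' U) (cechMap U η) where
  map_gr := cechMap_gr U η
  map_D := cechMap_D U η

end Cech

section Geometry
open AlgebraicGeometry Opposite TopologicalSpace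

variable {X : Scheme.{0}}

/-- Restriction of functions. -/
def resFun {V V' : X.Opens} (h : V' ≤ V) : Γ(X, V) →+* Γ(X, V') :=
  (X.presheaf.map (homOfLE h).op).hom

/-- Restriction of sections of a sheaf of modules. -/
def resSec (M : X.Modules) {V V' : X.Opens} (h : V' ≤ V) : Γ(M, V) →+ Γ(M, V') :=
  (M.presheaf.map (homOfLE h).op).hom

theorem resFun_resFun {V V' V'' : X.Opens} (h : V' ≤ V) (h' : V'' ≤ V') (a : Γ(X, V)) :
    resFun h' (resFun h a) = resFun (h'.trans h) a := by
  have := X.presheaf.map_comp (homOfLE h).op (homOfLE h').op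
  exact congr(($this).hom a).symm

theorem resFun_self {V : X.Opens} (a : Γ(X, V)) : resFun le_rfl a = a := by
  have := X.presheaf.map_id (op V)
  exact congr(($this).hom a)

theorem resSec_smul (M : X.Modules) {V V' : X.Opens} (h : V' ≤ V) (a : Γ(X, V)) (x : Γ(M, V)) :
    resSec M h (a • x) = resFun h a • resSec M h x :=
  Scheme.Modules.map_smul M (homOfLE h) a x

variable [X.Over (Spec (.of ℂ))]

/-- The constant functions on an open set of a scheme over `ℂ`. -/
def const (V : X.Opens) : ℂ →+* Γ(X, V) :=
  (resFun le_top).comp (((Scheme.ΓSpecIso (.of ℂ)).inv ≫ (X ↘ Spec (.of ℂ)).appTop).hom)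

theorem resFun_const {V V' : X.Opens} (h : V' ≤ V) (c : ℂ) : resFun h (const V c) = const V' c :=
  resFun_resFun _ _ _

instance (V : X.Opens) : Algebra ℂ Γ(X, V) := (const V).toAlgebra

theorem algebraMap_eq (V : X.Opens) (c : ℂ) : algebraMap ℂ Γ(X, V) c = const V c := rfl

instance (M : X.Modules) (V : X.Opens) : Module ℂ Γ(M, V) := Module.compHom _ (const V)

instance (M : X.Modules) (V : X.Opens) : IsScalarTower ℂ Γ(X, V) Γ(M, V) :=
  ⟨fun c a x => by
    rw [Algebra.smul_def, mul_smul]; rfl⟩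

variable (X) in
/-- A `ℤ/2`-graded sheaf of modules with an arbitrary odd endomorphism `δ = (δ₀, δ₁)`: a quasi matrix
factorization (no condition on `δ²`). -/
structure QFact where
  even : X.Modules
  odd : X.Modules
  δ₀ : even ⟶ odd
  δ₁ : odd ⟶ even

namespace QFact

/-- Sections of the graded sheaf over `W`. -/
abbrev Sec (P : QFact X) (W : X.Opens) : Type := Γ(P.even, W) × Γ(P.odd, W)

/-- Restriction of sections of the graded sheaf. -/
def res (P : QFact X) {V V' : X.Opens} (h : V' ≤ V) : P.Sec V →+ P.Sec V' :=
  (resSec P.even h).prodMap (resSec P.odd h)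

theorem res_smul (P : QFact X) {V V' : X.Opens} (h : V' ≤ V) (a : Γ(X, V)) (x : P.Sec V) :
    P.res h (a • x) = resFun h a • P.res h x :=
  Prod.ext (resSec_smul _ h a x.1) (resSec_smul _ h a x.2)

theorem res_smulC (P : QFact X) {V V' : X.Opens} (h : V' ≤ V) (c : ℂ) (x : P.Sec V) :
    P.res h (c • x) = c • P.res h x := by
  rw [← algebraMap_smul Γ(X, V) c x, res_smul, algebraMap_eq, resFun_const, ← algebraMap_eq,
    algebraMap_smul]

/-- Morphisms over `V` from `P` to `Q`: morphisms of sheaves of modules on `V` between the sums of the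
even and the odd part, as families of linear maps on sections over all `W ≤ V` that are compatible with
restriction. -/
def homSubmodule (V : X.Opens) (P Q : QFact X) :
    Submodule ℂ (∀ W : {W : X.Opens // W ≤ V}, P.Sec W.1 →ₗ[Γ(X, W.1)] Q.Sec W.1) where
  carrier := {a | ∀ (W W' : {W : X.Opens // W ≤ V}) (h : W'.1 ≤ W.1) (x : P.Sec W.1),
    a W' (P.res h x) = Q.res h (a W x)}
  add_mem' ha hb W W' h x := by
    simp only [Pi.add_apply, LinearMap.add_apply, map_add, ha W W' h x, hb W W' h x]
  zero_mem' W W' h x := by simp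
  smul_mem' c a ha W W' h x := by
    simp only [Pi.smul_apply, LinearMap.smul_apply, ha W W' h x, res_smulC]

/-- The `ℂ`-vector space of morphisms over `V`, of both parities. -/
def Hom (V : X.Opens) (P Q : QFact X) : ModuleCat.{0} ℂ := ModuleCat.of ℂ (homSubmodule V P Q)

variable {V : X.Opens} {P Q R S : QFact X}

/-- The action of a morphism on sections over `W`. -/
def app (a : Hom V P Q) (W : {W : X.Opens // W ≤ V}) : P.Sec W.1 →ₗ[Γ(X, W.1)] Q.Sec W.1 :=
  Subtype.val (p := (· ∈ homSubmodule V P Q)) a W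

theorem app_res (a : Hom V P Q) (W W' : {W : X.Opens // W ≤ V}) (h : W'.1 ≤ W.1) (x : P.Sec W.1) :
    app a W' (P.res h x) = Q.res h (app a W x) :=
  Subtype.property (p := (· ∈ homSubmodule V P Q)) a W W' h x

/-- A morphism from its action on sections. -/
def mkHom (a : ∀ W : {W : X.Opens // W ≤ V}, P.Sec W.1 →ₗ[Γ(X, W.1)] Q.Sec W.1)
    (h : ∀ (W W' : {W : X.Opens // W ≤ V}) (h : W'.1 ≤ W.1) (x : P.Sec W.1),
      a W' (P.res h x) = Q.res h (a W x)) : Hom V P Q :=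
  (⟨a, h⟩ : homSubmodule V P Q)

theorem hom_ext {a b : Hom V P Q} (h : ∀ W x, app a W x = app b W x) : a = b :=
  Subtype.ext (p := (· ∈ homSubmodule V P Q)) (funext fun W => LinearMap.ext (h W))

theorem mkHom_app (a : ∀ W : {W : X.Opens // W ≤ V}, P.Sec W.1 →ₗ[Γ(X, W.1)] Q.Sec W.1) (h) (W) :
    app (mkHom (V := V) a h) W = a W := rfl

theorem add_app (a b : Hom V P Q) (W x) : app (a + b) W x = app a W x + app b W x := rfl
theorem smul_app (c : ℂ) (a : Hom V P Q) (W x) : app (c • a) W x = c • app a W x := rfl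
theorem neg_app (a : Hom V P Q) (W x) : app (-a) W x = -app a W x := rfl

theorem map_smulC {W : X.Opens} (a : P.Sec W →ₗ[Γ(X, W)] Q.Sec W) (c : ℂ) (x : P.Sec W) :
    a (c • x) = c • a x := LinearMap.map_smul_of_tower a c x

/-- Composition of morphisms. -/
def comp : Hom V Q R →ₗ[ℂ] Hom V P Q →ₗ[ℂ] Hom V P R :=
  LinearMap.mk₂ ℂ (fun a b => mkHom (fun W => (app a W).comp (app b W)) fun W W' h x => by
      simp only [LinearMap.comp_apply, app_res _ W W' h])
    (fun _ _ _ => rfl) (fun _ _ _ => rfl)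
    (fun a b b' => hom_ext fun W x => map_add (app a W) (app b W x) (app b' W x))
    (fun c a b => hom_ext fun W x => map_smulC (app a W) c (app b W x))

theorem comp_app (a : Hom V Q R) (b : Hom V P Q) (W x) :
    app (comp a b) W x = app a W (app b W x) := rfl

theorem smul_smulC {W : X.Opens} (h : W ≤ V) (c : ℂ) (a : Γ(X, V)) (x : P.Sec W) :
    resFun h (c • a) • x = c • (resFun h a • x) := by
  rw [Algebra.smul_def, map_mul, mul_smul, algebraMap_eq, resFun_const, ← algebraMap_eq,
    algebraMap_smul]

/-- Multiplication by a function. -/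
def scalar (P : QFact X) : Γ(X, V) →ₗ[ℂ] Hom V P P where
  toFun a := mkHom (fun W => resFun W.2 a • LinearMap.id) fun W W' h x => by
    simp only [LinearMap.smul_apply, LinearMap.id_apply, res_smul, resFun_resFun]
  map_add' a b := hom_ext fun W x => by
    simp only [mkHom_app, add_app, map_add, add_smul, LinearMap.add_apply]
  map_smul' c a := hom_ext fun W x => by
    rw [RingHom.id_apply, smul_app]
    exact smul_smulC W.2 c a x

theorem scalar_app (a : Γ(X, V)) (W x) : app (scalar P a) W x = resFun W.2 a • x := rfl

/-- The involution that is `1` on the even and `-1` on the odd part. -/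
def sgn (P : QFact X) : Hom V P P :=
  mkHom (fun _ => LinearMap.prodMap LinearMap.id (-LinearMap.id)) fun _ _ h _ =>
    Prod.ext rfl (map_neg (resSec P.odd h) _).symm

theorem sgn_app (W x) : app (sgn (V := V) P) W x = (x.1, -x.2) := rfl

/-- The linear map on sections given by a morphism of sheaves of modules. -/
def linearApp {M N : X.Modules} (φ : M ⟶ N) (W : X.Opens) : Γ(M, W) →ₗ[Γ(X, W)] Γ(N, W) where
  toFun x := φ.app W x
  map_add' x y := map_add (φ.app W).hom x y
  map_smul' a x := Scheme.Modules.Hom.app_smul φ a x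

theorem linearApp_res {M N : X.Modules} (φ : M ⟶ N) {W W' : X.Opens} (h : W' ≤ W) (x : Γ(M, W)) :
    linearApp φ W' (resSec M h x) = resSec N h (linearApp φ W x) :=
  congr($(φ.mapPresheaf.naturality (homOfLE h).op) x)

/-- The odd endomorphism `δ`, over `V`. -/
def delta (P : QFact X) : Hom V P P :=
  mkHom (fun W => ((linearApp P.δ₁ W.1).comp (LinearMap.snd _ _ _)).prod
    ((linearApp P.δ₀ W.1).comp (LinearMap.fst _ _ _))) fun _ _ h x =>
    Prod.ext (linearApp_res P.δ₁ h x.2) (linearApp_res P.δ₀ h x.1)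

theorem delta_app (W x) :
    app (delta (V := V) P) W x = (linearApp P.δ₁ W.1 x.2, linearApp P.δ₀ W.1 x.1) := rfl

theorem sgn_sgn : comp (sgn (V := V) P) (sgn P) = scalar P 1 := hom_ext fun W x => by
  rw [comp_app, sgn_app, sgn_app, scalar_app, map_one, one_smul, neg_neg]

theorem sgn_delta : comp (sgn (V := V) P) (delta P) = -comp (delta P) (sgn P) :=
  hom_ext fun W x => by
    rw [neg_app, comp_app, comp_app, sgn_app, sgn_app, delta_app, delta_app, Prod.neg_mk,
      map_neg, neg_neg]

theorem one_comp (a : Hom V P Q) : comp (scalar Q 1) a = a := hom_ext fun W x => by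
  rw [comp_app, scalar_app, map_one, one_smul]

theorem comp_one (a : Hom V P Q) : comp a (scalar P 1) = a := hom_ext fun W x => by
  rw [comp_app, scalar_app, map_one, one_smul]

theorem assoc (a : Hom V R S) (b : Hom V Q R) (c : Hom V P Q) :
    comp (comp a b) c = comp a (comp b c) := hom_ext fun _ _ => rfl

theorem scalar_comp (f : Γ(X, V)) (a : Hom V P Q) : comp (scalar Q f) a = comp a (scalar P f) :=
  hom_ext fun W x => by
    rw [comp_app, comp_app, scalar_app, scalar_app, map_smul]

/-- The grading of morphisms, `gr a = (-1)^|a| a`. -/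
def gr : Hom V P Q →ₗ[ℂ] Hom V P Q := (comp (sgn Q)).comp (comp.flip (sgn P))

theorem gr_eq (a : Hom V P Q) : gr a = comp (sgn Q) (comp a (sgn P)) := rfl

/-- The differential `a ↦ δ a - (-1)^|a| a δ`. -/
def diff : Hom V P Q →ₗ[ℂ] Hom V P Q := comp (delta Q) - (comp.flip (delta P)).comp gr

theorem diff_eq (a : Hom V P Q) : diff a = comp (delta Q) a - comp (gr a) (delta P) := rfl

/-- The curvature `δ² - f`. -/
def curv (f : Γ(X, V)) (P : QFact X) : Hom V P P := comp (delta P) (delta P) - scalar P f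

theorem sgn_sgn_comp (a : Hom V P Q) : comp (sgn Q) (comp (sgn Q) a) = a := by
  rw [← assoc, sgn_sgn, one_comp]

theorem sgn_delta_comp (a : Hom V P Q) :
    comp (sgn Q) (comp (delta Q) a) = -comp (delta Q) (comp (sgn Q) a) := by
  rw [← assoc, sgn_delta, map_neg, LinearMap.neg_apply, assoc]

theorem gr_gr (a : Hom V P Q) : gr (gr a) = a := by
  simp only [gr_eq, assoc, sgn_sgn_comp, sgn_sgn, comp_one]

theorem gr_comp (a : Hom V Q R) (b : Hom V P Q) : gr (comp a b) = comp (gr a) (gr b) := by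
  simp only [gr_eq, assoc, sgn_sgn_comp]

theorem gr_delta : gr (delta (V := V) P) = -delta P := by
  rw [gr_eq, sgn_delta_comp, sgn_sgn, comp_one]

theorem gr_scalar (f : Γ(X, V)) : gr (scalar P f) = scalar P f := by
  rw [gr_eq, scalar_comp, sgn_sgn_comp]

theorem diff_gr (a : Hom V P Q) : diff (gr a) = -gr (diff a) := by
  simp only [diff_eq, gr_comp, map_sub, gr_delta, map_neg, LinearMap.neg_apply]
  abel

theorem diff_comp (a : Hom V Q R) (b : Hom V P Q) :
    diff (comp a b) = comp (diff a) b + comp (gr a) (diff b) := by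
  simp only [diff_eq, gr_comp, map_sub, LinearMap.sub_apply, assoc]
  abel

theorem diff_diff (f : Γ(X, V)) (a : Hom V P Q) :
    diff (diff a) = comp (curv f Q) a - comp a (curv f P) := by
  simp only [diff_eq, curv, map_sub, LinearMap.sub_apply, gr_comp, gr_delta, gr_gr, scalar_comp,
    assoc, map_neg, LinearMap.neg_apply]
  abel

theorem gr_curv (f : Γ(X, V)) : gr (curv f P) = curv f P := by
  simp only [curv, map_sub, gr_comp, gr_delta, gr_scalar, map_neg, LinearMap.neg_apply, neg_neg]

theorem diff_curv (f : Γ(X, V)) : diff (curv f P) = 0 := by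
  rw [diff_eq, gr_curv]
  simp only [curv, map_sub, LinearMap.sub_apply, assoc, scalar_comp, sub_self]

/-- Restriction of morphisms to a smaller open set. -/
def homRes {V' : X.Opens} (h : V' ≤ V) : Hom V P Q →ₗ[ℂ] Hom V' P Q where
  toFun a := mkHom (fun W => app a ⟨W.1, W.2.trans h⟩) fun W W' hW x =>
    app_res a ⟨W.1, W.2.trans h⟩ ⟨W'.1, W'.2.trans h⟩ hW x
  map_add' _ _ := hom_ext fun _ _ => rfl
  map_smul' _ _ := hom_ext fun _ _ => rfl

theorem homRes_scalar {V' : X.Opens} (h : V' ≤ V) (a : Γ(X, V)) :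
    homRes h (scalar P a) = scalar P (resFun h a) := hom_ext fun W x => by
  rw [scalar_app, resFun_resFun]; rfl

end QFact

open QFact

/-- The cdg category `𝒞(V)`: the full subcategory of quasi matrix factorizations of `f` over `V` on the
objects `P_1, …, P_r` restricted to `V`. -/
def qvectOn {r : ℕ} (P : Fin r → QFact X) (f : Γ(X, ⊤)) (V : X.Opens) : CdgCat where
  Ob := Fin r
  Hom i j := Hom V (P i) (P j)
  comp := QFact.comp
  one i := scalar (P i) (1 : Γ(X, V))
  one_comp := QFact.one_comp
  comp_one := QFact.comp_one
  assoc := QFact.assoc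
  gr := gr
  gr_gr := gr_gr
  gr_one i := gr_scalar 1
  gr_comp := gr_comp
  d := diff
  d_gr := diff_gr
  d_comp := diff_comp
  h i := curv (resFun le_top f) (P i)
  gr_h i := gr_curv _
  d_h i := diff_curv _
  d_d := diff_diff _

theorem homRes_curv {V V' : X.Opens} (h : V' ≤ V) (f : Γ(X, ⊤)) (P : QFact X) :
    homRes h (curv (resFun (le_top : V ≤ ⊤) f) P) = curv (resFun le_top f) P := by
  rw [curv, curv, map_sub, homRes_scalar, resFun_resFun]; rfl

/-- The restriction functor of `𝒞`. -/
def qvectRes {r : ℕ} (P : Fin r → QFact X) (f : Γ(X, ⊤)) {V V' : X.Opens} (h : V' ≤ V) :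
    qvectOn P f V ⟶ qvectOn P f V' where
  obj i := i
  map := homRes h
  map_one i := by
    change homRes h (scalar (P i) 1) = scalar (P i) 1
    rw [homRes_scalar, map_one]
  map_comp _ _ := rfl
  map_gr _ := rfl
  map_d _ := rfl
  map_h i := homRes_curv h f (P i)

/-- The presheaf of cdg categories `𝒞`. -/
def qvectPresheaf {r : ℕ} (P : Fin r → QFact X) (f : Γ(X, ⊤)) : TopCat.Presheaf CdgCat X where
  obj V := qvectOn P f V.unop
  map i := qvectRes P f i.unop.le
  map_id _ := rfl
  map_comp _ _ := rfl

/-- The cdg algebra `(O(V), 0, -f)` in even degree, as a cdg category with one object. -/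
def curvedOn (f : Γ(X, ⊤)) (V : X.Opens) : CdgCat where
  Ob := Unit
  Hom _ _ := ModuleCat.of ℂ Γ(X, V)
  comp := LinearMap.mul ℂ Γ(X, V)
  one _ := (1 : Γ(X, V))
  one_comp := one_mul (M := Γ(X, V))
  comp_one := mul_one (M := Γ(X, V))
  assoc := mul_assoc (G := Γ(X, V))
  gr := LinearMap.id
  gr_gr _ := rfl
  gr_one _ := rfl
  gr_comp _ _ := rfl
  d := 0
  d_gr _ := neg_zero.symm
  d_comp a b := by simp
  h _ := -resFun (le_top : V ≤ ⊤) f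
  gr_h _ := rfl
  d_h _ := rfl
  d_d a := by
    change (0 : Γ(X, V)) = _ * _ - _ * _
    rw [mul_comm, sub_self]

/-- Restriction of functions is `ℂ`-linear. -/
def resFunC {V V' : X.Opens} (h : V' ≤ V) : Γ(X, V) →ₗ[ℂ] Γ(X, V') where
  toFun := resFun h
  map_add' := map_add (resFun h)
  map_smul' c a := by
    rw [Algebra.smul_def, map_mul, algebraMap_eq, resFun_const, ← algebraMap_eq,
      ← Algebra.smul_def, RingHom.id_apply]

/-- The restriction functor of `O_{-f}`. -/
def curvedRes (f : Γ(X, ⊤)) {V V' : X.Opens} (h : V' ≤ V) : curvedOn f V ⟶ curvedOn f V' where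
  obj _ := ()
  map := resFunC h
  map_one _ := map_one (resFun h)
  map_comp := map_mul (resFun h)
  map_gr _ := rfl
  map_d _ := map_zero (resFun h)
  map_h _ := by
    change resFun h (-resFun _ f) = -resFun _ f
    rw [map_neg, resFun_resFun]

/-- The presheaf of cdg categories `O_{-f}`. -/
def curvedPresheaf (f : Γ(X, ⊤)) : TopCat.Presheaf CdgCat X where
  obj V := curvedOn f V.unop
  map i := curvedRes f i.unop.le
  map_id V := CdgFunctor.ext rfl (heq_of_eq (by
    funext x y
    exact LinearMap.ext fun a => resFun_self (X := X) a))
  map_comp i j := CdgFunctor.ext rfl (heq_of_eq (by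
    funext x y
    exact LinearMap.ext fun a => (resFun_resFun i.unop.le j.unop.le a).symm))

theorem scalar_mul {V : X.Opens} (P : QFact X) (a b : Γ(X, V)) :
    scalar P (a * b) = comp (scalar P a) (scalar P b) := hom_ext fun W x => by
  rw [comp_app, scalar_app, scalar_app, scalar_app, map_mul, mul_smul]

theorem delta_eq_zero {V : X.Opens} (P : QFact X) (h₀ : P.δ₀ = 0) (h₁ : P.δ₁ = 0) :
    delta (V := V) P = 0 := QFact.hom_ext fun W x => by
  rw [delta_app, h₀, h₁]; rfl

/-- For `δ_i = 0`, the cdg functor from `O_{-f}(V)` to `𝒞(V)` that sends the object to `P_i` and a function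
`a` to the multiplication by `a` on `P_i`. For `P_i = O_X` it is the Yoneda functor. -/
def yonedaOn {r : ℕ} (P : Fin r → QFact X) (f : Γ(X, ⊤)) (i : Fin r)
    (h₀ : (P i).δ₀ = 0) (h₁ : (P i).δ₁ = 0) (V : X.Opens) : curvedOn f V ⟶ qvectOn P f V where
  obj _ := i
  map := scalar (P i)
  map_one _ := rfl
  map_comp a b := scalar_mul (P i) a b
  map_gr a := (gr_scalar (P := P i) _).symm
  map_d a := by
    change scalar (P i) 0 = diff (scalar (P i) _)
    rw [diff_eq, delta_eq_zero (P i) h₀ h₁]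
    simp
  map_h _ := by
    change scalar (P i) (-_) = comp (delta (P i)) (delta (P i)) - scalar (P i) _
    rw [delta_eq_zero (P i) h₀ h₁]
    simp

/-- The functors `yonedaOn` as a morphism of presheaves of cdg categories. -/
def yoneda {r : ℕ} (P : Fin r → QFact X) (f : Γ(X, ⊤)) (i : Fin r)
    (h₀ : (P i).δ₀ = 0) (h₁ : (P i).δ₁ = 0) : curvedPresheaf f ⟶ qvectPresheaf P f where
  app V := yonedaOn P f i h₀ h₁ V.unop
  naturality V V' h := CdgFunctor.ext rfl (heq_of_eq (by
    funext x y
    exact LinearMap.ext fun a => (homRes_scalar (P := P i) h.unop.le a).symm))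

end Geometry

section WordSums
variable {Ob : Type}

/-- Sums of words of all lengths. -/
abbrev WordSum (Q : Ob → Ob → ModuleCat.{0} ℂ) (x z : Ob) : Type := ⨁ k : ℕ, Word Q k x z

variable {Q : Ob → Ob → ModuleCat.{0} ℂ}

/-- A single letter. -/
def WordSum.single {x z : Ob} : Q z x →ₗ[ℂ] WordSum Q x z :=
  (DirectSum.lof ℂ ℕ (fun k => Word Q k x z) 0).comp Word.single

/-- Put a letter in front. -/
def WordSum.cons {x y z : Ob} : Q y x →ₗ[ℂ] WordSum Q y z →ₗ[ℂ] WordSum Q x z :=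
  (DirectSum.toModule ℂ ℕ _ fun k => LinearMap.flip
    (Word.cons.compr₂ (DirectSum.lof ℂ ℕ (fun k => Word Q k x z) (k + 1)))).flip

end WordSums

section Shuffle
variable {C : CdgCat} (δ : ∀ x : C.Ob, C.Hom x x)

/-- `a ↦ a[δ|…|δ]` with `n` factors `δ`. -/
def shEnd : ∀ (n : ℕ) {x z : C.Ob}, C.Hom z x →ₗ[ℂ] WordSum C.Hom x z
  | 0, _, _ => WordSum.single
  | n + 1, _, z => WordSum.cons.flip (shEnd n (δ z))

/-- `a₀[a₁|…|a_k] ↦ ∑ a₀[δ|…|δ|a₁|δ|…|δ|…|a_k|δ|…|δ]`: insert altogether `n` factors `δ` after the letters,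
in all ways. In the recursion `m` is the number of factors between the first two letters. -/
def shWord : ∀ (k n : ℕ) {x z : C.Ob}, Word C.Hom k x z →ₗ[ℂ] WordSum C.Hom x z
  | 0, n => shEnd δ n
  | k + 1, n => Word.lift fun y => WordSum.cons.compl₂
      (∑ m ∈ Finset.range (n + 1),
        ((WordSum.cons (δ y) : Module.End ℂ (WordSum C.Hom y _)) ^ m).comp (shWord k (n - m)))

open Classical in
/-- `Sh([δ|…|δ], -)` with `n` factors, on Hochschild chains of the second kind. The summand for `k` is
zero unless `k + n = K`. -/
def sh (n : ℕ) : HochII C →ₗ[ℂ] HochII C :=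
  LinearMap.pi fun K => ∑ k ∈ Finset.range (K + 1),
    (DirectSum.lmap fun _ => (DirectSum.component ℂ ℕ _ K).comp (shWord δ k n)).comp
      (LinearMap.proj k)

end Shuffle

section Trace
open AlgebraicGeometry Opposite TopologicalSpace QFact

variable {X : Scheme.{0}} [X.Over (Spec (.of ℂ))]

/-- Indices of a homogeneous basis of the free module with `a.1` even and `a.2` odd basis vectors. -/
abbrev Idx (a : ℕ × ℕ) : Type := Fin a.1 ⊕ Fin a.2

/-- The sign `(-1)^|e|` of a basis vector `e`. -/
def idxSign {a : ℕ × ℕ} : Idx a → ℂ := Sum.elim (fun _ => 1) (fun _ => -1)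

/-- Morphisms `O^n ⊕ O^m → O^p ⊕ O^q` over `V`, for `a = (n, m)`, `b = (p, q)`, as matrices. These are the
morphism spaces of the presheaf of categories of trivial quasi matrix factorizations (with `δ = 0`). -/
def MatHom (V : X.Opens) (a b : ℕ × ℕ) : ModuleCat.{0} ℂ :=
  ModuleCat.of ℂ (Matrix (Idx b) (Idx a) Γ(X, V))

/-- Matrix multiplication. -/
def matMul {V : X.Opens} {a b c : ℕ × ℕ} :
    MatHom V b c →ₗ[ℂ] MatHom V a b →ₗ[ℂ] MatHom V a c :=
  LinearMap.mk₂ ℂ (fun (M : Matrix (Idx c) (Idx b) Γ(X, V)) (N : Matrix (Idx b) (Idx a) Γ(X, V)) =>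
      (M * N : Matrix (Idx c) (Idx a) Γ(X, V)))
    Matrix.add_mul Matrix.smul_mul Matrix.mul_add (fun c M N => Matrix.mul_smul M c N)

/-- The identity matrix. -/
def matOne {V : X.Opens} (a : ℕ × ℕ) : MatHom V a a :=
  (1 : Matrix (Idx a) (Idx a) Γ(X, V))

/-- An entry of a matrix. -/
def matEntry {V : X.Opens} {a b : ℕ × ℕ} (i : Idx b) (j : Idx a) : MatHom V a b →ₗ[ℂ] Γ(X, V) :=
  Matrix.entryLinearMap ℂ Γ(X, V) i j

/-- Hochschild chains of the second kind of the trivial quasi matrix factorizations over `V`. -/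
abbrev HochMat (V : X.Opens) : Type := ∀ k : ℕ, ⨁ a : ℕ × ℕ, Word (MatHom V) k a a

/-- For rows and columns `i`, `j`:
`F⁰[F¹|…|F^k] ↦ ∑ (-1)^(|l₁| + … + |l_k|) F⁰_{i l₁}[F¹_{l₁ l₂}|…|F^k_{l_k j}]`. -/
def strWord (f : Γ(X, ⊤)) (V : X.Opens) : ∀ (k : ℕ) {a b : ℕ × ℕ} (_ : Idx a) (_ : Idx b),
    Word (MatHom V) k a b →ₗ[ℂ] Word (curvedOn f V).Hom k () ()
  | 0, _, _, i, j => matEntry i j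
  | k + 1, _, _, i, j => Word.lift fun c => ∑ l : Idx c, idxSign l •
      (Word.cons (Q := (curvedOn f V).Hom)).compl₁₂ (matEntry i l) (strWord f V k l j)

open Classical in
/-- The supertrace: `F⁰[F¹|…|F^k] ↦ ∑ (-1)^σ F⁰_{l₀ l₁}[F¹_{l₁ l₂}|…|F^k_{l_k l₀}]` with
`σ = (k + 1)|l₀| + |l₁| + … + |l_k|`. -/
def sTr (f : Γ(X, ⊤)) (V : X.Opens) : HochMat V →ₗ[ℂ] HochII (curvedOn f V) :=
  LinearMap.pi fun k => (DirectSum.toModule ℂ (ℕ × ℕ) _ fun a =>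
    (DirectSum.lof ℂ Unit (fun x => Word (curvedOn f V).Hom k x x) ()).comp
      (∑ i : Idx a, idxSign i ^ (k + 1) • strWord f V k i i)).comp (LinearMap.proj k)

/-- A trivialisation `O^n ≅ M` over `V`, given by the images of the standard basis over all `W ≤ V`. -/
structure Frame (M : X.Modules) (V : X.Opens) (n : ℕ) where
  basis : ∀ W : {W : X.Opens // W ≤ V}, Module.Basis (Fin n) Γ(X, W.1) Γ(M, W.1)
  res_basis : ∀ (W W' : {W : X.Opens // W ≤ V}) (h : W'.1 ≤ W.1) (k : Fin n),
    resSec M h (basis W k) = basis W' k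

/-- A trivialisation `O^n ⊕ O^m ≅ P` over `V` of the underlying graded sheaf, `a = (n, m)`. It need not be
compatible with `δ`. -/
structure Trivialisation (P : QFact X) (V : X.Opens) (a : ℕ × ℕ) where
  even : Frame P.even V a.1
  odd : Frame P.odd V a.2

/-- The homogeneous basis of the sections over `W`. -/
def Trivialisation.basis {P : QFact X} {V : X.Opens} {a : ℕ × ℕ} (t : Trivialisation P V a)
    (W : {W : X.Opens // W ≤ V}) : Module.Basis (Idx a) Γ(X, W.1) (P.Sec W.1) :=
  (t.even.basis W).prod (t.odd.basis W)

variable {N r : ℕ} {U : Fin N → X.Opens} {P : Fin r → QFact X} {rk : Fin r → ℕ × ℕ}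
  (t : ∀ i j, Trivialisation (P i) (U j) (rk i))

variable (U) in
/-- The members of the cover that contain `V`. -/
abbrev Chart (V : X.Opens) : Type := {j : Fin N // V ≤ U j}

section Localise
variable {V : X.Opens}

/-- The basis of `P_x(V)` given by the trivialisation over `U_j`. -/
def frameAt (j : Chart U V) (x : Fin r) : Module.Basis (Idx (rk x)) Γ(X, V) ((P x).Sec V) :=
  (t x j.1).basis ⟨V, j.2⟩

/-- The matrix `(α)_j` of a morphism `α` in the trivialisations over `U_j`. -/
def matrixOf (j : Chart U V) {x y : Fin r} : Hom V (P x) (P y) →ₗ[ℂ] MatHom V (rk x) (rk y) where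
  toFun a := LinearMap.toMatrix (frameAt t j x) (frameAt t j y) (app a ⟨V, le_rfl⟩)
  map_add' a b := map_add (LinearMap.toMatrix (frameAt t j x) (frameAt t j y)) _ _
  map_smul' c a := Matrix.ext fun k l => by
    change LinearMap.toMatrix (frameAt t j x) (frameAt t j y) (app (c • a) ⟨V, le_rfl⟩) k l =
      c • LinearMap.toMatrix (frameAt t j x) (frameAt t j y) (app a ⟨V, le_rfl⟩) k l
    rw [LinearMap.toMatrix_apply, LinearMap.toMatrix_apply, smul_app,
      ← algebraMap_smul Γ(X, V) c (app a ⟨V, le_rfl⟩ _), map_smul, Finsupp.smul_apply,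
      algebraMap_smul]

/-- The change of basis matrix `g_{kl}`, with `g_{kl} (α)_l g_{kl}⁻¹ = (α)_k`. Its inverse is `g_{lk}`. -/
def transition (k l : Chart U V) (x : Fin r) : MatHom V (rk x) (rk x) :=
  LinearMap.toMatrix (frameAt t l x) (frameAt t k x) LinearMap.id

/-- For a list `L = (j₁, …, j_s)` and a start index `i`: `M ↦ M[-g_{j₁ i}⁻¹|-g_{j₂ j₁}⁻¹|…]`. -/
def hEnd : List (Chart U V) → Chart U V → ∀ {x z : Fin r},
    MatHom V (rk z) (rk x) →ₗ[ℂ] WordSum (MatHom V) (rk x) (rk z)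
  | [], _, _, _ => WordSum.single
  | j :: L, i, _, z => WordSum.cons.flip (hEnd L j (-transition t i j z))

/-- The way a word continues after a letter with target basis `i` when the indices `L` have not been used:
insert the inverse change of basis matrices for an initial part of `L`, negated, then continue by `F`. -/
def hInsert {y z : Fin r} {M : Type} [AddCommGroup M] [Module ℂ M]
    (F : List (Chart U V) → Chart U V → (M →ₗ[ℂ] WordSum (MatHom V) (rk y) (rk z))) :
    List (Chart U V) → Chart U V → (M →ₗ[ℂ] WordSum (MatHom V) (rk y) (rk z))
  | [], i => F [] i
  | j :: L, i => F (j :: L) i + (WordSum.cons (-transition t i j y)).comp (hInsert F L j)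

/-- The words of `h^q` for the indices `i, L` (of altogether `q + 1` members, `q` the length of `L`): the
letters are written as matrices in the basis of the current index, starting with `i`; the `q` matrices
`g_{j j₀}⁻¹` that pass from each index `j₀` to the next one `j` are inserted after arbitrary letters, in
this order; and the first letter is multiplied by `g` from the left. The sign is `(-1)^ε`,
`ε = ∑_s (∑_{j ≤ l_s} |α_j| + l_s)`, where the `s`-th matrix is inserted after the letter `α_{l_s}`: each letter
contributes `(-1)^(|α| + 1)` for each matrix inserted after it, and each inserted matrix contributes `-1`. -/
def hWord (f : Γ(X, ⊤)) : ∀ (k : ℕ) (L : List (Chart U V)) (i : Chart U V) {x z : Fin r},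
    MatHom V (rk x) (rk x) → Word (qvectOn P f V).Hom k x z →ₗ[ℂ] WordSum (MatHom V) (rk x) (rk z)
  | 0, L, i, _, _, g => (hEnd t L i).comp ((matMul g).comp ((matrixOf t i).comp
      ((-gr : Module.End ℂ _) ^ L.length)))
  | k + 1, L, i, _, _, g => Word.lift fun y => WordSum.cons.compl₁₂
      ((matMul g).comp ((matrixOf t i).comp ((-gr : Module.End ℂ _) ^ L.length)))
      (hInsert t (fun L i => hWord f k L i (matOne (rk y))) L i)

open Classical in
/-- The previous map on chains, for the indices `L` followed by `i₀`, with the first letter multiplied by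
`g_{i₀ j}`, where `j` is the first of the indices. The summand for `k` is zero unless `k + q = K`. -/
def hChain (f : Γ(X, ⊤)) (L : List (Chart U V)) (i₀ : Chart U V) :
    HochII (qvectOn P f V) →ₗ[ℂ] HochMat V :=
  LinearMap.pi fun K => ∑ k ∈ Finset.range (K + 1),
    (DirectSum.toModule ℂ (Fin r) _ fun x =>
      (DirectSum.lof ℂ (ℕ × ℕ) (fun a => Word (MatHom V) K a a) (rk x)).comp
        ((DirectSum.component ℂ ℕ _ K).comp
          (match L with
            | [] => hWord t f k [] i₀ (transition t i₀ i₀ x)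
            | j :: L' => hWord t f k (L' ++ [i₀]) j (transition t i₀ j x)))).comp
      (LinearMap.proj k)

end Localise

variable (f : Γ(X, ⊤))

/-- `U_j` contains `U_J` for `j ∈ J`. -/
def chartOf {J : Finset (Fin N)} (j : J) : Chart U (cap U J) := ⟨j.1, Finset.inf_le j.2⟩

/-- Čech cochains with values in the Hochschild chains of the trivial quasi matrix factorizations. -/
abbrev CechMat (U : Fin N → X.Opens) : Type := ∀ J : CechIndex N, HochMat (cap U J.1)

/-- The map `h^q` of Čech cochains. Its component over `U_J` is the sum over all decompositions
`i_{-q} < … < i_{-1} < i₀ < … < i_p` of `J`; here `i = i₀`, `L = (i_{-q}, …, i_{-1})`, `T = {i₀, …, i_p}`, and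
the sign is `(-1)^(p q + q(q-1)/2)`. -/
def hMap (q : ℕ) : CechHochII (qvectPresheaf P f) U →ₗ[ℂ] CechMat U :=
  LinearMap.pi fun J => ∑ i : J.1,
    let L := ((Finset.univ : Finset J.1).filter (· < i)).sort (· ≤ ·)
    let T : CechIndex N := ⟨J.1.filter (i.1 ≤ ·), i.1, by simp⟩
    if L.length = q then
      ((-1 : ℂ) ^ ((T.1.card - 1) * q + q.choose 2)) •
        ((hChain t f (L.map chartOf) (chartOf i)).comp
          (capRes (qvectPresheaf P f) U (Finset.filter_subset _ J.1))).comp (LinearMap.proj T)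
    else 0

/-- `Sh` on Čech cochains. -/
def shMap (n : ℕ) : CechHochII (qvectPresheaf P f) U →ₗ[ℂ] CechHochII (qvectPresheaf P f) U :=
  LinearMap.pi fun J => (sh (C := qvectOn P f (cap U J.1)) (fun x => delta (P x)) n).comp
    (LinearMap.proj J)

/-- `sTr` on Čech cochains. -/
def sTrMap : CechMat U →ₗ[ℂ] CechHochII (curvedPresheaf f) U :=
  LinearMap.pi fun J => (sTr f (cap U J.1)).comp (LinearMap.proj J)

/-- The trace map `φ = ∑_{n, q ≥ 0} (-1)^n sTr ∘ h^q ∘ Sh_n`. The sum is finite in each component: `Sh_n` raises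
the length by `n` and `h^q` raises it by `q`, so that only `n, q ≤ K` contribute to the component of length `K`. -/
def phi : CechHochII (qvectPresheaf P f) U →ₗ[ℂ] CechHochII (curvedPresheaf f) U :=
  LinearMap.pi fun J => LinearMap.pi fun K =>
    ∑ n ∈ Finset.range (K + 1), ∑ q ∈ Finset.range (K + 1), ((-1 : ℂ) ^ n) •
      ((LinearMap.proj K).comp (LinearMap.proj J)).comp
        ((sTrMap f).comp ((hMap t f q).comp (shMap f n)))

/-- `(P, δ)` is the structure sheaf in even degree, with `δ = 0`. -/
structure IsStructureSheaf (P : QFact X) : Prop where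
  even_iso : Nonempty (P.even ≅ (SheafOfModules.unit X.ringCatSheaf : X.Modules))
  odd_zero : Limits.IsZero P.odd
  δ₀_eq : P.δ₀ = 0
  δ₁_eq : P.δ₁ = 0

/-- The derived category `D_{ℤ/2}(ℂ)`: complexes indexed by `ℤ/2`, localized at the quasi-isomorphisms. -/
abbrev DerivedCat : Type 1 :=
  (HomologicalComplex.quasiIso (ModuleCat.{0} ℂ) (ComplexShape.up (ZMod 2))).Localization

/-- The localization functor. -/
abbrev toDerived :
    HomologicalComplex (ModuleCat.{0} ℂ) (ComplexShape.up (ZMod 2)) ⥤ DerivedCat :=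
  (HomologicalComplex.quasiIso (ModuleCat.{0} ℂ) (ComplexShape.up (ZMod 2))).Q

end Trace

end CechHoch

end

open CechHoch AlgebraicGeometry

open CategoryTheory TensorProduct DirectSum

noncomputable section

/-! The trivialisations enter through a formal device. Adjoin to a cdg category one copy of its
objects for each trivialisation (`blow`). A change of basis matrix is then the matrix of an identity
morphism from one copy to another, and `h^q` becomes the insertion of negated identities leading
through the copies `i_{-q}, …, i_0` (`insList`), followed by passage to matrices. Identities are
even and closed, so the only new terms in the differential of such a word are products of an
inserted identity with a neighbour. The product of an identity with a letter on its right cancels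
the product of that letter with an identity on its right. The product of two adjacent identities
skips a copy in the middle of the list. At the beginning there is an uncancelled term that drops the
first copy, and the cyclic term drops the last one. So insertion along a list commutes with the
differential up to a sign and up to the alternating sum over all ways to drop a member of the list
(`Dt_insList`). For a category with zero differential and diagonal curvature matrices the supertrace
commutes with the differential (`MatRep.Dt_Str`). The composite `MatRep.cut` of the two satisfies
the same boundary formula on products of chains (`MatRep.hochD_cut`).

The differential `δα ∓ αδ` and the summand `δ²` of the curvature are removed by the twist `∑ (-1)^n
Sh_n`. When factors `δ` are inserted in all ways, their products with neighbouring letters give the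
differential of the letters, products of two adjacent factors give `δ²`, and a factor in last
position is moved to the front by the cyclic term, where it cancels the remaining summand. Hence the
twist is a chain map to the complex of the category with the same morphisms, zero differential and
curvature `-f` (`hochD_twistFlat`). It is the identity plus terms that raise the length, so it is
bijective on the product over all lengths (`twist_bijective`).

With these two ingredients `φ` is the composite of the twist and `flatTrace` (`phi_eq`). The second
map is a cup product: a cochain of operators, given by `MatRep.cut` on lists of members of the
cover, is applied to a Čech cochain, the last index of the operator being the first index of the
cochain. The Leibniz rule for such products (`cup_identity`) turns the boundary formula for
`MatRep.cut` into the statement that `flatTrace` is a chain map. This gives (i).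

For (ii) both composites with the Yoneda map `y` are shown to be homotopic to the identity. For `φ ∘
y`, the global trivialisation of `P_i` is adjoined to those over the `U_j`. Traces along lists
ending in the global one form a cochain of operators whose value on the empty set is the identity,
and dropping the global member gives back the trace along the `U_j`; their cup product, with the
other choice of sign, is the homotopy (`cechD_starCup`). For `y ∘ φ`, over a single intersection and
in one chart each `P_x` is a sum of copies of `P_i`, up to parity. Insertion of one identity between
this decomposition and the trivial one is a homotopy between the identity and the trace in that
chart followed by `y` (`hochD_splitCut`). The choice of a chart is not compatible with restrictions,
so these homotopies work only modulo higher Čech degree, and a nilpotent error is left. As `y ∘ φ`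
is idempotent up to homotopy by the first composite, so is its difference from the identity; being
also homotopic to a nilpotent map, that difference is homotopic to zero (`Htpy.id_of_nilpotent`). -/

namespace CechHoch

/-! ### Homotopies of `ℤ/2`-graded complexes. -/

namespace SuperComplex

/-- Linear maps between `ℤ/2`-graded complexes that differ by `D s + s D` for an odd map `s`. -/
def Htpy {A B : SuperComplex} (f g : A.V →ₗ[ℂ] B.V) : Prop :=
  ∃ s : A.V →ₗ[ℂ] B.V, (∀ v, s (A.gr v) = -B.gr (s v)) ∧
    ∀ v, f v - g v = B.D (s v) + s (A.D v)

variable {A B C : SuperComplex}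

theorem IsChainMap.id : IsChainMap (A := A) (B := A) LinearMap.id :=
  ⟨fun _ => rfl, fun _ => rfl⟩

theorem IsChainMap.comp {g : B.V →ₗ[ℂ] C.V} {f : A.V →ₗ[ℂ] B.V} (hg : IsChainMap g)
    (hf : IsChainMap f) : IsChainMap (A := A) (B := C) (g.comp f) :=
  ⟨fun v => by simp [hf.map_gr, hg.map_gr], fun v => by simp [hf.map_D, hg.map_D]⟩

namespace Htpy

theorem refl (f : A.V →ₗ[ℂ] B.V) : Htpy f f := ⟨0, by simp, by simp⟩

theorem symm {f g : A.V →ₗ[ℂ] B.V} (h : Htpy f g) : Htpy g f := by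
  obtain ⟨s, h1, h2⟩ := h
  refine ⟨-s, fun v => by simp [h1], fun v => ?_⟩
  have := h2 v
  simp only [LinearMap.neg_apply, map_neg]
  linear_combination (norm := module) (-1 : ℂ) • this

theorem trans {f g h : A.V →ₗ[ℂ] B.V} (h₁ : Htpy f g) (h₂ : Htpy g h) : Htpy f h := by
  obtain ⟨s, hs, es⟩ := h₁
  obtain ⟨t, ht, et⟩ := h₂
  refine ⟨s + t, fun v => by simp [hs, ht]; abel, fun v => ?_⟩
  have e1 := es v
  have e2 := et v
  simp only [LinearMap.add_apply, map_add]
  linear_combination (norm := module) e1 + e2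

theorem comp_left {f g : A.V →ₗ[ℂ] B.V} (h : Htpy f g) {k : B.V →ₗ[ℂ] C.V} (hk : IsChainMap k) :
    Htpy (A := A) (B := C) (k.comp f) (k.comp g) := by
  obtain ⟨s, hs, es⟩ := h
  refine ⟨k.comp s, fun v => by simp [hs, hk.map_gr], fun v => ?_⟩
  simp only [LinearMap.comp_apply, ← map_sub, es, map_add, hk.map_D]

theorem comp_right {f g : B.V →ₗ[ℂ] C.V} (h : Htpy f g) {k : A.V →ₗ[ℂ] B.V} (hk : IsChainMap k) :
    Htpy (A := A) (B := C) (f.comp k) (g.comp k) := by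
  obtain ⟨s, hs, es⟩ := h
  refine ⟨s.comp k, fun v => by simp [hs, hk.map_gr], fun v => ?_⟩
  simp only [LinearMap.comp_apply, es, hk.map_D]

/-- One factor is exchanged at a time: `f^n f` is homotopic to `f^n g`, and this to `g^n g`. -/
theorem pow {f g : A.V →ₗ[ℂ] A.V} (hf : IsChainMap f) (hg : IsChainMap g) (h : Htpy f g) (n : ℕ) :
    Htpy ((f : Module.End ℂ A.V) ^ n) ((g : Module.End ℂ A.V) ^ n) := by
  have hn : ∀ n : ℕ, IsChainMap (A := A) (B := A) ((f : Module.End ℂ A.V) ^ n) := by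
    intro n
    induction n with
    | zero => exact IsChainMap.id
    | succ n ih => rw [pow_succ]; exact ih.comp hf
  induction n with
  | zero => exact refl _
  | succ n ih =>
    rw [pow_succ, pow_succ]
    exact (h.comp_left (hn n)).trans (ih.comp_right hg)

/-- A chain map which is idempotent up to homotopy, and homotopic to a nilpotent map, is
homotopic to zero. -/
theorem zero_of_nilpotent {f R : A.V →ₗ[ℂ] A.V} (hf : IsChainMap f) (hR : IsChainMap R)
    (h : Htpy f R) (hff : Htpy (f.comp f) f) {n : ℕ} (hn : (R : Module.End ℂ A.V) ^ (n + 1) = 0) :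
    Htpy f 0 := by
  -- All positive powers of `f` are homotopic to `f`, while the power with exponent `n + 1` is
  -- homotopic to the same power of `R`, which is zero.
  have key : ∀ n : ℕ, Htpy ((f : Module.End ℂ A.V) ^ (n + 1)) f := by
    intro n
    induction n with
    | zero => rw [zero_add, pow_one]; exact refl _
    | succ n ih => rw [pow_succ]; exact (ih.comp_right hf).trans hff
  have := h.pow hf hR (n + 1)
  rw [hn] at this
  exact (key n).symm.trans this

end Htpy

/-! ### From homotopies to the derived category. -/

section Derived

/-- Modulo 2 an odd map can be read as lowering the degree by one, which is the convention for
homotopies; hence the form `q + 1 = p`. -/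
theorem smem {s : A.V →ₗ[ℂ] B.V} (hs : ∀ v, s (A.gr v) = -B.gr (s v)) {p q : ZMod 2}
    (h : q + 1 = p) : ∀ v ∈ A.part p, s v ∈ B.part q := by
  intro v hv
  subst h
  rw [mem_part] at hv ⊢
  rw [sign_succ] at hv
  rw [← neg_neg (B.gr (s v)), ← hs, hv, map_smul, neg_smul, neg_neg]

/-- The underlying vector of an element of the homogeneous part of degree `p`. -/
def vec (A : SuperComplex) {p : ZMod 2} (v : A.toComplex.X p) : A.V :=
  Subtype.val (p := (· ∈ A.part p)) v

theorem vec_d {p q : ZMod 2} (h : p + 1 = q) (v : A.toComplex.X p) :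
    vec A (A.toComplex.d p q v) = A.D (vec A v) := by
  have : A.toComplex.d p q = ModuleCat.ofHom (A.D.restrict (h ▸ A.D_mem p)) := dif_pos h
  rw [this]
  rfl

/-- The restriction of an odd map to the homogeneous parts. -/
def oddHom (s : A.V →ₗ[ℂ] B.V) (hs : ∀ v, s (A.gr v) = -B.gr (s v)) (p q : ZMod 2) :
    A.toComplex.X p ⟶ B.toComplex.X q :=
  if h : q + 1 = p then ModuleCat.ofHom (s.restrict (smem hs h)) else 0

theorem vec_oddHom {s : A.V →ₗ[ℂ] B.V} (hs : ∀ v, s (A.gr v) = -B.gr (s v)) {p q : ZMod 2}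
    (h : q + 1 = p) (v : A.toComplex.X p) : vec B (oddHom s hs p q v) = s (vec A v) := by
  have : oddHom s hs p q = ModuleCat.ofHom (s.restrict (smem hs h)) := dif_pos h
  rw [this]
  rfl

/-- The homotopy of maps of complexes given by an odd linear map. -/
def homotopyOfOdd {f g : A.V →ₗ[ℂ] B.V} (hf : IsChainMap f) (hg : IsChainMap g)
    (s : A.V →ₗ[ℂ] B.V) (hs : ∀ v, s (A.gr v) = -B.gr (s v))
    (e : ∀ v, f v - g v = B.D (s v) + s (A.D v)) : Homotopy hf.hom hg.hom where
  hom := oddHom s hs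
  zero p q h := dif_neg h
  comm p := by
    have hp : (ComplexShape.up (ZMod 2)).Rel p (p + 1) := rfl
    have hm : (ComplexShape.up (ZMod 2)).Rel (p - 1) p := sub_add_cancel p 1
    rw [dNext_eq _ hp, prevD_eq _ hm]
    refine ModuleCat.hom_ext (LinearMap.ext fun v => ?_)
    have e' := e (vec A v)
    rw [sub_eq_iff_eq_add, ← vec_d hp, ← vec_oddHom hs hm, ← vec_oddHom hs hp, ← vec_d hm,
      add_comm (vec _ _) (vec _ _)] at e'
    exact Subtype.ext e'

theorem Htpy.nonempty_homotopy {f g : A.V →ₗ[ℂ] B.V} (hf : IsChainMap f) (hg : IsChainMap g)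
    (h : Htpy f g) : Nonempty (Homotopy hf.hom hg.hom) := by
  obtain ⟨s, hs, e⟩ := h
  exact ⟨homotopyOfOdd hf hg s hs e⟩

/-- Chain maps that are mutually inverse up to homotopy. -/
theorem quasiIso_of_htpy {f : A.V →ₗ[ℂ] B.V} {g : B.V →ₗ[ℂ] A.V} (hf : IsChainMap f)
    (hg : IsChainMap g) (h₁ : Htpy (g.comp f) LinearMap.id) (h₂ : Htpy (f.comp g) LinearMap.id) :
    QuasiIso hf.hom ∧
      (HomologicalComplex.quasiIso (ModuleCat.{0} ℂ) (ComplexShape.up (ZMod 2))).Q.map hf.hom ≫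
        (HomologicalComplex.quasiIso (ModuleCat.{0} ℂ) (ComplexShape.up (ZMod 2))).Q.map hg.hom
          = 𝟙 _ ∧
      (HomologicalComplex.quasiIso (ModuleCat.{0} ℂ) (ComplexShape.up (ZMod 2))).Q.map hg.hom ≫
        (HomologicalComplex.quasiIso (ModuleCat.{0} ℂ) (ComplexShape.up (ZMod 2))).Q.map hf.hom
          = 𝟙 _ := by
  obtain ⟨e₁⟩ : Nonempty (Homotopy (hf.hom ≫ hg.hom) (𝟙 _)) :=
    h₁.nonempty_homotopy (hg.comp hf) IsChainMap.id
  obtain ⟨e₂⟩ : Nonempty (Homotopy (hg.hom ≫ hf.hom) (𝟙 _)) :=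
    h₂.nonempty_homotopy (hf.comp hg) IsChainMap.id
  -- Homotopic maps become equal after localization as soon as every degree has a predecessor, here
  -- `n - 1`.
  have : (ComplexShape.up (ZMod 2)).QFactorsThroughHomotopy (ModuleCat.{0} ℂ) :=
    (ComplexShape.up (ZMod 2)).QFactorsThroughHomotopy_of_exists_prev
      (fun n => ⟨n - 1, sub_add_cancel n 1⟩) _
  refine ⟨(HomotopyEquiv.mk hf.hom hg.hom e₁ e₂).quasiIso_hom, ?_, ?_⟩
  · rw [← CategoryTheory.Functor.map_comp, ← CategoryTheory.Functor.map_id]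
    exact (ComplexShape.QFactorsThroughHomotopy.areEqualizedByLocalization e₁).map_eq _
  · rw [← CategoryTheory.Functor.map_comp, ← CategoryTheory.Functor.map_id]
    exact (ComplexShape.QFactorsThroughHomotopy.areEqualizedByLocalization e₂).map_eq _

end Derived

end SuperComplex

/-! ### Maps on products of chains as extensions of maps on finite sums. -/

section Completion
open Words
variable {C C' C'' : CdgCat}

/-- Words of length at least `n`. -/
def Words.lenGE (C : CdgCat) (x z : C.Ob) (n : ℕ) : Submodule ℂ (Words C x z) where
  carrier := {w | ∀ k < n, w k = 0}
  add_mem' hv hw k hk := by simp [hv k hk, hw k hk]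
  zero_mem' k _ := rfl
  smul_mem' c w hw k hk := by simp [DirectSum.smul_apply, hw k hk]

/-- Chains of length at least `n`. -/
def cycGE (C : CdgCat) (n : ℕ) : Submodule ℂ (Cyc C) where
  carrier := {w | ∀ k < n, w k = 0}
  add_mem' hv hw k hk := by simp [hv k hk, hw k hk]
  zero_mem' k _ := rfl
  smul_mem' c w hw k hk := by simp [DirectSum.smul_apply, hw k hk]

theorem Words.lenGE_anti {x z : C.Ob} {m n : ℕ} (h : m ≤ n) : lenGE C x z n ≤ lenGE C x z m :=
  fun _ hw k hk => hw k (hk.trans_le h)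

theorem cycGE_anti {m n : ℕ} (h : m ≤ n) : cycGE C n ≤ cycGE C m :=
  fun _ hw k hk => hw k (hk.trans_le h)

theorem Words.ι_apply_ne {x z : C.Ob} {j k : ℕ} (h : j ≠ k) (w : Word C.Hom j x z) :
    (ι j w : Words C x z) k = 0 := by
  rw [ι, DirectSum.lof_eq_of]; exact DirectSum.of_eq_of_ne _ _ _ h.symm

theorem Words.ι_mem {x z : C.Ob} {k n : ℕ} (h : n ≤ k) (w : Word C.Hom k x z) :
    ι k w ∈ lenGE C x z n := fun _ hj => ι_apply_ne (by omega) w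

theorem lof_mem_cycGE {k n : ℕ} (h : n ≤ k) (c : HochChain C k) :
    DirectSum.lof ℂ ℕ (fun k => HochChain C k) k c ∈ cycGE C n := fun _ hj => lof_ne C (by omega) c

theorem Words.eq_sum_ι {x z : C.Ob} (w : Words C x z) :
    ∃ s : Finset ℕ, (∀ k, k ∈ s ↔ w k ≠ 0) ∧ w = ∑ k ∈ s, ι k (w k) := by
  classical
  exact ⟨DFinsupp.support w, fun k => DFinsupp.mem_support_iff,
    (DirectSum.sum_support_of (β := fun k => Word C.Hom k x z) w).symm⟩

/-- A sum of words of length at least `n` is the sum of its components of these lengths, so an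
estimate for single lengths is enough. -/
theorem Words.map_mem {x z : C.Ob} {M : Type} [AddCommGroup M] [Module ℂ M]
    (F : Words C x z →ₗ[ℂ] M) (S : Submodule ℂ M) {n : ℕ}
    (h : ∀ k (w : Word C.Hom k x z), n ≤ k → F (ι k w) ∈ S) {w : Words C x z}
    (hw : w ∈ lenGE C x z n) : F w ∈ S := by
  obtain ⟨s, hs, e⟩ := w.eq_sum_ι
  rw [e, map_sum]
  refine S.sum_mem fun k hk => h k _ ?_
  by_contra hlt
  exact (hs k).1 hk (hw k (by omega))

theorem map_mem_of_cycGE {M : Type} [AddCommGroup M] [Module ℂ M]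
    (F : Cyc C →ₗ[ℂ] M) (S : Submodule ℂ M) {n : ℕ}
    (h : ∀ k x (w : Word C.Hom k x x), n ≤ k → F (inc (ι k w)) ∈ S) {u : Cyc C}
    (hu : u ∈ cycGE C n) : F u ∈ S := by
  classical
  rw [← DirectSum.sum_support_of (β := fun k => HochChain C k) u, map_sum]
  refine S.sum_mem fun k hk => ?_
  have hk' : n ≤ k := by
    by_contra hlt
    exact DFinsupp.mem_support_iff.1 hk (hu k (by omega))
  generalize u k = c
  induction c using DirectSum.induction_on with
  | zero => rw [map_zero, map_zero]; exact S.zero_mem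
  | add v w hv hw => rw [map_add, map_add]; exact S.add_mem hv hw
  | of x w =>
    have := h k x w hk'
    rwa [inc_ι] at this

theorem Words.cn_mem {x y z : C.Ob} {n : ℕ} (a : C.Hom y x) {w : Words C y z}
    (hw : w ∈ lenGE C y z n) : cn a w ∈ lenGE C x z (n + 1) :=
  map_mem (cn a) _ (fun k v hk => by rw [cn_ι]; exact ι_mem (by omega) _) hw

theorem Words.lm_mem {x y z : C.Ob} {n : ℕ} (a : C.Hom x y) {w : Words C x z}
    (hw : w ∈ lenGE C x z n) : lm a w ∈ lenGE C y z n :=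
  map_mem (lm a) _ (fun k v hk => by rw [lm_ι]; exact ι_mem hk _) hw

theorem Words.T_mem {x z : C.Ob} {n : ℕ} {w : Words C x z}
    (hw : w ∈ lenGE C x z n) : T w ∈ lenGE C x z n :=
  map_mem T _ (fun k v hk => by rw [T_ι]; exact ι_mem hk _) hw

theorem Words.inc_mem {x : C.Ob} {n : ℕ} {w : Words C x x}
    (hw : w ∈ lenGE C x x n) : inc w ∈ cycGE C n :=
  map_mem inc _ (fun k v hk => by rw [inc_ι]; exact lof_mem_cycGE hk _) hw

theorem Words.mem_lenGE_zero {x z : C.Ob} (w : Words C x z) : w ∈ lenGE C x z 0 :=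
  fun _ h => absurd h (Nat.not_lt_zero _)

/-- A finite sum of chains and a product of chains agree in lengths less than `K`. -/
def Agree (K : ℕ) (u : Cyc C) (c : HochII C) : Prop := ∀ k < K, u k = c k

/-- The part of lengths less than `K` of a product of chains. -/
def truncate (K : ℕ) (c : HochII C) : Cyc C :=
  ∑ k ∈ Finset.range K, DirectSum.lof ℂ ℕ (fun k => HochChain C k) k (c k)

theorem agree_truncate (K : ℕ) (c : HochII C) : Agree K (truncate K c) c := by
  classical
  intro j hj
  have : ∀ s : Finset ℕ, (∑ k ∈ s, DirectSum.lof ℂ ℕ (fun k => HochChain C k) k (c k)) j =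
      if j ∈ s then c j else 0 := by
    intro s
    induction s using Finset.induction_on with
    | empty => simp
    | insert a s ha ih =>
      rw [Finset.sum_insert ha, DirectSum.add_apply, ih]
      by_cases h : a = j
      · subst h; simp [ha, DirectSum.lof_apply]
      · rw [lof_ne C h, zero_add]
        simp [Ne.symm h]
  rw [truncate, this, if_pos (Finset.mem_range.2 hj)]

theorem exists_agree (K : ℕ) (c : HochII C) : ∃ u : Cyc C, Agree K u c :=
  ⟨_, agree_truncate K c⟩

theorem Agree.sub {K : ℕ} {u v : Cyc C} {c : HochII C} (hu : Agree K u c) (hv : Agree K v c) :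
    u - v ∈ cycGE C K := fun k hk => by
  rw [DirectSum.sub_apply, hu k hk, hv k hk, sub_self]

theorem Agree.mono {K L : ℕ} {u : Cyc C} {c : HochII C} (hu : Agree K u c) (h : L ≤ K) :
    Agree L u c := fun k hk => hu k (hk.trans_le h)

/-- Each component of `Dt u` depends on at most three neighbouring lengths, by the formula that
defines `hochD`. This is what makes the two differentials comparable length by length. -/
theorem Dt_apply (u : Cyc C) : (Dt u) 0 = δ1 C 0 (u 0) + hochD2 C 0 (u 1) ∧
    ∀ k, (Dt u) (k + 1) = δ0 C k (u k) + δ1 C (k + 1) (u (k + 1)) + hochD2 C (k + 1) (u (k + 2)) := by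
  classical
  induction u using DirectSum.induction_on with
  | zero => simp
  | add v w hv hw =>
    refine ⟨?_, fun k => ?_⟩
    · simp only [map_add, DirectSum.add_apply, hv.1, hw.1]; abel
    · simp only [map_add, DirectSum.add_apply, hv.2, hw.2]; abel
  | of j c =>
    rw [← DirectSum.lof_eq_of ℂ]
    match j with
    | 0 =>
      rw [Dt_lof_zero]
      refine ⟨?_, fun k => ?_⟩
      · simp (disch := omega) [lof_ne, DirectSum.lof_apply]
      · match k with
        | 0 => simp (disch := omega) [lof_ne, DirectSum.lof_apply]
        | k + 1 => simp (disch := omega) [lof_ne]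
    | 1 =>
      rw [Dt_lof_succ]
      refine ⟨?_, fun k => ?_⟩
      · simp (disch := omega) [lof_ne, DirectSum.lof_apply]
      · match k with
        | 0 => simp (disch := omega) [lof_ne, DirectSum.lof_apply]
        | 1 => simp (disch := omega) [lof_ne, DirectSum.lof_apply]
        | k + 2 => simp (disch := omega) [lof_ne]
    | j + 2 =>
      rw [Dt_lof_succ]
      refine ⟨?_, fun k => ?_⟩
      · simp (disch := omega) [lof_ne, DirectSum.lof_apply]
      · by_cases h1 : k = j
        · subst h1; simp (disch := omega) [lof_ne, DirectSum.lof_apply]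
        by_cases h2 : k = j + 1
        · subst h2; simp (disch := omega) [lof_ne, DirectSum.lof_apply]
        by_cases h3 : k = j + 2
        · subst h3; simp (disch := omega) [lof_ne, DirectSum.lof_apply]
        simp (disch := omega) [lof_ne]

/-- One length is lost because the bar differential lowers the length by one. For the same reason
`hochD` itself is not an instance of `Completes`. -/
theorem Agree.hochD {K : ℕ} {u : Cyc C} {c : HochII C} (h : Agree (K + 1) u c) :
    Agree K (Dt u) (hochD C c) := by
  intro k hk
  match k with
  | 0 =>
    rw [(Dt_apply u).1, h 0 (by omega), h 1 (by omega)]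
    rfl
  | k + 1 =>
    rw [(Dt_apply u).2, h k (by omega), h (k + 1) (by omega), h (k + 2) (by omega)]
    rfl

/-- A linear map on products of chains is the continuous extension of a linear map on finite sums
of chains. -/
def Completes (F : HochII C →ₗ[ℂ] HochII C') (Φ : Cyc C →ₗ[ℂ] Cyc C') : Prop :=
  ∀ K u c, Agree K u c → Agree K (Φ u) (F c)

namespace Completes

theorem id : Completes (LinearMap.id : HochII C →ₗ[ℂ] HochII C) LinearMap.id := fun _ _ _ h => h

theorem comp {F : HochII C →ₗ[ℂ] HochII C'} {Φ : Cyc C →ₗ[ℂ] Cyc C'}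
    {G : HochII C' →ₗ[ℂ] HochII C''} {Ψ : Cyc C' →ₗ[ℂ] Cyc C''} (hG : Completes G Ψ)
    (hF : Completes F Φ) : Completes (G.comp F) (Ψ.comp Φ) :=
  fun K _ _ h => hG K _ _ (hF K _ _ h)

theorem smul {F : HochII C →ₗ[ℂ] HochII C'} {Φ : Cyc C →ₗ[ℂ] Cyc C'} (hF : Completes F Φ)
    (s : ℂ) : Completes (s • F) (s • Φ) := fun K u c h k hk => by
  rw [LinearMap.smul_apply, DirectSum.smul_apply, hF K u c h k hk]; rfl

theorem zero : Completes (0 : HochII C →ₗ[ℂ] HochII C') 0 := fun _ _ _ _ _ _ => rfl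

theorem unique {F G : HochII C →ₗ[ℂ] HochII C'} {Φ : Cyc C →ₗ[ℂ] Cyc C'} (hF : Completes F Φ)
    (hG : Completes G Φ) : F = G := by
  refine LinearMap.ext fun c => funext fun K => ?_
  obtain ⟨u, hu⟩ := exists_agree (K + 1) c
  rw [← hF _ u c hu K (by omega), ← hG _ u c hu K (by omega)]

/-- Identities for the differential extend from finite sums to products. -/
theorem hochD_eq {F G : HochII C →ₗ[ℂ] HochII C'} {Φ Ψ : Cyc C →ₗ[ℂ] Cyc C'}
    (hF : Completes F Φ) (hG : Completes G Ψ) {s : ℂ}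
    (h : ∀ u, Dt (Φ u) = s • Φ (Dt u) + Ψ u) (c : HochII C) :
    hochD C' (F c) = s • F (hochD C c) + G c := by
  funext K
  -- To know the value at `K`, agreement below `K + 1` is needed, and the differential costs one
  -- more.
  obtain ⟨u, hu⟩ := exists_agree (K + 2) c
  rw [← (hF _ u c hu).hochD K (by omega), h, DirectSum.add_apply, DirectSum.smul_apply,
    hG _ u c hu K (by omega), hF _ _ _ hu.hochD K (by omega)]
  rfl

theorem of_lmap (φ : ∀ k, HochChain C k →ₗ[ℂ] HochChain C' k) :
    Completes (LinearMap.pi fun k => (φ k).comp (LinearMap.proj k)) (DirectSum.lmap φ) :=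
  fun K u c h k hk => by
    rw [DirectSum.lmap_apply, h k hk]; rfl

theorem hochGr : Completes (hochGr C) (DirectSum.lmap (chainGr C)) := of_lmap _

theorem hochMap (F : C ⟶ C') : Completes (hochMap F) (DirectSum.lmap (chainMap F)) := of_lmap _

end Completes

/-- The extension to products of a map that does not lower the length. -/
def completion (Φ : Cyc C →ₗ[ℂ] Cyc C') : HochII C →ₗ[ℂ] HochII C' :=
  LinearMap.pi fun K => ∑ k ∈ Finset.range (K + 1),
    (((DirectSum.component ℂ ℕ (fun k => HochChain C' k) K).comp Φ).comp
      (DirectSum.lof ℂ ℕ (fun k => HochChain C k) k)).comp (LinearMap.proj k)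

/-- Since `Φ` does not shorten words, its component of length `j` does not see the part of lengths
above `j`; it may be computed on any truncation beyond `j`. -/
theorem completes_completion {Φ : Cyc C →ₗ[ℂ] Cyc C'}
    (h : ∀ k x (w : Word C.Hom k x x), Φ (inc (ι k w)) ∈ cycGE C' k) :
    Completes (completion Φ) Φ := by
  intro K u c hu j hj
  set v : Cyc C := truncate (j + 1) c with hv
  have e : completion Φ c j = Φ v j := by
    have : ∀ w : Cyc C', w j = DirectSum.component ℂ ℕ (fun k => HochChain C' k) j w := fun _ => rfl
    rw [this, hv, truncate, map_sum, map_sum]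
    simp [completion]
  have hmem : u - v ∈ cycGE C (j + 1) :=
    Agree.sub (c := c) (hu.mono (by omega)) (agree_truncate _ _)
  have := map_mem_of_cycGE Φ (cycGE C' (j + 1)) (fun k x w hk => cycGE_anti hk (h k x w)) hmem
  rw [map_sub] at this
  have := this j (by omega)
  rw [DirectSum.sub_apply, sub_eq_zero] at this
  rw [e, this]

open Classical in
/-- A linear map on chains from linear maps on cyclic words. -/
def cycLift {M : Type} [AddCommGroup M] [Module ℂ M] (F : ∀ x, Words C x x →ₗ[ℂ] M) :
    Cyc C →ₗ[ℂ] M :=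
  DirectSum.toModule ℂ ℕ _ fun k => DirectSum.toModule ℂ C.Ob _ fun x => (F x).comp (ι k)

theorem cycLift_inc {M : Type} [AddCommGroup M] [Module ℂ M] (F : ∀ x, Words C x x →ₗ[ℂ] M)
    {x : C.Ob} (w : Words C x x) : cycLift F (inc w) = F x w := by
  classical
  induction w using ind_ι with
  | zero => simp
  | add v w hv hw => simp only [map_add, hv, hw]
  | h k w =>
    rw [inc_ι, cycLift, DirectSum.toModule_lof, DirectSum.toModule_lof]
    rfl

end Completion

/-! ### Copies of objects and alternating sums over lists. -/

/-- The cdg category with objects `(c, x)`, copies of the objects `x` of `C` indexed by `I`. -/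
def blow (I : Type) (C : CdgCat) : CdgCat where
  Ob := I × C.Ob
  Hom p q := C.Hom p.2 q.2
  comp := C.comp
  one p := C.one p.2
  one_comp := C.one_comp
  comp_one := C.comp_one
  assoc := C.assoc
  gr := C.gr
  gr_gr := C.gr_gr
  gr_one p := C.gr_one p.2
  gr_comp := C.gr_comp
  d := C.d
  d_gr := C.d_gr
  d_comp := C.d_comp
  h p := C.h p.2
  gr_h p := C.gr_h p.2
  d_h p := C.d_h p.2
  d_d := C.d_d

/-- The alternating sum of a function on the lists obtained by dropping an element that is not the
last one; the sign of the first element is `-1`. -/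
def inner {I M : Type} [AddCommGroup M] : (List I → M) → List I → M
  | _, [] => 0
  | _, [_] => 0
  | Φ, d :: d' :: L => -Φ (d' :: L) - inner (fun L => Φ (d :: L)) (d' :: L)

theorem inner_sub {I M : Type} [AddCommGroup M] (Φ Ψ : List I → M) (L : List I) :
    inner (fun L => Φ L - Ψ L) L = inner Φ L - inner Ψ L := by
  induction L generalizing Φ Ψ with
  | nil => simp [inner]
  | cons d L ih =>
    cases L with
    | nil => simp [inner]
    | cons d' L => simp only [inner, ih]; abel

theorem inner_add {I M : Type} [AddCommGroup M] (Φ Ψ : List I → M) (L : List I) :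
    inner (fun L => Φ L + Ψ L) L = inner Φ L + inner Ψ L := by
  induction L generalizing Φ Ψ with
  | nil => simp [inner]
  | cons d L ih =>
    cases L with
    | nil => simp [inner]
    | cons d' L => simp only [inner, ih]; abel

theorem inner_congr {I M : Type} [AddCommGroup M] {Φ Ψ : List I → M} {L : List I}
    (h : ∀ L', L' ≠ [] → L'.length + 1 = L.length → Φ L' = Ψ L') : inner Φ L = inner Ψ L := by
  induction L generalizing Φ Ψ with
  | nil => rfl
  | cons d L ih =>
    cases L with
    | nil => rfl
    | cons d' L =>
      rw [inner, inner, h _ (List.cons_ne_nil _ _) rfl, ih fun L' _ hl =>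
        h (d :: L') (List.cons_ne_nil _ _) (by simp only [List.length_cons] at hl ⊢; omega)]

theorem map_inner {I M M' : Type} [AddCommGroup M] [AddCommGroup M'] [Module ℂ M] [Module ℂ M']
    (f : M →ₗ[ℂ] M') (Φ : List I → M) (L : List I) :
    f (inner Φ L) = inner (fun L => f (Φ L)) L := by
  induction L generalizing Φ with
  | nil => simp [inner]
  | cons d L ih =>
    cases L with
    | nil => simp [inner]
    | cons d' L => simp only [inner, map_sub, map_neg, ih]

/-- The Leibniz rule for `1 · 1 = 1` gives `d 1 = d 1 + d 1`. -/
theorem CdgCat.d_one (C : CdgCat) (x : C.Ob) : C.d (C.one x) = 0 := by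
  have := C.d_comp (C.one x) (C.one x)
  rw [C.one_comp, C.gr_one, C.comp_one, C.one_comp] at this
  simpa using this

/-- The last element of `c :: L` is `e`. -/
def EndsAt {I : Type} (e : I) : List I → I → Prop
  | [], c => c = e
  | d :: L, _ => EndsAt e L d

/-! ### The sign that a letter receives from the identities inserted after it. -/

section Eps
variable {C : CdgCat} {x y z : C.Ob}

/-- Multiplication of a letter `a` by `(-1)^(q (|a| + 1))`. -/
def eps (q : ℕ) : C.Hom x y →ₗ[ℂ] C.Hom x y := (-C.gr : Module.End ℂ (C.Hom x y)) ^ q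

theorem eps_zero (a : C.Hom x y) : eps 0 a = a := rfl

theorem eps_succ (q : ℕ) (a : C.Hom x y) : eps (q + 1) a = -C.gr (eps q a) := by
  rw [eps, pow_succ']; rfl

theorem gr_eps (q : ℕ) (a : C.Hom x y) : C.gr (eps q a) = eps q (C.gr a) := by
  induction q with
  | zero => rfl
  | succ q ih => rw [eps_succ, eps_succ, map_neg, ih]

theorem gr_eps_succ (q : ℕ) (a : C.Hom x y) : C.gr (eps (q + 1) a) = -eps q a := by
  rw [eps_succ, map_neg, C.gr_gr]

theorem d_eps (q : ℕ) (a : C.Hom x y) : C.d (eps q a) = ((-1 : ℂ) ^ q) • eps q (C.d a) := by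
  induction q with
  | zero => simp [eps_zero]
  | succ q ih =>
    rw [eps_succ, eps_succ, map_neg, C.d_gr, ih, map_smul]
    module

theorem eps_of_even {a : C.Hom x y} (h : C.gr a = a) (q : ℕ) : eps q a = ((-1 : ℂ) ^ q) • a := by
  induction q with
  | zero => simp [eps_zero]
  | succ q ih => rw [eps_succ, ih, map_smul, h]; module

theorem eps_of_odd {a : C.Hom x y} (h : C.gr a = -a) (q : ℕ) : eps q a = a := by
  induction q with
  | zero => rfl
  | succ q ih => rw [eps_succ, ih, h, neg_neg]

/-- The exponents `(|b| + 1) + (|a| + 1)` and `|ba| + 1` differ by one modulo 2, once for each of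
the `q` identities. -/
theorem comp_eps (q : ℕ) (b : C.Hom y z) (a : C.Hom x y) :
    C.comp (eps q b) (eps q a) = ((-1 : ℂ) ^ q) • eps q (C.comp b a) := by
  induction q with
  | zero => simp [eps_zero]
  | succ q ih =>
    rw [eps_succ, eps_succ, eps_succ, map_neg, map_neg, LinearMap.neg_apply, neg_neg,
      ← C.gr_comp, ih, map_smul]
    module

end Eps

/-! ### Insertion of identities into words and the non-cyclic differential. -/

section Insertion
open Word Words
variable {I : Type} {C : CdgCat}

/-- The `c`-copy of an object. -/
def bo (c : I) (x : C.Ob) : (blow I C).Ob := (c, x)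

/-- A morphism of `C` as a morphism from a `d`-copy to a `c`-copy. -/
def lbl (c d : I) {x y : C.Ob} : C.Hom y x →ₗ[ℂ] (blow I C).Hom (bo d y) (bo c x) := LinearMap.id

section
variable {x y z : C.Ob} (b c d : I)

theorem comp_lbl (a : C.Hom y x) (a' : C.Hom z y) :
    (blow I C).comp (lbl b c a) (lbl c d a') = lbl b d (C.comp a a') := rfl
theorem gr_lbl (a : C.Hom y x) : (blow I C).gr (lbl c d a) = lbl c d (C.gr a) := rfl
theorem d_lbl (a : C.Hom y x) : (blow I C).d (lbl c d a) = lbl c d (C.d a) := rfl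
theorem h_lbl : (blow I C).h (bo c x) = lbl c c (C.h x) := rfl

end

variable (e : I)

/-- The word `-1[-1|…|-1]` of identities that lead from the `c`-copy to the `d`-copy and on through
the copies given by a list, ending in the `e`-copy. -/
def insEnd {z : C.Ob} : I → List I → ∀ c : I, Words (blow I C) (bo c z) (bo e z)
  | _, [], c => -sg (lbl c e (C.one z))
  | d, d' :: L, c => -cn (lbl c d (C.one z)) (insEnd d' L d)

/-- The words starting with a given letter followed by identities. -/
def insSingle {x z : C.Ob} : ∀ (L : List I) (c : I), C.Hom z x →ₗ[ℂ] Words (blow I C) (bo c x) (bo e z)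
  | [], c => Words.sg.comp (lbl c e)
  | d :: L, c => (cn.flip (insEnd e d L c)).comp ((lbl c c).comp (eps (L.length + 1)))

/-- Insertion of identities in front of words and inside of words. -/
def insHead {y z : C.Ob} {M : Type} [AddCommGroup M] [Module ℂ M]
    (F : ∀ (_ : List I) (c : I), M →ₗ[ℂ] Words (blow I C) (bo c y) (bo e z)) :
    ∀ (_ : List I) (c : I), M →ₗ[ℂ] Words (blow I C) (bo c y) (bo e z)
  | [], c => F [] c
  | d :: L, c => F (d :: L) c - (cn (lbl c d (C.one y))).comp (insHead F L d)

/-- Insertion of the negatives of the identities from the `c`-copy through the copies in the list, in this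
order and after arbitrary letters. -/
def insWord : ∀ (k : ℕ) (L : List I) (c : I) {x z : C.Ob},
    Word C.Hom k x z →ₗ[ℂ] Words (blow I C) (bo c x) (bo e z)
  | 0, L, c, _, _ => insSingle e L c
  | k + 1, L, c, _, _ => Word.lift fun _ => cn.compl₁₂ ((lbl c c).comp (eps L.length))
      (insHead e (fun L c => insWord k L c) L c)

/-- Insertion of identities, on words of all lengths. -/
def ins (L : List I) (c : I) {x z : C.Ob} : Words C x z →ₗ[ℂ] Words (blow I C) (bo c x) (bo e z) :=
  DirectSum.toModule ℂ ℕ _ fun k => insWord e k L c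

section
variable {x y z : C.Ob} (L : List I) (c d : I)

theorem ins_ι (k : ℕ) (w : Word C.Hom k x z) : ins e L c (ι k w) = insWord e k L c w := by
  simp [ins, ι]

theorem ins_sg_nil (a : C.Hom z x) : ins e [] c (sg a) = sg (lbl c e a) := by
  rw [sg_eq, ins_ι]; rfl

theorem ins_sg_cons (a : C.Hom z x) :
    ins e (d :: L) c (sg a) = cn (lbl c c (eps (L.length + 1) a)) (insEnd e d L c) := by
  rw [sg_eq, ins_ι]; rfl

/-- Insertion of identities, also in front of the word. -/
def insA {x z : C.Ob} (L : List I) (c : I) : Words C x z →ₗ[ℂ] Words (blow I C) (bo c x) (bo e z) :=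
  insHead e (fun L c => ins e L c) L c

theorem insA_nil (w : Words C x z) : insA e [] c w = ins e [] c w := rfl

theorem insA_cons (w : Words C x z) :
    insA e (d :: L) c w = ins e (d :: L) c w - cn (lbl c d (C.one x)) (insA e L d w) := rfl

theorem insHead_ι (k : ℕ) (w : Word C.Hom k x z) :
    insA e L c (ι k w) = insHead e (fun L c => insWord e k L c) L c w := by
  induction L generalizing c with
  | nil => exact ins_ι e [] c k w
  | cons d L ih => rw [insA_cons, ins_ι, ih]; rfl

theorem ins_cn (a : C.Hom y x) (w : Words C y z) :
    ins e L c (cn a w) = cn (lbl c c (eps L.length a)) (insA e L c w) := by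
  induction w using ind_ι with
  | zero => simp
  | add v w hv hw => simp only [map_add, hv, hw]
  | h k w =>
    rw [cn_ι, ins_ι, insHead_ι, insWord, lift_cons]
    rfl

theorem ins_lm (b : C.Hom x y) (w : Words C x z) :
    ins e L c (lm b w) = ((-1 : ℂ) ^ L.length) • lm (lbl c c (eps L.length b)) (ins e L c w) := by
  revert y b
  refine ind (p := fun x w => ∀ {y : C.Ob} (b : C.Hom x y), ins e L c (lm b w) =
    ((-1 : ℂ) ^ L.length) • lm (lbl c c (eps L.length b)) (ins e L c w)) ?_ ?_ ?_ ?_ x w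
  · intros; simp
  · intro x v w hv hw y b; simp only [map_add, hv, hw, smul_add]
  · intro x a y b
    cases L with
    | nil => simp only [lm_sg, ins_sg_nil, List.length_nil, pow_zero, one_smul,
        comp_lbl, eps_zero]
    | cons d L =>
      rw [lm_sg, ins_sg_cons, ins_sg_cons, lm_cn, comp_lbl, List.length_cons, comp_eps]
      simp only [map_smul, LinearMap.smul_apply, smul_smul, ← mul_pow]
      simp
  · intro x u a w hw y b
    rw [lm_cn, ins_cn, ins_cn, lm_cn, comp_lbl, comp_eps]
    simp only [map_smul, LinearMap.smul_apply, smul_smul, ← mul_pow]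
    simp

theorem T_insEnd : T (insEnd e d L c : Words (blow I C) (bo c z) (bo e z)) =
    ((-1 : ℂ) ^ (L.length + 1)) • insEnd e d L c := by
  induction L generalizing c d with
  | nil => simp only [insEnd, map_neg, T_sg, gr_lbl, C.gr_one, List.length_nil]; module
  | cons d' L ih =>
    simp only [insEnd, map_neg, T_cn, gr_lbl, C.gr_one, List.length_cons, ih, map_smul]
    module

/-- Each inserted identity is even, so `T` acts on it by `-1`. -/
theorem ins_T (w : Words C x z) : ins e L c (T w) = ((-1 : ℂ) ^ L.length) • T (ins e L c w) := by
  revert L c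
  refine ind (p := fun x w => ∀ L c,
    ins e L c (T w) = ((-1 : ℂ) ^ L.length) • T (ins e L c w)) ?_ ?_ ?_ ?_ x w
  · intros; simp
  · intro x v w hv hw L c; simp only [map_add, hv, hw, smul_add]
  · intro x a L c
    cases L with
    | nil => simp only [T_sg, ins_sg_nil, List.length_nil, pow_zero, one_smul, map_neg, gr_lbl]
    | cons d L =>
      rw [T_sg, map_neg, ins_sg_cons, ins_sg_cons, T_cn, T_insEnd, gr_lbl, gr_eps]
      simp only [map_smul, smul_neg, smul_smul, List.length_cons, ← mul_pow]
      simp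
  · intro x y a w hw L c
    have hA : ∀ L c, insA e L c (T w) = ((-1 : ℂ) ^ L.length) • T (insA e L c w) := by
      intro L
      induction L with
      | nil => intro c; exact hw [] c
      | cons d L ih =>
        intro c
        rw [insA_cons, insA_cons, hw, ih, map_sub, T_cn, gr_lbl, C.gr_one, map_smul,
          List.length_cons]
        module
    rw [T_cn, map_neg, ins_cn, ins_cn, T_cn, hA, gr_lbl, gr_eps, map_smul, smul_neg]

/-- The part of the boundary of an insertion that omits the first copy. -/
def insFirst : ∀ (_ : List I) (c : I) {x z : C.Ob},
    Words C x z →ₗ[ℂ] Words (blow I C) (bo c x) (bo e z)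
  | [], _, _, _ => 0
  | d :: L, c, x, _ => (lm (lbl c d (C.one x))).comp (ins e L d)

/-- `insEnd` as a function of one list. -/
def insTail (c : I) {z : C.Ob} : List I → Words (blow I C) (bo c z) (bo e z)
  | [] => 0
  | d :: L => insEnd e d L c

/-- This is the tail of identities after the last letter. Products of neighbours skip a copy and
give `inner`. The curvature can be inserted after any of the identities, so it appears among them as
in `insA`; the first summand removes the word with the curvature in front, which `N` does not
produce. -/
theorem N_insEnd (L : List I) (c d : I) (he : EndsAt e L d) :
    N (insEnd e d L c : Words (blow I C) (bo c z) (bo e z)) =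
      cn (lbl c c (C.h z)) (insEnd e d L c) +
      ((-1 : ℂ) ^ L.length) • insA e (d :: L) c (sg (C.h z)) + inner (insTail e c) (d :: L) := by
  induction L generalizing c d with
  | nil =>
    obtain rfl : d = e := he
    rw [insA_cons, insA_nil, ins_sg_nil, ins_sg_cons, eps_of_even (C.gr_h z)]
    simp only [insEnd, map_neg, N_sg, gr_lbl, d_lbl, C.gr_one, C.d_one, h_lbl, inner,
      List.length_nil, map_smul, LinearMap.smul_apply, map_zero]
    module
  | cons d' L ih =>
    have ih := ih d d' he
    have e1 : inner (fun L => insTail (z := z) e c (d :: L)) (d' :: L) =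
        -cn (lbl c d (C.one z)) (inner (insTail e d) (d' :: L)) := by
      rw [← LinearMap.neg_apply, map_inner]
      refine inner_congr fun L' h _ => ?_
      obtain ⟨d'', L', rfl⟩ := List.exists_cons_of_ne_nil h
      rfl
    rw [insA_cons, ins_sg_cons, eps_of_even (C.gr_h z), insEnd, map_neg, N_cn, ih, gr_lbl,
      C.gr_one, d_lbl, C.d_one, h_lbl, inner, e1]
    cases L with
    | nil =>
      simp only [insEnd, lm_sg, comp_lbl, C.one_comp, insTail, map_neg, map_add, map_smul,
        List.length_nil, List.length_cons, map_zero, LinearMap.smul_apply, LinearMap.zero_apply]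
      module
    | cons d'' L =>
      simp only [insEnd, lm_cn, comp_lbl, C.one_comp, insTail, map_neg, map_add, map_smul,
        List.length_cons, map_zero, LinearMap.smul_apply, LinearMap.zero_apply]
      rcases neg_one_pow_eq_or ℂ L.length with hs | hs <;> simp only [pow_succ, hs] <;> module

/-- Identities placed in front of `w` can be multiplied with the first letter of `w` from the left,
and these products cancel the term `insFirst` of the formula for `w`. In `insA (cn h w)` the
curvature stands before `w` with some identities in front of it, as it does when `N` inserts it
after these identities; the first summand corrects for the case where none precedes it. -/
theorem N_insA (w : Words C x z) (h : ∀ L c, EndsAt e L c → N (ins e L c w) =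
    ((-1 : ℂ) ^ L.length) • ins e L c (N w) + insFirst e L c w + inner (fun L => ins e L c w) L)
    (L : List I) (c : I) (he : EndsAt e L c) : N (insA e L c w) = cn (lbl c c (C.h x)) (insA e L c w)
      + ((-1 : ℂ) ^ L.length) • (insA e L c (N w) - insA e L c (cn (C.h x) w))
      + inner (fun L => insA e L c w) L := by
  induction L generalizing c with
  | nil =>
    rw [insA_nil, insA_nil, insA_nil, h _ _ he, ins_cn]
    simp only [insFirst, inner, List.length_nil, pow_zero, eps_zero, insA_nil, LinearMap.zero_apply]
    module
  | cons d L ih =>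
    have ih := ih d he
    have h1 := h (d :: L) c he
    rw [insA_cons, insA_cons, insA_cons, map_sub, h1, N_cn, ih, ins_cn, eps_of_even (C.gr_h x)]
    cases L with
    | nil =>
      simp only [insA_cons e [] c d w, insA_nil, insFirst, inner, gr_lbl, C.gr_one, d_lbl, C.d_one, map_zero, h_lbl,
        List.length_nil, List.length_cons, map_add, map_sub, map_smul, LinearMap.comp_apply,
        LinearMap.smul_apply, LinearMap.zero_apply]
      module
    | cons d' L =>
      -- Dropping a member of the list, split according to whether the identity leading out of `c`
      -- stands in front of the word; the extra summand comes from dropping `d`, after which this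
      -- identity leads to `d'`.
      have e1 : inner (fun L => insA e L c w) (d :: d' :: L) = inner (fun L => ins e L c w) (d :: d' :: L)
        + cn (lbl c d' (C.one x)) (insA e L d' w)
          + cn (lbl c d (C.one x)) (inner (fun L => insA e L d w) (d' :: L)) := by
        simp only [inner, insA_cons, inner_sub, map_inner]
        abel
      rw [e1]
      simp only [insA_cons e (d' :: L) c d w, insA_cons e L d d' w, insFirst, gr_lbl, C.gr_one, d_lbl, C.d_one, map_zero, h_lbl, lm_cn, comp_lbl,
        C.one_comp, List.length_cons, map_add, map_sub, map_smul, LinearMap.comp_apply,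
        LinearMap.smul_apply, LinearMap.zero_apply]
      rcases neg_one_pow_eq_or ℂ L.length with hs | hs <;> simp only [pow_succ, hs] <;> module

/-- An identity directly before a letter and one directly after it have the same product with that
letter, with opposite signs, so these terms cancel for all letters but the first. For the first
letter only the right-hand product exists, and it yields `insFirst`. Two adjacent identities merge
to one that omits the copy between them, which is `inner`. All other terms are insertions into terms
of `N w`. The hypothesis on `e` makes the labels of the last letter consistent. -/
theorem N_ins (w : Words C x z) (he : EndsAt e L c) : N (ins e L c w) =
    ((-1 : ℂ) ^ L.length) • ins e L c (N w) + insFirst e L c w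
      + inner (fun L => ins e L c w) L := by
  revert L c
  refine ind (p := fun x w => ∀ L c, EndsAt e L c → N (ins e L c w) =
    ((-1 : ℂ) ^ L.length) • ins e L c (N w) + insFirst e L c w
      + inner (fun L => ins e L c w) L) ?_ ?_ ?_ ?_ x w
  · intro x L c he
    simp only [map_zero, smul_zero, zero_add]
    exact (map_inner (0 : Words (blow I C) (bo c x) (bo e z) →ₗ[ℂ] _) (fun L => 0) L)
  · intro x v w hv hw L c he
    have : inner (fun L => ins e L c (v + w)) L = inner (fun L => ins e L c v) L
        + inner (fun L => ins e L c w) L := by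
      rw [← inner_add]; simp only [map_add]
    rw [map_add, map_add, map_add, hv L c he, hw L c he, map_add, map_add, this]
    module
  · intro x a L c he
    cases L with
    | nil =>
      obtain rfl : c = e := he
      simp only [N_sg, ins_sg_nil, ins_cn, insA_nil, map_add, d_lbl, gr_lbl, h_lbl, inner, insFirst,
        List.length_nil, eps_zero, LinearMap.zero_apply]
      module
    | cons d L =>
      have e1 : inner (fun L => ins e L c (sg a)) (d :: L) =
          cn (lbl c c (eps L.length a)) (inner (insTail (z := z) e c) (d :: L)) := by
        rw [map_inner]
        refine inner_congr fun L' h hl => ?_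
        obtain ⟨d', L', rfl⟩ := List.exists_cons_of_ne_nil h
        have hl : L'.length + 1 = L.length := by simpa using hl
        rw [ins_sg_cons, insTail, hl]
      rw [e1, N_sg, map_add, ins_sg_cons, ins_sg_cons, ins_cn, N_cn, N_insEnd e L c d he, gr_lbl,
        gr_eps_succ, ← gr_eps, List.length_cons, gr_eps_succ, d_lbl, d_eps, h_lbl]
      cases L with
      | nil =>
        simp only [insFirst, LinearMap.comp_apply, ins_sg_nil, lm_sg, comp_lbl, C.one_comp, insEnd,
          map_neg, map_add, map_smul, LinearMap.neg_apply, LinearMap.smul_apply, List.length_nil,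
          eps_zero, C.comp_one]
        module
      | cons d' L =>
        simp only [insFirst, LinearMap.comp_apply, ins_sg_cons, lm_cn, comp_lbl, C.one_comp, insEnd,
          map_neg, map_add, map_smul, LinearMap.neg_apply, LinearMap.smul_apply, List.length_cons,
          C.comp_one]
        module
  · intro x y a w hw L c he
    have hA := N_insA e w hw L c he
    cases L with
    | nil =>
      rw [N_cn, map_add, map_sub, map_add, ins_cn, ins_cn, ins_cn, ins_cn, ins_lm, N_cn, hA]
      simp only [insFirst, inner, insA_nil, List.length_nil, eps_zero, d_lbl, gr_lbl, h_lbl, map_add,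
        map_sub, map_smul, map_zero, LinearMap.zero_apply]
      module
    | cons d L =>
      have e1 : inner (fun L => ins e L c (cn a w)) (d :: L) =
          cn (lbl c c (eps L.length a)) (inner (fun L => insA e L c w) (d :: L)) := by
        rw [map_inner]
        refine inner_congr fun L' h hl => ?_
        have hl : L'.length = L.length := by simpa using hl
        rw [ins_cn, hl]
      rw [e1, N_cn, map_add, map_sub, map_add, ins_cn, ins_cn, ins_cn, ins_cn, ins_lm, N_cn, hA,
        List.length_cons, ← gr_eps, gr_lbl, gr_eps_succ, d_lbl, d_eps, h_lbl, insFirst,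
        LinearMap.comp_apply, ins_cn, lm_cn, comp_lbl, C.one_comp]
      simp only [insA_cons e L c d w, lm_cn, comp_lbl, C.comp_one,
        map_neg, map_add, map_sub, map_smul, LinearMap.neg_apply, LinearMap.smul_apply]
      rcases neg_one_pow_eq_or ℂ L.length with hs | hs <;> simp only [pow_succ, hs] <;> module

end

end Insertion

/-! ### Insertion into cyclic words and its boundary formula. -/

section Insertion
open Word Words
variable {I : Type} {C : CdgCat} (e l : I) {x y z : C.Ob} (c d : I)

theorem insTail_cons {L : List I} (h : L ≠ []) :
    (insTail e c (d :: L) : Words (blow I C) (bo c z) (bo e z)) =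
      -cn (lbl c d (C.one z)) (insTail e d L) := by
  obtain ⟨d', L', rfl⟩ := List.exists_cons_of_ne_nil h
  rfl

theorem ins_sg {L : List I} (h : L ≠ []) (a : C.Hom z x) :
    ins e L c (sg a) = cn (lbl c c (eps L.length a)) (insTail e c L) := by
  obtain ⟨d', L', rfl⟩ := List.exists_cons_of_ne_nil h
  rw [ins_sg_cons]; rfl

theorem insTail_concat {L : List I} (h : L ≠ []) (hl : EndsAt l L c) :
    (insTail e c (L ++ [e]) : Words (blow I C) (bo c z) (bo e z)) =
      -sn (insTail l c L) (lbl l e (C.one z)) := by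
  induction L generalizing c with
  | nil => exact absurd rfl h
  | cons d L ih =>
    cases L with
    | nil =>
      obtain rfl : d = l := hl
      simp only [List.cons_append, List.nil_append, insTail, insEnd, map_neg, LinearMap.neg_apply,
        sn_sg]
    | cons d' L =>
      rw [List.cons_append, insTail_cons e c d (by simp), ih d (by simp) hl,
        insTail_cons l c d (by simp)]
      simp only [map_neg, LinearMap.neg_apply, sn_cn]

theorem ins_concat_sg (L : List I) (hl : EndsAt l L c) (a : C.Hom z x) :
    ins e (L ++ [e]) c (sg a) = ((-1 : ℂ) ^ (L.length + 1)) •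
      sn (T (ins l L c (sg a))) (lbl l e (C.one z)) := by
  cases L with
  | nil =>
    obtain rfl : c = l := hl
    rw [List.nil_append, ins_sg_cons, ins_sg_nil, T_sg, insEnd, gr_lbl]
    simp only [map_neg, LinearMap.neg_apply, sn_sg, List.length_nil, eps_succ, eps_zero]
    module
  | cons d L =>
    rw [ins_sg e c (by simp), ins_sg l c (by simp), insTail_concat e l c (by simp) hl, T_cn, gr_lbl,
      insTail, T_insEnd, List.length_append, List.length_singleton, eps_succ]
    simp only [map_neg, map_smul, LinearMap.neg_apply, LinearMap.smul_apply, sn_cn, List.length_cons]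
    rcases neg_one_pow_eq_or ℂ L.length with hs | hs <;> simp only [pow_succ, hs] <;> module

theorem insA_concat_sg (L : List I) (hl : EndsAt l L c) (b : C.Hom z x) :
    insA e (L ++ [e]) c (sg b) = sn (insTail e c (L ++ [e])) (lbl e e b) +
      ((-1 : ℂ) ^ (L.length + 1)) • sn (T (insA l L c (sg b))) (lbl l e (C.one z)) := by
  induction L generalizing c with
  | nil =>
    obtain rfl : c = l := hl
    have := ins_concat_sg e c c [] rfl b
    rw [List.nil_append] at this
    rw [List.nil_append, insA_cons, this, insA_nil, insA_nil, insTail, insEnd]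
    simp only [ins_sg_nil, map_neg, LinearMap.neg_apply, sn_sg, List.length_nil]
    module
  | cons d L ih =>
    rw [List.cons_append, insA_cons, ih d hl, ← List.cons_append, ins_concat_sg e l c _ hl,
      List.cons_append, insA_cons, insTail_cons e c d (by simp)]
    simp only [map_neg, map_sub, map_add, map_smul, LinearMap.neg_apply, LinearMap.sub_apply, sn_cn,
      T_cn, gr_lbl, C.gr_one, List.length_cons]
    module

theorem ins_nil_sn (v : Words C x y) (b : C.Hom z y) :
    ins e [] e (sn v b) = sn (ins e [] e v) (lbl e e b) := by
  refine ind (p := fun x v => ins e [] e (sn v b) = sn (ins e [] e v) (lbl e e b)) ?_ ?_ ?_ ?_ x v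
  · intros; simp
  · intro x v w hv hw; simp only [map_add, LinearMap.add_apply, hv, hw]
  · intro x a; simp only [sn_sg, ins_cn, insA_nil, ins_sg_nil, List.length_nil, eps_zero]
  · intro x y a w hw; simp only [sn_cn, ins_cn, insA_nil, hw, List.length_nil, eps_zero]

/-- The identity that leads to the last copy `e` stands either before the last letter `b` or at the
very end. In the second case what precedes it is an insertion along the shorter list, ending in `l`.
The cyclic term treats the two cases differently. -/
theorem ins_concat_sn (v : Words C x y) (L : List I) (hl : EndsAt l L c) (b : C.Hom z y) :
    ins e (L ++ [e]) c (sn v b) = sn (ins e (L ++ [e]) c v) (lbl e e b) +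
      ((-1 : ℂ) ^ (L.length + 1)) • sn (T (ins l L c (sn v b))) (lbl l e (C.one z)) := by
  revert L c
  refine ind (p := fun x v => ∀ c L, EndsAt l L c →
    ins e (L ++ [e]) c (sn v b) = sn (ins e (L ++ [e]) c v) (lbl e e b) +
      ((-1 : ℂ) ^ (L.length + 1)) • sn (T (ins l L c (sn v b))) (lbl l e (C.one z))) ?_ ?_ ?_ ?_ x v
  · intros; simp
  · intro x v w hv hw c L hl
    simp only [map_add, LinearMap.add_apply, hv c L hl, hw c L hl, smul_add]; abel
  · intro x a c L hl
    rw [sn_sg, ins_cn, ins_cn, ins_sg e c (by simp), insA_concat_sg e l c L hl, T_cn, sn_cn, gr_lbl,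
      List.length_append, List.length_singleton, eps_succ]
    simp only [map_add, map_neg, map_smul, LinearMap.neg_apply, sn_cn]
  · intro x u a w hw c L hl
    have hA : ∀ L c, EndsAt l L c → insA e (L ++ [e]) c (sn w b) =
        sn (insA e (L ++ [e]) c w) (lbl e e b) +
        ((-1 : ℂ) ^ (L.length + 1)) • sn (T (insA l L c (sn w b))) (lbl l e (C.one z)) := by
      intro L
      induction L with
      | nil =>
        intro c hl
        have := hw c [] hl
        obtain rfl : c = l := hl
        rw [List.nil_append] at this
        simp only [List.nil_append, insA_cons, this, insA_nil, ins_nil_sn, List.length_nil, map_sub,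
          LinearMap.sub_apply, sn_cn, T_sn, gr_lbl]
        module
      | cons d L ih =>
        intro c hl
        rw [List.cons_append, insA_cons, ih d hl, ← List.cons_append, hw c _ hl,
          List.cons_append, insA_cons, insA_cons]
        simp only [map_sub, map_add, map_smul, LinearMap.sub_apply, sn_cn, T_cn, gr_lbl, C.gr_one,
          map_neg, LinearMap.neg_apply, List.length_cons]
        module
    rw [sn_cn, ins_cn, ins_cn, ins_cn, hA L c hl, T_cn, sn_cn, gr_lbl, List.length_append,
      List.length_singleton, eps_succ]
    simp only [map_add, map_neg, map_smul, LinearMap.neg_apply, sn_cn]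

/-- The last element of `c :: L`. -/
def lst : I → List I → I
  | c, [] => c
  | _, d :: L => lst d L

theorem endsAt_lst (L : List I) (c : I) : EndsAt (lst c L) L c := by
  induction L generalizing c with
  | nil => rfl
  | cons d L ih => exact ih d

theorem EndsAt.eq_lst {L : List I} {c : I} (h : EndsAt e L c) : e = lst c L := by
  induction L generalizing c with
  | nil => exact h.symm
  | cons d L ih => exact ih h

/-- The insertion of identities as a map of chains; the first letter is multiplied by the identity from the
first to the last copy. -/
def insCyc (L : List I) (c : I) : Cyc C →ₗ[ℂ] Cyc (blow I C) :=
  cycLift fun x => inc.comp ((lm (lbl (lst c L) c (C.one x))).comp (ins (lst c L) L c))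

/-- The insertion of identities for a list of copies. -/
def insList : List I → (Cyc C →ₗ[ℂ] Cyc (blow I C))
  | [] => 0
  | c :: L => insCyc L c

theorem insList_inc {L : List I} (he : EndsAt e L c) (w : Words C x x) :
    insList (c :: L) (inc w) = inc (lm (lbl e c (C.one x)) (ins e L c w)) := by
  rw [EndsAt.eq_lst e he]
  exact cycLift_inc _ w

/-- The alternating sum over all ways to drop an element of a list. -/
def bd {I M : Type} [AddCommGroup M] : (List I → M) → List I → M
  | _, [] => 0
  | Φ, c :: L => Φ L - bd (fun L => Φ (c :: L)) L

/-- `inner` lacks the term that drops the last member. In the differential of an insertion that term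
comes from the cyclic part. -/
theorem neg_bd {M : Type} [AddCommGroup M] [Module ℂ M] (Φ : List I → M) (L : List I) (e : I) :
    -bd Φ (L ++ [e]) = inner Φ (L ++ [e]) + ((-1 : ℂ) ^ (L.length + 1)) • Φ L := by
  induction L generalizing Φ with
  | nil => simp [bd, inner]
  | cons d L ih =>
    have := ih fun L => Φ (d :: L)
    rw [neg_eq_iff_eq_neg] at this
    rw [List.cons_append, bd, this]
    obtain ⟨d', L', h⟩ := List.exists_cons_of_ne_nil (show L ++ [e] ≠ [] by simp)
    rw [h, inner, List.length_cons]
    module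

theorem inner_congr_endsAt {M : Type} [AddCommGroup M] {Φ Ψ : List I → M} {L : List I}
    (h : ∀ L', L' ≠ [] → EndsAt e L' c → Φ L' = Ψ L') (he : EndsAt e L c) : inner Φ L = inner Ψ L := by
  induction L generalizing Φ Ψ with
  | nil => rfl
  | cons d L ih =>
    cases L with
    | nil => rfl
    | cons d' L =>
      rw [inner, inner, h (d' :: L) (List.cons_ne_nil _ _) he]
      congr 1
      refine ih (fun L' hn hl => h _ (List.cons_ne_nil _ _) ?_) he
      obtain ⟨d'', L', rfl⟩ := List.exists_cons_of_ne_nil hn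
      exact hl

/-- Moving `b` from the end to the front of the word changes the number of identities after it from
none to all of them. The resulting sign is `eps` for the letter, balanced by the signs of `ins_lm`
and `ins_T`. Even and odd `b` are separate because the cyclic sign is. -/
theorem K_insert {L : List I} (he : EndsAt e L c) (v : Words C x y) (b : C.Hom x y) :
    inc (K (lbl e e b) (lm (lbl e c (C.one x)) (ins e L c v))) =
      ((-1 : ℂ) ^ L.length) • insList (c :: L) (inc (K b v)) := by
  have key : ∀ b : C.Hom x y, (C.gr b = b ∨ C.gr b = -b) →
      inc (K (lbl e e b) (lm (lbl e c (C.one x)) (ins e L c v))) =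
      ((-1 : ℂ) ^ L.length) • insList (c :: L) (inc (K b v)) := by
    rintro b (hb | hb)
    · rw [insList_inc e c he, K_even hb, K_even (by rw [gr_lbl, hb]), ins_lm, ins_T, eps_of_even hb,
        T_lm, gr_lbl, C.gr_one, lm_lm, comp_lbl, C.comp_one]
      simp only [map_smul, LinearMap.smul_apply, lm_lm, comp_lbl, C.one_comp, smul_smul]
      rcases neg_one_pow_eq_or ℂ L.length with hs | hs <;> simp [hs]
    · rw [insList_inc e c he, K_odd hb, K_odd (by rw [gr_lbl, hb, map_neg]), map_neg (ins e L c),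
        ins_lm, eps_of_odd hb, lm_lm, comp_lbl, C.comp_one]
      simp only [map_smul, map_neg, lm_lm, comp_lbl, C.one_comp, smul_neg, smul_smul]
      rcases neg_one_pow_eq_or ℂ L.length with hs | hs <;> simp [hs]
  obtain ⟨b₁, b₂, h₁, h₂, rfl⟩ : ∃ b₁ b₂ : C.Hom x y, C.gr b₁ = b₁ ∧ C.gr b₂ = -b₂ ∧ b = b₁ + b₂ := by
    refine ⟨(2⁻¹ : ℂ) • (b + C.gr b), (2⁻¹ : ℂ) • (b - C.gr b), ?_, ?_, ?_⟩
    · rw [map_smul, map_add, C.gr_gr, add_comm]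
    · rw [map_smul, map_sub, C.gr_gr, ← smul_neg, neg_sub]
    · rw [← smul_add, add_add_sub_cancel, ← two_smul ℂ b, smul_smul,
        inv_mul_cancel₀ two_ne_zero, one_smul]
  rw [map_add (lbl e e), K_add, K_add, map_add inc, map_add inc, map_add (insList _),
    key b₁ (Or.inl h₁), key b₂ (Or.inr h₂), smul_add]

theorem cyc_ins_nil (w : Words C x x) :
    cyc (lm (lbl e e (C.one x)) (ins e [] e w)) = insList [e] (cyc w) := by
  refine ind_sn (p := fun w => cyc (lm (lbl e e (C.one x)) (ins e [] e w)) = insList [e] (cyc w))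
    ?_ ?_ ?_ ?_ w
  · simp
  · intro v w hv hw; simp only [map_add, hv, hw]
  · intro a; rw [ins_sg_nil, lm_sg, cyc_sg, cyc_sg, map_zero]
  · intro y v b
    rw [ins_nil_sn, lm_sn, cyc_sn, cyc_sn, K_insert (L := []) e e rfl]
    simp

/-- If the last letter is an original one, the cyclic term produces an insertion into `cyc w`. If it
is the identity from `l` to `e`, it is multiplied into the first letter, and the copy `e` disappears
from the list. -/
theorem cyc_ins_concat (L : List I) (hl : EndsAt l L c) (he : EndsAt e (L ++ [e]) c)
    (w : Words C x x) :
    cyc (lm (lbl e c (C.one x)) (ins e (L ++ [e]) c w)) = ((-1 : ℂ) ^ (L.length + 1)) •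
      (insList (c :: (L ++ [e])) (cyc w) + insList (c :: L) (inc w)) := by
  have key : ∀ u : Words (blow I C) (bo c x) (bo l x),
      cyc (lm (lbl e c (C.one x)) (sn (T u) (lbl l e (C.one x)))) =
        inc (lm (lbl l c (C.one x)) u) := by
    intro u
    rw [lm_sn, cyc_sn, K_even (by rw [gr_lbl, C.gr_one]), T_lm, gr_lbl, C.gr_one, lm_lm, comp_lbl,
      C.one_comp, T_T]
  refine ind_sn (p := fun w => cyc (lm (lbl e c (C.one x)) (ins e (L ++ [e]) c w)) =
    ((-1 : ℂ) ^ (L.length + 1)) •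
      (insList (c :: (L ++ [e])) (cyc w) + insList (c :: L) (inc w))) ?_ ?_ ?_ ?_ w
  · simp
  · intro v w hv hw; simp only [map_add, hv, hw]; module
  · intro a
    rw [ins_concat_sg e l c L hl, map_smul, map_smul, key, cyc_sg, map_zero, zero_add,
      insList_inc l c hl]
  · intro y v b
    rw [ins_concat_sn e l c v L hl, map_add, map_smul, map_add, map_smul, key, lm_sn, cyc_sn,
      K_insert e c he, cyc_sn, insList_inc l c hl, List.length_append, List.length_singleton]
    module

theorem N_lm_one (b : I) (u : Words (blow I C) (bo c x) (bo e z)) :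
    N (lm (lbl b c (C.one x)) u) = lm (lbl b c (C.one x)) (N u) := by
  rw [N_lm, d_lbl, C.d_one, gr_lbl, C.gr_one]
  simp

/-- The three boundary contributions are assembled: the first member is dropped by `insFirst`, the
inner ones by `inner`, the last one by the cyclic term. Together they are the full alternating sum
`bd`. -/
theorem Dt_insList (L : List I) (u : Cyc C) : Dt (insList (c :: L) u) =
    ((-1 : ℂ) ^ L.length) • insList (c :: L) (Dt u) + bd (fun M => insList M u) (c :: L) := by
  have h : Dt.comp (insList (c :: L)) = ((-1 : ℂ) ^ L.length) • (insList (c :: L)).comp Dt +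
      bd (fun M => insList (C := C) M) (c :: L) := by
    refine cyc_ext fun x w => ?_
    have hbd : ∀ (M : List I) (F : List I → (Cyc C →ₗ[ℂ] Cyc (blow I C))),
        bd F M (inc w) = bd (fun M => F M (inc w)) M := by
      intro M
      induction M with
      | nil => intro F; rfl
      | cons c M ih => intro F; rw [bd, bd, LinearMap.sub_apply, ih]
    simp only [LinearMap.comp_apply, LinearMap.add_apply, LinearMap.smul_apply, hbd, Dt_inc, map_add]
    rcases List.eq_nil_or_concat' L with rfl | ⟨L, e, rfl⟩
    · rw [insList_inc (L := []) c c rfl, insList_inc (L := []) c c rfl, Dt_inc, N_lm_one, N_ins c [] c w rfl, cyc_ins_nil]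
      simp [insFirst, inner, bd, insList]
    · have hl := endsAt_lst L c
      set l := lst c L
      have he : EndsAt e (L ++ [e]) c := by
        clear hl hbd
        generalize l = l'
        induction L generalizing c with
        | nil => rfl
        | cons d L ih => exact ih d
      have h1 : inc (lm (lbl e c (C.one x)) (insFirst e (L ++ [e]) c w)) =
          insList (L ++ [e]) (inc w) := by
        obtain ⟨d, L', h⟩ := List.exists_cons_of_ne_nil (show L ++ [e] ≠ [] by simp)
        rw [h] at he ⊢
        rw [insList_inc e d he, insFirst, LinearMap.comp_apply, lm_lm, comp_lbl, C.one_comp]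
      have h2 : inc (lm (lbl e c (C.one x)) (inner (fun L => ins e L c w) (L ++ [e]))) =
          inner (fun M => insList (c :: M) (inc w)) (L ++ [e]) := by
        rw [map_inner, map_inner]
        exact inner_congr_endsAt e c (fun L' _ h => (insList_inc e c h w).symm) he
      rw [insList_inc e c he, insList_inc e c he, Dt_inc, N_lm_one, N_ins e _ c w he,
        cyc_ins_concat e l c L hl he, bd, sub_eq_add_neg, neg_bd]
      simp only [map_add, map_smul, h1, h2, List.length_append, List.length_singleton]
      module
  have hb : ∀ (M : List I) (F : List I → (Cyc C →ₗ[ℂ] Cyc (blow I C))),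
      bd F M u = bd (fun M => F M u) M := by
    intro M
    induction M with
    | nil => intro F; rfl
    | cons c M ih => intro F; rw [bd, bd, LinearMap.sub_apply, ih]
  have := congr($h u)
  simpa only [LinearMap.comp_apply, LinearMap.add_apply, LinearMap.smul_apply, hb] using this

end Insertion

/-! ### Inserted identities raise the length. -/

section Length
open Word Words
variable {I : Type} {C : CdgCat} (e : I)

theorem insEnd_mem (L : List I) (c d : I) {z : C.Ob} :
    (insEnd e d L c : Words (blow I C) (bo c z) (bo e z)) ∈ lenGE _ _ _ L.length := by
  induction L generalizing c d with
  | nil => exact mem_lenGE_zero _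
  | cons d' L ih => exact Submodule.neg_mem _ (cn_mem _ (ih _ _))

theorem ins_mem (k : ℕ) {x z : C.Ob} (w : Word C.Hom k x z) (L : List I) (c : I) :
    ins e L c (ι k w) ∈ lenGE (blow I C) (bo c x) (bo e z) (k + L.length) := by
  refine wordInd (p := fun k x w => ∀ L c,
    ins e L c (ι k w) ∈ lenGE (blow I C) (bo c x) (bo e z) (k + L.length)) ?_ ?_ ?_ ?_ k x w L c
  · intro k x v w hv hw L c
    rw [map_add, map_add]
    exact Submodule.add_mem _ (hv L c) (hw L c)
  · intro k x L c
    rw [map_zero, map_zero]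
    exact Submodule.zero_mem _
  · intro x a L c
    rw [← sg_eq]
    cases L with
    | nil => exact mem_lenGE_zero _
    | cons d L =>
      rw [ins_sg_cons, List.length_cons, zero_add]
      exact cn_mem _ (insEnd_mem _ _ _ _)
  · intro k x y a w hw L c
    have hA : ∀ L c, insA e L c (ι k w) ∈ lenGE (blow I C) (bo c y) (bo e z) (k + L.length) := by
      intro L
      induction L with
      | nil => intro c; exact hw [] c
      | cons d L ih =>
        intro c
        rw [insA_cons]
        exact Submodule.sub_mem _ (hw _ _) (cn_mem _ (ih d))
    rw [← cn_ι, ins_cn, add_right_comm]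
    exact cn_mem _ (hA L c)

theorem insList_mem (k : ℕ) {x : C.Ob} (w : Word C.Hom k x x) (L : List I) :
    insList L (inc (ι k w)) ∈ cycGE (blow I C) (k + L.length - 1) := by
  cases L with
  | nil => exact Submodule.zero_mem _
  | cons c L =>
    rw [insList_inc (lst c L) c (endsAt_lst L c)]
    exact inc_mem (lm_mem _ (ins_mem _ _ _ _ _))

theorem gr_insList (L : List I) (u : Cyc C) (c : I) :
    DirectSum.lmap (chainGr (blow I C)) (insList (c :: L) u) =
      ((-1 : ℂ) ^ L.length) • insList (c :: L) (DirectSum.lmap (chainGr C) u) := by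
  have : (DirectSum.lmap (chainGr (blow I C))).comp (insList (c :: L)) =
      ((-1 : ℂ) ^ L.length) • (insList (c :: L)).comp (DirectSum.lmap (chainGr C)) := by
    refine cyc_ext fun x w => ?_
    have he := endsAt_lst L c
    simp only [LinearMap.comp_apply, LinearMap.smul_apply]
    rw [insList_inc _ c he, lmap_chainGr_inc, lmap_chainGr_inc, map_neg, insList_inc _ c he, T_lm,
      gr_lbl, C.gr_one, ins_T, map_smul, map_smul, smul_neg, smul_smul, ← mul_pow]
    simp
  exact congr($this u)

end Length

/-! ### The supertrace of words of matrices. -/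

/-- A family of matrices whose entries are morphisms of `B`, for the morphisms of `G`, compatible with
composition, gradings and curvatures; the differentials vanish. The rows and columns carry signs. -/
structure MatRep (G B : CdgCat) where
  I : G.Ob → Type
  fin : ∀ x, Fintype (I x)
  ob : ∀ {x : G.Ob}, I x → B.Ob
  s : ∀ {x : G.Ob}, I x → ℂ
  s_eq : ∀ {x : G.Ob} (i : I x), s i = 1 ∨ s i = -1
  e : ∀ {x y : G.Ob} (i : I y) (j : I x), G.Hom x y →ₗ[ℂ] B.Hom (ob j) (ob i)
  e_comp : ∀ {x y z : G.Ob} (i : I z) (k : I x) (a : G.Hom y z) (b : G.Hom x y),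
    e i k (G.comp a b) = ∑ j, B.comp (e i j a) (e j k b)
  gr_e : ∀ {x y : G.Ob} (i : I y) (j : I x) (a : G.Hom x y), B.gr (e i j a) = (s i * s j) • e i j (G.gr a)
  d_eq : ∀ {x y : G.Ob} (a : G.Hom x y), G.d a = 0
  d_e : ∀ {x y : G.Ob} (i : I y) (j : I x) (a : G.Hom x y), B.d (e i j a) = 0
  e_h_ne : ∀ {x : G.Ob} (i j : I x), i ≠ j → e i j (G.h x) = 0
  e_h : ∀ {x : G.Ob} (i : I x), e i i (G.h x) = B.h (ob i)

attribute [instance] MatRep.fin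

namespace MatRep
open Word Words
variable {G B : CdgCat} (R : MatRep G B)

theorem s_mul_s {x : G.Ob} (i : R.I x) : R.s i * R.s i = 1 := by
  rcases R.s_eq i with h | h <;> simp [h]

/-- The entry `(i, j)` of a word of matrices. -/
def strW : ∀ (k : ℕ) {x z : G.Ob} (i : R.I x) (j : R.I z),
    Word G.Hom k x z →ₗ[ℂ] Words B (R.ob i) (R.ob j)
  | 0, _, _, i, j => Words.sg.comp (R.e i j)
  | k + 1, _, _, i, j => Word.lift fun y => ∑ l : R.I y, R.s l • cn.compl₁₂ (R.e i l) (strW k l j)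

/-- The entry `(i, j)` of a sum of words of matrices. -/
def str {x z : G.Ob} (i : R.I x) (j : R.I z) : Words G x z →ₗ[ℂ] Words B (R.ob i) (R.ob j) :=
  DirectSum.toModule ℂ ℕ _ fun k => R.strW k i j

section
variable {x y z : G.Ob}

theorem str_ι (i : R.I x) (j : R.I z) (k : ℕ) (w : Word G.Hom k x z) :
    R.str i j (ι k w) = R.strW k i j w := by
  simp [str, ι]

theorem str_sg (i : R.I x) (j : R.I z) (a : G.Hom z x) : R.str i j (sg a) = sg (R.e i j a) := by
  rw [sg_eq, str_ι]; rfl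

theorem str_cn (i : R.I x) (j : R.I z) (a : G.Hom y x) (w : Words G y z) :
    R.str i j (cn a w) = ∑ l, R.s l • cn (R.e i l a) (R.str l j w) := by
  induction w using ind_ι with
  | zero => simp
  | add v w hv hw => simp only [map_add, hv, hw, smul_add, Finset.sum_add_distrib]
  | h k w =>
    rw [cn_ι, str_ι, strW, lift_cons]
    simp [LinearMap.sum_apply, str_ι]

theorem str_lm (i : R.I x) (j : R.I z) (b : G.Hom y x) (w : Words G y z) :
    R.str i j (lm b w) = ∑ l, lm (R.e i l b) (R.str l j w) := by
  revert x b i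
  refine ind (p := fun y w => ∀ {x} (i : R.I x) (b : G.Hom y x),
    R.str i j (lm b w) = ∑ l, lm (R.e i l b) (R.str l j w)) ?_ ?_ ?_ ?_ y w
  · intros; simp
  · intro y v w hv hw x i b; simp only [map_add, hv, hw, Finset.sum_add_distrib]
  · intro y a x i b; simp only [lm_sg, str_sg, R.e_comp, map_sum]
  · intro y u a w hw x i b
    simp only [lm_cn, str_cn, R.e_comp, map_sum, LinearMap.sum_apply, map_smul, Finset.smul_sum]
    rw [Finset.sum_comm]

theorem str_sn (i : R.I x) (j : R.I z) (v : Words G x y) (b : G.Hom z y) :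
    R.str i j (sn v b) = ∑ l, R.s l • sn (R.str i l v) (R.e l j b) := by
  revert i
  refine ind (p := fun x v => ∀ i : R.I x,
    R.str i j (sn v b) = ∑ l, R.s l • sn (R.str i l v) (R.e l j b)) ?_ ?_ ?_ ?_ x v
  · intros; simp
  · intro y v w hv hw i
    simp only [map_add, LinearMap.add_apply, hv, hw, smul_add, Finset.sum_add_distrib]
  · intro y a i; simp only [sn_sg, str_cn, str_sg]
  · intro y u a w hw i
    simp only [sn_cn, str_cn, hw, map_sum, LinearMap.sum_apply, map_smul, Finset.smul_sum,
      LinearMap.smul_apply]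
    rw [Finset.sum_comm]
    refine Finset.sum_congr rfl fun _ _ => Finset.sum_congr rfl fun _ _ => ?_
    rw [smul_comm]

theorem T_str (i : R.I x) (j : R.I z) (w : Words G x z) :
    T (R.str i j w) = (R.s i * R.s j) • R.str i j (T w) := by
  revert i
  refine ind (p := fun x w => ∀ i : R.I x,
    T (R.str i j w) = (R.s i * R.s j) • R.str i j (T w)) ?_ ?_ ?_ ?_ x w
  · intros; simp
  · intro y v w hv hw i; simp only [map_add, hv, hw, smul_add]
  · intro y a i; simp only [T_sg, str_sg, R.gr_e, map_neg, map_smul, smul_neg]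
  · intro y u a w hw i
    simp only [T_cn, str_cn, hw, map_sum, map_smul, map_neg, smul_neg, Finset.smul_sum, R.gr_e,
      LinearMap.smul_apply, ← Finset.sum_neg_distrib, smul_smul]
    refine Finset.sum_congr rfl fun l _ => ?_
    rw [show R.s l * (R.s l * R.s j * (R.s i * R.s l)) = R.s l * R.s l * (R.s i * R.s j * R.s l) by ring,
      s_mul_s, one_mul]

theorem str_cn_h (i : R.I x) (j : R.I z) (a : G.Hom y x) (w : Words G y z) :
    R.str i j (cn a (cn (G.h y) w)) = ∑ l, cn (R.e i l a) (cn (B.h (R.ob l)) (R.str l j w)) := by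
  simp only [str_cn]
  refine Finset.sum_congr rfl fun l _ => ?_
  rw [Finset.sum_eq_single l (fun m _ h => by rw [R.e_h_ne l m h.symm]; simp) (by simp), R.e_h]
  rw [map_smul, smul_smul, s_mul_s, one_smul]

/-- In a product of adjacent letters the sign of the contracted index `l` occurs once in `str_cn`
and once in `gr_e`, so it cancels and only `s i` remains. The differentials vanish, and the
curvature matrix is diagonal with entries the curvature of `B`. -/
theorem N_str (i : R.I x) (j : R.I z) (w : Words G x z) :
    N (R.str i j w) = R.s i • R.str i j (N w) := by
  revert i
  refine ind (p := fun x w => ∀ i : R.I x, N (R.str i j w) = R.s i • R.str i j (N w)) ?_ ?_ ?_ ?_ x w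
  · intros; simp
  · intro y v w hv hw i; simp only [map_add, hv, hw, smul_add]
  · intro y a i
    simp only [N_sg, str_sg, R.gr_e, R.d_e, R.d_eq, map_zero, zero_add, str_cn]
    rw [Finset.sum_eq_single j (fun m _ h => by rw [R.e_h_ne m j h]; simp) (by simp), R.e_h]
    simp only [map_smul, LinearMap.smul_apply, smul_smul]
  · intro y u a w hw i
    simp only [N_cn, R.d_eq, map_add, map_sub, map_zero, LinearMap.zero_apply, zero_add, str_cn_h,
      str_lm]
    rw [str_cn, str_cn, map_sum, smul_add, smul_sub, Finset.smul_sum, Finset.smul_sum, Finset.smul_sum,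
      ← Finset.sum_sub_distrib, ← Finset.sum_add_distrib]
    refine Finset.sum_congr rfl fun l _ => ?_
    simp only [map_smul, N_cn, R.d_e, map_zero, LinearMap.zero_apply, zero_add, hw, R.gr_e,
      LinearMap.smul_apply]
    rcases R.s_eq i with h | h <;> rcases R.s_eq l with h' | h' <;> simp only [h, h'] <;> module

theorem str_mem (i : R.I x) (j : R.I z) (k : ℕ) (w : Word G.Hom k x z) :
    R.str i j (ι k w) ∈ lenGE B (R.ob i) (R.ob j) k := by
  revert i
  refine wordInd (p := fun k x w => ∀ i : R.I x,
    R.str i j (ι k w) ∈ lenGE B (R.ob i) (R.ob j) k) ?_ ?_ ?_ ?_ k x w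
  · intro k x v w hv hw i; rw [map_add, map_add]; exact Submodule.add_mem _ (hv i) (hw i)
  · intro k x i; rw [map_zero, map_zero]; exact Submodule.zero_mem _
  · intro x a i; exact mem_lenGE_zero _
  · intro k x y a w hw i
    rw [← cn_ι, str_cn]
    exact Submodule.sum_mem _ fun l _ => Submodule.smul_mem _ _ (cn_mem _ (hw l))

end

/-- `T` for the sign `-1`, the identity for the sign `1`. -/
def tau {x z : B.Ob} (s : ℂ) : Words B x z →ₗ[ℂ] Words B x z :=
  ((1 + s) / 2) • LinearMap.id + ((1 - s) / 2) • T

theorem tau_one {x z : B.Ob} (w : Words B x z) : tau 1 w = w := by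
  simp [tau]

theorem tau_neg_one {x z : B.Ob} (w : Words B x z) : tau (-1) w = T w := by
  simp [tau]

/-- The supertrace. -/
def Str : Cyc G →ₗ[ℂ] Cyc B := cycLift fun _ => ∑ i, inc.comp ((tau (R.s i)).comp (R.str i i))

theorem Str_inc {x : G.Ob} (w : Words G x x) :
    R.Str (inc w) = ∑ i, inc (tau (R.s i) (R.str i i w)) := by
  rw [Str, cycLift_inc, LinearMap.sum_apply]; rfl

/-- Cyclic invariance of the supertrace. Moving the last letter to the front turns the contracted
index into the outer one and conversely. The parity of an entry of `b` depends on the signs of its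
row and column, so the cyclic signs are compared in each case. -/
theorem Str_cyc_sn {x y : G.Ob} (v : Words G x y) (b : G.Hom x y) :
    R.Str (cyc (sn v b)) = ∑ i, cyc (tau (R.s i) (R.str i i (sn v b))) := by
  have key : ∀ b : G.Hom x y, (G.gr b = b ∨ G.gr b = -b) →
      R.Str (cyc (sn v b)) = ∑ i, cyc (tau (R.s i) (R.str i i (sn v b))) := by
    intro b hb
    simp only [cyc_sn, Str_inc, str_sn, map_sum, map_smul]
    rw [Finset.sum_comm]
    refine Finset.sum_congr rfl fun l _ => ?_
    rcases hb with hb | hb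
    · have hK : R.str l l (K b v) =
          ∑ i, (R.s l * R.s i) • lm (R.e l i b) (T (R.str i l v)) := by
        rw [K_even hb, str_lm]
        refine Finset.sum_congr rfl fun i _ => ?_
        rw [R.T_str, map_smul, smul_smul,
          show R.s l * R.s i * (R.s i * R.s l) = R.s i * R.s i * (R.s l * R.s l) by ring, s_mul_s,
          s_mul_s, one_mul, one_smul]
      rw [hK, map_sum, map_sum]
      refine Finset.sum_congr rfl fun i _ => ?_
      have hg := R.gr_e l i b
      rw [hb] at hg
      rcases R.s_eq i with hi | hi <;> rcases R.s_eq l with hl | hl <;> rw [hi, hl] at hg <;>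
        simp only [hi, hl, tau_one, tau_neg_one, T_sn, cyc_sn, map_neg, map_smul] <;> norm_num at hg
      · rw [K_even hg]; simp
      · rw [K_odd hg]; simp [T_lm, T_T, hg]
      · rw [K_odd (by rw [hg]; simp [hg])]; simp [hg]; module
      · rw [K_even (by rw [hg, hg])]; simp [hg, T_lm, T_T]
    · have hK : R.str l l (K b v) = ∑ i, -lm (R.e l i b) (R.str i l v) := by
        rw [K_odd hb, map_neg, str_lm, Finset.sum_neg_distrib]
      rw [hK, map_sum, map_sum]
      refine Finset.sum_congr rfl fun i _ => ?_
      have hg := R.gr_e l i b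
      rw [hb] at hg
      rcases R.s_eq i with hi | hi <;> rcases R.s_eq l with hl | hl <;> rw [hi, hl] at hg <;>
        simp only [hi, hl, tau_one, tau_neg_one, T_sn, cyc_sn, map_neg] <;> norm_num at hg
      · rw [K_odd hg]; simp
      · rw [K_even hg]; simp [T_lm, hg]; module
      · rw [K_even (by rw [hg, hg])]; simp [hg, T_T]
      · rw [K_odd (by rw [hg]; simp [hg])]; simp [hg, T_lm]
  obtain ⟨b₁, b₂, h₁, h₂, rfl⟩ : ∃ b₁ b₂ : G.Hom x y, G.gr b₁ = b₁ ∧ G.gr b₂ = -b₂ ∧ b = b₁ + b₂ := by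
    refine ⟨(2⁻¹ : ℂ) • (b + G.gr b), (2⁻¹ : ℂ) • (b - G.gr b), ?_, ?_, ?_⟩
    · rw [map_smul, map_add, G.gr_gr, add_comm]
    · rw [map_smul, map_sub, G.gr_gr, ← smul_neg, neg_sub]
    · rw [← smul_add, add_add_sub_cancel, ← two_smul ℂ b, smul_smul,
        inv_mul_cancel₀ two_ne_zero, one_smul]
  simp only [map_add, Finset.sum_add_distrib]
  rw [key b₁ (Or.inl h₁), key b₂ (Or.inr h₂)]

theorem Str_cyc {x : G.Ob} (w : Words G x x) :
    R.Str (cyc w) = ∑ i, cyc (tau (R.s i) (R.str i i w)) := by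
  refine ind_sn (p := fun w => R.Str (cyc w) = ∑ i, cyc (tau (R.s i) (R.str i i w))) ?_ ?_ ?_ ?_ w
  · simp
  · intro v w hv hw; simp only [map_add, hv, hw, Finset.sum_add_distrib]
  · intro a
    rw [cyc_sg, map_zero]
    refine (Finset.sum_eq_zero fun i _ => ?_).symm
    rcases R.s_eq i with h | h <;> simp [h, tau_one, tau_neg_one, str_sg, T_sg, cyc_sg]
  · intro y v b; exact R.Str_cyc_sn v b

/-- The sign `s i` in `N_str` is absorbed by `tau`, because `T` anticommutes with `N`. -/
theorem Dt_Str (u : Cyc G) : Dt (R.Str u) = R.Str (Dt u) := by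
  have : Dt.comp R.Str = R.Str.comp Dt := by
    refine cyc_ext fun x w => ?_
    simp only [LinearMap.comp_apply, Dt_inc, Str_inc, map_add, map_sum, Str_cyc,
      Finset.sum_add_distrib]
    congr 1
    refine Finset.sum_congr rfl fun i _ => ?_
    have := R.N_str i i w
    rcases R.s_eq i with h | h <;> rw [h] at this <;>
      simp only [h, tau_one, tau_neg_one, N_T, this] <;> simp
  exact congr($this u)

theorem gr_Str (u : Cyc G) :
    DirectSum.lmap (chainGr B) (R.Str u) = R.Str (DirectSum.lmap (chainGr G) u) := by
  have : (DirectSum.lmap (chainGr B)).comp R.Str = R.Str.comp (DirectSum.lmap (chainGr G)) := by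
    refine cyc_ext fun x w => ?_
    simp only [LinearMap.comp_apply, lmap_chainGr_inc, Str_inc, map_neg, map_sum,
      Finset.sum_neg_distrib]
    congr 1
    refine Finset.sum_congr rfl fun i _ => ?_
    have := R.T_str i i w
    rw [s_mul_s, one_smul] at this
    rcases R.s_eq i with h | h <;> simp only [h, tau_one, tau_neg_one, this]
  exact congr($this u)

theorem Str_mem (k : ℕ) {x : G.Ob} (w : Word G.Hom k x x) : R.Str (inc (ι k w)) ∈ cycGE B k := by
  rw [Str_inc]
  refine Submodule.sum_mem _ fun i _ => inc_mem ?_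
  rcases R.s_eq i with h | h
  · rw [h, tau_one]; exact R.str_mem _ _ _ _
  · rw [h, tau_neg_one]; exact T_mem (R.str_mem _ _ _ _)

end MatRep

/-! ### Functoriality of the insertions. -/

section BlowMap
open Word Words
variable {I I' : Type} {C C' : CdgCat}

/-- The functoriality of the category of copies. -/
def blowMap (ρ : I → I') (F : C ⟶ C') : blow I C ⟶ blow I' C' where
  obj p := (ρ p.1, F.obj p.2)
  map := F.map
  map_one p := F.map_one p.2
  map_comp := F.map_comp
  map_gr := F.map_gr
  map_d := F.map_d
  map_h p := F.map_h p.2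

variable (ρ : I → I') (F : C ⟶ C') (e : I) {x y z : C.Ob}

theorem blowMap_lbl (c d : I) (a : C.Hom y x) :
    (blowMap ρ F).map (lbl c d a) = lbl (ρ c) (ρ d) (F.map a) := rfl

theorem map_eps (q : ℕ) (a : C.Hom x y) : F.map (eps q a) = eps q (F.map a) := by
  induction q with
  | zero => rfl
  | succ q ih => rw [eps_succ, eps_succ, map_neg, F.map_gr, ih]

theorem fW_insEnd (L : List I) (c d : I) :
    fW (blowMap ρ F) (insEnd e d L c : Words (blow I C) (bo c z) (bo e z)) =
      insEnd (z := F.obj z) (ρ e) (ρ d) (L.map ρ) (ρ c) := by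
  induction L generalizing c d with
  | nil => rw [insEnd, map_neg, fW_sg, blowMap_lbl, F.map_one]; rfl
  | cons d' L ih => rw [insEnd, map_neg, fW_cn, blowMap_lbl, F.map_one, ih]; rfl

theorem fW_ins (w : Words C x z) (L : List I) (c : I) :
    fW (blowMap ρ F) (ins e L c w) = ins (ρ e) (L.map ρ) (ρ c) (fW F w) := by
  revert L c
  refine ind (p := fun x w => ∀ L c,
    fW (blowMap ρ F) (ins e L c w) = ins (ρ e) (L.map ρ) (ρ c) (fW F w)) ?_ ?_ ?_ ?_ x w
  · intro x L c; simp only [map_zero]; rfl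
  · intro x v w hv hw L c
    rw [map_add, map_add (fW F), map_add (ins _ _ _), ← hv, ← hw]
    exact map_add (fW (blowMap ρ F)) _ _
  · intro x a L c
    cases L with
    | nil => rw [ins_sg_nil, fW_sg, fW_sg, List.map_nil, ins_sg_nil, blowMap_lbl]; rfl
    | cons d L =>
      rw [ins_sg_cons, fW_cn, fW_sg, List.map_cons, ins_sg_cons, fW_insEnd, blowMap_lbl, map_eps,
        List.length_map]
      rfl
  · intro x y a w hw L c
    have hA : ∀ L c, fW (blowMap ρ F) (insA e L c w) = insA (ρ e) (L.map ρ) (ρ c) (fW F w) := by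
      intro L
      induction L with
      | nil => intro c; exact hw [] c
      | cons d L ih =>
        intro c
        rw [insA_cons, List.map_cons, insA_cons, ← List.map_cons, ← hw, ← ih]
        refine (map_sub (fW (blowMap ρ F)) _ _).trans ?_
        rw [fW_cn, blowMap_lbl, F.map_one]
        rfl
    rw [ins_cn, fW_cn, fW_cn, ins_cn, hA, blowMap_lbl, map_eps, List.length_map]
    rfl

theorem lst_map (L : List I) (c : I) : lst (ρ c) (L.map ρ) = ρ (lst c L) := by
  induction L generalizing c with
  | nil => rfl
  | cons d L ih => exact ih d

theorem chainMap_insList (L : List I) (u : Cyc C) :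
    DirectSum.lmap (chainMap (blowMap ρ F)) (insList L u) =
      insList (L.map ρ) (DirectSum.lmap (chainMap F) u) := by
  cases L with
  | nil => exact map_zero _
  | cons c L =>
    have : (DirectSum.lmap (chainMap (blowMap ρ F))).comp (insList (c :: L)) =
        (insList (ρ c :: L.map ρ)).comp (DirectSum.lmap (chainMap F)) := by
      refine cyc_ext fun x w => ?_
      have he := endsAt_lst L c
      have he' := endsAt_lst (L.map ρ) (ρ c)
      rw [lst_map] at he'
      simp only [LinearMap.comp_apply]
      rw [insList_inc _ c he, chainMap_inc, chainMap_inc, insList_inc _ _ he', fW_lm, fW_ins,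
        blowMap_lbl, F.map_one]
      rfl
    exact congr($this u)

end BlowMap

/-! ### Matrices and functors on either side. -/

namespace MatRep
open Word Words
variable {G G' B B' : CdgCat}

/-- Apply a functor to the entries of the matrices. -/
def post (R : MatRep G B) (H : B ⟶ B') : MatRep G B' where
  I := R.I
  fin := R.fin
  ob i := H.obj (R.ob i)
  s := R.s
  s_eq := R.s_eq
  e i j := H.map.comp (R.e i j)
  e_comp i k a b := by simp [R.e_comp, H.map_comp]
  gr_e i j a := by simp [R.gr_e, ← H.map_gr]
  d_eq := R.d_eq
  d_e i j a := by simp [← H.map_d, R.d_e]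
  e_h_ne i j h := by simp [R.e_h_ne i j h]
  e_h i := by simp [R.e_h, H.map_h]

/-- The matrices of the images under a functor. -/
def pre (R : MatRep G' B) (F : G ⟶ G') (hd : ∀ {x y : G.Ob} (a : G.Hom x y), G.d a = 0) :
    MatRep G B where
  I x := R.I (F.obj x)
  fin x := R.fin (F.obj x)
  ob i := R.ob i
  s i := R.s i
  s_eq i := R.s_eq i
  e i j := (R.e i j).comp F.map
  e_comp i k a b := by simp [R.e_comp, F.map_comp]
  gr_e i j a := by simp [R.gr_e, F.map_gr]
  d_eq := hd
  d_e i j a := R.d_e _ _ _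
  e_h_ne i j h := by simp [F.map_h, R.e_h_ne i j h]
  e_h i := by simp [R.e_h, F.map_h]

theorem fW_tau {x z : B.Ob} (H : B ⟶ B') (s : ℂ) (w : Words B x z) :
    fW H (tau s w) = tau s (fW H w) := by
  simp [tau, fW_T]

theorem str_post (R : MatRep G B) (H : B ⟶ B') {x z : G.Ob} (i : R.I x) (j : R.I z)
    (w : Words G x z) : (R.post H).str i j w = fW H (R.str i j w) := by
  revert i
  refine ind (p := fun x w => ∀ i : R.I x, (R.post H).str i j w = fW H (R.str i j w)) ?_ ?_ ?_ ?_ x w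
  · intro x i; simp only [map_zero]; exact map_zero ((R.post H).str i j)
  · intro x v w hv hw i
    have e1 : (R.post H).str (x := x) (z := z) i j (v + w) = _ := map_add _ v w
    exact e1.trans ((congrArg₂ (· + ·) (hv i) (hw i)).trans
      ((map_add (fW H) _ _).symm.trans (congrArg (fW H) (map_add (R.str i j) v w).symm)))
  · intro x a i; rw [str_sg, fW_sg]; exact (R.post H).str_sg i j a
  · intro x y a w hw i
    rw [str_cn, map_sum]
    refine ((R.post H).str_cn i j a w).trans (Finset.sum_congr rfl fun l _ => ?_)
    rw [map_smul, fW_cn]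
    congr 2
    exact hw l

theorem Str_post (R : MatRep G B) (H : B ⟶ B') (u : Cyc G) :
    (R.post H).Str u = DirectSum.lmap (chainMap H) (R.Str u) := by
  have : (R.post H).Str = (DirectSum.lmap (chainMap H)).comp R.Str := by
    refine cyc_ext fun x w => ?_
    refine ((R.post H).Str_inc w).trans ?_
    rw [LinearMap.comp_apply, Str_inc, map_sum]
    refine Finset.sum_congr rfl fun i _ => ?_
    rw [chainMap_inc, fW_tau]
    exact congrArg (fun v => inc (tau (R.s _) v)) (R.str_post H i i w)
  exact congr($this u)

theorem str_pre (R : MatRep G' B) (F : G ⟶ G') (hd) {x z : G.Ob} (i : R.I (F.obj x))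
    (j : R.I (F.obj z)) (w : Words G x z) : (R.pre F hd).str i j w = R.str i j (fW F w) := by
  revert i
  refine ind (p := fun x w => ∀ i : R.I (F.obj x),
    (R.pre F hd).str i j w = R.str i j (fW F w)) ?_ ?_ ?_ ?_ x w
  · intro x i; simp only [map_zero]; exact map_zero ((R.pre F hd).str i j)
  · intro x v w hv hw i
    have e1 : (R.pre F hd).str (x := x) (z := z) i j (v + w) = _ := map_add _ v w
    exact e1.trans ((congrArg₂ (· + ·) (hv i) (hw i)).trans
      ((map_add (R.str i j) _ _).symm.trans (congrArg (R.str i j) (map_add (fW F) v w).symm)))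
  · intro x a i; rw [fW_sg, str_sg]; exact (R.pre F hd).str_sg i j a
  · intro x y a w hw i
    rw [fW_cn, str_cn]
    refine ((R.pre F hd).str_cn i j a w).trans (Finset.sum_congr rfl fun l _ => ?_)
    congr 2
    exact hw l

theorem Str_pre (R : MatRep G' B) (F : G ⟶ G') (hd) (u : Cyc G) :
    (R.pre F hd).Str u = R.Str (DirectSum.lmap (chainMap F) u) := by
  have : (R.pre F hd).Str = R.Str.comp (DirectSum.lmap (chainMap F)) := by
    refine cyc_ext fun x w => ?_
    refine ((R.pre F hd).Str_inc w).trans ?_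
    rw [LinearMap.comp_apply, chainMap_inc, Str_inc]
    refine Finset.sum_congr rfl fun i _ => ?_
    exact congrArg (fun v => inc (tau (R.s _) v)) (R.str_pre F hd i i w)
  exact congr($this u)

end MatRep

theorem map_bd {I M M' : Type} [AddCommGroup M] [AddCommGroup M'] [Module ℂ M] [Module ℂ M']
    (f : M →ₗ[ℂ] M') (Φ : List I → M) (L : List I) : f (bd Φ L) = bd (fun L => f (Φ L)) L := by
  induction L generalizing Φ with
  | nil => exact map_zero f
  | cons d L ih => rw [bd, bd, map_sub, ih]

open Words in
theorem Completes.bd {C C' : CdgCat} {I : Type} {F : List I → (HochII C →ₗ[ℂ] HochII C')}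
    {Φ : List I → (Cyc C →ₗ[ℂ] Cyc C')} (h : ∀ L, Completes (F L) (Φ L)) (L : List I) :
    Completes (CechHoch.bd F L) (CechHoch.bd Φ L) := by
  induction L generalizing F Φ with
  | nil => exact Completes.zero
  | cons d L ih =>
    intro K u c hu k hk
    rw [CechHoch.bd, CechHoch.bd, LinearMap.sub_apply, LinearMap.sub_apply, DirectSum.sub_apply,
      h L K u c hu k hk, ih (fun M => h (d :: M)) K u c hu k hk]
    rfl

/-! ### The operators trace-after-insertion on products of chains. -/

namespace MatRep
open Word Words
variable {I I' : Type} {C C' B B' : CdgCat} (R : MatRep (blow I C) B)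

/-- The trace of the insertion of identities for a list of copies, on products of chains. -/
def cut (L : List I) : HochII C →ₗ[ℂ] HochII B := completion (R.Str.comp (insList L))

theorem Str_insList_mem (L : List I) (k : ℕ) {x : C.Ob} (w : Word C.Hom k x x) :
    R.Str (insList L (inc (ι k w))) ∈ cycGE B (k + L.length - 1) :=
  map_mem_of_cycGE R.Str _ (fun _ _ v h => cycGE_anti h (R.Str_mem _ v)) (insList_mem k w L)

theorem completes_cut (L : List I) : Completes (R.cut L) (R.Str.comp (insList L)) := by
  cases L with
  | nil =>
    refine completes_completion fun k x w => ?_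
    rw [LinearMap.comp_apply, insList, LinearMap.zero_apply, map_zero]
    exact Submodule.zero_mem _
  | cons c L =>
    exact completes_completion fun k x w =>
      cycGE_anti (by simp only [List.length_cons]; omega) (R.Str_insList_mem (c :: L) k w)

theorem cut_nil : R.cut [] = 0 :=
  (R.completes_cut []).unique (by
    have : R.Str.comp (insList []) = 0 := LinearMap.ext fun u => map_zero R.Str
    rw [this]; exact Completes.zero)

/-- A list with `m` members inserts `m - 1` letters, so nothing of length below `m - 1` is produced.
-/
theorem cut_apply_eq_zero {L : List I} {K : ℕ} (h : K + 1 < L.length) (c : HochII C) :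
    R.cut L c K = 0 := by
  obtain ⟨u, hu⟩ := exists_agree (K + 1) c
  rw [← R.completes_cut L _ u c hu K (by omega)]
  exact map_mem_of_cycGE (n := 0) (R.Str.comp (insList L)) (cycGE B (K + 1))
    (fun k x w _ => cycGE_anti (by omega) (R.Str_insList_mem L k w))
    (fun _ h => absurd h (Nat.not_lt_zero _)) K (by omega)

theorem hochD_cut (d : I) (L : List I) (c : HochII C) : hochD B (R.cut (d :: L) c) =
    ((-1 : ℂ) ^ L.length) • R.cut (d :: L) (hochD C c) + bd (fun M => R.cut M c) (d :: L) := by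
  have := (R.completes_cut (d :: L)).hochD_eq (s := (-1) ^ L.length)
    (Completes.bd (fun M => R.completes_cut M) (d :: L)) (fun u => ?_) c
  · rw [this]
    congr 1
    exact map_bd (LinearMap.applyₗ c) (fun M => R.cut M) (d :: L)
  · rw [LinearMap.comp_apply, R.Dt_Str, Dt_insList, map_add, map_smul]
    congr 1
    rw [map_bd]
    exact (map_bd (LinearMap.applyₗ u) (fun M => R.Str.comp (insList M)) (d :: L)).symm

theorem gr_cut (d : I) (L : List I) (c : HochII C) : hochGr B (R.cut (d :: L) c) =
    ((-1 : ℂ) ^ L.length) • R.cut (d :: L) (hochGr C c) := by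
  have h1 := Completes.hochGr.comp (R.completes_cut (d :: L))
  have h2 := ((R.completes_cut (d :: L)).comp Completes.hochGr).smul ((-1) ^ L.length)
  have e : (DirectSum.lmap (chainGr B)).comp (R.Str.comp (insList (d :: L))) =
      ((-1 : ℂ) ^ L.length) • (R.Str.comp (insList (d :: L))).comp (DirectSum.lmap (chainGr C)) := by
    refine LinearMap.ext fun u => ?_
    simp only [LinearMap.comp_apply, LinearMap.smul_apply]
    rw [R.gr_Str, gr_insList, map_smul]
  rw [e] at h1
  exact congr($(h1.unique h2) c)

/-- The hypothesis says that the entries of the image of a morphism are the images of its entries.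
It is applied to restrictions to smaller open sets and to the Yoneda functor. -/
theorem cut_natural {R : MatRep (blow I C) B} {R' : MatRep (blow I' C') B'} {ρ : I → I'} {F : C ⟶ C'}
    {H : B ⟶ B'} (h : R.post H = R'.pre (blowMap ρ F) R.d_eq) (L : List I) (c : HochII C) :
    hochMap H (R.cut L c) = R'.cut (L.map ρ) (hochMap F c) := by
  have h1 := (Completes.hochMap H).comp (R.completes_cut L)
  have h2 := (R'.completes_cut (L.map ρ)).comp (Completes.hochMap F)
  have e : (DirectSum.lmap (chainMap H)).comp (R.Str.comp (insList L)) =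
      (R'.Str.comp (insList (L.map ρ))).comp (DirectSum.lmap (chainMap F)) := by
    refine LinearMap.ext fun u => ?_
    simp only [LinearMap.comp_apply]
    rw [← Str_post, h, Str_pre, chainMap_insList]
  rw [e] at h1
  exact congr($(h1.unique h2) c)

end MatRep

/-! ### Removal of the differential: insertion of `δ` into words. -/

/-- The cdg category with the same morphisms as `C`, zero differential and central curvature `η`. -/
def flat (C : CdgCat) (η : ∀ x : C.Ob, C.Hom x x) (hg : ∀ x, C.gr (η x) = η x)
    (hc : ∀ {x y : C.Ob} (a : C.Hom x y), C.comp (η y) a = C.comp a (η x)) : CdgCat :=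
  { C with
    d := 0
    h := η
    d_gr := fun a => by simp
    d_comp := fun a b => by simp
    gr_h := hg
    d_h := fun _ => rfl
    d_d := fun a => by simp [hc a] }

section Shuffle
open Word Words
variable {C : CdgCat} (δ : ∀ x : C.Ob, C.Hom x x) {x y z : C.Ob}

/-- Insertion of elements `η` into words, with the signs of the curvature part of the differential. -/
def insMid (η : ∀ x : C.Ob, C.Hom x x) : ∀ (k : ℕ) {x z : C.Ob},
    Word C.Hom k x z →ₗ[ℂ] Word C.Hom (k + 1) x z
  | 0, _, z => (Word.cons.flip (Word.single (η z))).comp C.gr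
  | k + 1, _, _ => lift fun y => Word.cons.compl₁₂ C.gr (Word.cons (η y) - insMid η k)

/-- Insertion of elements on words of all lengths. -/
def H2 (η : ∀ x : C.Ob, C.Hom x x) : Words C x z →ₗ[ℂ] Words C x z :=
  DirectSum.toModule ℂ ℕ _ fun k => (ι (k + 1)).comp (insMid η k)

/-- The internal differential on words of all lengths. -/
def H1 : Words C x z →ₗ[ℂ] Words C x z :=
  DirectSum.toModule ℂ ℕ _ fun k => (ι k).comp (hochD1 C k)

/-- The differential without the internal differential, with `h` replaced by `h - δ δ`. -/
def H0 : Words C x z →ₗ[ℂ] Words C x z := N - H1 - H2 fun x => C.comp (δ x) (δ x)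

theorem H2_ι (η : ∀ x : C.Ob, C.Hom x x) (k : ℕ) (w : Word C.Hom k x z) :
    H2 η (ι k w) = ι (k + 1) (insMid η k w) := by simp [H2, ι]

theorem H1_ι (k : ℕ) (w : Word C.Hom k x z) : H1 (ι k w) = ι k (hochD1 C k w) := by simp [H1, ι]

theorem H2_sg (η : ∀ x : C.Ob, C.Hom x x) (a : C.Hom z x) :
    H2 η (sg a) = cn (C.gr a) (sg (η z)) := by
  rw [sg_eq, H2_ι, sg_eq, cn_ι]; rfl

theorem H2_cn (η : ∀ x : C.Ob, C.Hom x x) (a : C.Hom y x) (w : Words C y z) :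
    H2 η (cn a w) = cn (C.gr a) (cn (η y) w) - cn (C.gr a) (H2 η w) := by
  induction w using ind_ι with
  | zero => simp
  | add v w hv hw => simp only [map_add, hv, hw]; abel
  | h k w => rw [cn_ι, H2_ι, H2_ι, insMid, lift_cons]; simp [cn_ι]

theorem H1_sg (a : C.Hom z x) : H1 (sg a) = sg (C.d a) := by
  rw [sg_eq, H1_ι]; rfl

theorem H1_cn (a : C.Hom y x) (w : Words C y z) :
    H1 (cn a w) = cn (C.d a) w - cn (C.gr a) (H1 w) := by
  induction w using ind_ι with
  | zero => simp
  | add v w hv hw => simp only [map_add, hv, hw]; abel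
  | h k w => rw [cn_ι, H1_ι, H1_ι, hochD1_cons]; simp [cn_ι]

variable {η : ∀ x : C.Ob, C.Hom x x}

theorem H0_sg (hh : ∀ x, C.h x = C.comp (δ x) (δ x) + η x) (a : C.Hom z x) :
    H0 δ (sg a) = cn (C.gr a) (sg (η z)) := by
  simp only [H0, LinearMap.sub_apply, N_sg, H1_sg, H2_sg, hh, map_add]; abel

theorem H0_cn (hh : ∀ x, C.h x = C.comp (δ x) (δ x) + η x) (a : C.Hom y x) (w : Words C y z) :
    H0 δ (cn a w) = cn (C.gr a) (cn (η y) w) - cn (C.gr a) (H0 δ w) + lm (C.gr a) w := by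
  simp only [H0, LinearMap.sub_apply, N_cn, H1_cn, H2_cn, hh, map_add, map_sub, LinearMap.add_apply]
  abel

/-- Insertion of `n - 3` factors `δ` (zero for `n < 3`). -/
def shW : ℕ → (Words C x z →ₗ[ℂ] Words C x z)
  | 0 => 0
  | 1 => 0
  | 2 => 0
  | n + 3 => DirectSum.toModule ℂ ℕ _ fun k => shWord δ k n

/-- Insertion of factors `δ`, also in front of the word. -/
def shA : ℕ → (Words C x z →ₗ[ℂ] Words C x z)
  | 0 => 0
  | n + 1 => shW δ (n + 1) + (cn (δ x)).comp (shA n)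

theorem shW_ι (n k : ℕ) (w : Word C.Hom k x z) : shW δ (n + 3) (ι k w) = shWord δ k n w := by
  simp [shW, ι]

/-- The additional summand is the word without any factor `δ`, which belongs to the index `n + 1 =
3` only. -/
theorem shW_sg (n : ℕ) (a : C.Hom z x) :
    shW δ (n + 1) (sg a) = cn a (shW δ n (sg (δ z))) + if n = 2 then sg a else 0 := by
  match n with
  | 0 => simp [shW]
  | 1 => simp [shW]
  | 2 => rw [sg_eq, shW_ι δ 0]; simp [shW]; rfl
  | n + 3 => rw [sg_eq, shW_ι δ (n + 1), if_neg (by omega), add_zero, sg_eq, shW_ι]; rfl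

theorem shA_succ (n : ℕ) (w : Words C x z) :
    shA δ (n + 1) w = shW δ (n + 1) w + cn (δ x) (shA δ n w) := rfl

theorem shA_add_three (n : ℕ) (w : Words C x z) : shA δ (n + 3) w =
    ∑ m ∈ Finset.range (n + 1), ((cn (δ x) : Module.End ℂ (Words C x z)) ^ m) (shW δ (n - m + 3) w) := by
  induction n with
  | zero => simp [shA, shW]
  | succ n ih =>
    rw [shA_succ, ih, Finset.sum_range_succ' _ (n + 1), add_comm, map_sum]
    simp [pow_succ']

theorem shW_cn (n : ℕ) (a : C.Hom y x) (w : Words C y z) :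
    shW δ n (cn a w) = cn a (shA δ n w) := by
  match n with
  | 0 => simp [shW, shA]
  | 1 => simp [shW, shA]
  | 2 => simp [shW, shA]
  | n + 3 =>
    induction w using ind_ι with
    | zero => simp
    | add v w hv hw => simp only [map_add, hv, hw]
    | h k w =>
      rw [cn_ι, shW_ι, shA_add_three]
      simp only [shW_ι]
      refine (lift_cons _ a w).trans ?_
      simp only [LinearMap.compl₂_apply, LinearMap.sum_apply, LinearMap.comp_apply]
      rfl

theorem shW_three (w : Words C x z) : shW δ 3 w = w := by
  refine ind (p := fun x w => shW δ 3 w = w) ?_ ?_ ?_ ?_ x w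
  · intros; simp
  · intro x v w hv hw; simp only [map_add, hv, hw]
  · intro x a; rw [shW_sg]; simp [shW]
  · intro x y a w hw; rw [shW_cn, shA_succ, hw]; simp [shW, shA]

theorem shW_lm (n : ℕ) (b : C.Hom x y) (w : Words C x z) :
    shW δ n (lm b w) = lm b (shW δ n w) := by
  revert y b
  refine ind (p := fun x w => ∀ {y : C.Ob} (b : C.Hom x y),
    shW δ n (lm b w) = lm b (shW δ n w)) ?_ ?_ ?_ ?_ x w
  · intros; simp
  · intro x v w hv hw y b; simp only [map_add, hv, hw]
  · intro x a y b
    cases n with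
    | zero => simp [shW]
    | succ n =>
      rw [lm_sg, shW_sg, shW_sg, map_add, lm_cn]
      split_ifs <;> simp [lm_sg]
  · intro x u a w hw y b; simp only [lm_cn, shW_cn]

theorem shW_T (hδ : ∀ x, C.gr (δ x) = -δ x) (n : ℕ) (w : Words C x z) :
    shW δ n (T w) = T (shW δ n w) := by
  revert n
  refine ind (p := fun x w => ∀ n, shW δ n (T w) = T (shW δ n w)) ?_ ?_ ?_ ?_ x w
  · intros; simp
  · intro x v w hv hw n; simp only [map_add, hv, hw]
  · have h : ∀ n (z : C.Ob), T (shW δ n (sg (δ z))) = shW δ n (sg (δ z)) := by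
      intro n
      induction n with
      | zero => intro z; simp [shW]
      | succ n ih =>
        intro z
        rw [shW_sg, map_add, T_cn, ih, hδ]
        split_ifs <;> simp [T_sg, hδ]
    intro x a n
    cases n with
    | zero => simp [shW]
    | succ n =>
      rw [T_sg, map_neg, shW_sg, shW_sg, map_add, T_cn, h]
      split_ifs <;> simp [T_sg, add_comm]
  · intro x y a w hw n
    have hA : ∀ n, shA δ n (T w) = T (shA δ n w) := by
      intro n
      induction n with
      | zero => simp [shA]
      | succ n ih => rw [shA_succ, shA_succ, map_add, T_cn, hw, ih, hδ]; simp
    rw [T_cn, map_neg, shW_cn, shW_cn, T_cn, hA]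

theorem shW_sg_eq_sn (n : ℕ) (b : C.Hom z x) :
    shW δ (n + 1) (sg b) = sn (shW δ n (sg b)) (δ z) + if n = 2 then sg b else 0 := by
  rw [shW_sg]
  congr 1
  induction n generalizing x with
  | zero => simp [shW]
  | succ n ih =>
    have h : ∀ c : C.Hom z x, sn (if n = 2 then sg c else 0 : Words C x z) (δ z) =
        cn c (if n = 2 then sg (δ z) else 0) := by intro c; split_ifs <;> simp [sn_sg]
    rw [shW_sg, ih, shW_sg, map_add sn, LinearMap.add_apply, sn_cn, h, map_add]

/-- The last letter is either `b` or an inserted `δ`. -/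
theorem shW_sn (n : ℕ) (v : Words C x y) (b : C.Hom z y) :
    shW δ (n + 1) (sn v b) = sn (shW δ (n + 1) v) b + sn (shW δ n (sn v b)) (δ z) := by
  revert n
  refine ind (p := fun x v => ∀ n,
    shW δ (n + 1) (sn v b) = sn (shW δ (n + 1) v) b + sn (shW δ n (sn v b)) (δ z)) ?_ ?_ ?_ ?_ x v
  · intros; simp
  · intro x v w hv hw n; simp only [map_add, LinearMap.add_apply, hv, hw]; abel
  · intro x a n
    have h1 : ∀ n, shA δ (n + 1) (sg b) = sn (shW δ n (sg (δ y))) b + (if n = 2 then sg b else 0) +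
        sn (shA δ n (sg b)) (δ z) := by
      intro n
      induction n with
      | zero => simp [shA, shW]
      | succ n ih =>
        conv_lhs => rw [shA_succ, ih, shW_sg_eq_sn]
        conv_rhs => rw [shA_succ, shW_sg]
        simp only [map_add, LinearMap.add_apply, sn_cn]
        split_ifs <;> simp [sn_sg] <;> abel
    rw [sn_sg, shW_cn, h1, shW_cn, shW_sg, map_add, map_add, map_add, LinearMap.add_apply, sn_cn,
      sn_cn]
    split_ifs <;> simp [sn_sg]
  · intro x u a w hw n
    have hA : ∀ n, shA δ (n + 1) (sn w b) = sn (shA δ (n + 1) w) b + sn (shA δ n (sn w b)) (δ z) := by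
      intro n
      induction n with
      | zero => rw [shA_succ, hw, shA_succ]; simp [shA, shW]
      | succ n ih =>
        conv_lhs => rw [shA_succ, hw, ih]
        conv_rhs => rw [shA_succ _ (n + 1), shA_succ _ n (sn w b)]
        simp only [map_add, LinearMap.add_apply, sn_cn]
        abel
    rw [sn_cn, shW_cn, shW_cn, shW_cn, hA, map_add, sn_cn, sn_cn]

/-- In `δ[δ|…|δ]` all products of neighbours enter with the same sign, since `δ` is odd; they give
one factor `δ²` in every position among the others. The inserted curvature gives `η` in every
position but the first. -/
theorem H0_shW_sg (hδ : ∀ x, C.gr (δ x) = -δ x) (hh : ∀ x, C.h x = C.comp (δ x) (δ x) + η x)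
    (n : ℕ) : -H0 δ (shW δ (n + 1) (sg (δ z))) = cn (δ z) (shA δ (n + 1) (sg (η z))) +
      shA δ n (sg (C.comp (δ z) (δ z))) := by
  induction n with
  | zero => simp [shW, shA]
  | succ n ih =>
    rw [neg_eq_iff_eq_neg] at ih
    have h1 : lm (δ z) (shW δ (n + 1) (sg (δ z))) = shW δ (n + 1) (sg (C.comp (δ z) (δ z))) := by
      rw [← shW_lm, lm_sg]
    have h2 : shA δ (n + 2) (sg (η z)) = cn (η z) (shW δ (n + 1) (sg (δ z))) +
        (if n + 1 = 2 then sg (η z) else 0) + cn (δ z) (shA δ (n + 1) (sg (η z))) := by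
      rw [← shW_sg, shA_succ]
    have h3 : H0 δ (if n + 1 = 2 then sg (δ z) else 0) =
        -cn (δ z) (if n + 1 = 2 then sg (η z) else 0) := by
      split_ifs <;> simp [H0_sg δ hh, hδ]
    rw [shW_sg δ (n + 1) (δ z), map_add, h3, H0_cn δ hh, h2,
      shA_succ δ n (sg (C.comp (δ z) (δ z))), hδ, ih]
    simp only [map_neg, LinearMap.neg_apply, h1, map_add]
    abel

/-- With `m` factors `δ`: the products of `δ` with a letter from both sides give `δa - (-1)^|a| aδ`,
that is `d` on that letter with `m - 1` factors left. The products of two factors give an inserted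
`δ²` with `m - 2` left. Nothing compensates for a `δ` in front of the first letter, whence the last
summand. With the index shifted by three, the start of the induction on the number of factors is `0
= 0`. -/
theorem H0_shW (hδ : ∀ x, C.gr (δ x) = -δ x) (hh : ∀ x, C.h x = C.comp (δ x) (δ x) + η x)
    (hd : ∀ {x y : C.Ob} (a : C.Hom x y), C.d a = C.comp (δ y) a - C.comp (C.gr a) (δ x))
    (w : Words C x z) (n : ℕ) : H0 δ (shW δ (n + 2) w) = shW δ (n + 2) (H0 δ w) -
    shW δ (n + 1) (H1 w) + shW δ n (H2 (fun x => C.comp (δ x) (δ x)) w) +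
    lm (δ x) (shW δ (n + 1) w) := by
  revert n
  refine ind (p := fun x w => ∀ n, H0 δ (shW δ (n + 2) w) = shW δ (n + 2) (H0 δ w) -
    shW δ (n + 1) (H1 w) + shW δ n (H2 (fun x => C.comp (δ x) (δ x)) w) +
    lm (δ x) (shW δ (n + 1) w)) ?_ ?_ ?_ ?_ x w
  · intros; simp
  · intro x v w hv hw n; simp only [map_add, hv, hw]; abel
  · intro x a n
    have h := H0_shW_sg (z := z) δ hδ hh n
    rw [neg_eq_iff_eq_neg] at h
    have h1 : H0 δ (if n + 1 = 2 then sg a else 0) =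
        cn (C.gr a) (if n + 1 = 2 then sg (η z) else 0) := by
      split_ifs <;> simp [H0_sg δ hh]
    have h2 : lm (C.gr a) (shW δ (n + 1) (sg (δ z))) = shW δ (n + 1) (sg (C.comp (C.gr a) (δ z))) := by
      rw [← shW_lm, lm_sg]
    have h3 : shA δ (n + 2) (sg (η z)) = cn (η z) (shW δ (n + 1) (sg (δ z))) +
        (if n + 1 = 2 then sg (η z) else 0) + cn (δ z) (shA δ (n + 1) (sg (η z))) := by
      rw [← shW_sg, shA_succ]
    rw [shW_sg δ (n + 1) a, map_add, H0_cn δ hh, h, h1, h2, H0_sg δ hh, H1_sg, H2_sg, shW_cn, shW_cn,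
      h3, hd, ← shW_lm, lm_sg]
    simp only [map_neg, map_add, map_sub]
    abel
  · intro x y a w hw n
    -- The same balance for insertions that may also begin in front of `w`; here the `δ` in front
    -- supplies the left-hand products, so there is no remaining summand.
    have hA : ∀ n, cn (η y) (shA δ (n + 2) w) - H0 δ (shA δ (n + 2) w) - shA δ (n + 2) (cn (η y) w) +
        shA δ (n + 2) (H0 δ w) - shA δ (n + 1) (H1 w) - shA δ n (cn (C.comp (δ y) (δ y)) w) +
        shA δ n (H2 (fun x => C.comp (δ x) (δ x)) w) = 0 := by
      intro n
      induction n with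
      | zero => simp [shA, shW]
      | succ n ih =>
        have ih' := congrArg (cn (δ y)) ih
        simp only [map_add, map_sub, map_zero] at ih'
        have hw' := hw (n + 1)
        have h1 : H0 δ (shA δ (n + 3) w) = H0 δ (shW δ (n + 3) w) - cn (δ y) (cn (η y) (shA δ (n + 2) w))
            + cn (δ y) (H0 δ (shA δ (n + 2) w)) - lm (δ y) (shW δ (n + 2) w)
            - cn (C.comp (δ y) (δ y)) (shA δ (n + 1) w) := by
          rw [shA_succ δ (n + 2), map_add, H0_cn δ hh, hδ]
          simp only [map_neg, LinearMap.neg_apply]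
          rw [shA_succ δ (n + 1) w, map_add (lm _), lm_cn]
          abel
        rw [h1, hw']
        rw [shA_succ δ (n + 2) (cn (η y) w), shW_cn, shA_succ δ (n + 2) (H0 δ w),
          shA_succ δ (n + 1) (H1 w), shA_succ δ n (cn (C.comp (δ y) (δ y)) w), shW_cn,
          shA_succ δ n (H2 _ w)]
        linear_combination (norm := module) ih'
    have hA' := congrArg (cn (C.gr a)) (hA n)
    simp only [map_add, map_sub, map_zero] at hA'
    have h1 : lm (C.gr a) (shA δ (n + 2) w) =
        lm (C.gr a) (shW δ (n + 2) w) + cn (C.comp (C.gr a) (δ y)) (shA δ (n + 1) w) := by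
      rw [shA_succ, map_add, lm_cn]
    rw [shW_cn, H0_cn δ hh, H0_cn δ hh, H1_cn, H2_cn, shW_cn, lm_cn, h1]
    simp only [map_add, map_sub, shW_cn, shW_lm, hd, LinearMap.sub_apply]
    linear_combination (norm := module) hA'

end Shuffle

/-! ### The twist by `δ` is a chain map. -/

section Twist
open Word Words
variable {C : CdgCat} (δ : ∀ x : C.Ob, C.Hom x x) {x y z : C.Ob}

/-- Insertion of `n - 3` factors `δ` into chains. -/
def shC (n : ℕ) : Cyc C →ₗ[ℂ] Cyc C := cycLift fun _ => inc.comp (shW δ n)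

theorem shC_inc (n : ℕ) (w : Words C x x) : shC δ n (inc w) = inc (shW δ n w) := cycLift_inc _ w

theorem K_shW (hδ : ∀ x, C.gr (δ x) = -δ x) (n : ℕ) (b : C.Hom x y) (v : Words C x y) :
    K b (shW δ n v) = shW δ n (K b v) := by
  simp only [K, map_smul, map_sub (shW δ n), shW_lm, shW_T δ hδ]

/-- An inserted `δ` in last position is moved to the front by the cyclic term. This cancels the last
summand of `H0_shW`. -/
theorem cyc_shW (hδ : ∀ x, C.gr (δ x) = -δ x) (n : ℕ) (w : Words C x x) :
    cyc (shW δ (n + 1) w) = shC δ (n + 1) (cyc w) - inc (lm (δ x) (shW δ n w)) := by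
  refine ind_sn (p := fun w => cyc (shW δ (n + 1) w) =
    shC δ (n + 1) (cyc w) - inc (lm (δ x) (shW δ n w))) ?_ ?_ ?_ ?_ w
  · simp
  · intro v w hv hw; simp only [map_add, hv, hw]; abel
  · intro a
    rw [shW_sg_eq_sn, map_add, cyc_sn, K_odd (hδ x), cyc_sg]
    split_ifs <;> simp [cyc_sg]
  · intro y v b
    rw [shW_sn, map_add, cyc_sn, cyc_sn, K_odd (hδ x), K_shW δ hδ, cyc_sn, shC_inc, map_neg,
      ← sub_eq_add_neg]

/-- The internal differential on chains. -/
def D1 : Cyc C →ₗ[ℂ] Cyc C := cycLift fun _ => inc.comp H1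

/-- Insertion of elements on chains. -/
def D2 (η : ∀ x : C.Ob, C.Hom x x) : Cyc C →ₗ[ℂ] Cyc C := cycLift fun _ => inc.comp (H2 η)

variable {η : ∀ x : C.Ob, C.Hom x x} (hg : ∀ x, C.gr (η x) = η x)
  (hc : ∀ {x y : C.Ob} (a : C.Hom x y), C.comp (η y) a = C.comp a (η x))

/-- An object of `C` as an object of the flat category. -/
def fo (x : C.Ob) : (flat C η hg hc).Ob := x

/-- A morphism of `C` as a morphism of the flat category. -/
def ret : C.Hom x y →ₗ[ℂ] (flat C η hg hc).Hom (fo hg hc x) (fo hg hc y) := LinearMap.id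

/-- Words of `C` as words of the flat category. -/
def toFlat : Words C x z →ₗ[ℂ] Words (flat C η hg hc) (fo hg hc x) (fo hg hc z) := LinearMap.id

/-- Chains of `C` as chains of the flat category. -/
def flatCyc : Cyc C →ₗ[ℂ] Cyc (flat C η hg hc) := LinearMap.id

theorem toFlat_sg (a : C.Hom z x) : toFlat hg hc (sg a) = sg (ret hg hc a) := rfl

theorem toFlat_cn (a : C.Hom y x) (w : Words C y z) :
    toFlat hg hc (cn a w) = cn (ret hg hc a) (toFlat hg hc w) := rfl

theorem toFlat_lm (b : C.Hom x y) (w : Words C x z) :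
    toFlat hg hc (lm b w) = lm (ret hg hc b) (toFlat hg hc w) := by
  revert y b
  refine ind (p := fun x w => ∀ {y : C.Ob} (b : C.Hom x y),
    toFlat hg hc (lm b w) = lm (ret hg hc b) (toFlat hg hc w)) ?_ ?_ ?_ ?_ x w
  · intros; simp
  · intro x v w hv hw y b; simp only [map_add, hv, hw]
  · intro x a y b; rw [lm_sg, toFlat_sg, toFlat_sg, lm_sg]; rfl
  · intro x t a w hw y b; rw [lm_cn, toFlat_cn, toFlat_cn, lm_cn]; rfl

theorem toFlat_T (w : Words C x z) : toFlat hg hc (T w) = T (toFlat hg hc w) := by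
  refine ind (p := fun x w => toFlat hg hc (T w) = T (toFlat hg hc w)) ?_ ?_ ?_ ?_ x w
  · intros; simp
  · intro x v w hv hw; simp only [map_add, hv, hw]
  · intro x a; rw [T_sg, map_neg, toFlat_sg, toFlat_sg, T_sg]; rfl
  · intro x t a w hw; rw [T_cn, map_neg, toFlat_cn, toFlat_cn, T_cn, hw]; rfl

theorem toFlat_sn (v : Words C x y) (b : C.Hom z y) :
    toFlat hg hc (sn v b) = sn (toFlat hg hc v) (ret hg hc b) := by
  refine ind (p := fun x v => toFlat hg hc (sn v b) = sn (toFlat hg hc v) (ret hg hc b)) ?_ ?_ ?_ ?_ x v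
  · intros; simp
  · intro x v w hv hw; simp only [map_add, LinearMap.add_apply, hv, hw]
  · intro x a; rw [sn_sg, toFlat_sg, toFlat_cn, toFlat_sg, sn_sg]
  · intro x u a w hw; rw [sn_cn, toFlat_cn, toFlat_cn, sn_cn, hw]

theorem N_toFlat (hh : ∀ x, C.h x = C.comp (δ x) (δ x) + η x) (w : Words C x z) :
    N (toFlat hg hc w) = toFlat hg hc (H0 δ w) := by
  have hz : ∀ {x y : C.Ob} (a : C.Hom x y), (flat C η hg hc).d (ret hg hc a) = 0 := fun _ => rfl
  refine ind (p := fun x w => N (toFlat hg hc w) = toFlat hg hc (H0 δ w)) ?_ ?_ ?_ ?_ x w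
  · intros; simp
  · intro x v w hv hw; simp only [map_add, hv, hw]
  · intro x a
    rw [H0_sg δ hh, toFlat_sg, N_sg, hz, map_zero, zero_add]
    rfl
  · intro x t a w hw
    rw [H0_cn δ hh, map_add, map_sub, toFlat_cn, toFlat_cn, toFlat_cn, toFlat_cn, toFlat_lm, N_cn, hz,
      map_zero, LinearMap.zero_apply, zero_add, hw]
    rfl

theorem flatCyc_inc (w : Words C x x) : flatCyc hg hc (inc w) = inc (toFlat hg hc w) := rfl

theorem cyc_toFlat (w : Words C x x) : cyc (toFlat hg hc w) = flatCyc hg hc (cyc w) := by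
  refine ind_sn (p := fun w => cyc (toFlat hg hc w) = flatCyc hg hc (cyc w)) ?_ ?_ ?_ ?_ w
  · simp
  · intro v w hv hw; simp only [map_add, hv, hw]
  · intro a; rw [toFlat_sg, cyc_sg, cyc_sg, map_zero]
  · intro y v b
    rw [toFlat_sn, cyc_sn, cyc_sn, flatCyc_inc]
    rw [K, K, map_smul (toFlat hg hc), map_sub (toFlat hg hc), toFlat_lm, toFlat_lm, toFlat_T]
    rfl

theorem Dt_flatCyc (hh : ∀ x, C.h x = C.comp (δ x) (δ x) + η x) (u : Cyc C) :
    Dt (flatCyc hg hc u) = flatCyc hg hc (Dt u - D1 u - D2 (fun x => C.comp (δ x) (δ x)) u) := by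
  have : Dt.comp (flatCyc hg hc) = (flatCyc hg hc).comp
      (Dt - D1 - D2 (fun x => C.comp (δ x) (δ x))) := by
    refine cyc_ext fun x w => ?_
    simp only [LinearMap.comp_apply, LinearMap.sub_apply, D1, D2, cycLift_inc]
    rw [flatCyc_inc, Dt_inc, Dt_inc, N_toFlat δ hg hc hh, cyc_toFlat, H0, map_sub, map_sub, map_add,
      flatCyc_inc, flatCyc_inc, flatCyc_inc]
    simp only [LinearMap.sub_apply, map_sub]
    abel
  exact congr($this u)

theorem Dt_shC (hδ : ∀ x, C.gr (δ x) = -δ x) (hh : ∀ x, C.h x = C.comp (δ x) (δ x) + η x)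
    (hd : ∀ {x y : C.Ob} (a : C.Hom x y), C.d a = C.comp (δ y) a - C.comp (C.gr a) (δ x))
    (n : ℕ) (u : Cyc C) : Dt (flatCyc hg hc (shC δ (n + 2) u)) = flatCyc hg hc
      (shC δ (n + 2) (Dt u - D1 u - D2 (fun x => C.comp (δ x) (δ x)) u) - shC δ (n + 1) (D1 u)
        + shC δ n (D2 (fun x => C.comp (δ x) (δ x)) u)) := by
  rw [Dt_flatCyc δ hg hc hh]
  congr 1
  have : (Dt - D1 - D2 (fun x => C.comp (δ x) (δ x))).comp (shC δ (n + 2)) =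
      (shC δ (n + 2)).comp (Dt - D1 - D2 (fun x => C.comp (δ x) (δ x))) - (shC δ (n + 1)).comp D1
      + (shC δ n).comp (D2 (fun x => C.comp (δ x) (δ x))) := by
    refine cyc_ext fun x w => ?_
    have h := H0_shW δ hδ hh hd w n
    have e : ∀ w : Words C x x, Dt (inc w) - D1 (inc w) - D2 (fun x => C.comp (δ x) (δ x)) (inc w) =
        inc (H0 δ w) + cyc w := by
      intro w
      simp only [D1, D2, cycLift_inc, LinearMap.comp_apply, Dt_inc, H0, LinearMap.sub_apply, map_sub]
      abel
    simp only [LinearMap.comp_apply, LinearMap.sub_apply, LinearMap.add_apply, shC_inc]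
    rw [e, e, h, cyc_shW δ hδ]
    simp only [map_add, map_sub, shC_inc, D1, D2, cycLift_inc, LinearMap.comp_apply]
    abel
  exact congr($this u)

theorem shEnd_mem (n : ℕ) (a : C.Hom z x) : (shEnd δ n a : Words C x z) ∈ lenGE C x z n := by
  induction n generalizing x with
  | zero => exact mem_lenGE_zero _
  | succ n ih => exact cn_mem a (ih (δ z))

theorem shW_mem (n k : ℕ) (w : Word C.Hom k x z) : shW δ n (ι k w) ∈ lenGE C x z (k + n - 3) := by
  revert n
  refine wordInd (p := fun k x w => ∀ n, shW δ n (ι k w) ∈ lenGE C x z (k + n - 3)) ?_ ?_ ?_ ?_ k x w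
  · intro k x v w hv hw n; rw [map_add, map_add]; exact Submodule.add_mem _ (hv n) (hw n)
  · intro k x n; rw [map_zero, map_zero]; exact Submodule.zero_mem _
  · intro x a n
    match n with
    | 0 => exact Submodule.zero_mem _
    | 1 => exact Submodule.zero_mem _
    | 2 => exact Submodule.zero_mem _
    | n + 3 =>
      rw [shW_ι]
      exact lenGE_anti (by omega) (shEnd_mem δ n a)
  · intro k x y a w hw n
    have hA : ∀ n, shA δ n (ι k w) ∈ lenGE C y z (k + n - 3) := by
      intro n
      induction n with
      | zero => exact Submodule.zero_mem _
      | succ n ih =>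
        rw [shA_succ]
        exact Submodule.add_mem _ (hw _) (lenGE_anti (by omega) (cn_mem _ ih))
    rw [← cn_ι, shW_cn]
    exact lenGE_anti (by omega) (cn_mem _ (hA n))

theorem shC_mem (n k : ℕ) (w : Word C.Hom k x x) : shC δ n (inc (ι k w)) ∈ cycGE C (k + n - 3) := by
  rw [shC_inc]; exact inc_mem (shW_mem δ n k w)

open Classical in
theorem inc_apply (w : Words C x x) (K : ℕ) :
    inc w K = DirectSum.lof ℂ C.Ob (fun y => Word C.Hom K y y) x (w K) := by
  induction w using ind_ι with
  | zero => simp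
  | add v w hv hw => rw [map_add, DirectSum.add_apply, hv, hw, DirectSum.add_apply, map_add]
  | h k w =>
    rw [inc_ι]
    by_cases h : k = K
    · subst h
      rw [DirectSum.lof_apply, ι, DirectSum.lof_apply]
    · rw [lof_ne C h, ι_apply_ne h, map_zero]

theorem completes_sh (n : ℕ) : Completes (sh δ n) (shC δ (n + 3)) := by
  classical
  have : sh δ n = completion (shC δ (n + 3)) := by
    refine LinearMap.ext fun c => funext fun K => ?_
    simp only [sh, completion, LinearMap.pi_apply, LinearMap.sum_apply]
    refine Finset.sum_congr rfl fun k _ => ?_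
    simp only [LinearMap.comp_apply, LinearMap.proj_apply]
    generalize c k = v
    induction v using DirectSum.induction_on with
    | zero => simp
    | add v w hv hw => simp only [map_add, hv, hw]
    | of x w =>
      rw [← DirectSum.lof_eq_of ℂ, ← inc_ι, shC_inc, shW_ι, DirectSum.lmap_lof]
      exact (inc_apply _ K).symm
  rw [this]
  exact completes_completion fun k x w => cycGE_anti (by omega) (shC_mem δ (n + 3) k w)

/-- The sum of the insertions of factors `δ` with alternating signs. -/
def twist : HochII C →ₗ[ℂ] HochII C :=
  LinearMap.pi fun K => ∑ n ∈ Finset.range (K + 1), ((-1 : ℂ) ^ n) • (LinearMap.proj K).comp (sh δ n)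

/-- A partial sum of the insertions of factors `δ` with alternating signs. -/
def shSum (M : ℕ) : Cyc C →ₗ[ℂ] Cyc C := ∑ n ∈ Finset.range M, ((-1 : ℂ) ^ (n + 1)) • shC δ n

theorem shC_apply_eq_zero {n K : ℕ} (h : K + 3 < n) (u : Cyc C) : shC δ n u K = 0 :=
  map_mem_of_cycGE (n := 0) (shC δ n) (cycGE C (K + 1))
    (fun k x w _ => cycGE_anti (by omega) (shC_mem δ n k w))
    (fun _ h => absurd h (Nat.not_lt_zero _)) K (by omega)

theorem shC_zero : shC δ 0 = 0 ∧ shC δ 1 = 0 ∧ shC δ 2 = 0 := by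
  refine ⟨?_, ?_, ?_⟩ <;>
  · refine cyc_ext fun x w => ?_
    rw [shC_inc]
    simp [shW]

/-- `shC n` lengthens words by `n - 3`, so the summands with `n ≥ L + 3` do not contribute below
length `L`. The sign `(-1)^(n+1)` is the sign `(-1)^(n-3)` of the twist. -/
theorem agree_shSum {L M : ℕ} (h : L + 3 ≤ M) {u : Cyc C} {c : HochII C} (hu : Agree L u c) :
    Agree L (shSum δ M u) (twist δ c) := by
  intro K hK
  have e : ∀ (s : Finset ℕ) (F : ℕ → Cyc C), (∑ n ∈ s, F n) K = ∑ n ∈ s, F n K := by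
    intro s F
    exact map_sum (DirectSum.component ℂ ℕ (fun k => HochChain C k) K) F s
  rw [shSum, LinearMap.sum_apply, e]
  simp only [LinearMap.smul_apply, DirectSum.smul_apply]
  obtain ⟨M, rfl⟩ : ∃ M', M = (K + 1 + 3) + M' := ⟨M - (K + 1 + 3), by omega⟩
  rw [Finset.sum_range_add, Finset.sum_eq_zero (s := Finset.range M), add_zero, add_comm (K + 1) 3,
    Finset.sum_range_add]
  · simp only [Finset.sum_range_succ, Finset.sum_range_zero, shC_zero, LinearMap.zero_apply,
      DirectSum.zero_apply, smul_zero, zero_add, twist, LinearMap.pi_apply, LinearMap.sum_apply,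
      LinearMap.smul_apply, LinearMap.comp_apply, LinearMap.proj_apply, LinearMap.add_apply]
    congr 1
    · refine Finset.sum_congr rfl fun n _ => ?_
      rw [add_comm 3 n, completes_sh δ n L u c hu K hK]
      congr 1; ring
    · rw [add_comm 3 K, completes_sh δ K L u c hu K hK]
      congr 1; ring
  · intro n _
    rw [shC_apply_eq_zero δ (by omega), smul_zero]

/-- The alternating signs turn the minus in front of `D1` in `Dt_shC` into a plus and keep the plus
in front of `D2`. The index shifts by one and two account for the different numbers of summands. -/
theorem Dt_shSum (hδ : ∀ x, C.gr (δ x) = -δ x) (hh : ∀ x, C.h x = C.comp (δ x) (δ x) + η x)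
    (hd : ∀ {x y : C.Ob} (a : C.Hom x y), C.d a = C.comp (δ y) a - C.comp (C.gr a) (δ x))
    (M : ℕ) (u : Cyc C) : Dt (flatCyc hg hc (shSum δ (M + 2) u)) = flatCyc hg hc
      (shSum δ (M + 2) (Dt u - D1 u - D2 (fun x => C.comp (δ x) (δ x)) u) + shSum δ (M + 1) (D1 u)
        + shSum δ M (D2 (fun x => C.comp (δ x) (δ x)) u)) := by
  have h2 : ∀ v : Cyc C, shSum δ (M + 2) v =
      ∑ n ∈ Finset.range M, ((-1 : ℂ) ^ (n + 1)) • shC δ (n + 2) v := by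
    intro v
    rw [shSum, add_comm M 2, Finset.sum_range_add, LinearMap.add_apply]
    simp only [Finset.sum_range_succ, Finset.sum_range_zero, shC_zero, smul_zero, add_zero,
      LinearMap.zero_apply, LinearMap.sum_apply, LinearMap.smul_apply, zero_add]
    refine Finset.sum_congr rfl fun n _ => ?_
    rw [add_comm 2 n]
    congr 1; ring
  have h1 : ∀ v : Cyc C, shSum δ (M + 1) v =
      ∑ n ∈ Finset.range M, ((-1 : ℂ) ^ (n + 1)) • -shC δ (n + 1) v := by
    intro v
    rw [shSum, add_comm M 1, Finset.sum_range_add, LinearMap.add_apply]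
    simp only [Finset.sum_range_succ, Finset.sum_range_zero, shC_zero, smul_zero, add_zero,
      LinearMap.zero_apply, LinearMap.sum_apply, LinearMap.smul_apply, zero_add]
    refine Finset.sum_congr rfl fun n _ => ?_
    rw [add_comm 1 n]
    module
  rw [h2, h2, h1, shSum, LinearMap.sum_apply, ← Finset.sum_add_distrib, ← Finset.sum_add_distrib,
    map_sum, map_sum, map_sum]
  refine Finset.sum_congr rfl fun n _ => ?_
  rw [map_smul, map_smul, Dt_shC δ hg hc hδ hh hd, LinearMap.smul_apply, ← map_smul]
  congr 1
  module

/-- The twist as a map to the chains of the flat category. -/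
def twistFlat : HochII C →ₗ[ℂ] HochII (flat C η hg hc) := twist δ

/-- In the limit the three partial sums of `Dt_shSum` become the same twist, applied to `Dt - D1 -
D2`, to `D1` and to `D2`, which add up to `Dt`. -/
theorem hochD_twistFlat (hδ : ∀ x, C.gr (δ x) = -δ x) (hh : ∀ x, C.h x = C.comp (δ x) (δ x) + η x)
    (hd : ∀ {x y : C.Ob} (a : C.Hom x y), C.d a = C.comp (δ y) a - C.comp (C.gr a) (δ x))
    (c : HochII C) : hochD (flat C η hg hc) (twistFlat δ hg hc c) =
      twistFlat δ hg hc (hochD C c) := by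
  funext K
  obtain ⟨u, hu⟩ := exists_agree (K + 2) c
  have e1 : Agree (K + 2) (flatCyc hg hc (shSum δ (K + 5 + 2) u)) (twistFlat δ hg hc c) :=
    agree_shSum δ (by omega) hu
  rw [← e1.hochD K (by omega), Dt_shSum δ hg hc hδ hh hd]
  -- At length `K` all partial sums with at least `K + 4` summands agree with the twist.
  have e2 : ∀ (v : Cyc C) (M : ℕ), K + 4 ≤ M → shSum δ M v K = twist δ (fun k => v k) K := fun v M h =>
    agree_shSum δ (L := K + 1) (by omega) (fun _ _ => rfl) K (by omega)
  have e3 : twistFlat δ hg hc (hochD C c) K = shSum δ (K + 5 + 2) (Dt u) K :=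
    (agree_shSum δ (L := K + 1) (by omega) hu.hochD K (by omega)).symm
  refine Eq.trans (b := (shSum δ (K + 5 + 2) (Dt u - D1 u - D2 (fun x => C.comp (δ x) (δ x)) u)
    + shSum δ (K + 5 + 1) (D1 u) + shSum δ (K + 5) (D2 (fun x => C.comp (δ x) (δ x)) u)) K) rfl ?_
  rw [e3, DirectSum.add_apply, DirectSum.add_apply, e2 _ (K + 5 + 1) (by omega),
    e2 _ (K + 5) (by omega), ← e2 _ (K + 5 + 2) (by omega), ← e2 _ (K + 5 + 2) (by omega),
    ← DirectSum.add_apply, ← DirectSum.add_apply, ← map_add, ← map_add]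
  congr 2
  abel

end Twist

/-- A linear map on a product indexed by lengths that is unipotent for the filtration by length. -/
theorem bijective_of_unipotent {M : ℕ → Type} [∀ k, AddCommGroup (M k)] [∀ k, Module ℂ (M k)]
    (Φ : (∀ k, M k) →ₗ[ℂ] ∀ k, M k)
    (h : ∀ K c, (∀ k < K, c k = 0) → Φ c K = c K) : Function.Bijective Φ := by
  constructor
  · rw [injective_iff_map_eq_zero]
    intro c hc
    funext K
    induction K using Nat.strong_induction_on with
    | _ K ih =>
      rw [← h K c ih, hc]
  · intro b
    -- Successive approximation: adding the error `b - Φ c` to `c` removes the error in one more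
    -- length, so the components stabilise.
    let s : ℕ → ∀ k, M k := fun n => n.rec 0 fun _ c => c + (b - Φ c)
    have hs : ∀ n, s (n + 1) = s n + (b - Φ (s n)) := fun _ => rfl
    have hr : ∀ n, ∀ k < n, (b - Φ (s n)) k = 0 := by
      intro n
      induction n with
      | zero => intro k hk; omega
      | succ n ih =>
        intro k hk
        have : b - Φ (s (n + 1)) = (b - Φ (s n)) - Φ (b - Φ (s n)) := by
          rw [hs, map_add, sub_add_eq_sub_sub]
        rw [this, Pi.sub_apply, h k _ fun j hj => ih j (by omega), sub_self]
    have hst : ∀ m K, K < m → s m K = s (K + 1) K := by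
      intro m K hK
      induction m with
      | zero => omega
      | succ m ih =>
        rcases (Nat.lt_succ_iff_lt_or_eq.1 hK) with hlt | rfl
        · rw [hs, Pi.add_apply, hr m K hlt, add_zero, ih hlt]
        · rfl
    refine ⟨fun k => s (k + 1) k, funext fun K => ?_⟩
    set c : ∀ k, M k := fun k => s (k + 1) k
    have e : Φ (c - s (K + 1)) K = 0 := by
      have hv : ∀ k < K + 1, (c - s (K + 1)) k = 0 := fun k hk => by
        rw [Pi.sub_apply, hst _ k hk, sub_self]
      rw [h K _ fun k hk => hv k (by omega), hv K (by omega)]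
    rw [map_sub, Pi.sub_apply, sub_eq_zero] at e
    have := hr (K + 1) K (by omega)
    rw [Pi.sub_apply, sub_eq_zero] at this
    rw [e, this]

/-! ### The twist is bijective and natural. -/

section Twist
open Word Words
variable {C C' B : CdgCat} (δ : ∀ x : C.Ob, C.Hom x x) {x y z : C.Ob}

theorem gr_sh (hδ : ∀ x, C.gr (δ x) = -δ x) (n : ℕ) (c : HochII C) :
    hochGr C (sh δ n c) = sh δ n (hochGr C c) := by
  have h1 := Completes.hochGr.comp (completes_sh δ n)
  have h2 := (completes_sh δ n).comp Completes.hochGr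
  have e : (DirectSum.lmap (chainGr C)).comp (shC δ (n + 3)) =
      (shC δ (n + 3)).comp (DirectSum.lmap (chainGr C)) := by
    refine cyc_ext fun x w => ?_
    simp only [LinearMap.comp_apply, lmap_chainGr_inc, shC_inc, map_neg, shW_T δ hδ]
  rw [e] at h1
  exact congr($(h1.unique h2) c)

theorem twist_apply (c : HochII C) (K : ℕ) :
    twist δ c K = ∑ n ∈ Finset.range (K + 1), ((-1 : ℂ) ^ n) • sh δ n c K := by
  simp [twist]

theorem gr_twist (hδ : ∀ x, C.gr (δ x) = -δ x) (c : HochII C) :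
    hochGr C (twist δ c) = twist δ (hochGr C c) := by
  funext K
  change chainGr C K (twist δ c K) = _
  rw [twist_apply, twist_apply, map_sum]
  refine Finset.sum_congr rfl fun n _ => ?_
  rw [map_smul, ← gr_sh δ hδ]
  rfl

theorem sh_apply_eq_zero {n K : ℕ} {c : HochII C} (hc : ∀ k < K, c k = 0) (hn : n ≠ 0) :
    sh δ n c K = 0 := by
  have h0 : Agree (K + 1) (DirectSum.lof ℂ ℕ (fun k => HochChain C k) K (c K)) c := by
    intro k hk
    by_cases h : K = k
    · subst h; rw [DirectSum.lof_apply]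
    · rw [lof_ne C h, hc k (by omega)]
  rw [← completes_sh δ n _ _ _ h0 K (by omega)]
  exact map_mem_of_cycGE (n := K) (shC δ (n + 3)) (cycGE C (K + 1))
    (fun k x w hk => cycGE_anti (by omega) (shC_mem δ _ k w)) (lof_mem_cycGE le_rfl _) K (by omega)

theorem sh_zero (c : HochII C) : sh δ 0 c = c := by
  have : shC δ 3 = LinearMap.id := cyc_ext fun x w => by rw [shC_inc, shW_three]; rfl
  have h := completes_sh δ 0
  rw [this] at h
  exact congr($(h.unique Completes.id) c)

/-- `Sh_0` is the identity and every other `Sh_n` raises the length, so the twist is unipotent. The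
inverse needs products over all lengths. -/
theorem twist_bijective : Function.Bijective (twist δ) :=
  bijective_of_unipotent _ fun K c hc => by
    rw [twist_apply, Finset.sum_eq_single 0 (fun n _ hn => by rw [sh_apply_eq_zero δ hc hn, smul_zero])
      (by simp), sh_zero, pow_zero, one_smul]

theorem fW_shW (F : C ⟶ C') (δ' : ∀ x : C'.Ob, C'.Hom x x) (hF : ∀ x, F.map (δ x) = δ' (F.obj x))
    (w : Words C x z) (n : ℕ) : fW F (shW δ n w) = shW δ' n (fW F w) := by
  revert n
  refine ind (p := fun x w => ∀ n, fW F (shW δ n w) = shW δ' n (fW F w)) ?_ ?_ ?_ ?_ x w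
  · intros; simp
  · intro x v w hv hw n; simp only [map_add, hv, hw]
  · intro x a n
    rw [fW_sg]
    clear w
    induction n generalizing x with
    | zero => simp [shW]
    | succ n ih =>
      rw [shW_sg, shW_sg, map_add, fW_cn, ih, hF]
      split_ifs <;> simp [fW_sg]
  · intro x y a w hw n
    have hA : ∀ n, fW F (shA δ n w) = shA δ' n (fW F w) := by
      intro n
      induction n with
      | zero => simp [shA]
      | succ n ih => rw [shA_succ, shA_succ, map_add, fW_cn, hw, ih, hF]
    rw [shW_cn, fW_cn, fW_cn, shW_cn, hA]

theorem hochMap_sh (F : C ⟶ C') (δ' : ∀ x : C'.Ob, C'.Hom x x)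
    (hF : ∀ x, F.map (δ x) = δ' (F.obj x)) (n : ℕ) (c : HochII C) :
    hochMap F (sh δ n c) = sh δ' n (hochMap F c) := by
  have h1 := (Completes.hochMap F).comp (completes_sh δ n)
  have h2 := (completes_sh δ' n).comp (Completes.hochMap F)
  have e : (DirectSum.lmap (chainMap F)).comp (shC δ (n + 3)) =
      (shC δ' (n + 3)).comp (DirectSum.lmap (chainMap F)) := by
    refine cyc_ext fun x w => ?_
    simp only [LinearMap.comp_apply, chainMap_inc, shC_inc, fW_shW δ F δ' hF]
  rw [e] at h1
  exact congr($(h1.unique h2) c)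

theorem hochMap_twist (F : C ⟶ C') (δ' : ∀ x : C'.Ob, C'.Hom x x)
    (hF : ∀ x, F.map (δ x) = δ' (F.obj x)) (c : HochII C) :
    hochMap F (twist δ c) = twist δ' (hochMap F c) := by
  funext K
  change chainMap F K (twist δ c K) = _
  rw [twist_apply, twist_apply, map_sum]
  refine Finset.sum_congr rfl fun n _ => ?_
  rw [map_smul, ← hochMap_sh δ F δ' hF]
  rfl

/-- On objects with `δ = 0` every word with an inserted `δ` vanishes. This is why the twist is
invisible to the Yoneda map. -/
theorem sh_hochMap_eq_zero (F : B ⟶ C) (hF : ∀ x, δ (F.obj x) = 0) {n : ℕ} (hn : n ≠ 0)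
    (c : HochII B) : sh δ n (hochMap F c) = 0 := by
  have h0 : ∀ {x z : B.Ob} (w : Words B x z) (n : ℕ), n ≠ 3 → shW δ n (fW F w) = 0 := by
    intro x z w
    refine ind (p := fun x w => ∀ n, n ≠ 3 → shW δ n (fW F w) = 0) ?_ ?_ ?_ ?_ x w
    · intros; simp
    · intro x v w hv hw n hn; rw [map_add, map_add, hv n hn, hw n hn, add_zero]
    · intro x a n hn
      cases n with
      | zero => rfl
      | succ n => rw [fW_sg, shW_sg, hF, if_neg (by omega)]; simp
    · intro x y a w hw n hn
      have hA : ∀ n, shA δ n (fW F w) = shW δ n (fW F w) := by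
        intro n
        cases n with
        | zero => rfl
        | succ n => rw [shA_succ, hF]; simp
      rw [fW_cn, shW_cn, hA, hw n hn, map_zero]
  have h1 := (completes_sh δ n).comp (Completes.hochMap F)
  have e : (shC δ (n + 3)).comp (DirectSum.lmap (chainMap F)) = 0 := by
    refine cyc_ext fun x w => ?_
    rw [LinearMap.comp_apply, chainMap_inc, shC_inc, h0 w _ (by omega), map_zero]
    rfl
  rw [e] at h1
  exact congr($(h1.unique Completes.zero) c)

theorem twist_hochMap (F : B ⟶ C) (hF : ∀ x, δ (F.obj x) = 0) (c : HochII B) :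
    twist δ (hochMap F c) = hochMap F c := by
  funext K
  rw [twist_apply, Finset.sum_eq_single 0
    (fun n _ hn => by rw [sh_hochMap_eq_zero δ F hF hn, Pi.zero_apply, smul_zero]) (by simp), sh_zero,
    pow_zero, one_smul]

end Twist

/-! ### Functors between categories with zero differential. -/

section Flat
open Word Words
variable {C C' B : CdgCat} {η : ∀ x : C.Ob, C.Hom x x} (hg : ∀ x, C.gr (η x) = η x)
  (hc : ∀ {x y : C.Ob} (a : C.Hom x y), C.comp (η y) a = C.comp a (η x))
  {η' : ∀ x : C'.Ob, C'.Hom x x} (hg' : ∀ x, C'.gr (η' x) = η' x)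
  (hc' : ∀ {x y : C'.Ob} (a : C'.Hom x y), C'.comp (η' y) a = C'.comp a (η' x))

/-- The functor of flat categories induced by a functor that preserves the central elements. -/
def flatMap (F : C ⟶ C') (h : ∀ x, F.map (η x) = η' (F.obj x)) :
    flat C η hg hc ⟶ flat C' η' hg' hc' where
  obj := F.obj
  map := F.map
  map_one := F.map_one
  map_comp := F.map_comp
  map_gr := F.map_gr
  map_d _ := map_zero F.map
  map_h := h

/-- A functor to `C` from a category with zero differential as a functor to the flat category. -/
def flatLift (F : B ⟶ C) (hd : ∀ {x y : B.Ob} (a : B.Hom x y), B.d a = 0)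
    (h : ∀ x, F.map (B.h x) = η (F.obj x)) : B ⟶ flat C η hg hc where
  obj := F.obj
  map := F.map
  map_one := F.map_one
  map_comp := F.map_comp
  map_gr := F.map_gr
  map_d a := (congrArg F.map (hd a)).trans (map_zero F.map)
  map_h := h

/-- Products of chains of `C` as products of chains of the flat category. -/
def flatHoch : HochII C →ₗ[ℂ] HochII (flat C η hg hc) := LinearMap.id

theorem completes_flatHoch : Completes (flatHoch hg hc) (flatCyc hg hc) := fun _ _ _ h => h

theorem hochGr_flatHoch (c : HochII C) :
    hochGr (flat C η hg hc) (flatHoch hg hc c) = flatHoch hg hc (hochGr C c) := by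
  have h1 := Completes.hochGr.comp (completes_flatHoch hg hc)
  have h2 := (completes_flatHoch hg hc).comp Completes.hochGr
  have e : (DirectSum.lmap (chainGr (flat C η hg hc))).comp (flatCyc hg hc) =
      (flatCyc hg hc).comp (DirectSum.lmap (chainGr C)) := by
    refine cyc_ext fun x w => ?_
    rw [LinearMap.comp_apply, LinearMap.comp_apply, flatCyc_inc, lmap_chainGr_inc, lmap_chainGr_inc,
      map_neg, flatCyc_inc, toFlat_T]
  rw [e] at h1
  exact congr($(h1.unique h2) c)

theorem hochMap_flatHoch (F : C ⟶ C') (h : ∀ x, F.map (η x) = η' (F.obj x)) (c : HochII C) :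
    hochMap (flatMap hg hc hg' hc' F h) (flatHoch hg hc c) = flatHoch hg' hc' (hochMap F c) := by
  have h1 := (Completes.hochMap (flatMap hg hc hg' hc' F h)).comp (completes_flatHoch hg hc)
  have h2 := (completes_flatHoch hg' hc').comp (Completes.hochMap F)
  have hw : ∀ {x z : C.Ob} (w : Words C x z), fW (flatMap hg hc hg' hc' F h) (toFlat hg hc w) =
      toFlat hg' hc' (fW F w) := by
    intro x z w
    refine ind (p := fun x w => fW (flatMap hg hc hg' hc' F h) (toFlat hg hc w) =
      toFlat hg' hc' (fW F w)) ?_ ?_ ?_ ?_ x w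
    · intro x; simp only [map_zero]; rfl
    · intro x v w hv hw
      rw [map_add (toFlat hg hc), map_add (fW F), map_add (toFlat hg' hc'), ← hv, ← hw]
      exact map_add (fW (flatMap hg hc hg' hc' F h)) _ _
    · intro x a; rw [toFlat_sg, fW_sg, fW_sg, toFlat_sg]; rfl
    · intro x y a w hw; rw [toFlat_cn, fW_cn, hw, fW_cn, toFlat_cn]; rfl
  have e : (DirectSum.lmap (chainMap (flatMap hg hc hg' hc' F h))).comp (flatCyc hg hc) =
      (flatCyc hg' hc').comp (DirectSum.lmap (chainMap F)) := by
    refine cyc_ext fun x w => ?_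
    rw [LinearMap.comp_apply, LinearMap.comp_apply, flatCyc_inc, chainMap_inc, chainMap_inc,
      flatCyc_inc, hw]
    rfl
  rw [e] at h1
  exact congr($(h1.unique h2) c)

theorem hochMap_flatLift (F : B ⟶ C) (hd : ∀ {x y : B.Ob} (a : B.Hom x y), B.d a = 0)
    (h : ∀ x, F.map (B.h x) = η (F.obj x)) (c : HochII B) :
    hochMap (flatLift hg hc F hd h) c = flatHoch hg hc (hochMap F c) := by
  have h1 := Completes.hochMap (flatLift hg hc F hd h)
  have h2 := (completes_flatHoch hg hc).comp (Completes.hochMap F)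
  have hw : ∀ {x z : B.Ob} (w : Words B x z), fW (flatLift hg hc F hd h) w =
      toFlat hg hc (fW F w) := by
    intro x z w
    refine ind (p := fun x w => fW (flatLift hg hc F hd h) w = toFlat hg hc (fW F w)) ?_ ?_ ?_ ?_ x w
    · intro x; simp only [map_zero]; rfl
    · intro x v w hv hw
      rw [map_add (fW F), map_add (toFlat hg hc), ← hv, ← hw]
      exact map_add (fW (flatLift hg hc F hd h)) _ _
    · intro x a; rw [fW_sg, fW_sg, toFlat_sg]; rfl
    · intro x y a w hw; rw [fW_cn, hw, fW_cn, toFlat_cn]; rfl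
  have e : DirectSum.lmap (chainMap (flatLift hg hc F hd h)) =
      (flatCyc hg hc).comp (DirectSum.lmap (chainMap F)) := by
    refine cyc_ext fun x w => ?_
    rw [LinearMap.comp_apply, chainMap_inc, chainMap_inc, flatCyc_inc, hw]
    rfl
  rw [e] at h1
  exact congr($(h1.unique h2) c)

end Flat

/-! ### Signs of cup products. -/

section CupSign

/-- The sign of a summand of a cup product, for a first factor with `q + 1` indices and a second factor
with `p` indices (the last and the first of them being the same). -/
def cupSign (σ : ℂ) (p q : ℕ) : ℂ := σ ^ (p + 1) * (-1) ^ ((p + 1) * q + q.choose 2)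

variable {σ : ℂ} (p q : ℕ)

theorem cupSign_succ_right : cupSign σ p (q + 1) = (-1) ^ (p + q + 1) * cupSign σ p q := by
  rw [cupSign, cupSign, Nat.choose_succ_succ' q 1, Nat.choose_one_right]
  have : (p + 1) * (q + 1) + (q + q.choose 2) = (p + q + 1) + ((p + 1) * q + q.choose 2) := by ring
  rw [this, pow_add (-1 : ℂ) (p + q + 1)]
  ring

theorem cupSign_succ_left : cupSign σ (p + 1) q = σ * (-1) ^ q * cupSign σ p q := by
  rw [cupSign, cupSign]
  have : (p + 1 + 1) * q + q.choose 2 = q + ((p + 1) * q + q.choose 2) := by ring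
  rw [this, pow_add (-1 : ℂ) q, pow_succ]
  ring

theorem neg_one_pow_mul_self : (-1 : ℂ) ^ p * (-1) ^ p = 1 := by rw [← mul_pow]; norm_num

end CupSign

/-! ### The Leibniz rule for cup products, for one index set. -/

section CupSum
variable {n : ℕ} {M : Type} [AddCommGroup M]

/-- This disposes of the terms of a cup product in which the index shared by the two factors has
been dropped from one of them. -/
theorem sum_telescope (J : Finset (Fin n)) (Z : Finset (Fin n) → M) :
    ∑ i ∈ J, (Z (J.filter (· < i)) - Z (J.filter (· ≤ i))) = Z ∅ - Z J := by
  induction J using Finset.induction_on_max generalizing Z with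
  | empty => simp
  | insert a S ha ih =>
    have hna : a ∉ S := fun h => lt_irrefl _ (ha a h)
    rw [Finset.sum_insert hna]
    have e1 : (insert a S).filter (· < a) = S := by
      ext x; simp only [Finset.mem_filter, Finset.mem_insert]
      exact ⟨fun h => h.1.resolve_left h.2.ne, fun h => ⟨Or.inr h, ha x h⟩⟩
    have e2 : (insert a S).filter (· ≤ a) = insert a S := by
      ext x; simp only [Finset.mem_filter, Finset.mem_insert]
      exact ⟨fun h => h.1, fun h => ⟨h, h.elim (fun h => h.le) fun h => (ha x h).le⟩⟩
    have e3 : ∀ i ∈ S, (insert a S).filter (· < i) = S.filter (· < i) ∧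
        (insert a S).filter (· ≤ i) = S.filter (· ≤ i) := by
      intro i hi
      constructor
      · rw [Finset.filter_insert, if_neg (ha i hi).asymm]
      · rw [Finset.filter_insert, if_neg (ha i hi).not_ge]
    rw [e1, e2, Finset.sum_congr rfl fun i hi => by rw [(e3 i hi).1, (e3 i hi).2], ih]
    abel

variable {W W' : Type} [AddCommGroup W] [Module ℂ W] [AddCommGroup W'] [Module ℂ W']

/-- The members of `J` up to `i`. -/
abbrev lowPart (J : Finset (Fin n)) (i : Fin n) : Finset (Fin n) := J.filter (· ≤ i)

/-- The members of `J` from `i` on. -/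
abbrev highPart (J : Finset (Fin n)) (i : Fin n) : Finset (Fin n) := J.filter (i ≤ ·)

variable {J : Finset (Fin n)} {i j : Fin n}

theorem lowPart_card (hi : i ∈ J) : (lowPart J i).card = place J i + 1 := by
  have : lowPart J i = insert i (J.filter (· < i)) := by
    ext x; simp only [Finset.mem_filter, Finset.mem_insert, le_iff_lt_or_eq]
    constructor
    · rintro ⟨h, h' | h'⟩ <;> tauto
    · rintro (rfl | h) <;> tauto
  rw [this, Finset.card_insert_of_notMem (by simp)]; rfl

theorem place_add_highPart_card : place J i + (highPart J i).card = J.card := by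
  rw [← Finset.card_filter_add_card_filter_not (s := J) (· < i)]
  congr 2
  ext x; simp

theorem place_lowPart (h : j ≤ i) : place (lowPart J i) j = place J j := by
  unfold place
  congr 1
  ext x
  simp only [Finset.mem_filter]
  exact ⟨fun h' => ⟨h'.1.1, h'.2⟩, fun h' => ⟨⟨h'.1, h'.2.le.trans h⟩, h'.2⟩⟩

theorem place_highPart (h : i ≤ j) : place J i + place (highPart J i) j = place J j := by
  unfold place
  rw [← Finset.card_filter_add_card_filter_not (s := J.filter (· < j)) (· < i)]
  congr 2
  · ext x
    simp only [Finset.mem_filter]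
    exact ⟨fun h' => ⟨⟨h'.1, h'.2.trans_le h⟩, h'.2⟩, fun h' => ⟨h'.1.1, h'.2⟩⟩
  · ext x
    simp only [Finset.mem_filter, not_lt]
    tauto

theorem lowPart_erase_of_lt (h : i < j) : lowPart (J.erase j) i = lowPart J i := by
  rw [lowPart, Finset.filter_erase, Finset.erase_eq_of_notMem (by simp [h])]

theorem lowPart_erase : lowPart (J.erase j) i = (lowPart J i).erase j := Finset.filter_erase _ _ _

theorem highPart_erase : highPart (J.erase j) i = (highPart J i).erase j := Finset.filter_erase _ _ _

theorem highPart_erase_of_lt (h : j < i) : highPart (J.erase j) i = highPart J i := by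
  rw [highPart_erase, Finset.erase_eq_of_notMem (by simp [h])]

variable (σ : ℂ) (F : Finset (Fin n) → W →ₗ[ℂ] W') (x : Finset (Fin n) → W)

/-- A cup product of a cochain of operators and a cochain, evaluated on `J`. -/
def cupSum (J : Finset (Fin n)) : W' :=
  ∑ i ∈ J, cupSign σ (highPart J i).card (place J i) • F (lowPart J i) (x (highPart J i))

theorem sum_split (J : Finset (Fin n)) (Φ : Fin n → Fin n → M) :
    ∑ j ∈ J, ∑ i ∈ J.erase j, Φ i j =
      ∑ i ∈ J, ((∑ j ∈ J.filter (· < i), Φ i j) + ∑ j ∈ J.filter (i < ·), Φ i j) := by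
  rw [Finset.sum_comm' (t' := J) (s' := fun i => J.erase i)
    (by intro x y; simp only [Finset.mem_erase]; tauto)]
  refine Finset.sum_congr rfl fun i hi => ?_
  rw [← Finset.sum_filter_add_sum_filter_not (J.erase i) (· < i)]
  congr 1
  · refine Finset.sum_congr ?_ fun _ _ => rfl
    ext y; simp only [Finset.mem_filter, Finset.mem_erase]
    exact ⟨fun h => ⟨h.1.2, h.2⟩, fun h => ⟨⟨h.2.ne, h.1⟩, h.2⟩⟩
  · refine Finset.sum_congr ?_ fun _ _ => rfl
    ext y; simp only [Finset.mem_filter, Finset.mem_erase, not_lt]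
    exact ⟨fun h => ⟨h.1.2, lt_of_le_of_ne h.2 (Ne.symm h.1.1)⟩, fun h => ⟨⟨h.2.ne', h.1⟩, h.2.le⟩⟩

theorem sum_lowPart (hi : i ∈ J) (Φ : Fin n → M) :
    ∑ j ∈ lowPart J i, Φ j = (∑ j ∈ J.filter (· < i), Φ j) + Φ i := by
  have : lowPart J i = insert i (J.filter (· < i)) := by
    ext x; simp only [Finset.mem_filter, Finset.mem_insert, le_iff_lt_or_eq]
    constructor
    · rintro ⟨h, h' | h'⟩ <;> tauto
    · rintro (rfl | h) <;> tauto
  rw [this, Finset.sum_insert (by simp), add_comm]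

theorem sum_highPart (hi : i ∈ J) (Φ : Fin n → M) :
    ∑ j ∈ highPart J i, Φ j = (∑ j ∈ J.filter (i < ·), Φ j) + Φ i := by
  have : highPart J i = insert i (J.filter (i < ·)) := by
    ext x; simp only [Finset.mem_filter, Finset.mem_insert, le_iff_lt_or_eq]
    constructor
    · rintro ⟨h, h' | h'⟩ <;> tauto
    · rintro (rfl | h) <;> tauto
  rw [this, Finset.sum_insert (by simp), add_comm]

/-- The sign with which the total differential of a cup product meets the faces of the first factor. -/
theorem cupSign_low {j : Fin n} (hj : j ∈ J) (h : j < i) :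
    cupSign σ (highPart (J.erase j) i).card (place (J.erase j) i) =
      (-1) ^ J.card * cupSign σ (highPart J i).card (place J i) := by
  rw [highPart_erase_of_lt h]
  have h1 := place_erase (i := i) hj
  rw [if_pos h] at h1
  rw [← h1, cupSign_succ_right, ← mul_assoc, ← place_add_highPart_card (J := J) (i := i), ← h1]
  have : place (J.erase j) i + 1 + (highPart J i).card =
    (highPart J i).card + place (J.erase j) i + 1 := by ring
  rw [this, neg_one_pow_mul_self, one_mul]

theorem cupSign_high (hσ : σ * σ = 1) {j : Fin n} (hj : j ∈ J) (h : i < j) :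
    cupSign σ (highPart (J.erase j) i).card (place (J.erase j) i) =
      σ * (-1) ^ place J i * cupSign σ (highPart J i).card (place J i) := by
  have h1 := place_erase (i := i) hj
  rw [if_neg h.asymm, add_zero] at h1
  rw [h1, highPart_erase]
  have h2 : ((highPart J i).erase j).card + 1 = (highPart J i).card :=
    Finset.card_erase_add_one (by simp [hj, h.le])
  rw [← h2, cupSign_succ_left]
  linear_combination (-cupSign σ ((highPart J i).erase j).card (place J i)) *
    ((-1) ^ place J i * (-1) ^ place J i * hσ + neg_one_pow_mul_self (place J i))

/-- Dropping an index `j` from `J` drops it from the first factor if `j < i` and from the second if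
`j > i`, where `i` is the shared index. The differentials of the factors have in addition the faces
that drop `i` itself, and those telescope. What remains of them is the value on the empty set. For
`σ = 1` the cup product is compatible with the differentials, for `σ = -1` it is a homotopy; `G`
measures the failure of `F` to be a cocycle. -/
theorem cup_identity (hσ : σ * σ = 1) (hx : x ∅ = 0) (b : W →ₗ[ℂ] W) (b' : W' →ₗ[ℂ] W')
    (G : Finset (Fin n) → W →ₗ[ℂ] W') (J : Finset (Fin n))
    (hF : ∀ M ⊆ J, M.Nonempty → ∀ w, b' (F M w) = (σ * (-1) ^ (M.card + 1)) • F M (b w)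
      + (∑ s ∈ M, ((-1 : ℂ) ^ place M s) • F (M.erase s) w) + G M w) :
    (∑ j ∈ J, ((-1 : ℂ) ^ place J j) • cupSum σ F x (J.erase j))
      + ((-1 : ℂ) ^ (J.card + 1)) • b' (cupSum σ F x J) =
    σ • cupSum σ F (fun T => (∑ j ∈ T, ((-1 : ℂ) ^ place T j) • x (T.erase j))
        + ((-1 : ℂ) ^ (T.card + 1)) • b (x T)) J
      + ((-1) ^ (J.card + 1) * σ ^ (J.card + 1)) • F ∅ (x J)
      + ((-1 : ℂ) ^ (J.card + 1)) • cupSum σ G x J := by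
  -- `Z A` is a product without a shared index. Dropping `i` from the first factor gives `A = {j <
  -- i}`, dropping it from the second gives `A = {j ≤ i}`. `Z ∅` is the summand with `F ∅`, and `Z
  -- J` vanishes because `x ∅ = 0`.
  let Z : Finset (Fin n) → W' := fun A =>
    ((-1) ^ ((J \ A).card + 1) * cupSign σ (J \ A).card A.card) • F A (x (J \ A))
  have hZ := sum_telescope J Z
  have hZ0 : Z ∅ = ((-1) ^ (J.card + 1) * σ ^ (J.card + 1)) • F ∅ (x J) := by
    simp [Z, cupSign]
  have hZJ : Z J = 0 := by simp [Z, hx]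
  rw [hZ0, hZJ, sub_zero] at hZ
  rw [← hZ]
  simp only [cupSum, Finset.smul_sum, map_sum, map_smul]
  rw [sum_split, ← Finset.sum_add_distrib, ← Finset.sum_add_distrib, ← Finset.sum_add_distrib]
  refine Finset.sum_congr rfl fun i hi => ?_
  have hlow : (lowPart J i).Nonempty := ⟨i, by simp [hi]⟩
  rw [hF _ (Finset.filter_subset _ _) hlow, map_add, map_sum, sum_lowPart hi, sum_highPart hi]
  have hA : J \ J.filter (· < i) = highPart J i := by
    ext y; simp only [Finset.mem_sdiff, Finset.mem_filter, not_and, not_lt]; tauto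
  have hB : J \ J.filter (· ≤ i) = J.filter (i < ·) := by
    ext y; simp only [Finset.mem_sdiff, Finset.mem_filter, not_and, not_le]; tauto
  have hC : (lowPart J i).erase i = J.filter (· < i) := by
    ext y; simp only [Finset.mem_erase, Finset.mem_filter]
    exact ⟨fun h => ⟨h.2.1, lt_of_le_of_ne h.2.2 h.1⟩, fun h => ⟨h.2.ne, h.1, h.2.le⟩⟩
  have hD : (highPart J i).erase i = J.filter (i < ·) := by
    ext y; simp only [Finset.mem_erase, Finset.mem_filter]
    exact ⟨fun h => ⟨h.2.1, lt_of_le_of_ne h.2.2 (Ne.symm h.1)⟩, fun h => ⟨h.2.ne', h.1, h.2.le⟩⟩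
  have hcD : (J.filter (i < ·)).card + 1 = (highPart J i).card := by
    rw [← hD]; exact Finset.card_erase_add_one (by simp [hi])
  set p := (J.filter (i < ·)).card
  set q := place J i
  set S := cupSign σ (highPart J i).card q with hS
  set y := x (highPart J i)
  have hcard : J.card = p + q + 1 := by
    have := place_add_highPart_card (J := J) (i := i)
    omega
  have e1 : ∑ j ∈ J.filter (· < i), ((-1 : ℂ) ^ place J j) •
      cupSign σ (highPart (J.erase j) i).card (place (J.erase j) i) •
        F (lowPart (J.erase j) i) (x (highPart (J.erase j) i)) =
      ∑ j ∈ J.filter (· < i), ((-1) ^ J.card * S) • ((-1 : ℂ) ^ place (lowPart J i) j) •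
        F ((lowPart J i).erase j) y := by
    refine Finset.sum_congr rfl fun j hj => ?_
    rw [Finset.mem_filter] at hj
    rw [cupSign_low σ hj.1 hj.2, highPart_erase_of_lt hj.2, lowPart_erase, place_lowPart hj.2.le]
    exact smul_comm _ _ _
  have e2 : ∑ j ∈ J.filter (i < ·), ((-1 : ℂ) ^ place J j) •
      cupSign σ (highPart (J.erase j) i).card (place (J.erase j) i) •
        F (lowPart (J.erase j) i) (x (highPart (J.erase j) i)) =
      ∑ j ∈ J.filter (i < ·), (σ * S) • F (lowPart J i) (((-1 : ℂ) ^ place (highPart J i) j) •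
        x ((highPart J i).erase j)) := by
    refine Finset.sum_congr rfl fun j hj => ?_
    rw [Finset.mem_filter] at hj
    rw [cupSign_high σ hσ hj.1 hj.2, lowPart_erase_of_lt hj.2, highPart_erase, map_smul, smul_smul,
      smul_smul, ← place_highPart hj.2.le, pow_add]
    congr 1
    linear_combination (σ * S * (-1) ^ place (highPart J i) j) * neg_one_pow_mul_self q
  have e3 : place (lowPart J i) i = q := place_lowPart le_rfl
  have e4 : place (highPart J i) i = 0 := by
    have := place_highPart (J := J) (le_refl i); omega
  have z1 : Z (J.filter (· < i)) = ((-1) ^ (p + 2) * S) • F (J.filter (· < i)) y := by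
    simp only [Z, hA, ← hcD, hS]; rfl
  have z2 : Z (J.filter (· ≤ i)) = (σ * S) • F (lowPart J i) (x (J.filter (i < ·))) := by
    simp only [Z, hB]
    congr 1
    have e5 : (J.filter (· ≤ i)).card = q + 1 := lowPart_card hi
    rw [e5, hS, ← hcD, cupSign_succ_left, cupSign_succ_right]
    have : (-1 : ℂ) ^ (p + q + 1) = (-1) ^ (p + 1) * (-1) ^ q := by ring
    rw [this]
    linear_combination (cupSign σ p q * (-1) ^ q) *
      (neg_one_pow_mul_self (p + 1) - hσ)
  rw [e1, e2, e3, e4, z1, z2, hC, hD, lowPart_card hi, ← hcD, hcard, ← Finset.smul_sum,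
    ← Finset.smul_sum, ← map_sum]
  simp only [map_smul, smul_add, smul_smul]
  set A1 := ∑ j ∈ J.filter (· < i), ((-1 : ℂ) ^ place (lowPart J i) j) • F ((lowPart J i).erase j) y
  set A2 := F (lowPart J i) (∑ j ∈ J.filter (i < ·), ((-1 : ℂ) ^ place (highPart J i) j) •
        x ((highPart J i).erase j))
  have hqJ : (-1 : ℂ) ^ place J i = (-1) ^ q := rfl
  rcases neg_one_pow_eq_or ℂ p with hp | hp <;> rcases neg_one_pow_eq_or ℂ q with hq | hq <;>
    (simp only [pow_add, hqJ, hp, hq, pow_zero]; module)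

end CupSum

/-! ### Alternating sums over lists and over finite sets. -/

section ListSums
variable {n : ℕ} {M : Type} [AddCommGroup M] {α β : Type}

theorem bd_map (Φ : List β → M) (f : α → β) (L : List α) :
    bd Φ (L.map f) = bd (fun L => Φ (L.map f)) L := by
  induction L generalizing Φ with
  | nil => rfl
  | cons a L ih => rw [List.map_cons, bd, bd, ih]; rfl

theorem bd_filterMap (Φ : List β → M) (g : α → Option β) (L : List α) (h : ∀ a ∈ L, (g a).isSome) :
    bd Φ (L.filterMap g) = bd (fun L => Φ (L.filterMap g)) L := by
  induction L generalizing Φ with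
  | nil => rfl
  | cons a L ih =>
    obtain ⟨b, hb⟩ := Option.isSome_iff_exists.1 (h a (by simp))
    rw [List.filterMap_cons_some hb, bd, bd, ih _ fun a ha => h a (by simp [ha])]
    congr 2
    funext L'
    rw [List.filterMap_cons_some hb]

variable [Module ℂ M]

theorem place_insert_of_lt {S : Finset (Fin n)} {a s : Fin n} (h : a < s) (ha : a ∉ S) :
    place (insert a S) s = place S s + 1 := by
  have := place_erase (J := insert a S) (i := s) (j := a) (Finset.mem_insert_self _ _)
  rw [Finset.erase_insert ha, if_pos h] at this
  exact this.symm

theorem bd_sort (Φ : List (Fin n) → M) (S : Finset (Fin n)) :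
    bd Φ (S.sort (· ≤ ·)) = ∑ s ∈ S, ((-1 : ℂ) ^ place S s) • Φ ((S.erase s).sort (· ≤ ·)) := by
  induction S using Finset.induction_on_min generalizing Φ with
  | empty => simp [bd]
  | insert a S ha ih =>
    have hna : a ∉ S := fun h => lt_irrefl _ (ha a h)
    have hp : place (insert a S) a = 0 := by
      rw [place, Finset.card_eq_zero, Finset.filter_eq_empty_iff]
      intro x hx
      rcases Finset.mem_insert.1 hx with rfl | hx
      · exact lt_irrefl _
      · exact (ha x hx).asymm
    rw [Finset.sort_insert (r := (· ≤ ·)) (fun b hb => (ha b hb).le) hna, bd, ih, Finset.sum_insert hna, hp,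
      Finset.erase_insert hna, pow_zero, one_smul, sub_eq_add_neg, ← Finset.sum_neg_distrib]
    congr 1
    refine Finset.sum_congr rfl fun s hs => ?_
    have hne : s ≠ a := (ha s hs).ne'
    rw [place_insert_of_lt (ha s hs) hna, Finset.erase_insert_of_ne hne.symm,
      Finset.sort_insert (r := (· ≤ ·)) (fun b hb => (ha b (Finset.mem_of_mem_erase hb)).le)
        (fun h => hna (Finset.mem_of_mem_erase h))]
    simp [pow_succ]

theorem bd_concat (Φ : List α → M) (L : List α) (e : α) :
    bd Φ (L ++ [e]) = bd (fun L => Φ (L ++ [e])) L + ((-1 : ℂ) ^ L.length) • Φ L := by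
  induction L generalizing Φ with
  | nil => simp [bd]
  | cons a L ih =>
    rw [List.cons_append, bd, bd, ih, List.length_cons, pow_succ]
    simp only [List.cons_append]
    module

end ListSums

/-! ### Members of the cover as lists of charts. -/

section Members
open TopologicalSpace
variable {X : TopCat.{0}} {n : ℕ} (U : Fin n → Opens X)

open Classical in
/-- The increasing list of the members of `M`, as indices of sets that contain `V`. -/
def memberList (V : Opens X) (M : Finset (Fin n)) : List {j : Fin n // V ≤ U j} :=
  (M.sort (· ≤ ·)).filterMap fun j => if h : V ≤ U j then some ⟨j, h⟩ else none

variable {U} {V V' : Opens X} {M : Finset (Fin n)}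

open Classical in
theorem map_memberList_val (h : ∀ j ∈ M, V ≤ U j) :
    (memberList U V M).map Subtype.val = M.sort (· ≤ ·) := by
  have key : ∀ L : List (Fin n), (∀ j ∈ L, V ≤ U j) → (L.filterMap fun j =>
      if h : V ≤ U j then (some ⟨j, h⟩ : Option {j : Fin n // V ≤ U j}) else none).map Subtype.val
        = L := by
    intro L hL
    induction L with
    | nil => rfl
    | cons a L ih =>
      have ha : V ≤ U a := hL a (by simp)
      rw [List.filterMap_cons_some (dif_pos ha), List.map_cons, ih fun j hj => hL j (by simp [hj])]
  exact key _ fun j hj => h j ((Finset.mem_sort _).1 hj)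

theorem eq_memberList (h : ∀ j ∈ M, V ≤ U j) {L : List {j : Fin n // V ≤ U j}}
    (hL : L.map Subtype.val = M.sort (· ≤ ·)) : L = memberList U V M :=
  List.map_injective_iff.2 Subtype.val_injective (hL.trans (map_memberList_val h).symm)

theorem length_memberList (h : ∀ j ∈ M, V ≤ U j) : (memberList U V M).length = M.card := by
  rw [← List.length_map Subtype.val, map_memberList_val h, Finset.length_sort]

/-- A set containing `V` contains each smaller `V'`. -/
abbrev memberRes (U : Fin n → Opens X) (h : V' ≤ V) (j : {j : Fin n // V ≤ U j}) :
    {j : Fin n // V' ≤ U j} := ⟨j.1, h.trans j.2⟩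

theorem map_memberList (hV : V' ≤ V) (h : ∀ j ∈ M, V ≤ U j) :
    (memberList U V M).map (memberRes U hV) = memberList U V' M :=
  eq_memberList (fun j hj => hV.trans (h j hj))
    (by rw [List.map_map, ← map_memberList_val h]; rfl)

theorem bd_memberList {A : Type} [AddCommGroup A] [Module ℂ A]
    (Φ : List {j : Fin n // V ≤ U j} → A) (h : ∀ j ∈ M, V ≤ U j) : bd Φ (memberList U V M) =
      ∑ s ∈ M, ((-1 : ℂ) ^ place M s) • Φ (memberList U V (M.erase s)) := by
  unfold memberList
  rw [bd_filterMap, bd_sort]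
  intro j hj
  rw [dif_pos (h j ((Finset.mem_sort _).1 hj))]
  rfl

end Members

/-! ### Cup products with Čech cochains. -/

section Cup
open Opposite TopologicalSpace Words
variable {X : TopCat.{0}} {E E' : TopCat.Presheaf CdgCat X} {n : ℕ} {U : Fin n → Opens X}

theorem hochMap_id (C : CdgCat) (c : HochII C) : hochMap (𝟙 C) c = c := by
  have e : DirectSum.lmap (chainMap (𝟙 C)) = LinearMap.id := by
    refine cyc_ext fun x w => ?_
    rw [chainMap_inc, LinearMap.id_apply]
    congr 1
    refine Words.ind (p := fun x w => fW (𝟙 C) w = w) ?_ ?_ ?_ ?_ x w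
    · intro x; exact map_zero _
    · intro x v w hv hw; exact (map_add _ _ _).trans (congrArg₂ _ hv hw)
    · intro x a; exact fW_sg _ a
    · intro x y a w hw; exact (fW_cn _ a w).trans (congrArg _ hw)
  have h := Completes.hochMap (𝟙 C)
  rw [e] at h
  exact congr($(h.unique Completes.id) c)

theorem capRes_self {J : Finset (Fin n)} (h : J ⊆ J) (c) : capRes E U h c = c := by
  rw [capRes]
  have : E.map (homOfLE (cap_mono U h)).op = 𝟙 _ := E.map_id _
  rw [this, hochMap_id]

/-- The component with index `T` of a Čech cochain, restricted to `U_J`. -/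
def component (J T : Finset (Fin n)) : CechHochII E U →ₗ[ℂ] HochII (E.obj (op (cap U J))) :=
  if h : T.Nonempty ∧ T ⊆ J then
    (capRes E U h.2).comp (LinearMap.proj (⟨T, h.1⟩ : CechIndex n))
  else 0

variable {J T : Finset (Fin n)}

theorem component_of (h : T.Nonempty) (h' : T ⊆ J) (c : CechHochII E U) :
    component J T c = capRes E U h' (c ⟨T, h⟩) := by
  rw [component, dif_pos ⟨h, h'⟩]; rfl

theorem component_empty (c : CechHochII E U) : component J ∅ c = 0 := by
  rw [component, dif_neg (by simp)]; rfl

theorem component_self (J : CechIndex n) (c : CechHochII E U) : component J.1 J.1 c = c J := by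
  rw [component_of J.2 (Finset.Subset.refl _), capRes_self]

theorem capRes_component {I : Finset (Fin n)} (h : I ⊆ J) (hT : T ⊆ I) (c : CechHochII E U) :
    capRes E U h (component I T c) = component J T c := by
  rcases T.eq_empty_or_nonempty with rfl | hne
  · rw [component_empty, component_empty, map_zero]
  · rw [component_of hne hT, component_of hne (hT.trans h), capRes_capRes]

theorem cechFace_eq (J : CechIndex n) (j : Fin n) (c : CechHochII E U) :
    cechFace E U J j c = component J.1 (J.1.erase j) c := by
  unfold cechFace component
  by_cases h : (J.1.erase j).Nonempty
  · rw [dif_pos h, dif_pos ⟨h, Finset.erase_subset _ _⟩]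
  · rw [dif_neg h, dif_neg (fun h' => h h'.1)]

theorem neg_one_pow_pred {k : ℕ} (hk : 0 < k) : (-1 : ℂ) ^ (k - 1) = (-1) ^ (k + 1) := by
  obtain ⟨m, rfl⟩ := Nat.exists_eq_add_of_le' hk
  rw [Nat.add_sub_cancel]; ring

theorem cechD_apply (J : CechIndex n) (c : CechHochII E U) : cechD E U c J =
    (∑ j ∈ J.1, ((-1 : ℂ) ^ place J.1 j) • component J.1 (J.1.erase j) c) +
      ((-1 : ℂ) ^ (J.1.card + 1)) • hochD _ (c J) := by
  rw [← neg_one_pow_pred J.2.card_pos]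
  simp only [← cechFace_eq]
  simp [cechD]

theorem cechGr_apply (J : CechIndex n) (c : CechHochII E U) : cechGr E U c J =
    ((-1 : ℂ) ^ (J.1.card + 1)) • hochGr _ (c J) := by
  rw [← neg_one_pow_pred J.2.card_pos]
  rfl

theorem component_cechD (h : T ⊆ J) (c : CechHochII E U) : component J T (cechD E U c) =
    (∑ j ∈ T, ((-1 : ℂ) ^ place T j) • component J (T.erase j) c) +
      ((-1 : ℂ) ^ (T.card + 1)) • hochD _ (component J T c) := by
  rcases T.eq_empty_or_nonempty with rfl | hne
  · simp [component_empty]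
  · rw [component_of hne h, component_of hne h, cechD_apply]
    simp only [map_add, map_sum, map_smul, hochD_capRes]
    congr 1
    refine Finset.sum_congr rfl fun j _ => ?_
    rw [capRes_component h (Finset.erase_subset _ _)]

theorem component_cechGr (h : T ⊆ J) (c : CechHochII E U) : component J T (cechGr E U c) =
    ((-1 : ℂ) ^ (T.card + 1)) • hochGr _ (component J T c) := by
  rcases T.eq_empty_or_nonempty with rfl | hne
  · simp [component_empty]
  · rw [component_of hne h, component_of hne h, cechGr_apply, map_smul, hochGr_capRes]

/-- The cup product of Čech cochains with a family of operators indexed by finite sets. -/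
def cup (σ : ℂ) (F : ∀ J : Finset (Fin n), Finset (Fin n) →
    (HochII (E.obj (op (cap U J))) →ₗ[ℂ] HochII (E'.obj (op (cap U J))))) :
    CechHochII E U →ₗ[ℂ] CechHochII E' U :=
  LinearMap.pi fun J => ∑ i ∈ J.1, cupSign σ (highPart J.1 i).card (place J.1 i) •
    (F J.1 (lowPart J.1 i)).comp (component J.1 (highPart J.1 i))

variable {σ : ℂ} {F : ∀ J : Finset (Fin n), Finset (Fin n) →
    (HochII (E.obj (op (cap U J))) →ₗ[ℂ] HochII (E'.obj (op (cap U J))))}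

theorem cup_apply (c : CechHochII E U) (J : CechIndex n) : cup σ F c J =
    cupSum σ (F J.1) (fun T => component J.1 T c) J.1 := by
  simp [cup, cupSum]

theorem component_cup (hF : ∀ {I J : Finset (Fin n)} (h : I ⊆ J) (M) (_ : M ⊆ I) (w),
      capRes E' U h (F I M w) = F J M (capRes E U h w))
    (h : T ⊆ J) (c : CechHochII E U) : component J T (cup σ F c) =
      cupSum σ (F J) (fun S => component J S c) T := by
  rcases T.eq_empty_or_nonempty with rfl | hne
  · simp [component_empty, cupSum]
  · rw [component_of hne h, cup_apply, cupSum, cupSum, map_sum]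
    refine Finset.sum_congr rfl fun i _ => ?_
    rw [map_smul, hF h _ (Finset.filter_subset _ _), capRes_component h (Finset.filter_subset _ _)]

theorem cupSum_congr {W W' : Type} [AddCommGroup W] [Module ℂ W] [AddCommGroup W'] [Module ℂ W']
    (F : Finset (Fin n) → W →ₗ[ℂ] W') {x y : Finset (Fin n) → W} (h : ∀ T ⊆ J, x T = y T) :
    cupSum σ F x J = cupSum σ F y J :=
  Finset.sum_congr rfl fun i _ => by rw [h _ (Finset.filter_subset _ _)]

/-- The total differential of a cup product. -/
theorem cechD_cup (hσ : σ * σ = 1)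
    (hF : ∀ {I J : Finset (Fin n)} (h : I ⊆ J) (M) (_ : M ⊆ I) (w),
      capRes E' U h (F I M w) = F J M (capRes E U h w))
    (G : ∀ J : Finset (Fin n), Finset (Fin n) →
      (HochII (E.obj (op (cap U J))) →ₗ[ℂ] HochII (E'.obj (op (cap U J)))))
    (hD : ∀ {J M : Finset (Fin n)}, M ⊆ J → M.Nonempty → ∀ w, hochD _ (F J M w) =
      (σ * (-1) ^ (M.card + 1)) • F J M (hochD _ w)
      + (∑ s ∈ M, ((-1 : ℂ) ^ place M s) • F J (M.erase s) w) + G J M w)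
    (c : CechHochII E U) (J : CechIndex n) : cechD E' U (cup σ F c) J =
      σ • cup σ F (cechD E U c) J
      + ((-1) ^ (J.1.card + 1) * σ ^ (J.1.card + 1)) • F J.1 ∅ (c J)
      + ((-1 : ℂ) ^ (J.1.card + 1)) • cup σ G c J := by
  have key := cup_identity σ (F J.1) (fun T => component J.1 T c) hσ (component_empty c)
    (hochD _) (hochD _) (G J.1) J.1 (fun M hM hM' w => hD hM hM' w)
  rw [cechD_apply, cup_apply, cup_apply, cup_apply, ← component_self J c,
    cupSum_congr (F J.1) (fun T hT => component_cechD hT c), ← key]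
  congr 1
  refine Finset.sum_congr rfl fun j _ => ?_
  rw [component_cup hF (Finset.erase_subset _ _)]

theorem cechGr_cup (hG : ∀ {J M : Finset (Fin n)}, M ⊆ J → M.Nonempty → ∀ w, hochGr _ (F J M w) =
      (σ * (-1) ^ (M.card + 1)) • F J M (hochGr _ w)) (c : CechHochII E U) :
    cechGr E' U (cup σ F c) = σ • cup σ F (cechGr E U c) := by
  funext J
  rw [cechGr_apply, cup_apply, Pi.smul_apply, cup_apply,
    cupSum_congr (F J.1) (fun T hT => component_cechGr hT c)]
  simp only [cupSum, map_sum, map_smul, Finset.smul_sum]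
  refine Finset.sum_congr rfl fun i hi => ?_
  rw [hG (Finset.filter_subset _ _) ⟨i, by simp [hi]⟩, lowPart_card hi,
    ← place_add_highPart_card (J := J.1) (i := i)]
  simp only [smul_smul]
  congr 1
  rcases neg_one_pow_eq_or ℂ (place J.1 i) with h | h <;>
    simp only [pow_add, h] <;> ring

end Cup

/-! ### Matrices of morphisms in a family of trivialisations. -/

section Frames
open AlgebraicGeometry Opposite TopologicalSpace QFact
variable {X : Scheme.{0}} [X.Over (Spec (.of ℂ))]

section
variable {P Q R : QFact X} {O O' O'' : X.Opens} {a b c : ℕ × ℕ} (t : Trivialisation P O a)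
  (s : Trivialisation Q O' b) (u : Trivialisation R O'' c)

namespace Trivialisation

theorem basis_inl (W : {W : X.Opens // W ≤ O}) (k : Fin a.1) :
    t.basis W (Sum.inl k) = (t.even.basis W k, 0) := by
  rw [Trivialisation.basis, Module.Basis.prod_apply]; simp

theorem basis_inr (W : {W : X.Opens // W ≤ O}) (k : Fin a.2) :
    t.basis W (Sum.inr k) = (0, t.odd.basis W k) := by
  rw [Trivialisation.basis, Module.Basis.prod_apply]; simp

theorem res_basis (W W' : {W : X.Opens // W ≤ O}) (h : W'.1 ≤ W.1) (k : Idx a) :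
    P.res h (t.basis W k) = t.basis W' k := by
  rcases k with k | k
  · rw [basis_inl, basis_inl]
    exact Prod.ext (t.even.res_basis W W' h k) (map_zero (resSec P.odd h))
  · rw [basis_inr, basis_inr]
    exact Prod.ext (map_zero (resSec P.even h)) (t.odd.res_basis W W' h k)

/-- Bases over different open sets are restrictions of one another, so coordinates restrict as well.
-/
theorem repr_res (W W' : {W : X.Opens // W ≤ O}) (h : W'.1 ≤ W.1) (x : P.Sec W.1) (k : Idx a) :
    (t.basis W').repr (P.res h x) k = resFun h ((t.basis W).repr x k) := by
  conv_lhs => rw [← (t.basis W).sum_repr x, map_sum]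
  simp only [res_smul, t.res_basis W W' h]
  exact congrFun ((t.basis W').repr_sum_self fun k => resFun h ((t.basis W).repr x k)) k

end Trivialisation

theorem idxSign_eq (k : Idx a) : idxSign k = 1 ∨ idxSign k = -1 := by
  rcases k with k | k
  · exact Or.inl rfl
  · exact Or.inr rfl

theorem idxSign_mul_self (k : Idx a) : idxSign k * idxSign k = 1 := by
  rcases idxSign_eq k with h | h <;> simp [h]

variable {V V' : X.Opens}

theorem sgn_basis (W : {W : X.Opens // W ≤ O}) (k : Idx a) :
    app (sgn (V := O) P) W (t.basis W k) = idxSign k • t.basis W k := by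
  rcases k with k | k
  · rw [t.basis_inl, sgn_app, idxSign, Sum.elim_inl, one_smul, neg_zero]
  · rw [t.basis_inr, sgn_app, idxSign, Sum.elim_inr, neg_one_smul, Prod.neg_mk, neg_zero]

theorem repr_smulC (W : {W : X.Opens // W ≤ O}) (z : ℂ) (x : P.Sec W.1) (k : Idx a) :
    (t.basis W).repr (z • x) k = z • (t.basis W).repr x k := by
  rw [← algebraMap_smul Γ(X, W.1) z x, map_smul, Finsupp.smul_apply, algebraMap_smul]

theorem repr_sgn (W : {W : X.Opens // W ≤ O}) (x : P.Sec W.1) (k : Idx a) :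
    (t.basis W).repr (app (sgn (V := O) P) W x) k = idxSign k • (t.basis W).repr x k := by
  conv_lhs => rw [← (t.basis W).sum_repr x, map_sum, map_sum]
  rw [Finsupp.finsetSum_apply, Finset.sum_eq_single k]
  · rw [map_smul, sgn_basis, map_smul, Finsupp.smul_apply, repr_smulC, Module.Basis.repr_self,
      Finsupp.single_eq_same, smul_comm, smul_eq_mul, mul_one]
  · intro j _ hj
    rw [map_smul, sgn_basis, map_smul, Finsupp.smul_apply, repr_smulC, Module.Basis.repr_self,
      Finsupp.single_eq_of_ne hj.symm, smul_zero, smul_zero]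
  · simp

/-- An entry of the matrix of a morphism. -/
def entry (hV : V ≤ O) (hV' : V ≤ O') (i : Idx b) (j : Idx a) : Hom V P Q →ₗ[ℂ] Γ(X, V) where
  toFun α := (s.basis ⟨V, hV'⟩).repr (app α ⟨V, le_rfl⟩ (t.basis ⟨V, hV⟩ j)) i
  map_add' α β := by
    rw [add_app]
    exact congr($(map_add (s.basis ⟨V, hV'⟩).repr _ _) i)
  map_smul' z α := by rw [smul_app]; exact repr_smulC s ⟨V, hV'⟩ z _ i

variable (hV : V ≤ O) (hV' : V ≤ O') (hV'' : V ≤ O'')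

theorem entry_comp (i : Idx c) (k : Idx a) (α : Hom V Q R) (β : Hom V P Q) :
    entry t u hV hV'' i k (comp α β) =
      ∑ j, entry s u hV' hV'' i j α * entry t s hV hV' j k β := by
  change (u.basis ⟨V, hV''⟩).repr (app (comp α β) ⟨V, le_rfl⟩ (t.basis ⟨V, hV⟩ k)) i = _
  rw [comp_app, ← (s.basis ⟨V, hV'⟩).sum_repr (app β ⟨V, le_rfl⟩ (t.basis ⟨V, hV⟩ k)), map_sum,
    map_sum, Finsupp.finsetSum_apply]
  refine Finset.sum_congr rfl fun j _ => ?_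
  rw [map_smul, map_smul, Finsupp.smul_apply, smul_eq_mul, mul_comm]
  rfl

theorem entry_gr (i : Idx b) (j : Idx a) (α : Hom V P Q) :
    entry t s hV hV' i j (gr α) = (idxSign i * idxSign j) • entry t s hV hV' i j α := by
  change (s.basis ⟨V, hV'⟩).repr (app (sgn (V := O') Q) ⟨V, hV'⟩ (app α ⟨V, le_rfl⟩
    (app (sgn (V := O) P) ⟨V, hV⟩ (t.basis ⟨V, hV⟩ j)))) i = _
  rw [repr_sgn, sgn_basis, map_smulC, repr_smulC, smul_smul]
  rfl

theorem entry_eq_gr (i : Idx b) (j : Idx a) (α : Hom V P Q) :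
    entry t s hV hV' i j α = (idxSign i * idxSign j) • entry t s hV hV' i j (gr α) := by
  rw [entry_gr, smul_smul, mul_mul_mul_comm, idxSign_mul_self, idxSign_mul_self, one_mul, one_smul]

theorem entry_scalar (g : Γ(X, V)) (i j : Idx a) :
    entry t t hV hV i j (scalar P g) = if i = j then g else 0 := by
  change (t.basis ⟨V, hV⟩).repr (resFun le_rfl g • t.basis ⟨V, hV⟩ j) i = _
  rw [resFun_self, map_smul, Finsupp.smul_apply, Module.Basis.repr_self, smul_eq_mul,
    Finsupp.single_apply]
  split_ifs with h h' h'
  · rw [mul_one]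
  · exact absurd h.symm h'
  · exact absurd h'.symm h
  · rw [mul_zero]

theorem resFun_entry (h : V' ≤ V) (i : Idx b) (j : Idx a) (α : Hom V P Q) :
    resFun h (entry t s hV hV' i j α) =
      entry t s (h.trans hV) (h.trans hV') i j (homRes h α) := by
  change resFun h ((s.basis ⟨V, hV'⟩).repr (app α ⟨V, le_rfl⟩ (t.basis ⟨V, hV⟩ j)) i) =
    (s.basis ⟨V', _⟩).repr (app α ⟨V', h⟩ (t.basis ⟨V', _⟩ j)) i
  rw [← t.res_basis ⟨V, hV⟩ ⟨V', h.trans hV⟩ h, app_res α ⟨V, le_rfl⟩ ⟨V', h⟩ h,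
    s.repr_res ⟨V, hV'⟩ ⟨V', h.trans hV'⟩ h]

end

variable {r : ℕ} (P : Fin r → QFact X) (f : Γ(X, ⊤))

theorem gr_scalar_neg (V : X.Opens) (x : (qvectOn P f V).Ob) :
    (qvectOn P f V).gr (scalar (P x) (-resFun (le_top : V ≤ ⊤) f)) =
      scalar (P x) (-resFun (le_top : V ≤ ⊤) f) := gr_scalar (P := P x) _

theorem scalar_central (V : X.Opens) {x y : (qvectOn P f V).Ob} (a : (qvectOn P f V).Hom x y) :
    (qvectOn P f V).comp (scalar (P y) (-resFun (le_top : V ≤ ⊤) f)) a =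
      (qvectOn P f V).comp a (scalar (P x) (-resFun (le_top : V ≤ ⊤) f)) := scalar_comp _ a

/-- The category of the `P_i` over `V` with zero differential and curvature `-f`. -/
def flatOn (V : X.Opens) : CdgCat :=
  flat (qvectOn P f V) (fun x => scalar (P x) (-resFun (le_top : V ≤ ⊤) f))
    (gr_scalar_neg P f V) (scalar_central P f V)

/-- The restriction functor of the categories with zero differential. -/
def flatRes {V V' : X.Opens} (h : V' ≤ V) : flatOn P f V ⟶ flatOn P f V' :=
  flatMap (gr_scalar_neg P f V) (scalar_central P f V) (gr_scalar_neg P f V')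
    (scalar_central P f V') (qvectRes P f h) fun x => by
    change homRes h (scalar (P x) _) = scalar (P x) _
    rw [homRes_scalar, map_neg, resFun_resFun]

/-- The presheaf of the categories with zero differential. -/
def flatPresheaf : TopCat.Presheaf CdgCat X where
  obj V := flatOn P f V.unop
  map i := flatRes P f i.unop.le
  map_id _ := CdgFunctor.ext rfl (heq_of_eq rfl)
  map_comp _ _ := CdgFunctor.ext rfl (heq_of_eq (by
    funext x y
    exact LinearMap.ext fun a => rfl))

/-- The functor `yonedaOn` to the category with zero differential. -/
def flatYonedaOn (i : Fin r) (V : X.Opens) : curvedOn f V ⟶ flatOn P f V where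
  obj _ := i
  map := scalar (P i)
  map_one _ := rfl
  map_comp a b := scalar_mul (P i) a b
  map_gr a := (gr_scalar (P := P i) _).symm
  map_d _ := map_zero (scalar (P i))
  map_h _ := rfl

/-- The functors `flatYonedaOn` as a morphism of presheaves. -/
def flatYoneda (i : Fin r) : curvedPresheaf f ⟶ flatPresheaf P f where
  app V := flatYonedaOn P f i V.unop
  naturality V V' h := CdgFunctor.ext rfl (heq_of_eq (by
    funext x y
    exact LinearMap.ext fun a => (homRes_scalar (P := P i) h.unop.le a).symm))

/-- The matrices of the morphisms of the `P_i` over `V`, for a family of trivialisations. -/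
def frameRep {I : Type} (V : X.Opens) (O : I → X.Opens) (hO : ∀ c, V ≤ O c) (rk : I → Fin r → ℕ × ℕ)
    (t : ∀ c x, Trivialisation (P x) (O c) (rk c x)) :
    MatRep (blow I (flatOn P f V)) (curvedOn f V) where
  I p := Idx (rk p.1 p.2)
  fin _ := inferInstance
  ob _ := ()
  s := idxSign
  s_eq := idxSign_eq
  e {p q} i j := entry (t p.1 p.2) (t q.1 q.2) (hO p.1) (hO q.1) i j
  e_comp {p q w} i k α β := entry_comp (t p.1 p.2) (t q.1 q.2) (t w.1 w.2) _ _ _ i k α β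
  gr_e {p q} i j α := entry_eq_gr (t p.1 p.2) (t q.1 q.2) (hO p.1) (hO q.1) i j α
  d_eq _ := rfl
  d_e _ _ _ := rfl
  e_h_ne {p} i j h := (entry_scalar (t p.1 p.2) (hO p.1) _ i j).trans (if_neg h)
  e_h {p} i := (entry_scalar (t p.1 p.2) (hO p.1) _ i i).trans (if_pos rfl)

/-- Matrix entries commute with restriction. This is the hypothesis of `MatRep.cut_natural` for
restriction functors, so it makes the traces compatible with the Čech differential. -/
theorem frameRep_res {I I' : Type} {V V' : X.Opens} (h : V' ≤ V) (ρ : I → I') (O : I' → X.Opens)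
    (hO : ∀ c, V ≤ O (ρ c)) (hO' : ∀ c, V' ≤ O c) (rk : I' → Fin r → ℕ × ℕ)
    (t : ∀ c x, Trivialisation (P x) (O c) (rk c x)) :
    (frameRep P f V (fun c => O (ρ c)) hO (fun c => rk (ρ c)) (fun c => t (ρ c))).post
        (curvedRes f h) =
      (frameRep P f V' O hO' rk t).pre (blowMap ρ (flatRes P f h)) (fun _ => rfl) := by
  have e : (fun (p q : I × Fin r) (i : Idx (rk (ρ q.1) q.2)) (j : Idx (rk (ρ p.1) p.2)) =>
      (resFunC h).comp (entry (t (ρ p.1) p.2) (t (ρ q.1) q.2) (hO p.1) (hO q.1) i j)) =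
      fun (p q : I × Fin r) i j => (entry (t (ρ p.1) p.2) (t (ρ q.1) q.2) (hO' (ρ p.1)) (hO' (ρ q.1)) i j).comp
        (homRes h) := by
    funext p q i j
    exact LinearMap.ext fun α => resFun_entry (t (ρ p.1) p.2) (t (ρ q.1) q.2) _ _ h i j α
  unfold MatRep.post MatRep.pre
  congr 1

end Frames

/-! ### Decompositions of objects into sums. -/

/-- A decomposition of an object as a finite sum of objects, up to the signs of the summands. -/
structure Splitting (C : CdgCat) (x : C.Ob) where
  I : Type
  fin : Fintype I
  ob : I → C.Ob
  s : I → ℂ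
  s_eq : ∀ i, s i = 1 ∨ s i = -1
  inc : ∀ i, C.Hom (ob i) x
  prj : ∀ i, C.Hom x (ob i)
  sum_inc_prj : ∑ i, C.comp (inc i) (prj i) = C.one x
  prj_inc : ∀ i, C.comp (prj i) (inc i) = C.one (ob i)
  prj_inc_ne : ∀ i j, i ≠ j → C.comp (prj i) (inc j) = 0
  gr_inc : ∀ i, C.gr (inc i) = s i • inc i
  gr_prj : ∀ i, C.gr (prj i) = s i • prj i

instance : Unique (Idx (1, 0)) := (Equiv.sumEmpty (Fin 1) (Fin 0)).unique

namespace Splitting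
variable {C : CdgCat}

/-- An object as a sum with one summand. -/
def trivial (x : C.Ob) : Splitting C x where
  I := Idx (1, 0)
  fin := inferInstance
  ob _ := x
  s := idxSign
  s_eq := idxSign_eq
  inc _ := C.one x
  prj _ := C.one x
  sum_inc_prj := (Fintype.sum_unique _).trans (C.one_comp _)
  prj_inc _ := C.one_comp _
  prj_inc_ne i j h := absurd (Subsingleton.elim i j) h
  gr_inc
    | Sum.inl _ => (C.gr_one x).trans (one_smul ℂ _).symm
  gr_prj
    | Sum.inl _ => (C.gr_one x).trans (one_smul ℂ _).symm

section
variable {x y z : C.Ob} (S : Splitting C x) (S' : Splitting C y) (S'' : Splitting C z)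

/-- An entry of the matrix of a morphism between sums. -/
def entry (i : S'.I) (j : S.I) : C.Hom x y →ₗ[ℂ] C.Hom (S.ob j) (S'.ob i) :=
  (C.comp (S'.prj i)).comp (C.comp.flip (S.inc j))

theorem entry_apply (i : S'.I) (j : S.I) (a : C.Hom x y) :
    entry S S' i j a = C.comp (S'.prj i) (C.comp a (S.inc j)) := rfl

theorem entry_comp (i : S''.I) (k : S.I) (a : C.Hom y z) (b : C.Hom x y) :
    entry S S'' i k (C.comp a b) =
      letI := S'.fin; ∑ j, C.comp (entry S' S'' i j a) (entry S S' j k b) := by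
  let := S'.fin
  have h : ∀ j, C.comp (entry S' S'' i j a) (entry S S' j k b) =
      C.comp (S''.prj i) (C.comp a (C.comp (C.comp (S'.inc j) (S'.prj j)) (C.comp b (S.inc k)))) := by
    intro j; simp only [entry_apply, C.assoc]
  rw [Finset.sum_congr rfl fun j _ => h j, entry_apply, ← map_sum, ← map_sum, ← LinearMap.sum_apply, ← map_sum, S'.sum_inc_prj, C.one_comp, C.assoc]

theorem gr_entry (i : S'.I) (j : S.I) (a : C.Hom x y) :
    C.gr (entry S S' i j a) = (S'.s i * S.s j) • entry S S' i j (C.gr a) := by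
  rw [entry_apply, entry_apply, C.gr_comp, C.gr_comp, S'.gr_prj, S.gr_inc, map_smul, map_smul,
    LinearMap.smul_apply, map_smul, smul_smul]

/-- If the differential vanishes, `d² = 0` says that the curvature commutes with all morphisms. So
its matrix with respect to any decomposition is diagonal. -/
theorem entry_h (hd : ∀ {x y : C.Ob} (a : C.Hom x y), C.d a = 0) (i j : S.I) : entry S S i j (C.h x) =
    C.comp (C.h (S.ob i)) (C.comp (S.prj i) (S.inc j)) := by
  have hc := C.d_d (S.prj i)
  rw [hd] at hc
  rw [entry_apply, ← C.assoc, ← sub_eq_zero.1 hc.symm, C.assoc]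

end

/-- The matrices of morphisms between sums. -/
def rep {I : Type} (σ : I → ∀ x : C.Ob, Splitting C x)
    (hd : ∀ {x y : C.Ob} (a : C.Hom x y), C.d a = 0) : MatRep (blow I C) C where
  I p := (σ p.1 p.2).I
  fin p := (σ p.1 p.2).fin
  ob {p} i := (σ p.1 p.2).ob i
  s {p} i := (σ p.1 p.2).s i
  s_eq {p} i := (σ p.1 p.2).s_eq i
  e {p q} i j := entry (σ p.1 p.2) (σ q.1 q.2) i j
  e_comp {p q r} i k a b := entry_comp (σ p.1 p.2) (σ q.1 q.2) (σ r.1 r.2) i k a b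
  gr_e {p q} i j a := gr_entry (σ p.1 p.2) (σ q.1 q.2) i j a
  d_eq := hd
  d_e _ _ _ := hd _
  e_h_ne {p} i j h := (entry_h (σ p.1 p.2) hd i j).trans (by
    rw [(σ p.1 p.2).prj_inc_ne i j h, map_zero])
  e_h {p} i := (entry_h (σ p.1 p.2) hd i i).trans (by
    rw [(σ p.1 p.2).prj_inc, C.comp_one])

end Splitting

/-! ### Matrices of size one. -/

namespace MatRep
open Word Words
variable {I I' : Type} {B B' C C' : CdgCat}

theorem lm_one {x z : C.Ob} (w : Words C x z) : lm (C.one x) w = w := by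
  refine ind (p := fun x w => lm (C.one x) w = w) ?_ ?_ ?_ ?_ x w
  · intros; simp
  · intro x v w hv hw; rw [map_add, hv, hw]
  · intro x a; rw [lm_sg, C.one_comp]
  · intro x y a w _; rw [lm_cn, C.one_comp]

theorem cut_pre (R : MatRep (blow I' C') B) (ρ : I → I') (F : C ⟶ C') (hd) (L : List I)
    (c : HochII C) : (R.pre (blowMap ρ F) hd).cut L c = R.cut (L.map ρ) (hochMap F c) := by
  have h1 := (R.completes_cut (L.map ρ)).comp (Completes.hochMap F)
  have e : (R.Str.comp (insList (L.map ρ))).comp (DirectSum.lmap (chainMap F)) =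
      (R.pre (blowMap ρ F) hd).Str.comp (insList L) := LinearMap.ext fun u => by
    rw [LinearMap.comp_apply, LinearMap.comp_apply, LinearMap.comp_apply, ← chainMap_insList]
    exact (R.Str_pre (blowMap ρ F) hd _).symm
  rw [e] at h1
  exact congr($(((R.pre (blowMap ρ F) hd).completes_cut L).unique h1) c)

variable (hd : ∀ {x y : C.Ob} (a : C.Hom x y), C.d a = 0)

/-- The matrices of size one. -/
def idRep : MatRep (blow Unit C) C := Splitting.rep (fun _ => Splitting.trivial) hd

theorem idRep_e {x y : C.Ob} (i : (idRep hd).I (bo () y)) (j : (idRep hd).I (bo () x))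
    (a : C.Hom x y) : (idRep hd).e i j (lbl () () a) = a :=
  (C.one_comp _).trans (C.comp_one _)

instance {x : C.Ob} : Unique ((idRep hd).I (bo () x)) := inferInstanceAs (Unique (Idx (1, 0)))

theorem idRep_s {x : C.Ob} (i : (idRep hd).I (bo () x)) : (idRep hd).s i = 1 := by
  rw [Subsingleton.elim i default]
  rfl

theorem str_idRep {x z : C.Ob} (i : (idRep hd).I (bo () x)) (j : (idRep hd).I (bo () z))
    (w : Words C x z) : (idRep hd).str i j (ins () [] () w) = w := by
  revert i
  refine ind (p := fun x w => ∀ i : (idRep hd).I (bo () x),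
    (idRep hd).str i j (ins () [] () w) = w) ?_ ?_ ?_ ?_ x w
  · intro x i; rw [map_zero, map_zero]; rfl
  · intro x v w hv hw i
    rw [map_add, map_add]
    exact congrArg₂ (· + ·) (hv i) (hw i)
  · intro x a i
    rw [ins_sg_nil, str_sg]
    exact congrArg (fun b => (sg b : Words C x z)) (idRep_e hd i j a)
  · intro x y a w hw i
    rw [ins_cn, str_cn]
    refine (Fintype.sum_unique _).trans ?_
    rw [idRep_s, one_smul]
    exact (congrArg (fun b => (cn b ((idRep hd).str (x := bo () y) (z := bo () z)
      default j (insA () [] () w)) : Words C x z)) (idRep_e hd i default a)).trans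
      (congrArg _ (hw _))

/-- A list with one member inserts nothing, and the trace of a matrix of size one and even degree is
its entry. -/
theorem cut_idRep (c : HochII C) : (idRep hd).cut [()] c = c := by
  have e : (idRep hd).Str.comp (insList [()]) = LinearMap.id := by
    refine cyc_ext fun x w => ?_
    rw [LinearMap.comp_apply, insList_inc (L := []) () () rfl, Str_inc]
    refine (Fintype.sum_unique _).trans ?_
    rw [idRep_s, tau_one]
    have : lm (lbl () () (C.one x)) (ins () [] () w) = ins () [] () w := lm_one (C := blow Unit C) _
    rw [this]
    exact congrArg (fun v => (inc v : Cyc C)) (str_idRep hd _ _ w)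
  have h1 := (idRep hd).completes_cut [()]
  rw [e] at h1
  exact congr($(h1.unique Completes.id) c)

end MatRep

/-! ### Matrix units and the global trivialisation of the structure sheaf. -/

section Frames
open AlgebraicGeometry Opposite TopologicalSpace QFact
variable {X : Scheme.{0}} [X.Over (Spec (.of ℂ))]

section Elementary
variable {P Q R : QFact X} {O O' O'' V : X.Opens} {a b c : ℕ × ℕ} (t : Trivialisation P O a)
  (s : Trivialisation Q O' b) (u : Trivialisation R O'' c) (hV : V ≤ O) (hV' : V ≤ O') (hV'' : V ≤ O'')

/-- The morphism whose matrix has a single entry, equal to `1`. -/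
def elementary (i : Idx b) (j : Idx a) : Hom V P Q :=
  mkHom (fun W => LinearMap.toSpanSingleton Γ(X, W.1) _ (s.basis ⟨W.1, W.2.trans hV'⟩ i) ∘ₗ
    (t.basis ⟨W.1, W.2.trans hV⟩).coord j) fun W W' h x => by
    simp only [LinearMap.comp_apply, LinearMap.toSpanSingleton_apply, Module.Basis.coord_apply,
      res_smul, t.repr_res ⟨W.1, W.2.trans hV⟩ ⟨W'.1, W'.2.trans hV⟩ h,
      s.res_basis ⟨W.1, W.2.trans hV'⟩ ⟨W'.1, W'.2.trans hV'⟩ h]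

theorem elementary_app (i : Idx b) (j : Idx a) (W x) : app (elementary t s hV hV' i j) W x =
    (t.basis ⟨W.1, W.2.trans hV⟩).repr x j • s.basis ⟨W.1, W.2.trans hV'⟩ i := rfl

theorem elementary_comp (i : Idx c) (j j' : Idx b) (k : Idx a) :
    comp (elementary s u hV' hV'' i j) (elementary t s hV hV' j' k) =
      if j = j' then elementary t u hV hV'' i k else 0 := hom_ext fun W x => by
  rw [comp_app, elementary_app, elementary_app, map_smul, Finsupp.smul_apply,
    Module.Basis.repr_self, Finsupp.single_apply]
  by_cases h : j' = j
  · rw [if_pos h, if_pos h.symm, smul_eq_mul, mul_one]; rfl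
  · rw [if_neg h, if_neg (Ne.symm h), smul_eq_mul, mul_zero, zero_smul]; rfl

theorem sum_elementary : ∑ j, elementary t t hV hV j j = scalar P (1 : Γ(X, V)) :=
  hom_ext fun W x => by
    rw [scalar_app, map_one, one_smul]
    have : ∀ S : Finset (Idx a), app (∑ j ∈ S, elementary t t hV hV j j) W x =
        ∑ j ∈ S, app (elementary t t hV hV j j) W x := by
      intro S
      induction S using Finset.induction_on with
      | empty => rfl
      | insert j S hj ih => rw [Finset.sum_insert hj, Finset.sum_insert hj, add_app, ih]
    rw [this]
    exact (t.basis ⟨W.1, W.2.trans hV⟩).sum_repr x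

theorem gr_elementary (i : Idx b) (j : Idx a) : gr (elementary t s hV hV' i j) =
    (idxSign i * idxSign j) • elementary t s hV hV' i j := hom_ext fun W x => by
  change app (sgn (V := O') Q) ⟨W.1, W.2.trans hV'⟩ (app (elementary t s hV hV' i j) W
    (app (sgn (V := O) P) ⟨W.1, W.2.trans hV⟩ x)) = _
  rw [elementary_app, map_smul, sgn_basis, repr_sgn, smul_app, elementary_app, mul_smul,
    smul_comm, smul_assoc]

/-- An entry of a matrix is recovered by composing with matrix units on both sides. As `R` has an
even basis with one member, the result is an endomorphism of `R` that multiplies by a function. -/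
theorem elementary_comp_comp {g : Trivialisation R ⊤ (1, 0)} (i : Idx b) (j : Idx a) (k l : Idx (1, 0))
    (α : Hom V P Q) :
    comp (elementary s g hV' le_top k i) (comp α (elementary g t le_top hV j l)) =
      scalar R (entry t s hV hV' i j α) := hom_ext fun W x => by
  rw [comp_app, comp_app, elementary_app, elementary_app, scalar_app, map_smul, map_smul,
    Finsupp.smul_apply, smul_eq_mul]
  have h1 : (s.basis ⟨W.1, W.2.trans hV'⟩).repr (app α W (t.basis ⟨W.1, W.2.trans hV⟩ j)) i =
      resFun W.2 (entry t s hV hV' i j α) := by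
    rw [resFun_entry]; rfl
  rw [h1, mul_comm, mul_smul]
  congr 1
  have h2 := (g.basis ⟨W.1, le_top⟩).sum_repr x
  rw [Fintype.sum_unique, Subsingleton.elim default k] at h2
  rw [Subsingleton.elim l k]
  exact h2

end Elementary

variable (X) in
/-- The structure sheaf as a sheaf of modules. -/
def structureModule : X.Modules := SheafOfModules.unit X.ringCatSheaf

/-- The sections of the structure sheaf as a module. -/
def unitSec (W : X.Opens) :
    Γ(structureModule X, W) ≃ₗ[Γ(X, W)] Γ(X, W) where
  toFun x := x
  invFun x := x
  map_add' _ _ := rfl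
  map_smul' _ _ := rfl
  left_inv _ := rfl
  right_inv _ := rfl

theorem unitSec_symm_res {W W' : X.Opens} (h : W' ≤ W) (x : Γ(X, W)) :
    resSec (structureModule X) h ((unitSec W).symm x) = (unitSec W').symm (resFun h x) := rfl

/-- The sections of a module that is isomorphic to the structure sheaf. -/
def isoSec {M : X.Modules} (φ : M ≅ structureModule X) (W : X.Opens) : Γ(M, W) ≃ₗ[Γ(X, W)] Γ(X, W) where
  toFun x := unitSec W (linearApp φ.hom W x)
  invFun x := linearApp φ.inv W ((unitSec W).symm x)
  map_add' x y := by rw [map_add, map_add]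
  map_smul' a x := by rw [map_smul, map_smul, RingHom.id_apply]
  left_inv x := congr(linearApp $(φ.hom_inv_id) W x)
  right_inv x := congr(linearApp $(φ.inv_hom_id) W ((unitSec W).symm x))

/-- The frame of a module that is isomorphic to the structure sheaf. -/
def frameOfIso {M : X.Modules} (φ : M ≅ structureModule X) : Frame M ⊤ 1 where
  basis W := Module.Basis.ofEquivFun
    ((isoSec φ W.1).trans (LinearEquiv.funUnique (Fin 1) Γ(X, W.1) Γ(X, W.1)).symm)
  res_basis W W' h k := by
    rw [Module.Basis.coe_ofEquivFun, Module.Basis.coe_ofEquivFun]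
    change resSec M h (linearApp φ.inv W.1 ((unitSec W.1).symm (Pi.single (M := fun _ => Γ(X, W.1)) k 1 0))) =
      linearApp φ.inv W'.1 ((unitSec W'.1).symm (Pi.single (M := fun _ => Γ(X, W'.1)) k 1 0))
    rw [← linearApp_res, unitSec_symm_res, Subsingleton.elim k 0, Pi.single_eq_same,
      Pi.single_eq_same, map_one]

theorem subsingleton_of_isZero {M : X.Modules} (h : Limits.IsZero M) (W : X.Opens) :
    Subsingleton Γ(M, W) := by
  refine ⟨fun x y => ?_⟩
  have e : 𝟙 M = 0 := h.eq_of_src _ _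
  have h0 : ∀ x : Γ(M, W), x = 0 := fun x => congr(linearApp $e W x)
  rw [h0 x, h0 y]

/-- The empty frame of the zero module. -/
def frameOfIsZero {M : X.Modules} (h : Limits.IsZero M) : Frame M ⊤ 0 where
  basis W := haveI := subsingleton_of_isZero h W.1; Module.Basis.empty _
  res_basis _ _ _ k := k.elim0

/-- The trivialisation of the structure sheaf. -/
def IsStructureSheaf.trivialisation {P : QFact X} (h : IsStructureSheaf P) :
    Trivialisation P ⊤ (1, 0) where
  even := frameOfIso h.even_iso.some
  odd := frameOfIsZero h.odd_zero

end Frames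

namespace MatRep
open Words
variable {G B C : CdgCat}

theorem mk_congr {I : G.Ob → Type} {fin : ∀ x, Fintype (I x)} {ob : ∀ {x : G.Ob}, I x → B.Ob}
    {s : ∀ {x : G.Ob}, I x → ℂ}
    {e e' : ∀ {x y : G.Ob} (i : I y) (j : I x), G.Hom x y →ₗ[ℂ] B.Hom (ob j) (ob i)}
    (h : ∀ {x y : G.Ob} (i : I y) (j : I x) (a : G.Hom x y), e i j a = e' i j a)
    {h₀ h₁ h₂ h₃ h₄ h₅ h₆ h₀' h₁' h₂' h₃' h₄' h₅' h₆'} :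
    MatRep.mk (G := G) (B := B) I fin ob s h₀ e h₁ h₂ h₃ h₄ h₅ h₆ =
      MatRep.mk I fin ob s h₀' e' h₁' h₂' h₃' h₄' h₅' h₆' := by
  have : @e = @e' := by
    funext x y i j
    exact LinearMap.ext fun a => h i j a
  subst this
  rfl

theorem hochD_cut_of_ne_nil {I : Type} (R : MatRep (blow I C) B) {L : List I} (hL : L ≠ [])
    (c : HochII C) : hochD B (R.cut L c) =
    ((-1 : ℂ) ^ (L.length + 1)) • R.cut L (hochD C c) + bd (fun M => R.cut M c) L := by
  obtain ⟨d, L, rfl⟩ := List.exists_cons_of_ne_nil hL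
  rw [R.hochD_cut, List.length_cons, pow_add _ _ 2, neg_one_sq, mul_one]

theorem gr_cut_of_ne_nil {I : Type} (R : MatRep (blow I C) B) {L : List I} (hL : L ≠ [])
    (c : HochII C) : hochGr B (R.cut L c) = ((-1 : ℂ) ^ (L.length + 1)) • R.cut L (hochGr C c) := by
  obtain ⟨d, L, rfl⟩ := List.exists_cons_of_ne_nil hL
  rw [R.gr_cut, List.length_cons, pow_add _ _ 2, neg_one_sq, mul_one]

end MatRep

theorem memberList_ne_nil {X : TopCat.{0}} {n : ℕ} {U : Fin n → TopologicalSpace.Opens X}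
    {V : TopologicalSpace.Opens X} {M : Finset (Fin n)} (h : ∀ j ∈ M, V ≤ U j) (hM : M.Nonempty) :
    memberList U V M ≠ [] := fun e => by
  have := length_memberList h
  rw [e, List.length_nil] at this
  exact hM.card_pos.ne this

theorem memberList_empty {X : TopCat.{0}} {n : ℕ} {U : Fin n → TopologicalSpace.Opens X}
    {V : TopologicalSpace.Opens X} : memberList U V ∅ = [] := by
  simp [memberList]

/-! ### Cup products that vanish on the empty set, and presheaf morphisms. -/

section Cup
open TopologicalSpace Opposite
variable {Y : TopCat.{0}} {E E' : TopCat.Presheaf CdgCat Y} {n : ℕ} {W : Fin n → Opens Y}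
  {F : ∀ J : Finset (Fin n), Finset (Fin n) →
    (HochII (E.obj (op (cap W J))) →ₗ[ℂ] HochII (E'.obj (op (cap W J))))}

theorem cechD_cup_of_empty
    (hF : ∀ {I J : Finset (Fin n)} (h : I ⊆ J) (M) (_ : M ⊆ I) (w),
      capRes E' W h (F I M w) = F J M (capRes E W h w)) (h₀ : ∀ J, F J ∅ = 0)
    (hD : ∀ {J M : Finset (Fin n)}, M ⊆ J → M.Nonempty → ∀ w, hochD _ (F J M w) =
      ((-1 : ℂ) ^ (M.card + 1)) • F J M (hochD _ w)
      + ∑ s ∈ M, ((-1 : ℂ) ^ place M s) • F J (M.erase s) w)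
    (c : CechHochII E W) : cechD E' W (cup 1 F c) = cup 1 F (cechD E W c) := by
  funext J
  rw [cechD_cup (σ := 1) (one_mul 1) hF (fun _ _ => 0) (fun h hM w => by
    rw [hD h hM, one_mul, LinearMap.zero_apply, add_zero]) c J, h₀, LinearMap.zero_apply, smul_zero,
    add_zero, one_smul, cup_apply (c := c), cupSum]
  simp only [LinearMap.zero_apply, smul_zero, Finset.sum_const_zero, add_zero]

theorem component_cechMap (F : E ⟶ E') {J T : Finset (Fin n)} (hT : T ⊆ J) (c : CechHochII E W) :
    component J T (cechMap W F c) = hochMap (F.app (op (cap W J))) (component J T c) := by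
  rcases T.eq_empty_or_nonempty with rfl | hne
  · rw [component_empty, component_empty, map_zero]
  rw [component_of hne hT, component_of hne hT]
  have h5 := hochMap_comp (E.map (homOfLE (cap_mono W hT)).op) (F.app (op (cap W J))) (c ⟨T, hne⟩)
  rw [F.naturality, hochMap_comp] at h5
  exact h5

end Cup

/-! ### The trace over the charts of the cover. -/

section Charts
open AlgebraicGeometry Opposite TopologicalSpace QFact
variable {X : Scheme.{0}} [X.Over (Spec (.of ℂ))] {N r : ℕ} {U : Fin N → X.Opens}
  {P : Fin r → QFact X} {rk : Fin r → ℕ × ℕ} (t : ∀ i j, Trivialisation (P i) (U j) (rk i))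
  (f : Γ(X, ⊤))

theorem cap_le {J M : Finset (Fin N)} (h : M ⊆ J) : ∀ j ∈ M, cap U J ≤ U j :=
  fun _ hj => Finset.inf_le (h hj)

section Trace

/-- The matrices of morphisms over `V` in the trivialisations over the members of the cover. -/
def chartRep (V : X.Opens) : MatRep (blow (Chart U V) (flatOn P f V)) (curvedOn f V) :=
  frameRep P f V (fun c => U c.1) (fun c => c.2) (fun _ => rk) (fun c x => t x c.1)

/-- The trace of the insertion of identities between the trivialisations indexed by `M`. -/
def chartCut (J M : Finset (Fin N)) :
    HochII ((flatPresheaf P f).obj (op (cap U J))) →ₗ[ℂ]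
      HochII ((curvedPresheaf f).obj (op (cap U J))) :=
  (chartRep t f (cap U J)).cut (memberList U (cap U J) M)

theorem capRes_chartCut {I J : Finset (Fin N)} (h : I ⊆ J) (M : Finset (Fin N)) (hM : M ⊆ I) (w) :
    capRes (curvedPresheaf f) U h (chartCut t f I M w) =
      chartCut t f J M (capRes (flatPresheaf P f) U h w) := by
  have h1 := MatRep.cut_natural (frameRep_res P f (cap_mono U h) (memberRes U (cap_mono U h))
    (fun c => U c.1) (fun c => c.2) (fun c => c.2) (fun _ => rk) (fun c x => t x c.1))
    (memberList U (cap U I) M) w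
  rw [map_memberList (cap_mono U h) (cap_le hM)] at h1
  exact h1

theorem chartCut_empty (J : Finset (Fin N)) : chartCut t f J ∅ = 0 := by
  rw [chartCut, memberList_empty]; exact MatRep.cut_nil _

attribute [local irreducible] flatOn

theorem hochD_chartCut {J M : Finset (Fin N)} (h : M ⊆ J) (hM : M.Nonempty)
    (w : HochII (flatOn P f (cap U J))) :
    hochD (curvedOn f (cap U J)) (chartCut t f J M w) =
      ((-1 : ℂ) ^ (M.card + 1)) • chartCut t f J M (hochD (flatOn P f (cap U J)) w)
      + ∑ s ∈ M, ((-1 : ℂ) ^ place M s) • chartCut t f J (M.erase s) w := by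
  have h1 := (chartRep t f (cap U J)).hochD_cut_of_ne_nil (memberList_ne_nil (cap_le h) hM) w
  rw [length_memberList (cap_le h), bd_memberList _ (cap_le h)] at h1
  exact h1

theorem gr_chartCut {J M : Finset (Fin N)} (h : M ⊆ J) (hM : M.Nonempty)
    (w : HochII (flatOn P f (cap U J))) :
    hochGr (curvedOn f (cap U J)) (chartCut t f J M w) =
      ((-1 : ℂ) ^ (M.card + 1)) • chartCut t f J M (hochGr (flatOn P f (cap U J)) w) := by
  have h1 := (chartRep t f (cap U J)).gr_cut_of_ne_nil (memberList_ne_nil (cap_le h) hM) w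
  rw [length_memberList (cap_le h)] at h1
  exact h1

/-- The trace on the Čech complex of the categories with zero differential. -/
def flatTrace : CechHochII (flatPresheaf P f) U →ₗ[ℂ] CechHochII (curvedPresheaf f) U :=
  cup 1 (chartCut t f)

theorem cechGr_flatTrace (c : CechHochII (flatPresheaf P f) U) :
    cechGr (curvedPresheaf f) U (flatTrace t f c) =
      flatTrace t f (cechGr (flatPresheaf P f) U c) :=
  (cechGr_cup (σ := 1) (F := chartCut t f) (fun h hM w => (gr_chartCut t f h hM w).trans
    (by rw [one_mul]; rfl)) c).trans (one_smul ℂ _)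

theorem cechD_flatTrace (c : CechHochII (flatPresheaf P f) U) :
    cechD (curvedPresheaf f) U (flatTrace t f c) =
      flatTrace t f (cechD (flatPresheaf P f) U c) :=
  cechD_cup_of_empty (F := chartCut t f) (capRes_chartCut t f) (fun J => chartCut_empty t f J)
    (fun {_ _} h hM w => hochD_chartCut t f h hM w) c

theorem flatTrace_isChainMap : SuperComplex.IsChainMap (A := cechComplex (flatPresheaf P f) U)
    (B := cechComplex (curvedPresheaf f) U) (flatTrace t f) where
  map_gr c := (cechGr_flatTrace t f c).symm
  map_D c := (cechD_flatTrace t f c).symm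

end Trace

/-! ### The homotopy between trace after Yoneda and the identity. -/

section Star
variable {i : Fin r} (g : Trivialisation (P i) ⊤ (1, 0))

variable (U) in
/-- The members of the cover together with the whole space. -/
def starCover (k : Option (Fin N)) : X.Opens := k.elim ⊤ U

variable (rk) in
/-- The ranks of the trivialisations over the members of `starCover`. -/
def starRk (i : Fin r) (k : Option (Fin N)) : ℕ × ℕ := k.elim (1, 0) fun _ => rk i

/-- The trivialisations over the members of `starCover`. -/
def starFrame : ∀ k : Option (Fin N), Trivialisation (P i) (starCover U k) (starRk rk i k)
  | none => g
  | some j => t i j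

/-- The matrices of the endomorphisms of `P_i` in the trivialisations over the members of `starCover`. -/
def starRep (V : X.Opens) : MatRep (blow {k : Option (Fin N) // V ≤ starCover U k}
    (flatOn (fun _ : Fin 1 => P i) f V)) (curvedOn f V) :=
  frameRep (fun _ => P i) f V (fun c => starCover U c.1) (fun c => c.2) (fun c _ => starRk rk i c.1)
    (fun c _ => starFrame t g c.1)

variable (U) in
/-- The index of a member of the cover. -/
def someChart {V : X.Opens} (j : Chart U V) : {k : Option (Fin N) // V ≤ starCover U k} :=
  ⟨some j.1, j.2⟩

variable (U) in
/-- The index of the whole space. -/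
def star (V : X.Opens) : {k : Option (Fin N) // V ≤ starCover U k} := ⟨none, le_top⟩

/-- On multiplications by functions of `P_i`, the enlarged family of trivialisations restricts to
the one over the cover. -/
theorem starRep_someChart (V : X.Opens) :
    (starRep t f g V).pre (blowMap (someChart U) (flatYonedaOn (fun _ => P i) f 0 V)) (fun _ => rfl) =
      (chartRep t f V).pre (blowMap id (flatYonedaOn P f i V)) (fun _ => rfl) := rfl

/-- In the global trivialisation the matrix of the multiplication by a function is that function. -/
theorem starRep_star (V : X.Opens) :
    (starRep t f g V).pre (blowMap (fun _ : Unit => star U V) (flatYonedaOn (fun _ => P i) f 0 V))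
      (fun _ => rfl) = MatRep.idRep (C := curvedOn f V) (fun _ => rfl) := by
  refine MatRep.mk_congr fun {x y} k l a => ?_
  refine (entry_scalar g le_top a k l).trans
    ((if_pos (Subsingleton.elim (α := Idx (1, 0)) k l)).trans ?_)
  exact (MatRep.idRep_e (C := curvedOn f V) (fun _ => rfl) (x := ()) (y := ()) k l a).symm

/-- The trace of the insertion of identities between the trivialisations in `L`, followed by the
global one. -/
def starTrace (V : X.Opens) (L : List (Chart U V)) : HochII (curvedOn f V) →ₗ[ℂ] HochII (curvedOn f V) :=
  ((starRep t f g V).cut (L.map (someChart U) ++ [star U V])).comp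
    (hochMap (flatYonedaOn (fun _ => P i) f 0 V))

theorem starTrace_nil (V : X.Opens) (w) : starTrace t f g V [] w = w := by
  have h1 := (starRep t f g V).cut_pre (fun _ : Unit => star U V)
    (flatYonedaOn (fun _ => P i) f 0 V) (fun _ => rfl) [()] w
  rw [starRep_star] at h1
  exact h1.symm.trans (MatRep.cut_idRep (C := curvedOn f V) (fun _ => rfl) w)

theorem cut_someChart (V : X.Opens) (L : List (Chart U V)) (w) :
    (starRep t f g V).cut (L.map (someChart U)) (hochMap (flatYonedaOn (fun _ => P i) f 0 V) w) =
      (chartRep t f V).cut L (hochMap (flatYonedaOn P f i V) w) := by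
  have h1 := (starRep t f g V).cut_pre (someChart U)
    (flatYonedaOn (fun _ => P i) f 0 V) (fun _ => rfl) L w
  have h2 := (chartRep t f V).cut_pre id (flatYonedaOn P f i V) (fun _ => rfl) L w
  rw [List.map_id] at h2
  exact h1.symm.trans ((congrArg (fun R : MatRep _ _ => R.cut L w)
    (starRep_someChart t f g V)).trans h2)

/-- Among the faces of a list that ends in the whole space, those that drop another member are of
the same kind. The one that drops the whole space is the trace over the charts; it is the last
summand. -/
theorem hochD_starTrace (V : X.Opens) (L : List (Chart U V)) (w) :
    hochD (curvedOn f V) (starTrace t f g V L w) =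
      ((-1 : ℂ) ^ L.length) • starTrace t f g V L (hochD (curvedOn f V) w)
      + bd (fun M => starTrace t f g V M w) L
      + ((-1 : ℂ) ^ L.length) • (chartRep t f V).cut L (hochMap (flatYonedaOn P f i V) w) := by
  have h1 := (starRep t f g V).hochD_cut_of_ne_nil (L := L.map (someChart U) ++ [star U V]) (by simp)
    (hochMap (flatYonedaOn (fun _ => P i) f 0 V) w)
  rw [bd_concat, bd_map, cut_someChart, hochD_map, List.length_append, List.length_map,
    List.length_singleton, ← add_assoc, pow_add _ _ 2, neg_one_sq, mul_one] at h1
  exact h1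

theorem gr_starTrace (V : X.Opens) (L : List (Chart U V)) (w) :
    hochGr (curvedOn f V) (starTrace t f g V L w) =
      ((-1 : ℂ) ^ L.length) • starTrace t f g V L (hochGr (curvedOn f V) w) := by
  have h1 := (starRep t f g V).gr_cut_of_ne_nil (L := L.map (someChart U) ++ [star U V]) (by simp)
    (hochMap (flatYonedaOn (fun _ => P i) f 0 V) w)
  rw [hochGr_map, List.length_append, List.length_map, List.length_singleton, add_assoc,
    pow_add _ _ 2, neg_one_sq, mul_one] at h1
  exact h1

theorem hochMap_flatYonedaOn {V V' : X.Opens} (h : V' ≤ V) (w : HochII (curvedOn f V)) :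
    hochMap (flatRes P f h) (hochMap (flatYonedaOn P f i V) w) =
      hochMap (flatYonedaOn P f i V') (hochMap (curvedRes f h) w) := by
  have h3 : curvedRes f h ≫ flatYonedaOn P f i V' = flatYonedaOn P f i V ≫ flatRes P f h :=
    (flatYoneda P f i).naturality (homOfLE h).op
  rw [← hochMap_comp, ← h3, hochMap_comp]

theorem hochMap_starTrace {V V' : X.Opens} (h : V' ≤ V) (L : List (Chart U V)) (w) :
    hochMap (curvedRes f h) (starTrace t f g V L w) =
      starTrace t f g V' (L.map (memberRes U h)) (hochMap (curvedRes f h) w) := by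
  have h1 := MatRep.cut_natural (frameRep_res (fun _ : Fin 1 => P i) f h
    (fun c : {k : Option (Fin N) // V ≤ starCover U k} =>
      (⟨c.1, h.trans c.2⟩ : {k : Option (Fin N) // V' ≤ starCover U k}))
    (fun c => starCover U c.1) (fun c => c.2) (fun c => c.2) (fun c _ => starRk rk i c.1)
    (fun c _ => starFrame t g c.1))
    (L.map (someChart U) ++ [star U V]) (hochMap (flatYonedaOn (fun _ => P i) f 0 V) w)
  rw [hochMap_flatYonedaOn, List.map_append, List.map_map] at h1
  exact h1.trans (congrArg (fun M => (starRep t f g V').cut (M ++ [star U V'])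
    (hochMap (flatYonedaOn (fun _ => P i) f 0 V') (hochMap (curvedRes f h) w)))
    (List.map_map (g := someChart U) (f := memberRes U h) (l := L)).symm)

/-- `starTrace` for the trivialisations indexed by `M`. -/
def starCut (J M : Finset (Fin N)) :
    HochII ((curvedPresheaf f).obj (op (cap U J))) →ₗ[ℂ]
      HochII ((curvedPresheaf f).obj (op (cap U J))) :=
  starTrace t f g (cap U J) (memberList U (cap U J) M)

theorem capRes_starCut {I J : Finset (Fin N)} (h : I ⊆ J) (M : Finset (Fin N)) (hM : M ⊆ I) (w) :
    capRes (curvedPresheaf f) U h (starCut t f g I M w) =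
      starCut t f g J M (capRes (curvedPresheaf f) U h w) := by
  have h1 := hochMap_starTrace t f g (cap_mono U h) (memberList U (cap U I) M) w
  rw [map_memberList (cap_mono U h) (cap_le hM)] at h1
  exact h1

theorem starCut_empty (J : Finset (Fin N)) (w) : starCut t f g J ∅ w = w := by
  rw [starCut, memberList_empty]; exact starTrace_nil t f g _ w

theorem hochD_starCut {J M : Finset (Fin N)} (h : M ⊆ J) (w : HochII (curvedOn f (cap U J))) :
    hochD (curvedOn f (cap U J)) (starCut t f g J M w) =
      ((-1 : ℂ) ^ M.card) • starCut t f g J M (hochD (curvedOn f (cap U J)) w)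
      + (∑ s ∈ M, ((-1 : ℂ) ^ place M s) • starCut t f g J (M.erase s) w)
      + ((-1 : ℂ) ^ M.card) • chartCut t f J M (hochMap (flatYonedaOn P f i (cap U J)) w) := by
  have h1 := hochD_starTrace t f g (cap U J) (memberList U (cap U J) M) w
  rw [length_memberList (cap_le h), bd_memberList _ (cap_le h)] at h1
  exact h1

theorem gr_starCut {J M : Finset (Fin N)} (h : M ⊆ J) (w : HochII (curvedOn f (cap U J))) :
    hochGr (curvedOn f (cap U J)) (starCut t f g J M w) =
      ((-1 : ℂ) ^ M.card) • starCut t f g J M (hochGr (curvedOn f (cap U J)) w) := by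
  have h1 := gr_starTrace t f g (cap U J) (memberList U (cap U J) M) w
  rw [length_memberList (cap_le h)] at h1
  exact h1

/-- `chartCut` on words in the endomorphisms of `P_i` that are multiplications by functions. -/
def yonedaCut (J M : Finset (Fin N)) :
    HochII ((curvedPresheaf f).obj (op (cap U J))) →ₗ[ℂ]
      HochII ((curvedPresheaf f).obj (op (cap U J))) :=
  ((-1 : ℂ) ^ M.card) • (chartCut t f J M).comp (hochMap ((flatYoneda P f i).app (op (cap U J))))

/-- The signs of the cup product for `σ = -1`, together with the sign `(-1)^|M|` in `yonedaCut`,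
differ from those for `σ = 1` by a factor that depends on `J` only. -/
theorem cup_yonedaCut (c : CechHochII (curvedPresheaf f) U) (J : CechIndex N) :
    ((-1 : ℂ) ^ (J.1.card + 1)) • cup (-1) (yonedaCut (i := i) t f) c J =
      -(flatTrace t f (cechMap U (flatYoneda P f i) c) J) := by
  rw [flatTrace, cup_apply, cup_apply, cupSum, cupSum, Finset.smul_sum, ← Finset.sum_neg_distrib]
  refine Finset.sum_congr rfl fun k hk => ?_
  rw [yonedaCut, LinearMap.smul_apply, LinearMap.comp_apply, component_cechMap _ (show highPart J.1 k ⊆ J.1 from Finset.filter_subset _ _),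
    lowPart_card hk, smul_smul, smul_smul, ← neg_smul, ← place_add_highPart_card (J := J.1) (i := k)]
  refine congrArg₂ (· • ·) ?_ rfl
  rw [cupSign, cupSign, one_pow, one_mul]
  rcases neg_one_pow_eq_or ℂ (place J.1 k) with h | h <;>
  rcases neg_one_pow_eq_or ℂ (highPart J.1 k).card with h' | h' <;>
    simp only [pow_succ, pow_add _ (place J.1 k), h, h'] <;> ring

/-- The whole space acts as an extra last vertex of the simplex `J`. The value on the empty set
gives the identity (`starTrace_nil`), and the face opposite to the extra vertex gives the trace
after the Yoneda map. -/
theorem cechD_starCup (g : Trivialisation (P i) ⊤ (1, 0)) (c : CechHochII (curvedPresheaf f) U) :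
    cechD (curvedPresheaf f) U (cup (-1) (starCut t f g) c) =
      c - flatTrace t f (cechMap U (flatYoneda P f i) c) -
        cup (-1) (starCut t f g) (cechD (curvedPresheaf f) U c) := by
  funext J
  have h1 := cechD_cup (σ := -1) (F := starCut t f g) (by norm_num) (capRes_starCut t f g)
    (yonedaCut (i := i) t f) (fun {J M} h _ w =>
    (hochD_starCut t f g h w).trans (by rw [pow_succ', neg_one_mul, neg_one_mul, neg_neg]; rfl)) c J
  rw [cup_yonedaCut, starCut_empty, ← mul_pow, neg_one_mul, neg_neg, one_pow, one_smul,
    neg_one_smul] at h1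
  rw [h1, Pi.sub_apply, Pi.sub_apply]
  abel

theorem cechGr_starCup (g : Trivialisation (P i) ⊤ (1, 0)) (c : CechHochII (curvedPresheaf f) U) :
    cup (-1) (starCut t f g) (cechGr (curvedPresheaf f) U c) =
      -cechGr (curvedPresheaf f) U (cup (-1) (starCut t f g) c) := by
  have := cechGr_cup (σ := -1) (F := starCut t f g) (fun {J M} h _ w =>
    (gr_starCut t f g h w).trans (by rw [pow_succ', neg_one_mul, neg_one_mul, neg_neg]; rfl)) c
  rw [neg_one_smul] at this
  rw [this, neg_neg]

theorem flatTrace_comp_yoneda (g : Trivialisation (P i) ⊤ (1, 0)) :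
    SuperComplex.Htpy (A := cechComplex (curvedPresheaf f) U)
      (B := cechComplex (curvedPresheaf f) U)
      ((flatTrace t f).comp (cechMap U (flatYoneda P f i))) LinearMap.id :=
  SuperComplex.Htpy.symm ⟨cup (-1) (starCut t f g), cechGr_starCup t f g, fun c =>
    eq_add_of_sub_eq (cechD_starCup t f g c).symm⟩

end Star

end Charts

/-! ### Homotopies to the identity up to a nilpotent error. -/

namespace SuperComplex
variable {A B : SuperComplex}

theorem IsChainMap.sub {f g : A.V →ₗ[ℂ] B.V} (hf : IsChainMap f) (hg : IsChainMap g) :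
    IsChainMap (f - g) :=
  ⟨fun v => by simp [hf.map_gr, hg.map_gr], fun v => by simp [hf.map_D, hg.map_D]⟩

theorem IsChainMap.of_odd {s : A.V →ₗ[ℂ] B.V} (hs : ∀ v, s (A.gr v) = -B.gr (s v)) :
    IsChainMap (B.D.comp s + s.comp A.D) :=
  ⟨fun v => by simp [hs, A.D_gr, B.D_gr], fun v => by simp [A.D_D, B.D_D]⟩

/-- `id - Φ` is idempotent up to homotopy because `Φ` is. By means of `s` it is homotopic to a
nilpotent map, so `Htpy.zero_of_nilpotent` applies to it. -/
theorem Htpy.id_of_nilpotent {Φ s : A.V →ₗ[ℂ] A.V} (hΦ : IsChainMap Φ) (hΦΦ : Htpy (Φ.comp Φ) Φ)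
    (hs : ∀ v, s (A.gr v) = -A.gr (s v)) {n : ℕ}
    (hn : (LinearMap.id - Φ - (A.D.comp s + s.comp A.D) : Module.End ℂ A.V) ^ (n + 1) = 0) :
    Htpy Φ LinearMap.id := by
  have hff : Htpy ((LinearMap.id - Φ).comp (LinearMap.id - Φ)) (LinearMap.id - Φ) := by
    obtain ⟨u, hu, eu⟩ := hΦΦ
    refine ⟨u, hu, fun v => (Eq.trans ?_ (eu v))⟩
    simp only [LinearMap.comp_apply, LinearMap.sub_apply, LinearMap.id_apply, map_sub]
    abel
  have hf := IsChainMap.id.sub hΦ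
  obtain ⟨u, hu, eu⟩ := (Htpy.zero_of_nilpotent hf (hf.sub (IsChainMap.of_odd hs))
    ⟨s, hs, fun v => by simp⟩ hff hn).symm
  refine ⟨u, hu, fun v => Eq.trans ?_ (eu v)⟩
  simp

end SuperComplex

/-! ### The filtration by Čech degree. -/

section Filtration
open TopologicalSpace Opposite
variable {Y : TopCat.{0}} {E E' : TopCat.Presheaf CdgCat Y} {n : ℕ} {W : Fin n → Opens Y}

/-- The first element of an index of the Čech complex. -/
def leader (J : CechIndex n) : Fin n := J.1.min' J.2

theorem leader_mem (J : CechIndex n) : leader J ∈ J.1 := Finset.min'_mem _ _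

theorem component_eq_zero {J T : Finset (Fin n)} (c : CechHochII E W)
    (hc : ∀ T' : CechIndex n, T'.1 = T → c T' = 0) : component J T c = 0 := by
  by_cases h : T.Nonempty ∧ T ⊆ J
  · rw [component_of h.1 h.2, hc _ rfl, map_zero]
  · rw [component, dif_neg h, LinearMap.zero_apply]

/-- If the components with fewer indices vanish, only the decomposition of `J` whose upper part is
all of `J` contributes; its shared index is the first member of `J`. So modulo higher Čech degree
the cup product acts componentwise. -/
theorem cup_one_leading {F : ∀ J : Finset (Fin n), Finset (Fin n) →
      (HochII (E.obj (op (cap W J))) →ₗ[ℂ] HochII (E'.obj (op (cap W J))))}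
    (c : CechHochII E W) (J : CechIndex n) (hc : ∀ T : CechIndex n, T.1.card < J.1.card → c T = 0) :
    cup 1 F c J = F J.1 {leader J} (c J) := by
  rw [cup_apply, cupSum, Finset.sum_eq_single (leader J)]
  · have h1 : highPart J.1 (leader J) = J.1 :=
      Finset.filter_true_of_mem fun x hx => Finset.min'_le _ _ hx
    have h2 : lowPart J.1 (leader J) = {leader J} := by
      ext x
      simp only [lowPart, Finset.mem_filter, Finset.mem_singleton]
      exact ⟨fun h => le_antisymm h.2 (Finset.min'_le _ _ h.1), fun h => by
        subst h; exact ⟨leader_mem J, le_rfl⟩⟩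
    have h3 : place J.1 (leader J) = 0 := by
      have := place_add_highPart_card (J := J.1) (i := leader J)
      rw [h1] at this
      omega
    rw [h1, h2, h3, component_self]
    simp [cupSign]
  · intro i hi hne
    rw [component_eq_zero c, map_zero, smul_zero]
    intro T hT
    apply hc
    rw [hT]
    refine Finset.card_lt_card (Finset.filter_ssubset.2 ⟨leader J, leader_mem J, fun h => ?_⟩)
    exact hne (le_antisymm h (Finset.min'_le _ _ hi))
  · exact fun h => absurd (leader_mem J) h

/-- A map defined on each component of the Čech complex, with the sign of the Čech degree. -/
def levelwise (h : ∀ J : CechIndex n, HochII (E.obj (op (cap W J.1))) →ₗ[ℂ]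
    HochII (E'.obj (op (cap W J.1)))) : CechHochII E W →ₗ[ℂ] CechHochII E' W :=
  LinearMap.pi fun J => ((-1 : ℂ) ^ (J.1.card + 1)) • (h J).comp (LinearMap.proj J)

theorem levelwise_apply (h : ∀ J : CechIndex n, HochII (E.obj (op (cap W J.1))) →ₗ[ℂ]
    HochII (E'.obj (op (cap W J.1)))) (c : CechHochII E W) (J : CechIndex n) :
    levelwise h c J = ((-1 : ℂ) ^ (J.1.card + 1)) • h J (c J) := rfl

variable {h k : ∀ J : CechIndex n, HochII (E.obj (op (cap W J.1))) →ₗ[ℂ] HochII (E.obj (op (cap W J.1)))}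

theorem cechGr_levelwise (hgr : ∀ J w, h J (hochGr _ w) = -hochGr _ (h J w)) (c : CechHochII E W) :
    levelwise h (cechGr E W c) = -cechGr E W (levelwise h c) := by
  funext J
  rw [levelwise_apply, cechGr_apply, Pi.neg_apply, cechGr_apply, levelwise_apply, map_smul, hgr,
    map_smul, smul_neg, smul_neg]

/-- The family `h` need not commute with restrictions. On cochains whose components with fewer
indices vanish, the Čech faces do not contribute to the component `J`, and the formula for a single
intersection survives. The signs `(-1)^p` of the two factors cancel. -/
theorem cechD_levelwise (hD : ∀ J w, hochD _ (h J w) = w - k J w - h J (hochD _ w))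
    (c : CechHochII E W) (J : CechIndex n) (hc : ∀ T : CechIndex n, T.1.card < J.1.card → c T = 0) :
    cechD E W (levelwise h c) J + levelwise h (cechD E W c) J = c J - k J (c J) := by
  have hz : ∀ j ∈ J.1, ∀ c' : CechHochII E W, (∀ T : CechIndex n, T.1.card < J.1.card → c' T = 0) →
      ((-1 : ℂ) ^ place J.1 j) • component J.1 (J.1.erase j) c' = 0 := by
    intro j hj c' hc'
    rw [component_eq_zero c', smul_zero]
    intro T hT
    exact hc' T (by rw [hT]; exact Finset.card_erase_lt_of_mem hj)
  rw [levelwise_apply, cechD_apply, cechD_apply, Finset.sum_eq_zero fun j hj => hz j hj c hc,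
    Finset.sum_eq_zero fun j hj => hz j hj (levelwise h c) fun T hT => by
      rw [levelwise_apply, hc T hT, map_zero, smul_zero],
    zero_add, zero_add, levelwise_apply, map_smul, map_smul, smul_smul, smul_smul, ← mul_pow,
    neg_one_mul, neg_neg, one_pow, one_smul, one_smul, hD]
  abel

/-- The error `R` left by the componentwise homotopy raises the Čech degree, by `cechD_levelwise`
and `hk`. There are finitely many degrees, so `R` is nilpotent. -/
theorem htpy_id_of_levelwise {Φ : CechHochII E W →ₗ[ℂ] CechHochII E W}
    (hΦ : SuperComplex.IsChainMap (A := cechComplex E W) (B := cechComplex E W) Φ)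
    (hΦΦ : SuperComplex.Htpy (A := cechComplex E W) (B := cechComplex E W) (Φ.comp Φ) Φ)
    (hgr : ∀ J w, h J (hochGr _ w) = -hochGr _ (h J w))
    (hD : ∀ J w, hochD _ (h J w) = w - k J w - h J (hochD _ w))
    (hk : ∀ (c : CechHochII E W) (J : CechIndex n),
      (∀ T : CechIndex n, T.1.card < J.1.card → c T = 0) → Φ c J = k J (c J)) :
    SuperComplex.Htpy (A := cechComplex E W) (B := cechComplex E W) Φ LinearMap.id := by
  set R : CechHochII E W →ₗ[ℂ] CechHochII E W :=
    LinearMap.id - Φ - ((cechD E W).comp (levelwise h) + (levelwise h).comp (cechD E W)) with hR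
  have hfil : ∀ m (c : CechHochII E W) (J : CechIndex n), J.1.card ≤ m →
      ((R : Module.End ℂ (CechHochII E W)) ^ m) c J = 0 := by
    intro m
    induction m with
    | zero => exact fun c J hJ => absurd J.2.card_pos (by omega)
    | succ m ih =>
      intro c J hJ
      rw [pow_succ', Module.End.mul_apply]
      have hc : ∀ T : CechIndex n, T.1.card < J.1.card →
          ((R : Module.End ℂ (CechHochII E W)) ^ m) c T = 0 := fun T hT => ih c T (by omega)
      generalize ((R : Module.End ℂ (CechHochII E W)) ^ m) c = c' at hc
      have h1 := cechD_levelwise hD c' J hc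
      have h2 := hk c' J hc
      change (c' J - Φ c' J) - (cechD E W (levelwise h c') J + levelwise h (cechD E W c') J) = 0
      rw [h1, h2, sub_self]
  have hn : (R : Module.End ℂ (CechHochII E W)) ^ (n + 1) = 0 := by
    refine LinearMap.ext fun c => funext fun J => hfil (n + 1) c J ?_
    -- An index set has at most `n` members; the power `m` kills all components with at most `m` of
    -- them.
    exact (Finset.card_le_univ _).trans (by simp)
  exact SuperComplex.Htpy.id_of_nilpotent (A := cechComplex E W) hΦ hΦΦ (cechGr_levelwise hgr) hn

end Filtration

/-! ### Local homotopy between the identity and Yoneda after the trace in one chart. -/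

section Split
open AlgebraicGeometry Opposite TopologicalSpace QFact
variable {X : Scheme.{0}} [X.Over (Spec (.of ℂ))] {N r : ℕ} {U : Fin N → X.Opens}
  {P : Fin r → QFact X} {rk : Fin r → ℕ × ℕ} (t : ∀ i j, Trivialisation (P i) (U j) (rk i))
  (f : Γ(X, ⊤)) {i : Fin r} (g : Trivialisation (P i) ⊤ (1, 0)) (V : X.Opens)

theorem elementary_comp_elementary {P Q : QFact X} {O O' V : X.Opens} {a : ℕ × ℕ}
    (g : Trivialisation P O (1, 0)) (t : Trivialisation Q O' a) (hV : V ≤ O) (hV' : V ≤ O')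
    (l : Idx a) : QFact.comp (elementary t g hV' hV default l) (elementary g t hV hV' l default) =
      scalar P (1 : Γ(X, V)) := by
  rw [elementary_comp, if_pos rfl, ← sum_elementary g hV, Fintype.sum_unique]

/-- The decomposition of `P_x` into copies of the structure sheaf `P_i` given by a trivialisation. -/
def frameSplitting (c : Chart U V) (x : Fin r) : Splitting (flatOn P f V) x where
  I := Idx (rk x)
  fin := inferInstance
  ob _ := i
  s := idxSign
  s_eq := idxSign_eq
  inc l := elementary g (t x c.1) le_top c.2 l default
  prj l := elementary (t x c.1) g c.2 le_top default l
  sum_inc_prj := by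
    refine (Finset.sum_congr rfl fun l _ => ?_).trans (sum_elementary (t x c.1) c.2)
    exact (elementary_comp (t x c.1) g (t x c.1) c.2 le_top c.2 l default default l).trans (if_pos rfl)
  prj_inc l := elementary_comp_elementary g (t x c.1) le_top c.2 l
  prj_inc_ne l l' h :=
    (elementary_comp g (t x c.1) g le_top c.2 le_top default l l' default).trans (if_neg h)
  gr_inc l := (gr_elementary g (t x c.1) le_top c.2 l default).trans
    (congrArg (· • _) (mul_one _))
  gr_prj l := (gr_elementary (t x c.1) g c.2 le_top default l).trans
    (congrArg (· • _) (one_mul _))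

/-- The decompositions given by the members of the cover, and the trivial one. -/
def splitting : ∀ (_ : Option (Chart U V)) (x : Fin r), Splitting (flatOn P f V) x
  | none, x => Splitting.trivial (C := flatOn P f V) x
  | some c, x => frameSplitting t f g V c x

/-- The matrices of morphisms with respect to `splitting`. -/
def splitRep : MatRep (blow (Option (Chart U V)) (flatOn P f V)) (flatOn P f V) :=
  Splitting.rep (C := flatOn P f V) (splitting t f g V) fun _ => rfl

theorem splitRep_none : (splitRep t f g V).pre (blowMap (fun _ : Unit => none) (𝟙 (flatOn P f V)))
    (fun _ => rfl) = MatRep.idRep (C := flatOn P f V) (fun _ => rfl) := rfl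

/-- Over a chart the entries with respect to the decomposition into copies of `P_i` are the
multiplications by the matrix entries in the trivialisation, by `elementary_comp_comp`. -/
theorem splitRep_some : (chartRep t f V).post (flatYonedaOn P f i V) =
    (splitRep t f g V).pre (blowMap some (𝟙 (flatOn P f V))) (fun _ => rfl) :=
  MatRep.mk_congr fun {p q : Chart U V × Fin r} (k : Idx (rk q.2)) (l : Idx (rk p.2))
      (α : Hom V (P p.2) (P q.2)) =>
    (elementary_comp_comp (t p.2 p.1.1) (t q.2 q.1.1) p.1.2 q.1.2 (g := g) k l default default α).symm

/-- The homotopy between the two ways to take traces. -/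
def splitCut (c : Chart U V) : HochII (flatOn P f V) →ₗ[ℂ] HochII (flatOn P f V) :=
  (splitRep t f g V).cut [some c, none]

theorem splitRep_cut_none (w : HochII (flatOn P f V)) : (splitRep t f g V).cut [none] w = w := by
  have h1 := (splitRep t f g V).cut_pre (fun _ : Unit => none) (𝟙 (flatOn P f V)) (fun _ => rfl) [()] w
  rw [hochMap_id, splitRep_none] at h1
  exact h1.symm.trans (MatRep.cut_idRep (C := flatOn P f V) (fun _ => rfl) w)

theorem splitRep_cut_some (c : Chart U V) (w : HochII (flatOn P f V)) :
    (splitRep t f g V).cut [some c] w = hochMap (flatYonedaOn P f i V) ((chartRep t f V).cut [c] w) := by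
  have h1 := MatRep.cut_natural (splitRep_some t f g V) [c] w
  rw [hochMap_id] at h1
  exact h1.symm

/-- The boundary formula for a list with two members. Dropping the chart leaves the trivial
decomposition, whose trace is the identity; dropping the trivial one leaves the trace in the chart,
followed by the Yoneda functor. -/
theorem hochD_splitCut (c : Chart U V) (w : HochII (flatOn P f V)) :
    hochD (flatOn P f V) (splitCut t f g V c w) =
      w - hochMap (flatYonedaOn P f i V) ((chartRep t f V).cut [c] w)
        - splitCut t f g V c (hochD (flatOn P f V) w) := by
  have h1 := (splitRep t f g V).hochD_cut (some c) [none] w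
  rw [List.length_singleton, pow_one, neg_one_smul] at h1
  rw [← splitRep_cut_some t f g V c w]
  refine h1.trans ?_
  simp only [bd]
  rw [splitRep_cut_none t f g V w, splitCut]
  abel

theorem gr_splitCut (c : Chart U V) (w : HochII (flatOn P f V)) :
    splitCut t f g V c (hochGr (flatOn P f V) w) = -hochGr (flatOn P f V) (splitCut t f g V c w) := by
  have h1 := (splitRep t f g V).gr_cut (some c) [none] w
  rw [List.length_singleton, pow_one, neg_one_smul] at h1
  exact (neg_eq_iff_eq_neg.2 h1).symm

end Split

/-! ### Maps of Čech complexes given on each intersection. -/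

section Levels
open TopologicalSpace Opposite
variable {Y : TopCat.{0}} {E E' : TopCat.Presheaf CdgCat Y} {n : ℕ} {W : Fin n → Opens Y}
  (S : ∀ J : Finset (Fin n), HochII (E.obj (op (cap W J))) →ₗ[ℂ] HochII (E'.obj (op (cap W J))))

/-- A map of Čech complexes given on each intersection. -/
def levelMap : CechHochII E W →ₗ[ℂ] CechHochII E' W :=
  LinearMap.pi fun J => (S J.1).comp (LinearMap.proj J)

theorem levelMap_apply (c : CechHochII E W) (J : CechIndex n) : levelMap S c J = S J.1 (c J) := rfl

theorem levelMap_bijective (h : ∀ J, Function.Bijective (S J)) : Function.Bijective (levelMap S) := by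
  constructor
  · intro c c' e
    funext J
    exact (h J.1).1 (congrFun e J)
  · intro c
    choose u hu using fun J : CechIndex n => (h J.1).2 (c J)
    exact ⟨u, funext hu⟩

variable {S}

theorem component_levelMap
    (hS : ∀ {I J : Finset (Fin n)} (h : I ⊆ J) (w), capRes E' W h (S I w) = S J (capRes E W h w))
    {J T : Finset (Fin n)} (hT : T ⊆ J) (c : CechHochII E W) :
    component J T (levelMap S c) = S J (component J T c) := by
  rcases T.eq_empty_or_nonempty with rfl | hne
  · rw [component_empty, component_empty, map_zero]
  rw [component_of hne hT, component_of hne hT, levelMap_apply, hS]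

theorem cechD_levelMap
    (hS : ∀ {I J : Finset (Fin n)} (h : I ⊆ J) (w), capRes E' W h (S I w) = S J (capRes E W h w))
    (hD : ∀ J w, hochD _ (S J w) = S J (hochD _ w)) (c : CechHochII E W) :
    cechD E' W (levelMap S c) = levelMap S (cechD E W c) := by
  funext J
  rw [cechD_apply, levelMap_apply, levelMap_apply, cechD_apply, map_add, map_sum, map_smul, hD]
  refine congrArg (· + _) (Finset.sum_congr rfl fun j _ => ?_)
  rw [map_smul, component_levelMap hS (Finset.erase_subset _ _)]

theorem cechGr_levelMap (hgr : ∀ J w, hochGr _ (S J w) = S J (hochGr _ w)) (c : CechHochII E W) :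
    cechGr E' W (levelMap S c) = levelMap S (cechGr E W c) := by
  funext J
  rw [cechGr_apply, levelMap_apply, levelMap_apply, cechGr_apply, map_smul, hgr]

end Levels

/-! ### The homotopy between Yoneda after the trace and the identity. -/

section Inverse
open AlgebraicGeometry Opposite TopologicalSpace QFact
variable {X : Scheme.{0}} [X.Over (Spec (.of ℂ))] {N r : ℕ} {U : Fin N → X.Opens}
  {P : Fin r → QFact X} {rk : Fin r → ℕ × ℕ} (t : ∀ i j, Trivialisation (P i) (U j) (rk i))
  (f : Γ(X, ⊤)) {i : Fin r} (g : Trivialisation (P i) ⊤ (1, 0))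

theorem memberList_singleton {V : X.Opens} (j : Chart U V) : memberList U V {j.1} = [j] :=
  (eq_memberList (by simp [j.2]) (by simp)).symm

variable (U) in
/-- The first member of the cover in an index of the Čech complex. -/
def leadingChart (J : CechIndex N) : Chart U (cap U J.1) :=
  ⟨leader J, Finset.inf_le (leader_mem J)⟩

theorem chartCut_leader (J : CechIndex N) : chartCut t f J.1 {leader J} =
    (chartRep t f (cap U J.1)).cut [leadingChart U J] := by
  rw [← memberList_singleton (leadingChart U J)]; rfl

attribute [local irreducible] flatOn

/-- Modulo higher Čech degree the composite is, on `J`, the trace in the chart of the first member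
of `J`, so the local homotopy is taken for that chart. Idempotence up to homotopy follows from the
other composite, `flatTrace_comp_yoneda`. -/
theorem yoneda_comp_flatTrace (g : Trivialisation (P i) ⊤ (1, 0)) :
    SuperComplex.Htpy (A := cechComplex (flatPresheaf P f) U) (B := cechComplex (flatPresheaf P f) U)
      ((cechMap U (flatYoneda P f i)).comp (flatTrace t f)) LinearMap.id := by
  have hy := cechMap_isChainMap U (flatYoneda P f i)
  have hψ := flatTrace_isChainMap t f (U := U)
  refine htpy_id_of_levelwise (h := fun J => splitCut t f g (cap U J.1) (leadingChart U J))
    (k := fun J => (hochMap ((flatYoneda P f i).app (op (cap U J.1)))).comp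
      (chartCut t f J.1 {leader J})) (hy.comp hψ)
    (((flatTrace_comp_yoneda t f g).comp_left hy).comp_right hψ)
    (fun J w => gr_splitCut t f g (cap U J.1) (leadingChart U J) w) (fun J w => ?_) (fun c J hc => ?_)
  · refine (hochD_splitCut t f g (cap U J.1) (leadingChart U J) w).trans ?_
    rw [← chartCut_leader t f J]
    rfl
  · exact congrArg (hochMap ((flatYoneda P f i).app (op (cap U J.1)))) (cup_one_leading c J hc)

end Inverse

/-! ### The twist for the categories of the `P_i`. -/

section Twist
open AlgebraicGeometry Opposite TopologicalSpace QFact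
variable {X : Scheme.{0}} [X.Over (Spec (.of ℂ))] {N r : ℕ} (U : Fin N → X.Opens)
  (P : Fin r → QFact X) (f : Γ(X, ⊤))

/-- The twist by `δ`, from the Hochschild complex of the `P_i` over `V` to that of the category with
zero differential. -/
def twistOn (V : X.Opens) : HochII (qvectOn P f V) →ₗ[ℂ] HochII (flatOn P f V) :=
  twistFlat (C := qvectOn P f V) (fun x => delta (P x)) (gr_scalar_neg P f V) (scalar_central P f V)

/-- The twist by `δ` of Čech complexes. -/
def cechTwist : CechHochII (qvectPresheaf P f) U →ₗ[ℂ] CechHochII (flatPresheaf P f) U :=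
  levelMap fun J => twistOn P f (cap U J)

theorem hochD_twist_delta (V : X.Opens) (w : HochII (qvectOn P f V)) :
    hochD (flatOn P f V) (twistOn P f V w) =
    twistOn P f V (hochD (qvectOn P f V) w) :=
  hochD_twistFlat (C := qvectOn P f V) (fun x => delta (P x)) (gr_scalar_neg P f V)
    (scalar_central P f V) (fun x => gr_delta) (fun x : Fin r =>
      (sub_eq_add_neg _ _).trans (congrArg (_ + ·) (map_neg (scalar (P x)) _).symm)) (fun a => diff_eq a) w

theorem gr_twist_delta (V : X.Opens) (w : HochII (qvectOn P f V)) :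
    hochGr (flatOn P f V) (twistOn P f V w) =
    twistOn P f V (hochGr (qvectOn P f V) w) :=
  (hochGr_flatHoch (gr_scalar_neg P f V) (scalar_central P f V) _).trans
    (gr_twist (C := qvectOn P f V) (fun x => delta (P x)) (fun _ => gr_delta) w)

theorem hochMap_twist_delta {V V' : X.Opens} (h : V' ≤ V) (w : HochII (qvectOn P f V)) :
    hochMap (flatRes P f h) (twistOn P f V w) =
    twistOn P f V' (hochMap (qvectRes P f h) w) :=
  (hochMap_flatHoch (gr_scalar_neg P f V) (scalar_central P f V) (gr_scalar_neg P f V')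
    (scalar_central P f V') (qvectRes P f h) _ _).trans
    (hochMap_twist (C := qvectOn P f V) (C' := qvectOn P f V') (fun x => delta (P x)) (qvectRes P f h)
      (fun x => delta (P x)) (fun _ => rfl) w)

theorem twist_delta_yoneda {i : Fin r} (h₀ : (P i).δ₀ = 0) (h₁ : (P i).δ₁ = 0) (V : X.Opens)
    (w : HochII (curvedOn f V)) :
    twistOn P f V (hochMap (yonedaOn P f i h₀ h₁ V) w) =
    hochMap (flatYonedaOn P f i V) w :=
  (twist_hochMap (C := qvectOn P f V) (fun x => delta (P x)) (yonedaOn P f i h₀ h₁ V)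
    (fun _ => delta_eq_zero (P i) h₀ h₁) w).trans
  (hochMap_flatLift (gr_scalar_neg P f V) (scalar_central P f V) (yonedaOn P f i h₀ h₁ V)
    (fun _ => rfl) (fun _ => rfl) w).symm

theorem twistOn_bijective (V : X.Opens) : Function.Bijective (twistOn P f V) :=
  twist_bijective (C := qvectOn P f V) (fun x => delta (P x))

end Twist

/-! ### The twist on Čech complexes. -/

section CechTwist
open AlgebraicGeometry Opposite TopologicalSpace QFact
variable {X : Scheme.{0}} [X.Over (Spec (.of ℂ))] {N r : ℕ} (U : Fin N → X.Opens)
  (P : Fin r → QFact X) (f : Γ(X, ⊤))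

attribute [local irreducible] flatOn qvectOn

theorem hochGr_twistOn (J : Finset (Fin N)) (w : HochII ((qvectPresheaf P f).obj (op (cap U J)))) :
    hochGr ((flatPresheaf P f).obj (op (cap U J))) (twistOn P f (cap U J) w) =
      twistOn P f (cap U J) (hochGr ((qvectPresheaf P f).obj (op (cap U J))) w) :=
  gr_twist_delta P f (cap U J) w

theorem hochD_twistOn (J : Finset (Fin N)) (w : HochII ((qvectPresheaf P f).obj (op (cap U J)))) :
    hochD ((flatPresheaf P f).obj (op (cap U J))) (twistOn P f (cap U J) w) =
      twistOn P f (cap U J) (hochD ((qvectPresheaf P f).obj (op (cap U J))) w) :=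
  hochD_twist_delta P f (cap U J) w

theorem capRes_twistOn {I J : Finset (Fin N)} (h : I ⊆ J)
    (w : HochII ((qvectPresheaf P f).obj (op (cap U I)))) :
    capRes (flatPresheaf P f) U h (twistOn P f (cap U I) w) =
      twistOn P f (cap U J) (capRes (qvectPresheaf P f) U h w) :=
  hochMap_twist_delta P f (cap_mono U h) w

theorem cechTwist_isChainMap : SuperComplex.IsChainMap (A := cechComplex (qvectPresheaf P f) U)
    (B := cechComplex (flatPresheaf P f) U) (cechTwist U P f) where
  map_gr c := (cechGr_levelMap (hochGr_twistOn U P f) c).symm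
  map_D c := (cechD_levelMap (capRes_twistOn U P f) (hochD_twistOn U P f) c).symm

theorem cechTwist_bijective : Function.Bijective (cechTwist U P f) :=
  levelMap_bijective _ fun J => twistOn_bijective P f (cap U J)

theorem cechTwist_comp_yoneda {i : Fin r} (h₀ : (P i).δ₀ = 0) (h₁ : (P i).δ₁ = 0) :
    (cechTwist U P f).comp (cechMap U (yoneda P f i h₀ h₁)) = cechMap U (flatYoneda P f i) :=
  LinearMap.ext fun c => funext fun J => twist_delta_yoneda P f h₀ h₁ (cap U J.1) (c J)

end CechTwist

/-! ### The explicit supertrace with values in functions. -/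

section Supertrace
open AlgebraicGeometry Opposite TopologicalSpace QFact Words
variable {X : Scheme.{0}} [X.Over (Spec (.of ℂ))] (f : Γ(X, ⊤)) (V : X.Opens)

/-- The object of `curvedOn`. -/
def pt : (curvedOn f V).Ob := ()

theorem koszul_curvedOn (k : ℕ) {x z : (curvedOn f V).Ob} (w : Word (curvedOn f V).Hom k x z) :
    koszul (curvedOn f V) k w = ((-1 : ℂ) ^ (k + 1)) • w := by
  refine Word.wordInd (p := fun k x w => koszul (curvedOn f V) k (x := x) (z := z) w =
    ((-1 : ℂ) ^ (k + 1)) • w) ?_ ?_ ?_ ?_ k x w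
  · intro k x v w hv hw; rw [map_add, hv, hw, smul_add]
  · intro k x; rw [map_zero, smul_zero]
  · intro x a
    rw [koszul_single, zero_add, pow_one, neg_one_smul]; rfl
  · intro k x y a w hw
    rw [koszul_cons, hw, map_smul, ← neg_smul, pow_succ (-1 : ℂ) (k + 1), mul_neg_one]
    rfl

/-- All letters are even functions, so `T` is the sign `(-1)^(K+1)` on words of length `K`. Thus
`tau` produces the exponent `(k + 1)|l₀|` in the sign of `sTr`. -/
theorem tau_curvedOn {x z : (curvedOn f V).Ob} {s : ℂ} (hs : s = 1 ∨ s = -1)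
    (w : Words (curvedOn f V) x z) (K : ℕ) :
    (MatRep.tau (B := curvedOn f V) s w) K = s ^ (K + 1) • w K := by
  rcases hs with rfl | rfl
  · rw [MatRep.tau_one, one_pow, one_smul]
  · rw [MatRep.tau_neg_one, ← koszul_curvedOn]
    rfl

/-- An entry of a matrix as a morphism of `curvedOn`. -/
def entryHom {a b : ℕ × ℕ} (i : Idx a) (j : Idx b) :
    MatHom V b a →ₗ[ℂ] (curvedOn f V).Hom (pt f V) (pt f V) := matEntry i j

/-- The entry `(i, j)` of a word of matrices, with signs. -/
def strHom (k : ℕ) {a b : ℕ × ℕ} (i : Idx a) (j : Idx b) :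
    Word (MatHom V) k a b →ₗ[ℂ] Word (curvedOn f V).Hom k (pt f V) (pt f V) := strWord f V k i j

theorem strHom_cons {k : ℕ} {a b c : ℕ × ℕ} (i : Idx a) (j : Idx b) (A : MatHom V c a)
    (w : Word (MatHom V) k c b) : strHom f V (k + 1) i j (Word.cons A w) =
      ∑ l : Idx c, idxSign l • Word.cons (entryHom f V i l A) (strHom f V k l j w) := by
  have h : (∑ l : Idx c, idxSign l • (Word.cons (Q := (curvedOn f V).Hom)).compl₁₂
      (entryHom f V i l) (strHom f V k l j)) A w =
      ∑ l : Idx c, idxSign l • Word.cons (entryHom f V i l A) (strHom f V k l j w) := by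
    rw [LinearMap.sum_apply, LinearMap.sum_apply]
    rfl
  exact (Word.lift_cons _ A w).trans h

/-- The entry `(i, j)` of a sum of words of matrices, with signs. -/
def strSum {a b : ℕ × ℕ} (i : Idx a) (j : Idx b) :
    WordSum (MatHom V) a b →ₗ[ℂ] Words (curvedOn f V) (pt f V) (pt f V) :=
  DirectSum.lmap fun k => strHom f V k i j

theorem strSum_single {a b : ℕ × ℕ} (i : Idx a) (j : Idx b) (A : MatHom V b a) :
    strSum f V i j (WordSum.single A) =
      sg (C := curvedOn f V) (entryHom f V i j A) :=
  DirectSum.lmap_lof _ _ _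

theorem strSum_cons {a b c : ℕ × ℕ} (i : Idx a) (j : Idx b) (A : MatHom V c a)
    (w : WordSum (MatHom V) c b) : strSum f V i j (WordSum.cons A w) =
      ∑ l : Idx c, idxSign l • cn (entryHom f V i l A) (strSum f V l j w) := by
  induction w using DirectSum.induction_on with
  | zero => simp
  | add v w hv hw => simp only [map_add, hv, hw, smul_add, Finset.sum_add_distrib]
  | of k w =>
    have h1 : WordSum.cons A (DirectSum.of (fun k => Word (MatHom V) k c b) k w) =
        DirectSum.lof ℂ ℕ (fun k => Word (MatHom V) k a b) (k + 1) (Word.cons A w) := by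
      rw [← DirectSum.lof_eq_of ℂ]
      simp [WordSum.cons]
    have h2 : ∀ l : Idx c, strSum f V l j (DirectSum.of (fun k => Word (MatHom V) k c b) k w) =
        ι k (strHom f V k l j w) := by
      intro l
      rw [← DirectSum.lof_eq_of ℂ]
      exact DirectSum.lmap_lof _ _ _
    rw [h1]
    refine (DirectSum.lmap_lof _ _ _).trans ?_
    rw [strHom_cons, map_sum]
    refine Finset.sum_congr rfl fun l _ => ?_
    rw [h2, cn_ι, map_smul]
    rfl

theorem strSum_apply {a b : ℕ × ℕ} (i : Idx a) (j : Idx b) (w : WordSum (MatHom V) a b) (K : ℕ) :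
    strSum f V i j w K = strHom f V K i j (w K) := DirectSum.lmap_apply _ _ _

end Supertrace

/-! ### The explicit words of `h^q` as matrices of inserted identities. -/

section Compare
open AlgebraicGeometry Opposite TopologicalSpace QFact Words
variable {X : Scheme.{0}} [X.Over (Spec (.of ℂ))] {N r : ℕ} {U : Fin N → X.Opens}
  {P : Fin r → QFact X} {rk : Fin r → ℕ × ℕ} (t : ∀ i j, Trivialisation (P i) (U j) (rk i))
  (f : Γ(X, ⊤)) (V : X.Opens)

/-- An object of `flatOn`. -/
def vert (P : Fin r → QFact X) (x : Fin r) : (flatOn P f V).Ob := x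

/-- The entry `(i, j)` of a word of morphisms of the `P_x`, with signs. -/
def chartStr {b e : Chart U V} {x z : Fin r} (i : Idx (rk x)) (j : Idx (rk z)) :
    Words (blow (Chart U V) (flatOn P f V)) (bo b (vert f V P x)) (bo e (vert f V P z)) →ₗ[ℂ] Words (curvedOn f V) (pt f V) (pt f V) :=
  (chartRep t f V).str i j

/-- The entry `(i, j)` of a morphism. -/
def chartEntry {b e : Chart U V} {x z : Fin r} (i : Idx (rk x)) (j : Idx (rk z)) :
    (blow (Chart U V) (flatOn P f V)).Hom (bo e (vert f V P z)) (bo b (vert f V P x)) →ₗ[ℂ]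
      (curvedOn f V).Hom (pt f V) (pt f V) := (chartRep t f V).e i j

/-- The identity from the `c`-copy to the `b`-copy. -/
def idLetter (P : Fin r → QFact X) (f : Γ(X, ⊤)) {V : X.Opens} (b c : Chart U V) (x : Fin r) :
    (blow (Chart U V) (flatOn P f V)).Hom (bo c (vert f V P x)) (bo b (vert f V P x)) :=
  lbl (C := flatOn P f V) b c ((flatOn P f V).one (vert f V P x))

/-- A morphism as a morphism of `c`-copies. -/
def letter (f : Γ(X, ⊤)) {V : X.Opens} (c : Chart U V) {x y : Fin r} (α : Hom V (P y) (P x)) :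
    (blow (Chart U V) (flatOn P f V)).Hom (bo c (vert f V P y)) (bo c (vert f V P x)) :=
  lbl (C := flatOn P f V) c c (α : (flatOn P f V).Hom (vert f V P y) (vert f V P x))

section
variable {t f V}
variable {b c e : Chart U V} {x y z : Fin r}

/-- A change of basis matrix is the matrix of the identity between two copies. The comparison of
`hWord` with `ins` rests on this. -/
theorem entryHom_transition (i l : Idx (rk x)) : entryHom f V i l (transition t b c x) =
    chartEntry t f V i l (idLetter P f b c x) := by
  refine (LinearMap.toMatrix_apply (frameAt t c x) (frameAt t b x) LinearMap.id i l).trans ?_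
  change _ = (frameAt t b x).repr (app (scalar (P x) 1) ⟨V, le_rfl⟩ (frameAt t c x l)) i
  rw [scalar_app, map_one, one_smul]
  rfl

theorem entryHom_matrixOf (i : Idx (rk x)) (l : Idx (rk y)) (α : Hom V (P y) (P x)) :
    entryHom f V i l (matrixOf t c α) = chartEntry t f V i l (letter f c α) :=
  LinearMap.toMatrix_apply (frameAt t c y) (frameAt t c x) (app α ⟨V, le_rfl⟩) i l

/-- The factor `g` at the first letter corresponds to the multiplication by the identity from the
first to the last copy in `insCyc`. -/
theorem entryHom_matMul (i : Idx (rk x)) (l : Idx (rk y)) (α : Hom V (P y) (P x)) :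
    entryHom f V i l (matMul (transition t b c x) (matrixOf t c α)) = chartEntry t f V i l
        ((blow (Chart U V) (flatOn P f V)).comp (idLetter P f b c x) (letter f c α)) := by
  refine Eq.trans ?_ ((chartRep t f V).e_comp (x := bo c (vert f V P y)) (y := bo c (vert f V P x)) (z := bo b (vert f V P x)) i l
    (idLetter P f b c x) (letter f c α)).symm
  refine (Matrix.mul_apply (M := (transition t b c x : Matrix _ _ _))).trans ?_
  exact Finset.sum_congr rfl fun m _ => congrArg₂ (· * ·) (entryHom_transition i m)
    (entryHom_matrixOf m l α)

theorem chartStr_sg (i : Idx (rk x)) (j : Idx (rk z)) (a) :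
    chartStr t f V (b := b) (e := e) i j (sg a) =
      sg (chartEntry t f V i j a) :=
  (chartRep t f V).str_sg (x := bo b (vert f V P x)) (z := bo e (vert f V P z)) i j a

theorem chartStr_cn (i : Idx (rk x)) (j : Idx (rk z)) (a)
    (w : Words (blow (Chart U V) (flatOn P f V)) (bo c (vert f V P y)) (bo e (vert f V P z))) :
    chartStr t f V (b := b) (e := e) i j (cn a w) =
      ∑ l : Idx (rk y), idxSign l • cn (chartEntry t f V i l a) (chartStr t f V l j w) :=
  (chartRep t f V).str_cn (x := bo b (vert f V P x)) (y := bo c (vert f V P y)) (z := bo e (vert f V P z)) i j a w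

theorem strSum_hEnd (L : List (Chart U V)) (d : Chart U V) (he : EndsAt e L d) (l j : Idx (rk z)) :
    strSum f V l j (hEnd t L d (-transition t c d z)) =
      chartStr t f V (b := c) (e := e) l j (insEnd (C := flatOn P f V) (z := vert f V P z) e d L c) := by
  induction L generalizing c d l with
  | nil =>
    obtain rfl : d = e := he
    rw [hEnd, strSum_single, insEnd, map_neg, map_neg, map_neg]
    refine congrArg (fun u => -u) ((congrArg _ (entryHom_transition l j)).trans
      (chartStr_sg l j _).symm)
  | cons d' L ih =>
    rw [hEnd, LinearMap.flip_apply, strSum_cons, insEnd]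
    refine Eq.trans ?_ (map_neg (chartStr t f V l j) (cn (idLetter P f c d z) (insEnd e d' L d))).symm
    refine Eq.trans ?_ (congrArg (fun u => -u) (chartStr_cn l j (idLetter P f c d z) _)).symm
    rw [← Finset.sum_neg_distrib]
    refine Finset.sum_congr rfl fun m _ => ?_
    rw [ih d' he m, map_neg, map_neg, LinearMap.neg_apply, smul_neg, entryHom_transition]

theorem strSum_hInsert {M : Type} [AddCommGroup M] [Module ℂ M] (v : M)
    (F : List (Chart U V) → Chart U V → (M →ₗ[ℂ] WordSum (MatHom V) (rk y) (rk z)))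
    (w : Words (flatOn P f V) (vert f V P y) (vert f V P z))
    (hF : ∀ L c, EndsAt e L c → ∀ (i : Idx (rk y)) (j : Idx (rk z)), strSum f V i j (F L c v) =
      chartStr t f V i j (ins e L c w))
    (L : List (Chart U V)) (c : Chart U V) (he : EndsAt e L c) (i : Idx (rk y)) (j : Idx (rk z)) :
    strSum f V i j (hInsert t F L c v) = chartStr t f V i j (insA e L c w) := by
  induction L generalizing c i with
  | nil => exact hF [] c he i j
  | cons d L ih =>
    rw [hInsert, LinearMap.add_apply, map_add, hF (d :: L) c he, insA_cons, map_sub, sub_eq_add_neg]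
    refine congrArg (_ + ·) ?_
    refine Eq.trans ?_ (congrArg (fun u => -u) (chartStr_cn i j (idLetter P f c d y) _)).symm
    rw [LinearMap.comp_apply, strSum_cons, ← Finset.sum_neg_distrib]
    refine Finset.sum_congr rfl fun m _ => ?_
    rw [ih d he m, map_neg, map_neg, LinearMap.neg_apply, smul_neg, entryHom_transition]

variable (P f V) in
/-- An object of `qvectOn`. -/
def qvert (x : Fin r) : (qvectOn P f V).Ob := x

/-- A morphism of the `P_x` as a morphism of the category with zero differential. -/
def flatLetter (x y : Fin r) : (qvectOn P f V).Hom (qvert P f V y) (qvert P f V x) →ₗ[ℂ]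
    (flatOn P f V).Hom (vert f V P y) (vert f V P x) := LinearMap.id

variable (P f V) in
/-- A word of morphisms of the `P_x` as a sum of words of the category with zero differential. -/
def flatWord (k : ℕ) (x z : Fin r) : Word (qvectOn P f V).Hom k (qvert P f V x) (qvert P f V z) →ₗ[ℂ]
    Words (flatOn P f V) (vert f V P x) (vert f V P z) :=
  Words.ι (C := flatOn P f V) (x := vert f V P x) (z := vert f V P z) k

theorem flatWord_cons {k : ℕ} (a : (qvectOn P f V).Hom (qvert P f V y) (qvert P f V x))
    (w : Word (qvectOn P f V).Hom k (qvert P f V y) (qvert P f V z)) :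
    flatWord P f V (k + 1) x z (Word.cons a w) =
      cn (C := flatOn P f V) (x := vert f V P x) (y := vert f V P y) (flatLetter x y a)
        (flatWord P f V k y z w) :=
  (cn_ι (C := flatOn P f V) (x := vert f V P x) (y := vert f V P y) (z := vert f V P z) a w).symm

variable (t f V) in
/-- `hWord` for the change of basis from the `c`-copy to the `b`-copy. -/
def matWord (k : ℕ) (L : List (Chart U V)) (b c : Chart U V) (x z : Fin r) :
    Word (qvectOn P f V).Hom k (qvert P f V x) (qvert P f V z) →ₗ[ℂ] WordSum (MatHom V) (rk x) (rk z) :=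
  hWord t f k L c (transition t b c x)

variable (t f V) in
/-- The matrix of a letter of `hWord`. -/
def matLetter (q : ℕ) (b c : Chart U V) (x y : Fin r) :
    (qvectOn P f V).Hom (qvert P f V y) (qvert P f V x) →ₗ[ℂ] MatHom V (rk y) (rk x) :=
  (matMul (transition t b c x)).comp ((matrixOf t c).comp ((-gr : Module.End ℂ _) ^ q))

theorem flatWord_single (a : (qvectOn P f V).Hom (qvert P f V z) (qvert P f V x)) :
    flatWord P f V 0 x z (Word.single a) =
      sg (C := flatOn P f V) (x := vert f V P x) (z := vert f V P z) (flatLetter x z a) := rfl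

theorem matWord_zero (L : List (Chart U V)) (a : (qvectOn P f V).Hom (qvert P f V z) (qvert P f V x)) :
    matWord t f V 0 L b c x z (Word.single a) = hEnd t L c (matLetter t f V L.length b c x z a) := rfl

theorem transition_self : transition t c c x = matOne (rk x) := LinearMap.toMatrix_id _

end

end Compare

section Compare
open AlgebraicGeometry Opposite TopologicalSpace QFact Words
variable {X : Scheme.{0}} [X.Over (Spec (.of ℂ))] {N r : ℕ} {U : Fin N → X.Opens}
  {P : Fin r → QFact X} {rk : Fin r → ℕ × ℕ} (t : ∀ i j, Trivialisation (P i) (U j) (rk i))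
  (f : Γ(X, ⊤)) (V : X.Opens)

section
variable {t f V}
variable {b c e : Chart U V} {x y z : Fin r}

theorem hWord_cons {k : ℕ} (L : List (Chart U V)) (c : Chart U V) (g : MatHom V (rk x) (rk x))
    (a : (qvectOn P f V).Hom (qvert P f V y) (qvert P f V x))
    (w : Word (qvectOn P f V).Hom k (qvert P f V y) (qvert P f V z)) :
    hWord t f (k + 1) L c (x := x) (z := z) g (Word.cons (y := qvert P f V y) a w) =
      WordSum.cons (((matMul g).comp ((matrixOf t c).comp ((-gr : Module.End ℂ _) ^ L.length))) a)
        (hInsert t (fun L i => hWord t f k L i (matOne (rk y))) L c w) := by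
  rw [hWord]
  exact (Word.lift_cons (Q := (qvectOn P f V).Hom) (x := qvert P f V x) (y := qvert P f V y) (z := qvert P f V z) _ a w)

theorem matWord_cons {k : ℕ} (L : List (Chart U V))
    (a : (qvectOn P f V).Hom (qvert P f V y) (qvert P f V x))
    (w : Word (qvectOn P f V).Hom k (qvert P f V y) (qvert P f V z)) :
    matWord t f V (k + 1) L b c x z (Word.cons a w) =
      WordSum.cons (matLetter t f V L.length b c x y a)
        (hInsert t (fun L i => matWord t f V k L i i y z) L c w) := by
  -- Only the first letter of the whole word carries a change of basis; the recursion continues with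
  -- the identity matrix, which is the change from a trivialisation to itself.
  have h : (fun L i => matWord t f V k L i i y z) = fun L i => hWord t f k L i (matOne (rk y)) := by
    funext L i
    rw [matWord, transition_self]
    rfl
  rw [h]
  exact hWord_cons L c (transition t b c x) a w

theorem entryHom_matLetter (q : ℕ) (i : Idx (rk x)) (l : Idx (rk y))
    (a : (qvectOn P f V).Hom (qvert P f V y) (qvert P f V x)) :
    entryHom f V i l (matLetter t f V q b c x y a) = chartEntry t f V i l
      ((blow (Chart U V) (flatOn P f V)).comp (idLetter P f b c x)
        (lbl c c (eps (C := flatOn P f V) q (flatLetter x y a)))) :=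
  entryHom_matMul i l _

theorem strSum_matWord_single (L : List (Chart U V)) (he : EndsAt e L c)
    (i : Idx (rk x)) (j : Idx (rk z)) (a : (qvectOn P f V).Hom (qvert P f V z) (qvert P f V x)) :
    strSum f V i j (matWord t f V 0 L b c x z (Word.single a)) =
      chartStr t f V i j (lm (idLetter P f b c x)
        (ins (C := flatOn P f V) e L c (flatWord P f V 0 x z (Word.single a)))) := by
  rw [matWord_zero, flatWord_single]
  cases L with
  | nil =>
    obtain rfl : c = e := he
    rw [ins_sg_nil, lm_sg, chartStr_sg, hEnd, strSum_single, entryHom_matLetter]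
    rfl
  | cons d L =>
    rw [ins_sg_cons, lm_cn, chartStr_cn, hEnd, LinearMap.flip_apply, strSum_cons]
    refine Finset.sum_congr rfl fun l _ => ?_
    rw [strSum_hEnd L d he l j, entryHom_matLetter]
    rfl

theorem strSum_matWord_cons {k : ℕ} (L : List (Chart U V)) (he : EndsAt e L c)
    (i : Idx (rk x)) (j : Idx (rk z)) (a : (qvectOn P f V).Hom (qvert P f V y) (qvert P f V x))
    (w : Word (qvectOn P f V).Hom k (qvert P f V y) (qvert P f V z))
    (ih : ∀ (L : List (Chart U V)) (c : Chart U V), EndsAt e L c → ∀ (i : Idx (rk y)) (j : Idx (rk z)),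
      strSum f V i j (matWord t f V k L c c y z w) =
        chartStr t f V i j (ins (C := flatOn P f V) e L c (flatWord P f V k y z w))) :
    strSum f V i j (matWord t f V (k + 1) L b c x z (Word.cons a w)) =
      chartStr t f V i j (lm (idLetter P f b c x)
        (ins (C := flatOn P f V) e L c (flatWord P f V (k + 1) x z (Word.cons a w)))) := by
  rw [matWord_cons, flatWord_cons, ins_cn, lm_cn, chartStr_cn, strSum_cons]
  refine Finset.sum_congr rfl fun l _ => ?_
  rw [entryHom_matLetter, strSum_hInsert w _ (flatWord P f V k y z w) ih L c he l j]

theorem lm_idLetter (w : Words (blow (Chart U V) (flatOn P f V)) (bo c (vert f V P x))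
    (bo e (vert f V P z))) : lm (idLetter P f c c x) w = w := MatRep.lm_one w

/-- Both sides obey the same recursion on the letters: the matrices in `hWord` are those of the
letters and identities in `ins`, with the same signs. The entries therefore agree. -/
theorem strSum_matWord (k : ℕ) (L : List (Chart U V)) (b c : Chart U V) (he : EndsAt e L c)
    (i : Idx (rk x)) (j : Idx (rk z))
    (w : Word (qvectOn P f V).Hom k (qvert P f V x) (qvert P f V z)) :
    strSum f V i j (matWord t f V k L b c x z w) =
      chartStr t f V i j (lm (idLetter P f b c x)
        (ins (C := flatOn P f V) e L c (flatWord P f V k x z w))) := by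
  induction k generalizing x L b c i j with
  | zero => exact strSum_matWord_single L he i j w
  | succ k ih =>
    let F : Word (qvectOn P f V).Hom (k + 1) (qvert P f V x) (qvert P f V z) →ₗ[ℂ] _ :=
      (strSum f V i j).comp (matWord t f V (k + 1) L b c x z)
    let G : Word (qvectOn P f V).Hom (k + 1) (qvert P f V x) (qvert P f V z) →ₗ[ℂ] _ :=
      (chartStr t f V i j).comp ((lm (idLetter P f b c x)).comp
        ((ins (C := flatOn P f V) e L c).comp (flatWord P f V (k + 1) x z)))
    have key : F = G := by
      refine Word.ext_cons fun (y : Fin r) a w => ?_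
      exact strSum_matWord_cons (y := y) L he i j a w fun L c he i j => by
        have h := ih (x := y) L c c he i j w
        rwa [lm_idLetter] at h
    exact congr($key w)

end

end Compare

section
variable {ι R : Type} [Semiring R] {M : ι → Type} [∀ i, AddCommMonoid (M i)] [∀ i, Module R (M i)]

theorem lof_decidableEq (d d' : DecidableEq ι) (i : ι) : @DirectSum.lof R _ ι M _ _ d i =
    @DirectSum.lof R _ ι M _ _ d' i := by
  rw [Subsingleton.elim d d']

end

theorem endsAt_concat {I : Type} (c e : I) (L : List I) : EndsAt e (L ++ [e]) c := by
  induction L generalizing c with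
  | nil => rfl
  | cons d L ih => exact ih d

/-! ### The explicit trace of a chain is the formal one. -/

section TraceOfChains
open AlgebraicGeometry Opposite TopologicalSpace QFact Words
variable {X : Scheme.{0}} [X.Over (Spec (.of ℂ))] {N r : ℕ} {U : Fin N → X.Opens}
  {P : Fin r → QFact X} {rk : Fin r → ℕ × ℕ} (t : ∀ i j, Trivialisation (P i) (U j) (rk i))
  (f : Γ(X, ⊤)) {V : X.Opens}

/-- A word in elements of `O(V)` as a chain. -/
def wordChain (V : X.Opens) (K : ℕ) :
    Word (curvedOn f V).Hom K (pt f V) (pt f V) →ₗ[ℂ] HochChain (curvedOn f V) K :=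
  DirectSum.lof ℂ Unit (fun x => Word (curvedOn f V).Hom K x x) ()

/-- The supertrace of a cyclic word of matrices. -/
def matTr (V : X.Opens) (K : ℕ) {a : ℕ × ℕ} : Word (MatHom V) K a a →ₗ[ℂ] HochChain (curvedOn f V) K :=
  (wordChain f V K).comp (∑ i : Idx a, idxSign i ^ (K + 1) • strHom f V K i i)

theorem chartRep_Str_inc {c e : Chart U V} {x : Fin r}
    (w : Words (flatOn P f V) (vert f V P x) (vert f V P x)) (W : WordSum (MatHom V) (rk x) (rk x))
    {L : List (Chart U V)} (he : EndsAt e L c)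
    (h : ∀ i : Idx (rk x), strSum f V i i W =
      chartStr t f V i i (lm (idLetter P f e c x) (ins (C := flatOn P f V) e L c w))) (K : ℕ) :
    (chartRep t f V).Str (insList (c :: L) (inc w)) K = matTr f V K (W K) := by
  rw [insList_inc e c he]
  refine (congrArg (fun u : Cyc (curvedOn f V) => u K) ((chartRep t f V).Str_inc (x := bo e (vert f V P x)) _)).trans ?_
  have h1 : ∀ i : Idx (rk x), inc (C := curvedOn f V) (x := pt f V)
      (MatRep.tau (idxSign i) (chartStr t f V i i (lm (idLetter P f e c x)
        (ins (C := flatOn P f V) e L c w)))) K =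
      wordChain f V K (idxSign i ^ (K + 1) • strHom f V K i i (W K)) := by
    intro i
    rw [inc_apply, tau_curvedOn f V (by rcases i with i | i; exacts [Or.inl rfl, Or.inr rfl]), ← h,
      strSum_apply]
    exact congr($(lof_decidableEq _ _ _) _)
  have h2 : matTr f V K (W K) = ∑ i : Idx (rk x),
      wordChain f V K (idxSign i ^ (K + 1) • strHom f V K i i (W K)) := by
    rw [matTr, LinearMap.comp_apply, LinearMap.sum_apply, map_sum]
    rfl
  rw [h2]
  exact (DFinsupp.finsetSum_apply _ _ _).trans (Finset.sum_congr rfl fun i _ => h1 i)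

/-- The words of `hChain`. -/
def chainWord (k : ℕ) (L : List (Chart U V)) (e : Chart U V) (x : Fin r) :
    Word (qvectOn P f V).Hom k (qvert P f V x) (qvert P f V x) →ₗ[ℂ] WordSum (MatHom V) (rk x) (rk x) :=
  match L with
  | [] => hWord t f k [] e (transition t e e x)
  | j :: L' => hWord t f k (L' ++ [e]) j (transition t e j x)

theorem chartRep_Str_chainWord (k : ℕ) (L : List (Chart U V)) (e : Chart U V) {x : Fin r}
    (w : Word (qvectOn P f V).Hom k (qvert P f V x) (qvert P f V x)) (K : ℕ) :
    (chartRep t f V).Str (insList (L ++ [e]) (inc (flatWord P f V k x x w))) K =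
      matTr f V K (chainWord t f k L e x w K) := by
  cases L with
  | nil =>
    exact chartRep_Str_inc t f (flatWord P f V k x x w) (chainWord t f k [] e x w) (c := e) (e := e) (L := []) (rfl : e = e)
      (fun i => strSum_matWord (t := t) k [] e e rfl i i w) K
  | cons j L =>
    exact chartRep_Str_inc t f (flatWord P f V k x x w) (chainWord t f k (j :: L) e x w) (c := j) (e := e) (L := L ++ [e]) (endsAt_concat j e L)
      (fun i => strSum_matWord (t := t) k (L ++ [e]) e j (endsAt_concat j e L) i i w) K

/-- Chains of `qvectOn` as chains of `flatOn`. -/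
def flatChain (V : X.Opens) (k : ℕ) : HochChain (qvectOn P f V) k →ₗ[ℂ] HochChain (flatOn P f V) k :=
  LinearMap.id

/-- Products of chains of `qvectOn` as products of chains of `flatOn`. -/
def flatChains (V : X.Opens) : HochII (qvectOn P f V) →ₗ[ℂ] HochII (flatOn P f V) :=
  LinearMap.pi fun k => (flatChain f V k).comp (LinearMap.proj k)

open Classical in
theorem flatChain_lof (k : ℕ) (x : Fin r)
    (w : Word (qvectOn P f V).Hom k (qvert P f V x) (qvert P f V x)) :
    DirectSum.lof ℂ ℕ (fun k => HochChain (flatOn P f V) k) k (flatChain f V k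
      (DirectSum.lof ℂ (Fin r) (fun x => Word (qvectOn P f V).Hom k (qvert P f V x) (qvert P f V x)) x w)) =
    inc (flatWord P f V k x x w) := by
  refine Eq.trans ?_ (inc_ι (C := flatOn P f V) k (vert f V P x) w).symm
  exact congrArg _ congr($(lof_decidableEq _ _ _) _)

open Classical in
/-- The summands of `hChain`, with the supertrace. -/
theorem matTr_hChain (k K : ℕ) (L : List (Chart U V)) (e : Chart U V)
    (w : HochChain (qvectOn P f V) k) :
    (DirectSum.toModule ℂ (ℕ × ℕ) _ fun a => matTr f V K (a := a))
      ((DirectSum.toModule ℂ (Fin r) _ fun x =>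
      (DirectSum.lof ℂ (ℕ × ℕ) (fun a => Word (MatHom V) K a a) (rk x)).comp
        ((DirectSum.component ℂ ℕ _ K).comp (chainWord t f k L e x))) w) =
    (chartRep t f V).Str (insList (L ++ [e]) (DirectSum.lof ℂ ℕ (fun k => HochChain (flatOn P f V) k) k
      (flatChain f V k w))) K := by
  have key : (DirectSum.toModule ℂ (ℕ × ℕ) _ fun a => matTr f V K (a := a)).comp
      (DirectSum.toModule ℂ (Fin r) _ fun x =>
      (DirectSum.lof ℂ (ℕ × ℕ) (fun a => Word (MatHom V) K a a) (rk x)).comp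
        ((DirectSum.component ℂ ℕ _ K).comp (chainWord t f k L e x))) =
    (DirectSum.component ℂ ℕ (fun k => HochChain (curvedOn f V) k) K).comp
      (((chartRep t f V).Str.comp (insList (L ++ [e]))).comp
      ((DirectSum.lof ℂ ℕ (fun k => HochChain (flatOn P f V) k) k).comp (flatChain f V k))) := by
    refine DirectSum.linearMap_ext ℂ fun x => LinearMap.ext fun w => ?_
    have h1 := chartRep_Str_chainWord t f k L e w K
    rw [← flatChain_lof] at h1
    refine Eq.trans ?_ h1.symm
    simp only [LinearMap.comp_apply]
    rw [DirectSum.toModule_lof]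
    simp only [LinearMap.comp_apply]
    rw [DirectSum.toModule_lof]
    rfl
  exact congr($key w)

/-- The entries of words agree by `strSum_matWord`, the outer sign by `tau_curvedOn`; what remains
is to sum over the lengths. -/
theorem sTr_hChain (L : List (Chart U V)) (e : Chart U V) (w : HochII (qvectOn P f V)) :
    sTr f V (hChain t f L e w) = (chartRep t f V).cut (L ++ [e]) (flatChains f V w) := by
  funext K
  have h1 : (chartRep t f V).cut (L ++ [e]) (flatChains f V w) K =
      ∑ k ∈ Finset.range (K + 1), (chartRep t f V).Str (insList (L ++ [e])
        (DirectSum.lof ℂ ℕ (fun k => HochChain (flatOn P f V) k) k (flatChain f V k (w k)))) K := by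
    simp only [MatRep.cut, completion, LinearMap.pi_apply, LinearMap.comp_apply, LinearMap.sum_apply]
    rfl
  rw [h1]
  have h2 : sTr f V (hChain t f L e w) K = (DirectSum.toModule ℂ (ℕ × ℕ) _ fun a => matTr f V K (a := a))
      (∑ k ∈ Finset.range (K + 1), (DirectSum.toModule ℂ (Fin r) _ fun x =>
      (DirectSum.lof ℂ (ℕ × ℕ) (fun a => Word (MatHom V) K a a) (rk x)).comp
        ((DirectSum.component ℂ ℕ _ K).comp (chainWord t f k L e x))) (w k)) := by
    refine congrArg (DirectSum.toModule ℂ (ℕ × ℕ) _ fun a => matTr f V K (a := a)) ?_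
    rw [hChain]
    exact LinearMap.sum_apply _ _ _
  rw [h2, map_sum]
  exact Finset.sum_congr rfl fun k _ => matTr_hChain t f k K L e (w k)

end TraceOfChains

/-! ### Maps that do not lower the length, applied to the twist. -/

section Expand
open Words
variable {C C' : CdgCat}

theorem Completes.congr {F : HochII C →ₗ[ℂ] HochII C'} {Φ : Cyc C →ₗ[ℂ] Cyc C'} (hF : Completes F Φ)
    {K : ℕ} {c c' : HochII C} (h : ∀ k ≤ K, c k = c' k) : F c K = F c' K := by
  obtain ⟨u, hu⟩ := exists_agree (K + 1) c
  rw [← hF _ u c hu K (by omega), ← hF (K + 1) u c' (fun k hk => (hu k hk).trans (h k (by omega))) K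
    (by omega)]

variable (δ : ∀ x : C.Ob, C.Hom x x)

theorem sh_apply_eq_zero_of_lt {n K : ℕ} (h : K < n) (c : HochII C) : sh δ n c K = 0 := by
  obtain ⟨u, hu⟩ := exists_agree (K + 1) c
  rw [← completes_sh δ n _ u c hu K (by omega), shC_apply_eq_zero δ (by omega)]

theorem twist_apply_of_le {k K : ℕ} (h : k ≤ K) (c : HochII C) :
    twist δ c k = ∑ n ∈ Finset.range (K + 1), ((-1 : ℂ) ^ n) • sh δ n c k := by
  rw [twist_apply]
  refine Finset.sum_subset (Finset.range_subset_range.2 (by omega)) fun n _ hn => ?_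
  rw [sh_apply_eq_zero_of_lt δ (by simpa using hn), smul_zero]

/-- Up to length `K` the twist is a finite sum over `n ≤ K`, and a map that completes a map of
finite sums depends at length `K` on these lengths only. So it may be applied term by term. -/
theorem Completes.apply_twist {F : HochII C →ₗ[ℂ] HochII C'} {Φ : Cyc C →ₗ[ℂ] Cyc C'}
    (hF : Completes F Φ) (c : HochII C) (K : ℕ) :
    F (twist δ c) K = ∑ n ∈ Finset.range (K + 1), ((-1 : ℂ) ^ n) • F (sh δ n c) K := by
  rw [hF.congr (c' := ∑ n ∈ Finset.range (K + 1), ((-1 : ℂ) ^ n) • sh δ n c) fun k hk => ?_]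
  · simp only [map_sum, map_smul, Finset.sum_apply, Pi.smul_apply]
  · rw [twist_apply_of_le δ hk]
    simp only [Finset.sum_apply, Pi.smul_apply]

end Expand

/-! ### Increasing lists and signs of the decompositions of an index. -/

section Order
variable {N : ℕ}

theorem sort_lowPart {J : Finset (Fin N)} (i : J) :
    (((Finset.univ : Finset J).filter (· < i)).sort (· ≤ ·)).map Subtype.val ++ [i.1] =
      (lowPart J i.1).sort (· ≤ ·) := by
  set L := ((Finset.univ : Finset J).filter (· < i)).sort (· ≤ ·) with hL
  have hlt : ∀ a ∈ L, a < i := fun a ha => by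
    rw [hL, Finset.mem_sort] at ha
    simpa using ha
  have hs : (L.map Subtype.val ++ [i.1]).Pairwise (· < ·) := by
    rw [List.pairwise_append]
    refine ⟨?_, List.pairwise_singleton _ _, fun a ha b hb => ?_⟩
    · rw [List.pairwise_map]
      exact Finset.sortedLT_sort _ |>.pairwise
    · rw [List.mem_singleton.1 hb]
      obtain ⟨a', ha', rfl⟩ := List.mem_map.1 ha
      exact hlt a' ha'
  have hn : (L.map Subtype.val ++ [i.1]).Nodup := hs.imp fun h => h.ne
  rw [← (List.toFinset_sort (· ≤ ·) hn).2 (hs.imp fun h => h.le)]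
  congr 1
  ext a
  simp only [List.mem_toFinset, List.mem_append, List.mem_map, List.mem_singleton, hL,
    Finset.mem_sort, Finset.mem_filter, Finset.mem_univ, true_and]
  constructor
  · rintro (⟨b, hb, rfl⟩ | rfl)
    · exact ⟨b.2, hb.le⟩
    · exact ⟨i.2, le_rfl⟩
  · rintro ⟨ha, hai⟩
    rcases hai.lt_or_eq with h | rfl
    · exact Or.inl ⟨⟨a, ha⟩, h, rfl⟩
    · exact Or.inr rfl

theorem length_sort_lt {J : Finset (Fin N)} (i : J) :
    (((Finset.univ : Finset J).filter (· < i)).sort (· ≤ ·)).length = place J i.1 := by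
  have h := congrArg List.length (sort_lowPart i)
  rw [List.length_append, List.length_map, Finset.length_sort (r := (· ≤ ·)) (s := lowPart J i.1), lowPart_card i.2] at h
  simpa using h

/-- Here `p` counts the indices of the second factor, so its Čech degree is `p - 1`; the exponents
`(p + 1) q` and `(p - 1) q` have the same parity. -/
theorem cupSign_one {p q : ℕ} (hp : 0 < p) : cupSign 1 p q = (-1) ^ ((p - 1) * q + q.choose 2) := by
  obtain ⟨m, rfl⟩ := Nat.exists_eq_add_of_le' hp
  rw [cupSign, one_pow, one_mul, Nat.add_sub_cancel,
    show (m + 1 + 1) * q + q.choose 2 = 2 * q + (m * q + q.choose 2) by ring, pow_add, pow_mul,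
    neg_one_sq, one_pow, one_mul]

end Order

/-! ### Expansion of the formal trace of the twist. -/

section TraceMap
open AlgebraicGeometry Opposite TopologicalSpace QFact Words
variable {X : Scheme.{0}} [X.Over (Spec (.of ℂ))] {N r : ℕ} {U : Fin N → X.Opens}
  {P : Fin r → QFact X} {rk : Fin r → ℕ × ℕ} (t : ∀ i j, Trivialisation (P i) (U j) (rk i))
  (f : Γ(X, ⊤))

theorem map_chartOf {J : Finset (Fin N)} (i : J) :
    ((((Finset.univ : Finset J).filter (· < i)).sort (· ≤ ·)).map (chartOf (U := U))) ++
      [chartOf (U := U) i] = memberList U (cap U J) (lowPart J i.1) :=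
  eq_memberList (cap_le (Finset.filter_subset _ _)) (by
    rw [List.map_append, List.map_map, ← sort_lowPart]; rfl)

variable (P) in
/-- `sh` for the endomorphisms `δ`. -/
def shOn (V : X.Opens) (n : ℕ) : HochII (qvectOn P f V) →ₗ[ℂ] HochII (qvectOn P f V) :=
  sh (C := qvectOn P f V) (fun x => delta (P x)) n

theorem hochMap_shOn {V V' : X.Opens} (h : V' ≤ V) (n : ℕ) (w : HochII (qvectOn P f V)) :
    hochMap (qvectRes P f h) (shOn P f V n w) = shOn P f V' n (hochMap (qvectRes P f h) w) :=
  hochMap_sh (C := qvectOn P f V) (C' := qvectOn P f V') (fun x => delta (P x)) (qvectRes P f h)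
    (fun x => delta (P x)) (fun _ => rfl) n w

theorem completes_cut_flatChains {V : X.Opens} (M : List (Chart U V)) :
    Completes (C := qvectOn P f V) (((chartRep t f V).cut M).comp (flatChains f V))
      (((chartRep t f V).Str.comp (insList M)).comp
        (flatCyc (C := qvectOn P f V) (gr_scalar_neg P f V) (scalar_central P f V))) :=
  ((chartRep t f V).completes_cut M).comp (C' := flatOn P f V)
    (completes_flatHoch (C := qvectOn P f V) (gr_scalar_neg P f V) (scalar_central P f V))

theorem cut_twistOn {V : X.Opens} (M : List (Chart U V)) (w : HochII (qvectOn P f V)) (K : ℕ) :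
    (chartRep t f V).cut M (twistOn P f V w) K = ∑ n ∈ Finset.range (K + 1), ((-1 : ℂ) ^ n) •
      (chartRep t f V).cut M (flatChains f V (shOn P f V n w)) K :=
  Completes.apply_twist (C := qvectOn P f V) (fun x => delta (P x)) (completes_cut_flatChains t f M) w K

end TraceMap

/-! ### The trace map is the trace of the twist. -/

section TraceMap
open AlgebraicGeometry Opposite TopologicalSpace QFact Words
variable {X : Scheme.{0}} [X.Over (Spec (.of ℂ))] {N r : ℕ} {U : Fin N → X.Opens}
  {P : Fin r → QFact X} {rk : Fin r → ℕ × ℕ} (t : ∀ i j, Trivialisation (P i) (U j) (rk i))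
  (f : Γ(X, ⊤))

/-- The components of `sh` on Čech cochains. -/
def shComponent (n : ℕ) (J T : Finset (Fin N)) (c : CechHochII (qvectPresheaf P f) U) :
    HochII (qvectOn P f (cap U J)) :=
  shOn P f (cap U J) n (component (E := qvectPresheaf P f) J T c)

theorem capRes_shMap (n : ℕ) {J : Finset (Fin N)} (T : CechIndex N) (h : T.1 ⊆ J)
    (c : CechHochII (qvectPresheaf P f) U) :
    capRes (qvectPresheaf P f) U h (shMap f n c T) = shComponent f n J T.1 c :=
  (hochMap_shOn f (cap_mono U h) n (c T)).trans
    (congrArg (shOn P f (cap U J) n) (component_of T.2 h c).symm)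

/-- The summands of the trace map. -/
def traceTerm (J : CechIndex N) (i : J.1) (n : ℕ) (c : CechHochII (qvectPresheaf P f) U) :
    HochII (curvedOn f (cap U J.1)) :=
  (chartRep t f (cap U J.1)).cut (memberList U (cap U J.1) (lowPart J.1 i.1))
    (flatChains f (cap U J.1) (shComponent f n J.1 (highPart J.1 i.1) c))

theorem traceTerm_eq_zero (J : CechIndex N) (i : J.1) (n : ℕ) {K : ℕ} (h : K < place J.1 i.1)
    (c : CechHochII (qvectPresheaf P f) U) : traceTerm t f J i n c K = 0 :=
  MatRep.cut_apply_eq_zero _ (by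
    rw [length_memberList (cap_le (Finset.filter_subset _ _)), lowPart_card i.2]; omega) _

theorem sTr_hMap (q n : ℕ) (J : CechIndex N) (c : CechHochII (qvectPresheaf P f) U) :
    sTr f (cap U J.1) (hMap t f q (shMap f n c) J) = ∑ i : J.1, if place J.1 i.1 = q then
      cupSign 1 (highPart J.1 i.1).card (place J.1 i.1) • traceTerm t f J i n c else 0 := by
  have h1 : ∀ i : J.1, sTr f (cap U J.1) (hChain t f
      ((((Finset.univ : Finset J.1).filter (· < i)).sort (· ≤ ·)).map chartOf) (chartOf i)
        (shComponent f n J.1 (highPart J.1 i.1) c)) = traceTerm t f J i n c := by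
    intro i
    rw [sTr_hChain, map_chartOf]
    rfl
  rw [hMap, LinearMap.pi_apply, LinearMap.sum_apply, map_sum]
  refine Finset.sum_congr rfl fun i _ => ?_
  have hT : (highPart J.1 i.1).Nonempty := ⟨i.1, by simp⟩
  simp only [length_sort_lt]
  split_ifs with h
  · rw [← h1 i, ← capRes_shMap f n ⟨highPart J.1 i.1, hT⟩ (Finset.filter_subset _ _), cupSign_one hT.card_pos, h]
    exact (sTr f (cap U J.1)).map_smul _ _
  · exact map_zero _

theorem flatTrace_cechTwist (J : CechIndex N) (K : ℕ) (c : CechHochII (qvectPresheaf P f) U) :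
    flatTrace t f (cechTwist U P f c) J K = ∑ i : J.1,
      cupSign 1 (highPart J.1 i.1).card (place J.1 i.1) •
        ∑ n ∈ Finset.range (K + 1), ((-1 : ℂ) ^ n) • traceTerm t f J i n c K := by
  have h1 : ∀ i : Fin N, chartCut t f J.1 (lowPart J.1 i)
      (component J.1 (highPart J.1 i) (cechTwist U P f c)) K =
      ∑ n ∈ Finset.range (K + 1), ((-1 : ℂ) ^ n) •
        (chartRep t f (cap U J.1)).cut (memberList U (cap U J.1) (lowPart J.1 i))
    (flatChains f (cap U J.1) (shComponent f n J.1 (highPart J.1 i) c)) K := by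
    intro i
    have h2 : component J.1 (highPart J.1 i) (cechTwist U P f c) =
        twistOn P f (cap U J.1) (component J.1 (highPart J.1 i) c) :=
      component_levelMap (capRes_twistOn U P f) (Finset.filter_subset _ _) c
    rw [h2]
    exact cut_twistOn t f _ _ K
  rw [flatTrace, cup_apply, cupSum, Finset.sum_apply,
    ← Finset.sum_coe_sort J.1 fun i => (cupSign 1 (highPart J.1 i).card (place J.1 i) •
      chartCut t f J.1 (lowPart J.1 i)
        (component J.1 (highPart J.1 i) (cechTwist U P f c))) K]
  exact Finset.sum_congr rfl fun i _ => congrArg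
    (fun v => cupSign 1 (highPart J.1 i.1).card (place J.1 i.1) • v) (h1 i.1)

/-- Both sides are sums over `n` and over the decompositions of `J`; in `φ` the latter are grouped
by the number `q` of indices before the shared one. The two cut-offs at `K` lose nothing, as the
omitted terms have length greater than `K`. -/
theorem phi_eq : phi t f = (flatTrace t f).comp (cechTwist U P f) := by
  refine LinearMap.ext fun c => funext fun J => funext fun K => ?_
  rw [LinearMap.comp_apply, flatTrace_cechTwist]
  have h1 : phi t f c J K = ∑ n ∈ Finset.range (K + 1), ∑ q ∈ Finset.range (K + 1),
      ((-1 : ℂ) ^ n) • sTr f (cap U J.1) (hMap t f q (shMap f n c) J) K := by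
    simp only [phi, LinearMap.pi_apply, LinearMap.sum_apply, LinearMap.smul_apply]
    rfl
  have h2 : ∀ n, ∑ q ∈ Finset.range (K + 1),
      ((-1 : ℂ) ^ n) • sTr f (cap U J.1) (hMap t f q (shMap f n c) J) K =
      ∑ i : J.1, ((-1 : ℂ) ^ n) • cupSign 1 (highPart J.1 i.1).card (place J.1 i.1) •
        traceTerm t f J i n c K := by
    intro n
    simp only [sTr_hMap, Finset.sum_apply, Finset.smul_sum]
    rw [Finset.sum_comm]
    refine Finset.sum_congr rfl fun i _ => ?_
    -- A decomposition with more than `K` indices before the shared one inserts too many letters to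
    -- reach length `K`, so both sides vanish.
    by_cases hi : place J.1 i.1 < K + 1
    · rw [Finset.sum_eq_single (place J.1 i.1) (fun q _ hq => by rw [if_neg hq.symm]; simp)
        (fun h => absurd (Finset.mem_range.2 hi) h), if_pos rfl]
      rfl
    · rw [traceTerm_eq_zero t f J i n (by omega), smul_zero, smul_zero]
      refine Finset.sum_eq_zero fun q hq => ?_
      rw [if_neg (by have := Finset.mem_range.1 hq; omega)]
      simp
  rw [h1, Finset.sum_congr rfl fun n _ => h2 n, Finset.sum_comm]
  refine Finset.sum_congr rfl fun i _ => ?_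
  rw [Finset.smul_sum]
  refine Finset.sum_congr rfl fun n _ => ?_
  rw [smul_smul, smul_smul, mul_comm]

end TraceMap

/-! ### Conjugation of homotopies by an isomorphism. -/

namespace SuperComplex
variable {A B C : SuperComplex}

theorem IsChainMap.symm {S : A.V →ₗ[ℂ] B.V} (hS : IsChainMap S) (h : Function.Bijective S) :
    IsChainMap (A := B) (B := A) (LinearEquiv.ofBijective S h).symm.toLinearMap := by
  have key : ∀ v, S ((LinearEquiv.ofBijective S h).symm v) = v :=
    (LinearEquiv.ofBijective S h).apply_symm_apply
  refine ⟨fun v => h.1 ?_, fun v => h.1 ?_⟩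
  · rw [hS.map_gr]; exact (key _).trans (congrArg _ (key v).symm)
  · rw [hS.map_D]; exact (key _).trans (congrArg _ (key v).symm)

theorem Htpy.of_eq {f f' g : A.V →ₗ[ℂ] B.V} (h : f = f') (H : Htpy (A := A) (B := B) f' g) :
    Htpy (A := A) (B := B) f g := h ▸ H

/-- A homotopy to the identity, conjugated by an isomorphism. -/
theorem Htpy.conj {S : B.V →ₗ[ℂ] C.V} (hS : IsChainMap S) (h : Function.Bijective S)
    {y : A.V →ₗ[ℂ] B.V} {ψ : C.V →ₗ[ℂ] A.V}
    (H : Htpy (A := C) (B := C) ((S.comp y).comp ψ) LinearMap.id) :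
    Htpy (A := B) (B := B) (y.comp (ψ.comp S)) LinearMap.id := by
  have h1 := (H.comp_right hS).comp_left (hS.symm h)
  have key : ∀ v, (LinearEquiv.ofBijective S h).symm (S v) = v :=
    (LinearEquiv.ofBijective S h).symm_apply_apply
  have e1 : (LinearEquiv.ofBijective S h).symm.toLinearMap.comp (((S.comp y).comp ψ).comp S) =
      y.comp (ψ.comp S) := LinearMap.ext fun v => key _
  have e2 : (LinearEquiv.ofBijective S h).symm.toLinearMap.comp (LinearMap.id.comp S) =
      LinearMap.id := LinearMap.ext fun v => key v
  rwa [e1, e2] at h1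

end SuperComplex

/-! ### The trace map and the Yoneda map are inverse up to homotopy. -/

section Result
open AlgebraicGeometry
variable {X : Scheme.{0}} [X.Over (Spec (.of ℂ))] {N r : ℕ} {U : Fin N → X.Opens}
  {P : Fin r → QFact X} {rk : Fin r → ℕ × ℕ} (t : ∀ i j, Trivialisation (P i) (U j) (rk i))
  (f : Γ(X, ⊤))

theorem phi_isChainMap : SuperComplex.IsChainMap (A := cechComplex (qvectPresheaf P f) U)
    (B := cechComplex (curvedPresheaf f) U) (phi t f) := by
  rw [phi_eq]
  exact (flatTrace_isChainMap t f).comp (cechTwist_isChainMap U P f)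

variable {i : Fin r} (hi : IsStructureSheaf (P i))

theorem phi_comp_yoneda : SuperComplex.Htpy (A := cechComplex (curvedPresheaf f) U)
    (B := cechComplex (curvedPresheaf f) U)
    ((phi t f).comp (cechMap U (yoneda P f i hi.δ₀_eq hi.δ₁_eq))) LinearMap.id := by
  have e : (phi t f).comp (cechMap U (yoneda P f i hi.δ₀_eq hi.δ₁_eq)) =
      (flatTrace t f).comp (cechMap U (flatYoneda P f i)) := by
    rw [phi_eq, LinearMap.comp_assoc, cechTwist_comp_yoneda]
  exact SuperComplex.Htpy.of_eq e (flatTrace_comp_yoneda t f hi.trivialisation)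

/-- The twist carries the Yoneda map to its version with zero differential and is an isomorphism of
complexes. So the homotopy for the category with zero differential can be transported back. -/
theorem yoneda_comp_phi : SuperComplex.Htpy (A := cechComplex (qvectPresheaf P f) U)
    (B := cechComplex (qvectPresheaf P f) U)
    ((cechMap U (yoneda P f i hi.δ₀_eq hi.δ₁_eq)).comp (phi t f)) LinearMap.id := by
  have e : ((cechTwist U P f).comp (cechMap U (yoneda P f i hi.δ₀_eq hi.δ₁_eq))).comp (flatTrace t f) =
      (cechMap U (flatYoneda P f i)).comp (flatTrace t f) := by
    rw [cechTwist_comp_yoneda]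
  have H : SuperComplex.Htpy (A := cechComplex (flatPresheaf P f) U)
      (B := cechComplex (flatPresheaf P f) U)
      (((cechTwist U P f).comp (cechMap U (yoneda P f i hi.δ₀_eq hi.δ₁_eq))).comp (flatTrace t f))
        LinearMap.id :=
    SuperComplex.Htpy.of_eq e (yoneda_comp_flatTrace t f hi.trivialisation)
  have h1 := SuperComplex.Htpy.conj (A := cechComplex (curvedPresheaf f) U)
    (cechTwist_isChainMap U P f) (cechTwist_bijective U P f) H
  exact SuperComplex.Htpy.of_eq
    (congrArg (cechMap U (yoneda P f i hi.δ₀_eq hi.δ₁_eq)).comp (phi_eq t f)) h1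

end Result

end CechHoch

end

theorem mainTheorem2 (X : Scheme.{0}) [X.Over (Spec (.of ℂ))]
    [Smooth (X ↘ Spec (.of ℂ))] [IsSeparated (X ↘ Spec (.of ℂ))]
    {N r : ℕ} (U : Fin N → X.Opens) (hU : ∀ j, IsAffineOpen (U j)) (hcov : ⨆ j, U j = ⊤)
    (f : Γ(X, ⊤)) (P : Fin r → QFact X) (rk : Fin r → ℕ × ℕ)
    (t : ∀ i j, Trivialisation (P i) (U j) (rk i)) :
    ∃ hφ : SuperComplex.IsChainMap (A := cechComplex (qvectPresheaf P f) U)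
        (B := cechComplex (curvedPresheaf f) U) (phi t f),
      ∀ (i : Fin r) (hi : IsStructureSheaf (P i)),
        let y := (cechMap_isChainMap U (yoneda P f i hi.δ₀_eq hi.δ₁_eq)).hom
        QuasiIso y ∧ toDerived.map y ≫ toDerived.map hφ.hom = 𝟙 _ ∧
          toDerived.map hφ.hom ≫ toDerived.map y = 𝟙 _ :=
  ⟨phi_isChainMap t f, fun _ hi => SuperComplex.quasiIso_of_htpy (cechMap_isChainMap U _)
    (phi_isChainMap t f) (phi_comp_yoneda t f hi) (yoneda_comp_phi t f hi)⟩
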